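/- For integers $m\ge 3$ and $x$ let $P_m(x)=\frac{m-2}{2}x^2-\frac{m-4}{2}x$. For positive integers $a_1,\dots,a_n$, the $m$-gonal form $\langle a_1,\dots,a_n\rangle_m$ of rank $n$ is $\Delta_{m,\mathbf a}(\mathbf x)=a_1P_m(x_1)+\cdots+a_nP_m(x_n)$ with variables $x_i$ ranging over the non-negative integers $\mathbb N_0$. It \emph{represents} $N\in\mathbb N_0$ if $\Delta_{m,\mathbf a}(\mathbf x)=N$ for some $\mathbf x\in\mathbb N_0^n$; it \emph{locally represents} $N$ if for every integer $r\ge1$ the congruence $\Delta_{m,\mathbf a}(\mathbf x)\equiv N\pmod r$ has a solution $\mathbf x\in\mathbb Z^n$. It is \emph{regular} if it represents every $N\in\mathbb N_0$ that it locally represents, \emph{universal} if it represents every $N\in\mathbb N_0$, and \emph{primitive} if $\gcd(a_1,\dots,a_n)=1$. Consider the following types of forms, where the coefficients are taken up to order and the $a_i'$ denote positive integers: (A) $\langle a_1,3a_2',\dots,3a_n'\rangle_m$ with $a_1\in\{1,2\}$, representing every integer in $(a_1+3\mathbb N_0)\cup 3\mathbb N_0$; (B) $\langle a_1,4a_2',\dots,4a_n'\rangle_m$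 with $a_1\in\{1,3\}$, representing every integer in $(a_1+4\mathbb N_0)\cup 4\mathbb N_0$; (C) $\langle 1,3,4a_3',\dots,4a_n'\rangle_m$, representing every integer in $\mathbb N_0\setminus(2+4\mathbb N_0)$; (D) $\langle 1,1,4a_3',\dots,4a_n'\rangle_m$, representing every integer in $\mathbb N_0\setminus(3+4\mathbb N_0)$; (E) $\langle 3,4,12a_3',\dots,12a_n'\rangle_m$, representing every $N\in\mathbb N_0$ with $N\equiv 0,3,4,7\pmod{12}$; (F) $\langle 3,8,12a_3',\dots,12a_n'\rangle_m$, representing every $N\in\mathbb N_0$ with $N\equiv 0,3,8,11\pmod{12}$; (G) $\langle 3,3,4,12a_4',\dots,12a_n'\rangle_m$, representing every $N\in\mathbb N_0$ with $N\equiv 0,3,4,6,7,10\pmod{12}$. Let $\Delta_{m,\mathbf a}$ be a primitive regular $m$-gonal form of rank $n\ge 4$. (1) If $m\ge 9$, $m\not\equiv 0\pmod 4$ and $m\equiv 2\pmod 3$, then $\Delta_{m,\mathbf a}$ is universal. (2) If $m\ge 9$, $m\not\equiv 0\pmod 4$ and $m\not\equiv 2\pmod 3$, then $\Delta_{m,\mathbf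 a}$ is universal or of type (A). (3) If $m\ge 12$, $m\equiv 0\pmod 4$ and $m\equiv 2\pmod 3$, then $\Delta_{m,\mathbf a}$ is universal or of type (B), (C) or (D). (4) If $m\ge 12$, $m\equiv 0\pmod 4$ and $m\not\equiv 2\pmod 3$, then $\Delta_{m,\mathbf a}$ is universal or of type (A), (B), (C), (D), (E), (F) or (G). -/

import Mathlib

namespace PolygonalForm

/-- The `m`-gonal number `P_m(x) = ((m - 2) x ^ 2 - (m - 4) x) / 2`, for an integer `x`.
The integer division is exact, see `two_mul_polygonal`. -/
def polygonal (m : ℕ) (x : ℤ) : ℤ :=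
  (((m : ℤ) - 2) * x ^ 2 - ((m : ℤ) - 4) * x) / 2

theorem two_mul_polygonal (m : ℕ) (x : ℤ) :
    2 * polygonal m x = ((m : ℤ) - 2) * x ^ 2 - ((m : ℤ) - 4) * x := by
  unfold polygonal
  apply Int.mul_ediv_cancel'
  obtain ⟨k, hk⟩ := (Int.even_mul_succ_self (x - 1)).two_dvd
  refine ⟨m * k - x ^ 2 + 2 * x, ?_⟩
  linear_combination (m : ℤ) * hk

/-- The value `a_1 P_m(x_1) + ⋯ + a_n P_m(x_n)` of the `m`-gonal form with coefficients `a`. -/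
def form (m : ℕ) {n : ℕ} (a : Fin n → ℕ) (x : Fin n → ℤ) : ℤ :=
  ∑ i, (a i : ℤ) * polygonal m (x i)

/-- The (non-generalized) `m`-gonal form represents `N`: all variables are non-negative integers. -/
def Represents (m : ℕ) {n : ℕ} (a : Fin n → ℕ) (N : ℕ) : Prop :=
  ∃ x : Fin n → ℕ, form m a (fun i => (x i : ℤ)) = (N : ℤ)

/-- The form locally represents `N`: the congruence modulo `r` has an integer solution
for every modulus `r ≥ 1`. -/
def LocallyRepresents (m : ℕ) {n : ℕ} (a : Fin n → ℕ) (N : ℕ) : Prop :=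
  ∀ r : ℕ, 0 < r → ∃ x : Fin n → ℤ, form m a x ≡ (N : ℤ) [ZMOD (r : ℤ)]

/-- The form represents every non-negative integer that it locally represents. -/
def IsRegular (m : ℕ) {n : ℕ} (a : Fin n → ℕ) : Prop :=
  ∀ N : ℕ, LocallyRepresents m a N → Represents m a N

/-- The form represents every non-negative integer. -/
def IsUniversal (m : ℕ) {n : ℕ} (a : Fin n → ℕ) : Prop :=
  ∀ N : ℕ, Represents m a N

/-- The greatest common divisor of the coefficients is `1`. -/
def IsPrimitive {n : ℕ} (a : Fin n → ℕ) : Prop :=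
  Finset.univ.gcd a = 1

/-- Up to the order of the coefficients, `a` consists of the coefficients in `head`, followed by
positive multiples of `d`: the form is `⟨head, d a', d a'', …⟩`. -/
def HasShape {n : ℕ} (head : Multiset ℕ) (d : ℕ) (a : Fin n → ℕ) : Prop :=
  ∃ t : Multiset ℕ, (∀ b ∈ t, 0 < b) ∧
    Finset.univ.val.map a = head + t.map (fun b => d * b)

/-- `⟨c, 3a', …⟩` with `c ∈ {1, 2}`, representing all of `c + 3ℕ₀ ∪ 3ℕ₀`. -/
def Type3 (m : ℕ) {n : ℕ} (a : Fin n → ℕ) : Prop :=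
  ∃ c : ℕ, (c = 1 ∨ c = 2) ∧ HasShape {c} 3 a ∧
    ∀ N : ℕ, (∃ k, N = c + 3 * k) ∨ (∃ k, N = 3 * k) → Represents m a N

/-- `⟨c, 4a', …⟩` with `c ∈ {1, 3}`, representing all of `c + 4ℕ₀ ∪ 4ℕ₀`. -/
def Type4 (m : ℕ) {n : ℕ} (a : Fin n → ℕ) : Prop :=
  ∃ c : ℕ, (c = 1 ∨ c = 3) ∧ HasShape {c} 4 a ∧
    ∀ N : ℕ, (∃ k, N = c + 4 * k) ∨ (∃ k, N = 4 * k) → Represents m a N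

/-- `⟨1, 3, 4a', …⟩`, representing all of `ℕ₀ \ (2 + 4ℕ₀)`. -/
def Type13 (m : ℕ) {n : ℕ} (a : Fin n → ℕ) : Prop :=
  HasShape {1, 3} 4 a ∧ ∀ N : ℕ, (¬ ∃ k, N = 2 + 4 * k) → Represents m a N

/-- `⟨1, 1, 4a', …⟩`, representing all of `ℕ₀ \ (3 + 4ℕ₀)`. -/
def Type11 (m : ℕ) {n : ℕ} (a : Fin n → ℕ) : Prop :=
  HasShape {1, 1} 4 a ∧ ∀ N : ℕ, (¬ ∃ k, N = 3 + 4 * k) → Represents m a N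

/-- `⟨3, 4, 12a', …⟩`, representing every `N ≡ 0, 3, 4, 7 (mod 12)`. -/
def Type34 (m : ℕ) {n : ℕ} (a : Fin n → ℕ) : Prop :=
  HasShape {3, 4} 12 a ∧
    ∀ N : ℕ, N % 12 ∈ ({0, 3, 4, 7} : Finset ℕ) → Represents m a N

/-- `⟨3, 8, 12a', …⟩`, representing every `N ≡ 0, 3, 8, 11 (mod 12)`. -/
def Type38 (m : ℕ) {n : ℕ} (a : Fin n → ℕ) : Prop :=
  HasShape {3, 8} 12 a ∧
    ∀ N : ℕ, N % 12 ∈ ({0, 3, 8, 11} : Finset ℕ) → Represents m a N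

/-- `⟨3, 3, 4, 12a', …⟩`, representing every `N ≡ 0, 3, 4, 6, 7, 10 (mod 12)`. -/
def Type334 (m : ℕ) {n : ℕ} (a : Fin n → ℕ) : Prop :=
  HasShape {3, 3, 4} 12 a ∧
    ∀ N : ℕ, N % 12 ∈ ({0, 3, 4, 6, 7, 10} : Finset ℕ) → Represents m a N

end PolygonalForm

/-!
A form is handled as the list `l` of its coefficients, up to permutation. `Rep m l N` says that `N`
is represented by natural arguments, `Loc m p l N` that it is a value over the `p`-adic integers.
If `p` is odd and `p ∤ m - 2`, or if `p = 2` and `4 ∣ m`, completing the square deduces `Loc` from a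
representation by the diagonal quadratic form (`QLoc`); at all other primes `Loc` always holds, as
some coefficient is a unit. A regular form represents all numbers that satisfy `Loc` at every prime,
and the proof shows which primes can exclude a number at all.

*No prime `p ≥ 5` excludes a number.* If it does, all but one or two coefficients are divisible by
`p`, and two remaining ones are anisotropic (`primeShape`). Integral arguments also give locally
represented numbers, so the values at `-1` and `-2` have to be taken at small natural arguments; this
forces `p ∣ (m - 3) (m - 4)` (`ListRegular.prime_dvd`). For the set `B` of all such primes, with
product `Q`, one counts residues modulo `Q`. At each `p ∈ B` many residues satisfy the condition at
`p` unconditionally. At 2 and 3 one stays in a residue class that satisfies the conditions there and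
restricts the arguments modulo 2 and modulo 3 (`TwoClass`, `ThreeClass`). All these residues are
attained by numbers below `D₂ D₃ Q`, hence by arguments in a short window, and the number of
admissible arguments is too small unless `B = {5}` (`card_sq_le`, `ClassData.eq_singleton_five`). The
prime 5 is treated by looking at the values modulo 5 in the window (`FiveData.false`).

*Only 3 excludes numbers.* Then `m` is not 2 modulo 3. The smallest locally represented numbers give
the smallest coefficients (escalation), and these leave only `Type3`: `three_single` and
`three_pair_false`.

*Only 2 excludes numbers.* Then `4 ∣ m`. There are seven shapes of the coefficients modulo powers of
2 (`twoShape`), because four suitable coefficients are universal over the 2-adic integers. In each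
shape, escalation leads to `Type4`, `Type13`, `Type11`, to a universal form, or to a number that is locally
represented but not represented (`TwoShape.twoExceptional`).

*Both 2 and 3 exclude numbers.* With two coefficients prime to 3, the escalation is a finite search
that the kernel evaluates (`ThreePair.contradiction`). With a single such coefficient `a`, the
numbers in the degenerate class modulo 3 are represented by the other coefficients divided by 3, and
the case of the prime 2 applies to these, up to a small bound (`ThreeSingle.exceptional`). This
leads to `Type34`, `Type38`, `Type334`.
-/

namespace PolygonalForm

/-- `Val f l w`: the integer `w` is a value `∑ c * f x` of the diagonal form with coefficient
list `l` in the one-variable function `f`, with independent arguments for all coefficients. -/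
def Val {α : Type} (f : α → ℤ) : List ℕ → ℤ → Prop
  | [], w => w = 0
  | c :: l, w => ∃ x w', Val f l w' ∧ w = c * f x + w'

section Val
variable {α : Type} {f : α → ℤ}

@[simp] theorem val_nil {w : ℤ} : Val f [] w ↔ w = 0 := Iff.rfl

theorem val_cons {c : ℕ} {l : List ℕ} {w : ℤ} :
    Val f (c :: l) w ↔ ∃ x w', Val f l w' ∧ w = c * f x + w' := Iff.rfl

theorem Val.cons {l : List ℕ} {w : ℤ} (h : Val f l w) (c : ℕ) (x : α) :
    Val f (c :: l) (c * f x + w) := ⟨x, w, h, rfl⟩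

theorem Val.perm {l l' : List ℕ} (h : l.Perm l') : ∀ {w : ℤ}, Val f l w → Val f l' w := by
  induction h with
  | nil => exact fun h => h
  | cons c _ ih =>
    rintro w ⟨x, w', h, rfl⟩
    exact ⟨x, w', ih h, rfl⟩
  | swap c d l =>
    rintro w ⟨x, w', ⟨y, w'', h, rfl⟩, rfl⟩
    exact ⟨y, _, ⟨x, w'', h, rfl⟩, by ring⟩
  | trans _ _ ih1 ih2 => exact fun h => ih2 (ih1 h)

theorem val_append {l l' : List ℕ} {w : ℤ} :
    Val f (l ++ l') w ↔ ∃ u v, Val f l u ∧ Val f l' v ∧ w = u + v := by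
  induction l generalizing w with
  | nil =>
    simp only [List.nil_append, val_nil]
    exact ⟨fun h => ⟨0, w, rfl, h, by ring⟩, by rintro ⟨u, v, rfl, h, rfl⟩; simpa using h⟩
  | cons c l ih =>
    simp only [List.cons_append, val_cons, ih]
    constructor
    · rintro ⟨x, _, ⟨u, v, hu, hv, rfl⟩, rfl⟩
      exact ⟨_, v, ⟨x, u, hu, rfl⟩, hv, by ring⟩
    · rintro ⟨_, v, ⟨x, u, hu, rfl⟩, hv, rfl⟩
      exact ⟨x, _, ⟨u, v, hu, hv, rfl⟩, by ring⟩

theorem Val.zero (x₀ : α) (h : f x₀ = 0) : ∀ l : List ℕ, Val f l 0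
  | [] => rfl
  | _ :: l => ⟨x₀, 0, Val.zero x₀ h l, by simp [h]⟩

theorem Val.append_zero (x₀ : α) (h : f x₀ = 0) {l : List ℕ} {w : ℤ} (hl : Val f l w)
    (t : List ℕ) : Val f (l ++ t) w :=
  val_append.2 ⟨w, 0, hl, Val.zero x₀ h t, by ring⟩

theorem val_ofFn {n : ℕ} {a : Fin n → ℕ} {w : ℤ} :
    Val f (List.ofFn a) w ↔ ∃ x : Fin n → α, ∑ i, (a i : ℤ) * f (x i) = w := by
  induction n generalizing w with
  | zero => simp [eq_comm]
  | succ n ih =>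
    rw [List.ofFn_succ, val_cons]
    constructor
    · rintro ⟨x, w', h, rfl⟩
      obtain ⟨y, rfl⟩ := ih.1 h
      exact ⟨Fin.cons x y, by simp [Fin.sum_univ_succ]⟩
    · rintro ⟨x, rfl⟩
      exact ⟨x 0, _, ih.2 ⟨fun i => x i.succ, rfl⟩, by simp [Fin.sum_univ_succ]⟩

/-- A common divisor of the coefficients divides every value. -/
theorem Val.dvd {d : ℕ} {l : List ℕ} (hd : ∀ c ∈ l, d ∣ c) {w : ℤ} (h : Val f l w) :
    (d : ℤ) ∣ w := by
  induction l generalizing w with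
  | nil => rw [val_nil] at h; simp [h]
  | cons c l ih =>
    obtain ⟨x, w', h, rfl⟩ := h
    exact dvd_add (Dvd.dvd.mul_right (by exact_mod_cast hd c (by simp)) _)
      (ih (fun e he => hd e (by simp [he])) h)

theorem Val.scale (d : ℕ) {l : List ℕ} {w : ℤ} (h : Val f l w) :
    Val f (l.map (fun c => d * c)) (d * w) := by
  induction l generalizing w with
  | nil => rw [val_nil] at h; simp [h]
  | cons c l ih =>
    obtain ⟨x, w', h, rfl⟩ := h
    exact ⟨x, _, ih h, by push_cast; ring⟩

theorem Val.unscale {d : ℕ} (hd : 0 < d) {l : List ℕ} {w : ℤ}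
    (h : Val f (l.map (fun c => d * c)) (d * w)) : Val f l w := by
  have key : ∀ {l : List ℕ} {v : ℤ}, Val f (l.map (fun c => d * c)) v →
      ∃ w, Val f l w ∧ v = d * w := by
    intro l
    induction l with
    | nil => intro v h; exact ⟨0, rfl, by simpa using h⟩
    | cons c l ih =>
      rintro v ⟨x, w', h, rfl⟩
      obtain ⟨w, hw, rfl⟩ := ih h
      exact ⟨_, ⟨x, w, hw, rfl⟩, by push_cast; ring⟩
  obtain ⟨w', hw, h⟩ := key h
  have : w = w' := mul_left_cancel₀ (by exact_mod_cast hd.ne') h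
  rwa [this]

end Val

/-! ### Polygonal numbers -/

theorem polygonal_zero (m : ℕ) : polygonal m 0 = 0 := by simp [polygonal]

theorem polygonal_one (m : ℕ) : polygonal m 1 = 1 := by
  have := two_mul_polygonal m 1
  linarith

theorem polygonal_two (m : ℕ) : polygonal m 2 = m := by
  have := two_mul_polygonal m 2
  linarith

theorem polygonal_three (m : ℕ) : polygonal m 3 = 3 * m - 3 := by
  have := two_mul_polygonal m 3
  linarith

theorem polygonal_four (m : ℕ) : polygonal m 4 = 6 * m - 8 := by
  have := two_mul_polygonal m 4
  linarith

theorem polygonal_five (m : ℕ) : polygonal m 5 = 10 * m - 15 := by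
  have := two_mul_polygonal m 5
  linarith

theorem polygonal_neg_one (m : ℕ) : polygonal m (-1) = m - 3 := by
  have := two_mul_polygonal m (-1)
  linarith

theorem polygonal_neg_two (m : ℕ) : polygonal m (-2) = 3 * m - 8 := by
  have := two_mul_polygonal m (-2)
  linarith

theorem polygonal_mono {m : ℕ} (hm : 4 ≤ m) {x y : ℕ} (h : x ≤ y) :
    polygonal m x ≤ polygonal m y := by
  have h1 := two_mul_polygonal m x
  have h2 := two_mul_polygonal m y
  have h3 : (x : ℤ) ≤ y := by exact_mod_cast h
  have h4 : (4 : ℤ) ≤ m := by exact_mod_cast hm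
  rcases h3.eq_or_lt with h5 | h5
  · rw [h5]
  have h6 : 0 ≤ ((y : ℤ) - x) * (((m : ℤ) - 2) * (x + y) - ((m : ℤ) - 4)) := by
    apply mul_nonneg (by linarith)
    have : (1 : ℤ) ≤ x + y := by omega
    nlinarith
  linarith [h6, h1, h2, (by ring : ((y : ℤ) - x) * (((m : ℤ) - 2) * (x + y) - ((m : ℤ) - 4)) =
    (((m : ℤ) - 2) * y ^ 2 - ((m : ℤ) - 4) * y) - (((m : ℤ) - 2) * x ^ 2 - ((m : ℤ) - 4) * x))]

theorem polygonal_nonneg {m : ℕ} (hm : 4 ≤ m) (x : ℕ) : 0 ≤ polygonal m x := by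
  have := polygonal_mono hm (Nat.zero_le x)
  simpa [polygonal_zero] using this

theorem polygonal_congr_of_two_mul {m : ℕ} {s x y : ℤ} (h : x ≡ y [ZMOD 2 * s]) :
    polygonal m x ≡ polygonal m y [ZMOD s] := by
  obtain ⟨t, ht⟩ := h.dvd
  rw [Int.modEq_iff_dvd]
  refine ⟨t * (((m : ℤ) - 2) * (x + y) - ((m : ℤ) - 4)), ?_⟩
  have h1 := two_mul_polygonal m x
  have h2 := two_mul_polygonal m y
  have : y = x + 2 * s * t := by linarith
  subst this
  apply mul_left_cancel₀ (two_ne_zero (α := ℤ))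
  linear_combination h2 - h1

theorem polygonal_congr_of_odd {m : ℕ} {r x y : ℤ} (hr : Odd r) (h : x ≡ y [ZMOD r]) :
    polygonal m x ≡ polygonal m y [ZMOD r] := by
  obtain ⟨t, ht⟩ := h.dvd
  have h1 := two_mul_polygonal m x
  have h2 := two_mul_polygonal m y
  rw [Int.modEq_iff_dvd]
  have hc : IsCoprime r 2 := by
    obtain ⟨k, rfl⟩ := hr
    exact ⟨1, -k, by ring⟩
  apply hc.dvd_of_dvd_mul_left
  refine ⟨t * (((m : ℤ) - 2) * (x + y) - ((m : ℤ) - 4)), ?_⟩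
  have : y = x + r * t := by linarith
  subst this
  linear_combination h2 - h1

/-! ### Representations and local conditions -/

/-- The `m`-gonal form with coefficient list `l` represents `N`, in non-negative variables. -/
def Rep (m : ℕ) (l : List ℕ) (N : ℤ) : Prop := Val (fun x : ℕ => polygonal m x) l N

/-- The `m`-gonal form with coefficient list `l` takes the value `N` in the `p`-adic integers,
expressed by congruences modulo all powers of `p`. -/
def Loc (m p : ℕ) (l : List ℕ) (N : ℤ) : Prop :=
  ∀ k : ℕ, ∃ w, Val (polygonal m) l w ∧ w ≡ N [ZMOD (p : ℤ) ^ k]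

/-- The diagonal quadratic form with coefficient list `l` takes the value `M` modulo `p ^ k`. -/
def QLocMod (p k : ℕ) (l : List ℕ) (M : ℤ) : Prop :=
  ∃ w, Val (fun y : ℤ => y ^ 2) l w ∧ w ≡ M [ZMOD (p : ℤ) ^ k]

/-- The diagonal quadratic form with coefficient list `l` takes the value `M` in the `p`-adic
integers. -/
def QLoc (p : ℕ) (l : List ℕ) (M : ℤ) : Prop := ∀ k : ℕ, QLocMod p k l M

theorem Rep.perm {m : ℕ} {l l' : List ℕ} {N : ℤ} (h : l.Perm l') (hr : Rep m l N) :
    Rep m l' N := Val.perm h hr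

theorem Loc.perm {m p : ℕ} {l l' : List ℕ} {N : ℤ} (h : l.Perm l') (hr : Loc m p l N) :
    Loc m p l' N := fun k => let ⟨w, hw, hk⟩ := hr k; ⟨w, hw.perm h, hk⟩

theorem QLocMod.perm {p k : ℕ} {l l' : List ℕ} {N : ℤ} (h : l.Perm l') (hr : QLocMod p k l N) :
    QLocMod p k l' N := let ⟨w, hw, hk⟩ := hr; ⟨w, hw.perm h, hk⟩

theorem QLoc.perm {p : ℕ} {l l' : List ℕ} {N : ℤ} (h : l.Perm l') (hr : QLoc p l N) :
    QLoc p l' N := fun k => (hr k).perm h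

theorem Loc.append {m p : ℕ} {l : List ℕ} {N : ℤ} (h : Loc m p l N) (t : List ℕ) :
    Loc m p (l ++ t) N := fun k =>
  let ⟨w, hw, hk⟩ := h k; ⟨w, hw.append_zero 0 (polygonal_zero m) t, hk⟩

theorem QLocMod.append {p k : ℕ} {l : List ℕ} {N : ℤ} (h : QLocMod p k l N) (t : List ℕ) :
    QLocMod p k (l ++ t) N :=
  let ⟨w, hw, hk⟩ := h; ⟨w, hw.append_zero 0 (by simp) t, hk⟩

theorem Loc.of_val {m p : ℕ} {l : List ℕ} {N : ℤ} (h : Val (polygonal m) l N) : Loc m p l N :=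
  fun _ => ⟨N, h, Int.ModEq.refl _⟩

theorem Rep.val {m : ℕ} {l : List ℕ} {N : ℤ} (h : Rep m l N) : Val (polygonal m) l N := by
  induction l generalizing N with
  | nil => exact h
  | cons c l ih =>
    obtain ⟨x, w, hw, rfl⟩ := h
    exact ⟨x, w, ih hw, rfl⟩

theorem represents_iff {m n : ℕ} {a : Fin n → ℕ} {N : ℕ} :
    Represents m a N ↔ Rep m (List.ofFn a) N := by
  unfold Represents Rep form
  rw [val_ofFn]

theorem exists_form_modEq_mul {m n : ℕ} {a : Fin n → ℕ} {N : ℤ} {r s : ℕ}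
    (hrs : Nat.Coprime r s) (hr : ∃ x : Fin n → ℤ, form m a x ≡ N [ZMOD r])
    (hs : ∃ x : Fin n → ℤ, form m a x ≡ N [ZMOD s]) :
    ∃ x : Fin n → ℤ, form m a x ≡ N [ZMOD ((r * s : ℕ) : ℤ)] := by
  -- one of the two moduli is odd, and modulo an odd number `polygonal m` has period one modulus
  wlog hodd : Odd r generalizing r s
  · have hs' : Odd s := by
      rw [Nat.not_odd_iff_even] at hodd
      rcases Nat.even_or_odd s with h | h
      · have := Nat.dvd_gcd hodd.two_dvd h.two_dvd
        rw [hrs] at this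
        norm_num at this
      · exact h
    rw [mul_comm r s]
    exact this hrs.symm hs hr hs'
  obtain ⟨x, hx⟩ := hr
  obtain ⟨y, hy⟩ := hs
  have hc : IsCoprime (r : ℤ) (2 * s : ℤ) := by
    have : Nat.Coprime r (2 * s) := Nat.Coprime.mul_right (Nat.coprime_two_right.2 hodd) hrs
    exact_mod_cast Nat.isCoprime_iff_coprime.2 this
  obtain ⟨u, v, huv⟩ := hc
  let z : Fin n → ℤ := fun i => y i * (u * r) + x i * (v * (2 * s))
  have h1 : ∀ i, z i ≡ x i [ZMOD r] := fun i => by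
    rw [Int.modEq_iff_dvd]
    exact ⟨(x i - y i) * u, by simp only [z]; linear_combination (-(x i)) * huv⟩
  have h2 : ∀ i, z i ≡ y i [ZMOD 2 * s] := fun i => by
    rw [Int.modEq_iff_dvd]
    exact ⟨(y i - x i) * v, by simp only [z]; linear_combination (-(y i)) * huv⟩
  refine ⟨z, ?_⟩
  rw [Nat.cast_mul, ← Int.modEq_and_modEq_iff_modEq_mul (by simpa using hrs)]
  constructor
  · refine Int.ModEq.trans (Int.ModEq.sum fun i _ => ?_) hx
    exact (polygonal_congr_of_odd (by exact_mod_cast hodd) (h1 i)).mul_left _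
  · refine Int.ModEq.trans (Int.ModEq.sum fun i _ => ?_) hy
    exact (polygonal_congr_of_two_mul (h2 i)).mul_left _

theorem locallyRepresents_of_loc {m n : ℕ} {a : Fin n → ℕ} {N : ℕ}
    (h : ∀ p : ℕ, p.Prime → Loc m p (List.ofFn a) N) : LocallyRepresents m a N := by
  intro r hr
  induction r using Nat.recOnPosPrimePosCoprime with
  | prime_pow p k hp hk =>
    obtain ⟨w, hw, hk⟩ := h p hp k
    obtain ⟨x, rfl⟩ := val_ofFn.1 hw
    exact ⟨x, by simpa [form] using hk⟩
  | zero => omega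
  | one => exact ⟨0, by simpa using Int.modEq_one⟩
  | coprime r s hr hs hrs ihr ihs =>
    exact exists_form_modEq_mul hrs (ihr (by omega)) (ihs (by omega))

/-! ### Diagonal quadratic forms over the `p`-adic integers -/

theorem exists_mul_sq_modEq_two_pow {a M : ℤ} (ha : a % 2 = 1) (h : M ≡ a [ZMOD 8]) (k : ℕ) :
    ∃ y : ℤ, a * y ^ 2 ≡ M [ZMOD 2 ^ k] := by
  have key : ∀ k : ℕ, ∃ y : ℤ, y % 2 = 1 ∧ (2 : ℤ) ^ (k + 3) ∣ a * y ^ 2 - M := by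
    intro k
    induction k with
    | zero =>
      exact ⟨1, by simp, by have := h.dvd; norm_num; exact this⟩
    | succ k ih =>
      obtain ⟨y, hy, t, ht⟩ := ih
      rcases Int.even_or_odd' t with ⟨s, rfl | rfl⟩
      · exact ⟨y, hy, s, by rw [ht]; ring⟩
      · refine ⟨y + 2 ^ (k + 2), by rw [pow_succ]; omega, ?_⟩
        have hodd : Odd (a * y) := (Int.odd_iff.2 ha).mul (Int.odd_iff.2 hy)
        obtain ⟨r, hr⟩ := hodd
        exact ⟨s + r + 1 + a * 2 ^ k, by
          linear_combination ht + (2 : ℤ) ^ (k + 3) * hr⟩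
  obtain ⟨y, -, hy⟩ := key k
  refine ⟨y, (Int.modEq_iff_dvd.2 ?_).symm⟩
  exact (pow_dvd_pow 2 (by omega)).trans hy

theorem exists_mul_sq_modEq_prime_pow {p : ℕ} (hp : p.Prime) (hp2 : p ≠ 2) {a y M : ℤ}
    (ha : ¬ (p : ℤ) ∣ a) (hy : ¬ (p : ℤ) ∣ y) (h : a * y ^ 2 ≡ M [ZMOD p]) (k : ℕ) :
    ∃ z : ℤ, a * z ^ 2 ≡ M [ZMOD (p : ℤ) ^ k] := by
  have hpi : Prime (p : ℤ) := Nat.prime_iff_prime_int.1 hp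
  have hp2' : ¬ (p : ℤ) ∣ 2 := fun hd => by
    have : p ∣ 2 := by exact_mod_cast hd
    exact hp2 ((Nat.prime_dvd_prime_iff_eq hp Nat.prime_two).1 this)
  have key : ∀ k : ℕ, ∃ z : ℤ, ¬ (p : ℤ) ∣ z ∧ (p : ℤ) ^ (k + 1) ∣ a * z ^ 2 - M := by
    intro k
    induction k with
    | zero => exact ⟨y, hy, by simpa using h.symm.dvd⟩
    | succ k ih =>
      obtain ⟨z, hz, t, ht⟩ := ih
      have hc : IsCoprime (p : ℤ) (2 * a * z) :=
        (hpi.coprime_iff_not_dvd).2 fun hd => by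
          rcases hpi.dvd_or_dvd hd with hd | hd
          · rcases hpi.dvd_or_dvd hd with hd | hd
            exacts [hp2' hd, ha hd]
          · exact hz hd
      obtain ⟨u, v, huv⟩ := hc
      refine ⟨z + (p : ℤ) ^ (k + 1) * (-t * v), fun hd => hz ?_,
        u * t + a * (p : ℤ) ^ k * (t * v) ^ 2, ?_⟩
      · have h1 : (p : ℤ) ∣ (p : ℤ) ^ (k + 1) * (-t * v) :=
          Dvd.dvd.mul_right (dvd_pow_self _ (by omega)) _
        exact (dvd_add_left h1).1 hd
      · linear_combination ht - (p : ℤ) ^ (k + 1) * t * huv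
  obtain ⟨z, -, hz⟩ := key k
  exact ⟨z, (Int.modEq_iff_dvd.2 ((pow_dvd_pow _ (by omega)).trans hz)).symm⟩

theorem QLoc.of_two_unit {a : ℕ} {t : List ℕ} {M w : ℤ} (ha : a % 2 = 1)
    (hw : Val (fun y : ℤ => y ^ 2) t w) (h : (M - w - a) % 8 = 0) : QLoc 2 (a :: t) M := by
  intro k
  obtain ⟨y, hy⟩ := exists_mul_sq_modEq_two_pow (a := a) (M := M - w) (by omega)
    (by rw [Int.modEq_iff_dvd]; omega) k
  refine ⟨_, hw.cons a y, ?_⟩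
  have := hy.add_right w
  simpa using this

theorem QLoc.of_prime_unit {p : ℕ} (hp : p.Prime) (hp2 : p ≠ 2) {a : ℕ} {t : List ℕ} {M w y : ℤ}
    (ha : ¬ p ∣ a) (hy : ¬ (p : ℤ) ∣ y) (hw : Val (fun y : ℤ => y ^ 2) t w)
    (h : a * y ^ 2 + w ≡ M [ZMOD p]) : QLoc p (a :: t) M := by
  intro k
  obtain ⟨z, hz⟩ := exists_mul_sq_modEq_prime_pow hp hp2 (a := a) (M := M - w)
    (by exact_mod_cast ha) hy (by simpa using h.sub_right w) k
  refine ⟨_, hw.cons a z, ?_⟩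
  have := hz.add_right w
  simpa using this

theorem QLocMod.mul_prime {p k : ℕ} {l l' : List ℕ} {M : ℤ}
    (h : QLocMod p k (l.map (p * ·) ++ l') M) :
    QLocMod p (k + 1) (l ++ l'.map (p * ·)) (p * M) := by
  obtain ⟨w, hw, hk⟩ := h
  obtain ⟨u, v, hu, hv, rfl⟩ := val_append.1 hw
  have key : ∀ {l : List ℕ} {u : ℤ}, Val (fun y : ℤ => y ^ 2) (l.map (p * ·)) u →
      Val (fun y : ℤ => y ^ 2) l (p * u) := by
    intro l
    induction l with
    | nil => intro u hu; rw [List.map_nil, val_nil] at hu; simp [hu]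
    | cons c l ih =>
      rintro u ⟨y, u', hu, rfl⟩
      exact ⟨p * y, _, ih hu, by push_cast; ring⟩
  refine ⟨p * u + p * v, val_append.2 ⟨_, _, key hu, hv.scale p, rfl⟩, ?_⟩
  rw [← mul_add, pow_succ']
  exact hk.mul_left'

theorem QLocMod.mul_sq {p k : ℕ} {l : List ℕ} {M : ℤ} (h : QLocMod p k l M) :
    QLocMod p (k + 2) l (p ^ 2 * M) := by
  have h1 : QLocMod p (k + 1) (l.map (p * ·)) (p * M) := by
    have := QLocMod.mul_prime (l := []) (l' := l) (by simpa using h)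
    simpa using this
  have h2 := QLocMod.mul_prime (l := l) (l' := []) (by simpa using h1)
  rw [pow_two, mul_assoc]
  simpa using h2

theorem QLoc.mul_prime {p : ℕ} {l l' : List ℕ} {M : ℤ}
    (h : QLoc p (l.map (p * ·) ++ l') M) :
    QLoc p (l ++ l'.map (p * ·)) (p * M) := by
  intro k
  rcases k with _ | k
  · exact ⟨0, Val.zero 0 (by simp) _, by simpa using Int.modEq_one⟩
  · exact (h k).mul_prime

theorem QLoc.mul_sq {p : ℕ} {l : List ℕ} {M : ℤ} (h : QLoc p l M) : QLoc p l (p ^ 2 * M) := by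
  intro k
  rcases k with _ | _ | k
  · exact ⟨0, Val.zero 0 (by simp) _, by simpa using Int.modEq_one⟩
  · exact ⟨0, Val.zero 0 (by simp) _,
      (Int.modEq_zero_iff_dvd.2 (by simp [pow_two, mul_assoc])).symm⟩
  · exact (h k).mul_sq

theorem QLoc.append {p : ℕ} {l : List ℕ} {M : ℤ} (h : QLoc p l M) (t : List ℕ) :
    QLoc p (l ++ t) M := fun k => (h k).append t

/-- The completed square: if `U * P + T ^ 2` is the square of a linear polynomial whose slope is a
unit at `p`, then the local behaviour of the polygonal form is that of the diagonal
quadratic form with the same coefficients. -/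
theorem Loc.of_qLoc {m p : ℕ} (hp : p.Prime) (U S T : ℤ)
    (hid : ∀ x : ℤ, U * polygonal m x + T ^ 2 = (S * x - T) ^ 2)
    (hU : ¬ (p : ℤ) ∣ U) (hS : ¬ (p : ℤ) ∣ S) {l : List ℕ} {N : ℤ}
    (h : QLoc p l (U * N + T ^ 2 * l.sum)) : Loc m p l N := by
  intro k
  have hpi : Prime (p : ℤ) := Nat.prime_iff_prime_int.1 hp
  have key : ∀ {l : List ℕ} {w : ℤ}, Val (fun y : ℤ => y ^ 2) l w →
      ∃ w', Val (polygonal m) l w' ∧ U * w' + T ^ 2 * l.sum ≡ w [ZMOD (p : ℤ) ^ k] := by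
    intro l
    induction l with
    | nil => intro w hw; exact ⟨0, rfl, by rw [val_nil] at hw; simp [hw, Int.ModEq.refl]⟩
    | cons c l ih =>
      rintro w ⟨y, w, hw, rfl⟩
      obtain ⟨w', hw', hk⟩ := ih hw
      obtain ⟨u, v, huv⟩ : IsCoprime ((p : ℤ) ^ k) S :=
        (hpi.coprime_iff_not_dvd.2 hS).pow_left
      refine ⟨_, hw'.cons c ((y + T) * v), ?_⟩
      have h1 : S * ((y + T) * v) - T ≡ y [ZMOD (p : ℤ) ^ k] := by
        rw [Int.modEq_iff_dvd]
        exact ⟨(y + T) * u, by linear_combination (-(y + T)) * huv⟩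
      have h2 := ((h1.pow 2).mul_left (c : ℤ)).add hk
      rw [← hid] at h2
      have h3 : U * (c * polygonal m ((y + T) * v) + w') + T ^ 2 * (((c :: l).sum : ℕ) : ℤ) =
          c * (U * polygonal m ((y + T) * v) + T ^ 2) + (U * w' + T ^ 2 * l.sum) := by
        rw [List.sum_cons]
        push_cast
        ring
      rw [h3]
      exact h2
  obtain ⟨w, hw, hk⟩ := h k
  obtain ⟨w', hw', hk'⟩ := key hw
  refine ⟨w', hw', ?_⟩
  have h3 := (hk'.trans hk).dvd
  rw [Int.modEq_iff_dvd]
  have hc : IsCoprime ((p : ℤ) ^ k) U := (hpi.coprime_iff_not_dvd.2 hU).pow_left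
  apply hc.dvd_of_dvd_mul_left
  have h4 : U * (N - w') = U * N + T ^ 2 * l.sum - (U * w' + T ^ 2 * l.sum) := by ring
  rw [h4]
  exact h3

/-- At `p = 2` and `m = 4 v + 4`. -/
theorem Loc.of_qLoc_two {v : ℕ} {l : List ℕ} {N : ℤ}
    (h : QLoc 2 l ((2 * v + 1) * N + v ^ 2 * l.sum)) : Loc (4 * v + 4) 2 l N := by
  refine Loc.of_qLoc Nat.prime_two (2 * v + 1) (2 * v + 1) v (fun x => ?_) ?_ ?_ h
  · have := two_mul_polygonal (4 * v + 4) x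
    push_cast at this
    have h2 : polygonal (4 * v + 4) x = (2 * v + 1) * x ^ 2 - 2 * v * x := by linarith
    rw [h2]
    ring
  · push_cast; omega
  · push_cast; omega

theorem Loc.of_qLoc_odd {m p : ℕ} (hp : p.Prime) (hp2 : p ≠ 2) (hm : ¬ (p : ℤ) ∣ (m : ℤ) - 2)
    {l : List ℕ} {N : ℤ} (h : QLoc p l (8 * ((m : ℤ) - 2) * N + ((m : ℤ) - 4) ^ 2 * l.sum)) :
    Loc m p l N := by
  have hpi : Prime (p : ℤ) := Nat.prime_iff_prime_int.1 hp
  have hp2' : ¬ (p : ℤ) ∣ 2 := fun hd => by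
    have : p ∣ 2 := by exact_mod_cast hd
    exact hp2 ((Nat.prime_dvd_prime_iff_eq hp Nat.prime_two).1 this)
  refine Loc.of_qLoc hp (8 * ((m : ℤ) - 2)) (2 * ((m : ℤ) - 2)) ((m : ℤ) - 4) (fun x => ?_)
    ?_ ?_ h
  · have := two_mul_polygonal m x
    linear_combination 4 * ((m : ℤ) - 2) * this
  · intro hd
    rcases hpi.dvd_or_dvd hd with hd | hd
    · exact hp2' (hpi.dvd_of_dvd_pow (show (p : ℤ) ∣ 2 ^ 3 by norm_num; exact hd))
    · exact hm hd
  · intro hd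
    rcases hpi.dvd_or_dvd hd with hd | hd
    exacts [hp2' hd, hm hd]

/-! ### Universality of quadratic forms at odd primes -/

theorem exists_mul_sq_add_mul_sq_modEq {p : ℕ} (hp : p.Prime) (hp2 : p ≠ 2) {a b : ℕ}
    (ha : ¬ p ∣ a) (hb : ¬ p ∣ b) (M : ℤ) : ∃ x y : ℤ, a * x ^ 2 + b * y ^ 2 ≡ M [ZMOD p] := by
  have := Fact.mk hp
  have ha' : (a : ZMod p) ≠ 0 := by rwa [Ne, ZMod.natCast_eq_zero_iff]
  have hb' : (b : ZMod p) ≠ 0 := by rwa [Ne, ZMod.natCast_eq_zero_iff]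
  obtain ⟨x, y, h⟩ := FiniteField.exists_root_sum_quadratic
    (f := Polynomial.C (a : ZMod p) * Polynomial.X ^ 2)
    (g := Polynomial.C (b : ZMod p) * Polynomial.X ^ 2 + Polynomial.C (-(M : ZMod p)))
    (Polynomial.degree_C_mul_X_pow 2 ha')
    (by
      rw [Polynomial.degree_add_C (by rw [Polynomial.degree_C_mul_X_pow 2 hb']; norm_num)]
      exact Polynomial.degree_C_mul_X_pow 2 hb')
    (by rw [ZMod.card]; exact (hp.eq_two_or_odd.resolve_left hp2))
  obtain ⟨x, rfl⟩ := ZMod.intCast_surjective x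
  obtain ⟨y, rfl⟩ := ZMod.intCast_surjective y
  refine ⟨x, y, (ZMod.intCast_eq_intCast_iff _ _ _).1 ?_⟩
  simp only [Polynomial.eval_add, Polynomial.eval_mul, Polynomial.eval_C, Polynomial.eval_pow,
    Polynomial.eval_X] at h
  push_cast
  linear_combination h

theorem QLoc.two_units {p : ℕ} (hp : p.Prime) (hp2 : p ≠ 2) {a b : ℕ} {M : ℤ}
    (ha : ¬ p ∣ a) (hb : ¬ p ∣ b) (hM : ¬ (p : ℤ) ∣ M) (t : List ℕ) :
    QLoc p (a :: b :: t) M := by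
  obtain ⟨x, y, h⟩ := exists_mul_sq_add_mul_sq_modEq hp hp2 ha hb M
  by_cases hx : (p : ℤ) ∣ x
  · have hy : ¬ (p : ℤ) ∣ y := fun hy => hM <| by
      have h1 : (p : ℤ) ∣ a * x ^ 2 + b * y ^ 2 :=
        dvd_add (Dvd.dvd.mul_left (dvd_pow hx two_ne_zero) _)
          (Dvd.dvd.mul_left (dvd_pow hy two_ne_zero) _)
      simpa using dvd_add h.dvd h1
    have := QLoc.of_prime_unit hp hp2 (t := a :: t) hb hy
      ((Val.zero 0 (by simp) t).cons a x) (M := M) (by convert h using 1; ring)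
    exact this.perm (by grind)
  · exact QLoc.of_prime_unit hp hp2 ha hx ((Val.zero 0 (by simp) t).cons b y) (M := M)
      (by convert h using 1; ring)

theorem QLoc.three_units {p : ℕ} (hp : p.Prime) (hp2 : p ≠ 2) {a b c : ℕ}
    (ha : ¬ p ∣ a) (hb : ¬ p ∣ b) (hc : ¬ p ∣ c) (M : ℤ) (t : List ℕ) :
    QLoc p (a :: b :: c :: t) M := by
  obtain ⟨x, y, h⟩ := exists_mul_sq_add_mul_sq_modEq hp hp2 ha hb (M - c)
  have hone : ¬ (p : ℤ) ∣ 1 := fun hd => hp.one_lt.ne' (by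
    have : p ∣ 1 := by exact_mod_cast hd
    simpa using this)
  have := QLoc.of_prime_unit hp hp2 hc hone
      (((Val.zero 0 (by simp) t).cons b y).cons a x) (M := M)
      (by convert h.add_right (c : ℤ) using 1 <;> push_cast <;> ring)
  exact this.perm (by grind)

theorem QLoc.isotropic {p : ℕ} (hp : p.Prime) (hp2 : p ≠ 2) {a b : ℕ} {y M : ℤ}
    (ha : ¬ p ∣ a) (hb : ¬ p ∣ b) (hy : (p : ℤ) ∣ a * y ^ 2 + b) (t : List ℕ) :
    QLoc p (a :: b :: t) M := by
  by_cases hM : (p : ℤ) ∣ M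
  · have hy' : ¬ (p : ℤ) ∣ y := fun hd => hb (by
      have h1 : (p : ℤ) ∣ a * y ^ 2 := Dvd.dvd.mul_left (dvd_pow hd two_ne_zero) _
      have := (dvd_add_right h1).1 hy
      exact_mod_cast this)
    refine QLoc.of_prime_unit hp hp2 ha hy' ((Val.zero 0 (by simp) t).cons b 1) ?_
    refine (Int.modEq_iff_dvd.2 ?_)
    have h4 : M - (a * y ^ 2 + (b * 1 ^ 2 + 0)) = M - (a * y ^ 2 + b) := by ring
    rw [h4]
    exact dvd_sub hM hy
  · exact QLoc.two_units hp hp2 ha hb hM t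

/-! ### Universal quadratic forms over the 2-adic integers -/

theorem Val.sq_zero (t : List ℕ) : Val (fun y : ℤ => y ^ 2) t 0 := Val.zero 0 (by simp) t

/-- With a second odd coefficient `b`, a 2-adic unit coefficient `a` reaches a whole residue class
modulo 4: the variable of `b` may be 0 or 2. -/
theorem QLoc.of_two_odd {a b : ℕ} {t : List ℕ} {M w : ℤ} (ha : a % 2 = 1) (hb : b % 2 = 1)
    (hw : Val (fun y : ℤ => y ^ 2) t w) (h : (M - w - a) % 4 = 0) : QLoc 2 (a :: b :: t) M := by
  by_cases h8 : (M - w - a) % 8 = 0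
  · exact QLoc.of_two_unit ha (hw.cons b 0) (by simpa using h8)
  · exact QLoc.of_two_unit ha (hw.cons b 2) (by omega)

/-- With a further coefficient `d ≡ 4 (mod 8)`, a 2-adic unit coefficient `a` reaches a whole
residue class modulo 4. -/
theorem QLoc.of_odd_four {a d : ℕ} {t : List ℕ} {M w : ℤ} (ha : a % 2 = 1) (hd : d % 8 = 4)
    (hw : Val (fun y : ℤ => y ^ 2) t w) (h : (M - w - a) % 4 = 0) : QLoc 2 (a :: d :: t) M := by
  by_cases h8 : (M - w - a) % 8 = 0
  · exact QLoc.of_two_unit ha (hw.cons d 0) (by simpa using h8)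
  · exact QLoc.of_two_unit ha (hw.cons d 1) (by omega)

/-- Three odd coefficients represent every integer not divisible by 4 in the presence of
congruences modulo 4 as stated. -/
theorem QLoc.odd3 {a b c : ℕ} {M : ℤ} (ha : a % 2 = 1) (hb : b % 2 = 1) (hc : c % 2 = 1)
    (t : List ℕ) (h : M % 4 = 2 ∨ (M - a) % 4 = 0 ∨ a % 4 ≠ b % 4) :
    QLoc 2 (a :: b :: c :: t) M := by
  have z := Val.sq_zero t
  by_cases h1 : (M - a) % 4 = 0
  · exact QLoc.of_two_odd ha hb ((Val.sq_zero t).cons c 0) (by simpa using h1)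
  by_cases h2 : (M - b) % 4 = 0
  · exact (QLoc.of_two_odd hb ha ((Val.sq_zero t).cons c 0) (M := M) (by simpa using h2)).perm
      (by grind)
  by_cases h3 : (M - a - b) % 4 = 0
  · exact (QLoc.of_two_odd ha hc ((Val.sq_zero t).cons b 1) (M := M) (by omega)).perm
      (by grind)
  by_cases h4 : (M - a - c) % 4 = 0
  · exact (QLoc.of_two_odd ha hb ((Val.sq_zero t).cons c 1) (M := M) (by omega)).perm
      (by grind)
  · exact (QLoc.of_two_odd hb ha ((Val.sq_zero t).cons c 1) (M := M) (by omega)).perm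
      (by grind)

/-- The names of the following universality results list how many coefficients are odd, 2 modulo 4,
4 modulo 8 and 8 modulo 16. -/
theorem qLoc_odd4 {a b c d : ℕ} (ha : a % 2 = 1) (hb : b % 2 = 1) (hc : c % 2 = 1)
    (hd : d % 2 = 1) (M : ℤ) : QLoc 2 [a, b, c, d] M := by
  intro k
  induction k using Nat.strong_induction_on generalizing M with
  | _ k ih =>
    by_cases h0 : M % 4 = 0
    · obtain ⟨M, rfl⟩ : ∃ K, M = 2 ^ 2 * K := ⟨M / 4, by omega⟩
      rcases k with _ | _ | k
      · exact ⟨0, Val.sq_zero _, by simpa using Int.modEq_one⟩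
      · exact ⟨0, Val.sq_zero _, (Int.modEq_zero_iff_dvd.2 ⟨2 * M, by push_cast; ring⟩).symm⟩
      · exact (ih k (by omega) M).mul_sq
    by_cases h1 : M % 4 = 2 ∨ (M - a) % 4 = 0 ∨ a % 4 ≠ b % 4
    · exact QLoc.odd3 ha hb hc [d] h1 k
    by_cases h2 : a % 4 ≠ c % 4
    · exact ((QLoc.odd3 ha hc hb [d] (Or.inr (Or.inr h2))).perm (by grind)) k
    by_cases h3 : a % 4 ≠ d % 4
    · exact ((QLoc.odd3 ha hd hb [c] (M := M) (Or.inr (Or.inr h3))).perm (by grind)) k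
    · exact QLoc.of_two_odd ha hb (((Val.sq_zero []).cons d 1).cons c 1)
        (by omega) k

theorem qLoc_odd3_four {a b c d : ℕ} (ha : a % 2 = 1) (hb : b % 2 = 1) (hc : c % 2 = 1)
    (hd : d % 8 = 4) (M : ℤ) : QLoc 2 [a, b, c, d] M := by
  by_cases h0 : M % 4 = 0
  · obtain ⟨M, rfl⟩ : ∃ K, M = 2 * (2 * K) := ⟨M / 4, by omega⟩
    obtain ⟨e, rfl⟩ : ∃ e, d = 2 * (2 * e) := ⟨d / 4, by omega⟩
    have h := qLoc_odd4 ha hb hc (d := e) (by omega) M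
    have h1 : QLoc 2 [2 * a, 2 * b, 2 * c, 2 * e] (2 * M) := by
      simpa using QLoc.mul_prime (p := 2) (l := []) (l' := [a, b, c, e]) (by simpa using h)
    simpa using QLoc.mul_prime (p := 2) (l := [a, b, c]) (l' := [2 * e]) (by simpa using h1)
  by_cases h1 : M % 4 = 2 ∨ (M - a) % 4 = 0 ∨ a % 4 ≠ b % 4
  · exact QLoc.odd3 ha hb hc [d] h1
  by_cases h2 : a % 4 ≠ c % 4
  · exact ((QLoc.odd3 ha hc hb [d] (Or.inr (Or.inr h2))).perm (by grind))
  · exact (QLoc.of_odd_four ha hd (((Val.sq_zero []).cons c 1).cons b 1) (M := M)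
      (by omega)).perm (by grind)

/-- Three odd coefficients that are not all congruent modulo 4. -/
theorem qLoc_odd3_mixed {a b c : ℕ} (ha : a % 2 = 1) (hb : b % 2 = 1) (hc : c % 2 = 1)
    (hab : a % 4 ≠ b % 4) (M : ℤ) : QLoc 2 [a, b, c] M :=
  QLoc.odd3 ha hb hc [] (Or.inr (Or.inr hab))

theorem qLoc_odd3_two {a b c d : ℕ} (ha : a % 2 = 1) (hb : b % 2 = 1) (hc : c % 2 = 1)
    (hd : d % 4 = 2) (M : ℤ) : QLoc 2 [a, b, c, d] M := by
  by_cases h1 : M % 4 = 2 ∨ (M - a) % 4 = 0 ∨ a % 4 ≠ b % 4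
  · exact QLoc.odd3 ha hb hc [d] h1
  by_cases h2 : a % 4 ≠ c % 4
  · exact ((QLoc.odd3 ha hc hb [d] (Or.inr (Or.inr h2))).perm (by grind))
  by_cases h3 : M % 2 = 1
  · exact QLoc.of_two_odd ha hb (((Val.sq_zero []).cons d 1).cons c 0) (by omega)
  · exact QLoc.of_two_odd ha hb (((Val.sq_zero []).cons d 1).cons c 1) (by omega)

theorem qLoc_odd2_two2 {a b c d : ℕ} (ha : a % 2 = 1) (hb : b % 2 = 1) (hc : c % 4 = 2)
    (hd : d % 4 = 2) (M : ℤ) : QLoc 2 [a, b, c, d] M := by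
  intro k
  induction k generalizing a b c d M with
  | zero => exact ⟨0, Val.sq_zero _, by simpa using Int.modEq_one⟩
  | succ k ih =>
    by_cases h0 : M % 2 = 0
    · obtain ⟨M, rfl⟩ : ∃ K, M = 2 * K := ⟨M / 2, by omega⟩
      obtain ⟨c, rfl⟩ : ∃ e, c = 2 * e := ⟨c / 2, by omega⟩
      obtain ⟨d, rfl⟩ : ∃ e, d = 2 * e := ⟨d / 2, by omega⟩
      have h := ih (a := c) (b := d) (c := 2 * a) (d := 2 * b) (by omega) (by omega) (by omega)
        (by omega) M
      have h' := h.perm (l' := [2 * a, 2 * b, c, d]) (by grind)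
      simpa using QLocMod.mul_prime (p := 2) (l := [a, b]) (l' := [c, d]) (by simpa using h')
    by_cases h1 : (M - a) % 4 = 0
    · exact QLoc.of_two_odd ha hb (Val.sq_zero _) (by simpa using h1) k.succ
    · exact QLoc.of_two_odd ha hb ((Val.sq_zero [d]).cons c 1) (by omega) k.succ

theorem qLoc_odd2_two_four {a b c d : ℕ} (ha : a % 2 = 1) (hb : b % 2 = 1) (hc : c % 4 = 2)
    (hd : d % 8 = 4) (M : ℤ) : QLoc 2 [a, b, c, d] M := by
  by_cases h1 : (M - a) % 4 = 0
  · exact QLoc.of_two_odd ha hb (Val.sq_zero _) (by simpa using h1)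
  by_cases h0 : M % 2 = 1
  · exact QLoc.of_two_odd ha hb ((Val.sq_zero [d]).cons c 1) (by omega)
  by_cases h2 : (M - b - a) % 4 = 0
  · exact (QLoc.of_odd_four ha hd (((Val.sq_zero []).cons c 0).cons b 1) (M := M)
      (by omega)).perm (by grind)
  · exact (QLoc.of_odd_four ha hd (((Val.sq_zero []).cons c 1).cons b 1) (M := M)
      (by omega)).perm (by grind)

theorem QLoc.odd_two3_of_odd {a b c d : ℕ} (ha : a % 2 = 1) (hb : b % 4 = 2) (hbc : b % 8 = c % 8)
    (hd : d % 4 = 2) {M : ℤ} (hM : M % 2 = 1) : QLoc 2 [a, b, c, d] M := by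
  have key : ∀ x y z : ℤ, (M - (b * x ^ 2 + (c * y ^ 2 + (d * z ^ 2 + 0))) - a) % 8 = 0 →
      QLoc 2 [a, b, c, d] M := fun x y z h =>
    QLoc.of_two_unit ha ((((Val.sq_zero []).cons d z).cons c y).cons b x) h
  by_cases h0 : (M - a) % 8 = 0
  · exact key 0 0 0 (by omega)
  by_cases h1 : (M - a) % 8 = 4
  · exact key 1 1 0 (by omega)
  by_cases h2 : (M - a - b) % 8 = 0
  · exact key 1 0 0 (by omega)
  by_cases h3 : d % 8 = b % 8
  · exact key 1 1 1 (by omega)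
  · exact key 0 0 1 (by omega)

theorem qLoc_odd_two3 {a b c d : ℕ} (ha : a % 2 = 1) (hb : b % 4 = 2) (hc : c % 4 = 2)
    (hd : d % 4 = 2) (M : ℤ) : QLoc 2 [a, b, c, d] M := by
  by_cases h0 : M % 2 = 0
  · obtain ⟨M, rfl⟩ : ∃ K, M = 2 * K := ⟨M / 2, by omega⟩
    obtain ⟨b, rfl⟩ : ∃ e, b = 2 * e := ⟨b / 2, by omega⟩
    obtain ⟨c, rfl⟩ : ∃ e, c = 2 * e := ⟨c / 2, by omega⟩
    obtain ⟨d, rfl⟩ : ∃ e, d = 2 * e := ⟨d / 2, by omega⟩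
    have h := qLoc_odd3_two (a := b) (b := c) (c := d) (d := 2 * a) (by omega) (by omega)
      (by omega) (by omega) M
    have h' := h.perm (l' := [2 * a, b, c, d]) (by grind)
    simpa using QLoc.mul_prime (p := 2) (l := [a]) (l' := [b, c, d]) (by simpa using h')
  have hM : M % 2 = 1 := by omega
  by_cases h1 : b % 8 = c % 8
  · exact QLoc.odd_two3_of_odd ha hb h1 hd hM
  by_cases h2 : b % 8 = d % 8
  · exact (QLoc.odd_two3_of_odd ha hb h2 hc hM).perm (by grind)
  · exact (QLoc.odd_two3_of_odd ha hc (c := d) (by omega) hb hM).perm (by grind)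

theorem qLoc_odd_two2_four {a b c d : ℕ} (ha : a % 2 = 1) (hb : b % 4 = 2) (hc : c % 4 = 2)
    (hd : d % 8 = 4) (M : ℤ) : QLoc 2 [a, b, c, d] M := by
  by_cases h0 : M % 2 = 0
  · obtain ⟨M, rfl⟩ : ∃ K, M = 2 * K := ⟨M / 2, by omega⟩
    obtain ⟨b, rfl⟩ : ∃ e, b = 2 * e := ⟨b / 2, by omega⟩
    obtain ⟨c, rfl⟩ : ∃ e, c = 2 * e := ⟨c / 2, by omega⟩
    obtain ⟨d, rfl⟩ : ∃ e, d = 2 * e := ⟨d / 2, by omega⟩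
    have h := qLoc_odd2_two2 (a := b) (b := c) (c := d) (d := 2 * a) (by omega) (by omega)
      (by omega) (by omega) M
    have h' := h.perm (l' := [2 * a, b, c, d]) (by grind)
    simpa using QLoc.mul_prime (p := 2) (l := [a]) (l' := [b, c, d]) (by simpa using h')
  by_cases h1 : (M - a) % 4 = 0
  · exact (QLoc.of_odd_four ha hd (Val.sq_zero [b, c]) (M := M) (by simpa using h1)).perm
      (by grind)
  · exact (QLoc.of_odd_four ha hd ((Val.sq_zero [c]).cons b 1) (M := M)
      (by omega)).perm (by grind)

theorem qLoc_odd_two_four2 {a b c d : ℕ} (ha : a % 2 = 1) (hb : b % 4 = 2) (hc : c % 8 = 4)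
    (hd : d % 8 = 4) (M : ℤ) : QLoc 2 [a, b, c, d] M := by
  by_cases h0 : M % 2 = 0
  · obtain ⟨M, rfl⟩ : ∃ K, M = 2 * K := ⟨M / 2, by omega⟩
    obtain ⟨b, rfl⟩ : ∃ e, b = 2 * e := ⟨b / 2, by omega⟩
    obtain ⟨c, rfl⟩ : ∃ e, c = 2 * e := ⟨c / 2, by omega⟩
    obtain ⟨d, rfl⟩ : ∃ e, d = 2 * e := ⟨d / 2, by omega⟩
    have h := qLoc_odd_two3 (a := b) (b := c) (c := d) (d := 2 * a) (by omega) (by omega)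
      (by omega) (by omega) M
    have h' := h.perm (l' := [2 * a, b, c, d]) (by grind)
    simpa using QLoc.mul_prime (p := 2) (l := [a]) (l' := [b, c, d]) (by simpa using h')
  by_cases h1 : (M - a) % 4 = 0
  · exact (QLoc.of_odd_four ha hd (Val.sq_zero [b, c]) (M := M) (by simpa using h1)).perm
      (by grind)
  · exact (QLoc.of_odd_four ha hd ((Val.sq_zero [c]).cons b 1) (M := M)
      (by omega)).perm (by grind)

theorem qLoc_odd_two_four_eight {a b c d : ℕ} (ha : a % 2 = 1) (hb : b % 4 = 2) (hc : c % 8 = 4)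
    (hd : d % 16 = 8) (M : ℤ) : QLoc 2 [a, b, c, d] M := by
  by_cases h0 : M % 2 = 0
  · obtain ⟨M, rfl⟩ : ∃ K, M = 2 * K := ⟨M / 2, by omega⟩
    obtain ⟨b, rfl⟩ : ∃ e, b = 2 * e := ⟨b / 2, by omega⟩
    obtain ⟨c, rfl⟩ : ∃ e, c = 2 * e := ⟨c / 2, by omega⟩
    obtain ⟨d, rfl⟩ : ∃ e, d = 2 * e := ⟨d / 2, by omega⟩
    have h := qLoc_odd_two2_four (a := b) (b := 2 * a) (c := c) (d := d) (by omega) (by omega)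
      (by omega) (by omega) M
    have h' := h.perm (l' := [2 * a, b, c, d]) (by grind)
    simpa using QLoc.mul_prime (p := 2) (l := [a]) (l' := [b, c, d]) (by simpa using h')
  by_cases h1 : (M - a) % 4 = 0
  · exact (QLoc.of_odd_four ha hc (Val.sq_zero [b, d]) (M := M) (by simpa using h1)).perm
      (by grind)
  · exact (QLoc.of_odd_four ha hc ((Val.sq_zero [d]).cons b 1) (M := M)
      (by omega)).perm (by grind)

theorem qLoc_odd2_two_eight {a b c d : ℕ} (ha : a % 2 = 1) (hb : b % 2 = 1) (hc : c % 4 = 2)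
    (hd : d % 16 = 8) (M : ℤ) : QLoc 2 [a, b, c, d] M := by
  by_cases h0 : M % 2 = 0
  · obtain ⟨M, rfl⟩ : ∃ K, M = 2 * K := ⟨M / 2, by omega⟩
    obtain ⟨c, rfl⟩ : ∃ e, c = 2 * e := ⟨c / 2, by omega⟩
    obtain ⟨d, rfl⟩ : ∃ e, d = 2 * e := ⟨d / 2, by omega⟩
    have h := qLoc_odd_two2_four (a := c) (b := 2 * a) (c := 2 * b) (d := d) (by omega) (by omega)
      (by omega) (by omega) M
    have h' := h.perm (l' := [2 * a, 2 * b, c, d]) (by grind)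
    simpa using QLoc.mul_prime (p := 2) (l := [a, b]) (l' := [c, d]) (by simpa using h')
  by_cases h1 : (M - a) % 4 = 0
  · exact QLoc.of_two_odd ha hb (Val.sq_zero _) (by simpa using h1)
  · exact QLoc.of_two_odd ha hb ((Val.sq_zero [d]).cons c 1) (by omega)

/-! ### Local solvability of polygonal forms -/

theorem Loc.cons {m p a : ℕ} {t : List ℕ} {N w : ℤ} (h : Loc m p [a] (N - w))
    (hw : Val (polygonal m) t w) : Loc m p (a :: t) N := by
  intro k
  obtain ⟨_, ⟨x, _, rfl, rfl⟩, hk⟩ := h k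
  refine ⟨_, hw.cons a x, ?_⟩
  simpa using hk.add_right w

theorem Loc.scale {m p : ℕ} (d : ℕ) {l : List ℕ} {N : ℤ} (h : Loc m p l N) :
    Loc m p (l.map (fun c => d * c)) (d * N) := fun k =>
  let ⟨w, hw, hk⟩ := h k; ⟨d * w, hw.scale d, hk.mul_left _⟩

/-- A unit coefficient and an argument `x` at which `polygonal m` is non-degenerate modulo `p`. -/
theorem Loc.of_prime_unit {m p : ℕ} (hp : p.Prime) (hp2 : p ≠ 2)
    (hm : ¬ (p : ℤ) ∣ (m : ℤ) - 2) {a : ℕ} {t : List ℕ} {N w x : ℤ} (ha : ¬ p ∣ a)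
    (hx : ¬ (p : ℤ) ∣ 2 * ((m : ℤ) - 2) * x - ((m : ℤ) - 4)) (hw : Val (polygonal m) t w)
    (h : a * polygonal m x + w ≡ N [ZMOD p]) : Loc m p (a :: t) N := by
  refine Loc.cons (w := w) (Loc.of_qLoc_odd hp hp2 hm ?_) hw
  refine QLoc.of_prime_unit hp hp2 ha hx (w := 0) rfl ?_
  have h1 := two_mul_polygonal m x
  have h2 := (h.mul_left (8 * ((m : ℤ) - 2))).add_right (((m : ℤ) - 4) ^ 2 * a - 8 * (m - 2) * w)
  convert h2 using 1
  · linear_combination (-4 * ((m : ℤ) - 2) * a) * h1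
  · simp only [List.sum_cons, List.sum_nil]
    push_cast
    ring

/-- For even `v`, an odd argument of the unit coefficient `a` is non-degenerate, and its values fill
the class of `a` modulo 8. -/
theorem Loc.of_two_unit_even {v a : ℕ} (hv : v % 2 = 0) {t : List ℕ} {N w : ℤ} (ha : a % 2 = 1)
    (hw : Val (polygonal (4 * v + 4)) t w) (h : (N - w - a) % 8 = 0) :
    Loc (4 * v + 4) 2 (a :: t) N := by
  refine Loc.cons (w := w) (Loc.of_qLoc_two ?_) hw
  refine QLoc.of_two_unit ha (w := 0) rfl ?_
  obtain ⟨j, rfl⟩ : ∃ j, v = 2 * j := ⟨v / 2, by omega⟩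
  obtain ⟨i, hi⟩ : ∃ i, N - w = a + 8 * i := ⟨(N - w - a) / 8, by omega⟩
  obtain ⟨e, he⟩ := (Int.even_mul_succ_self (j : ℤ)).two_dvd
  rw [hi]
  simp only [List.sum_cons, List.sum_nil]
  push_cast
  have : (2 * (2 * (j : ℤ)) + 1) * (a + 8 * i) + (2 * j) ^ 2 * (a + 0) - 0 - a =
      8 * (e * a + (4 * j + 1) * i) := by linear_combination 4 * (a : ℤ) * he
  omega

/-- For odd `v`, an even argument of the unit coefficient `a` is non-degenerate, and its values fill
the class of 0 modulo 8. -/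
theorem Loc.of_two_unit_odd {v a : ℕ} (hv : v % 2 = 1) {t : List ℕ} {N w : ℤ} (ha : a % 2 = 1)
    (hw : Val (polygonal (4 * v + 4)) t w) (h : (N - w) % 8 = 0) :
    Loc (4 * v + 4) 2 (a :: t) N := by
  refine Loc.cons (w := w) (Loc.of_qLoc_two ?_) hw
  refine QLoc.of_two_unit ha (w := 0) rfl ?_
  obtain ⟨j, rfl⟩ : ∃ j, v = 2 * j + 1 := ⟨v / 2, by omega⟩
  obtain ⟨i, hi⟩ : ∃ i, N - w = 8 * i := ⟨(N - w) / 8, by omega⟩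
  obtain ⟨e, he⟩ := (Int.even_mul_succ_self (j : ℤ)).two_dvd
  rw [hi]
  simp only [List.sum_cons, List.sum_nil]
  push_cast
  have : (2 * (2 * (j : ℤ) + 1) + 1) * (8 * i) + (2 * j + 1) ^ 2 * (a + 0) - 0 - a =
      8 * (e * a + (4 * j + 3) * i) := by linear_combination 4 * (a : ℤ) * he
  omega

theorem loc_all_of_qLoc_two {v : ℕ} {l l' : List ℕ} (h : ∀ M, QLoc 2 l M) (t : List ℕ)
    (hl : (l ++ t).Perm l') (N : ℤ) : Loc (4 * v + 4) 2 l' N :=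
  (Loc.of_qLoc_two (((h _).append t).perm hl))

/-- If `2 (polygonal m)` has derivative a unit at `p` everywhere, the polygonal form attains
everything. -/
theorem Loc.of_dvd_sub_two {m p : ℕ} (hp : p.Prime) (hp2 : p ≠ 2)
    (hm : (p : ℤ) ∣ (m : ℤ) - 2) {a : ℕ} (ha : ¬ p ∣ a) (t : List ℕ) (N : ℤ) :
    Loc m p (a :: t) N := by
  have hpi : Prime (p : ℤ) := Nat.prime_iff_prime_int.1 hp
  have hc : IsCoprime (p : ℤ) 2 := hpi.coprime_iff_not_dvd.2 fun hd => by
    have : p ∣ 2 := by exact_mod_cast hd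
    exact hp2 ((Nat.prime_dvd_prime_iff_eq hp Nat.prime_two).1 this)
  have key : ∀ (z : ℤ) (k : ℕ), ∃ x, (p : ℤ) ^ k ∣ polygonal m x - z := by
    intro z k
    induction k with
    | zero => exact ⟨0, by simp⟩
    | succ k ih =>
      obtain ⟨x, s, hs⟩ := ih
      obtain ⟨j, hj⟩ := hm
      refine ⟨x - p ^ k * s, ?_⟩
      apply (hc.pow_left (m := k + 1)).dvd_of_dvd_mul_left
      refine ⟨s * (j - j * (2 * x - p ^ k * s)), ?_⟩
      have h1 := two_mul_polygonal m x
      have h2 := two_mul_polygonal m (x - p ^ k * s)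
      linear_combination 2 * hs + h2 - h1 + (s * p ^ k) * (1 - (2 * x - p ^ k * s)) * hj
  intro k
  have hca : IsCoprime ((p : ℤ) ^ k) a :=
    (hpi.coprime_iff_not_dvd.2 (by exact_mod_cast ha)).pow_left
  obtain ⟨u, v, huv⟩ := hca
  obtain ⟨x, y, hx⟩ := key (v * N) k
  refine ⟨_, (Val.zero 0 (polygonal_zero m) t).cons a x, (Int.modEq_iff_dvd.2 ?_)⟩
  exact ⟨u * N - a * y, by linear_combination (-N) * huv - a * hx⟩

theorem Loc.of_not_four_dvd {m : ℕ} (hm : m % 4 ≠ 0) {a : ℕ} (ha : a % 2 = 1) (t : List ℕ)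
    (N : ℤ) : Loc m 2 (a :: t) N := by
  have key : ∀ (z : ℤ) (k : ℕ), ∃ x, (2 : ℤ) ^ k ∣ polygonal m x - z := by
    intro z k
    induction k with
    | zero => exact ⟨0, by simp⟩
    | succ k ih =>
      obtain ⟨x, s, hs⟩ := ih
      have h1 := two_mul_polygonal m x
      by_cases h2 : m % 2 = 0
      · obtain ⟨j, rfl⟩ : ∃ j, m = 4 * j + 2 := ⟨m / 4, by omega⟩
        refine ⟨x + 2 ^ k * s, s * (1 - j + j * (2 * x + 2 ^ k * s)), ?_⟩
        have h2 := two_mul_polygonal (4 * j + 2) (x + 2 ^ k * s)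
        push_cast at h1 h2
        apply mul_left_cancel₀ (two_ne_zero (α := ℤ))
        linear_combination 2 * hs + h2 - h1
      · obtain ⟨j, rfl⟩ : ∃ j, m = 2 * j + 1 := ⟨m / 2, by omega⟩
        refine ⟨x + 2 ^ (k + 1) * s, s * (2 - j + (2 * j - 1) * (x + 2 ^ k * s)), ?_⟩
        have h2 := two_mul_polygonal (2 * j + 1) (x + 2 ^ (k + 1) * s)
        push_cast at h1 h2
        apply mul_left_cancel₀ (two_ne_zero (α := ℤ))
        linear_combination 2 * hs + h2 - h1
  intro k
  have hca : IsCoprime ((2 : ℤ) ^ k) a :=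
    (Int.prime_two.coprime_iff_not_dvd.2 (by omega)).pow_left
  obtain ⟨u, v, huv⟩ := hca
  obtain ⟨x, y, hx⟩ := key (v * N) k
  refine ⟨_, (Val.zero 0 (polygonal_zero m) t).cons a x, (Int.modEq_iff_dvd.2 ?_)⟩
  exact ⟨u * N - a * y, by push_cast; linear_combination (-N) * huv - a * hx⟩

/-! ### The degenerate class at the prime 3 -/

theorem qLoc_three_isotropic {a b c : ℕ} (hb : b % 9 = 3) (hc : c % 9 = 6) {M : ℤ}
    (hM : (3 : ℤ) ∣ M) : QLoc 3 [a, b, c] M := by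
  obtain ⟨M, rfl⟩ := hM
  obtain ⟨b, rfl⟩ : ∃ e, b = 3 * e := ⟨b / 3, by omega⟩
  obtain ⟨c, rfl⟩ : ∃ e, c = 3 * e := ⟨c / 3, by omega⟩
  have h := QLoc.isotropic Nat.prime_three (by simp) (a := b) (b := c) (y := 1) (M := M)
    (by omega) (by omega) (by omega) [3 * a]
  have h' := h.perm (l' := [3 * a, b, c]) (by grind)
  simpa using QLoc.mul_prime (p := 3) (l := [a]) (l' := [b, c]) (by simpa using h')

theorem qLoc_three_units {a b c d : ℕ} (hb : b % 9 = 3 ∨ b % 9 = 6) (hc : c % 9 = 3 ∨ c % 9 = 6)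
    (hd : d % 9 = 3 ∨ d % 9 = 6) {M : ℤ} (hM : (3 : ℤ) ∣ M) : QLoc 3 [a, b, c, d] M := by
  obtain ⟨M, rfl⟩ := hM
  obtain ⟨b, rfl⟩ : ∃ e, b = 3 * e := ⟨b / 3, by omega⟩
  obtain ⟨c, rfl⟩ : ∃ e, c = 3 * e := ⟨c / 3, by omega⟩
  obtain ⟨d, rfl⟩ : ∃ e, d = 3 * e := ⟨d / 3, by omega⟩
  have h := QLoc.three_units Nat.prime_three (by simp) (a := b) (b := c) (c := d)
    (by omega) (by omega) (by omega) M [3 * a]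
  have h' := h.perm (l' := [3 * a, b, c, d]) (by grind)
  simpa using QLoc.mul_prime (p := 3) (l := [a]) (l' := [b, c, d]) (by simpa using h')

/-- Two units together with `3` times two units: every non-zero integer is represented over the
3-adic integers. -/
theorem qLoc_three_two_two {a b c d : ℕ} (ha : ¬ 3 ∣ a) (hb : ¬ 3 ∣ b) (hc : ¬ 3 ∣ c)
    (hd : ¬ 3 ∣ d) : ∀ M : ℤ, M ≠ 0 → QLoc 3 [a, b, 3 * c, 3 * d] M := by
  intro M
  induction h : M.natAbs using Nat.strong_induction_on generalizing M with
  | _ n ih =>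
    intro hM
    by_cases h3 : (3 : ℤ) ∣ M
    · obtain ⟨K, rfl⟩ := h3
      have key : QLoc 3 [3 * a, 3 * b, c, d] K := by
        by_cases h9 : (3 : ℤ) ∣ K
        · obtain ⟨J, rfl⟩ := h9
          have := ih J.natAbs (by omega) J rfl (by omega)
          have := this.perm (l' := [3 * c, 3 * d, a, b]) (by grind)
          exact (QLoc.mul_prime (p := 3) (l := [c, d]) (l' := [a, b])
            (by simpa using this)).perm (by simp; grind)
        · exact (QLoc.two_units Nat.prime_three (by simp) hc hd h9 [3 * a, 3 * b]).perm
            (by grind)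
      simpa using QLoc.mul_prime (p := 3) (l := [a, b]) (l' := [c, d]) (by simpa using key)
    · exact QLoc.two_units Nat.prime_three (by simp) ha hb h3 _

theorem qLoc_three_nine {a b c d : ℕ} (ha : ¬ 3 ∣ a) (hb : b % 9 = 3 ∨ b % 9 = 6)
    (hc : c % 9 = 3 ∨ c % 9 = 6) (hd : d % 27 = 9 ∨ d % 27 = 18) {M : ℤ} (hM : (3 : ℤ) ∣ M)
    (h0 : M ≠ 0) : QLoc 3 [a, b, c, d] M := by
  obtain ⟨M, rfl⟩ := hM
  obtain ⟨b, rfl⟩ : ∃ e, b = 3 * e := ⟨b / 3, by omega⟩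
  obtain ⟨c, rfl⟩ : ∃ e, c = 3 * e := ⟨c / 3, by omega⟩
  obtain ⟨d, rfl⟩ : ∃ e, d = 3 * (3 * e) := ⟨d / 9, by omega⟩
  have h := qLoc_three_two_two (a := b) (b := c) (c := a) (d := d) (by omega) (by omega) ha
    (by omega) M (by omega)
  have h' := h.perm (l' := [3 * a, b, c, 3 * d]) (by grind)
  simpa using QLoc.mul_prime (p := 3) (l := [a]) (l' := [b, c, 3 * d]) (by simpa using h')

/-- The coefficients `t`, all multiples of 3, supply the degenerate residue class modulo 3:
they contain `3 b, 3 c` with `b + c ≡ 0`, or three elements exactly divisible by 3,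
or two elements exactly divisible by 3 and one exactly divisible by 9. -/
def SuppliesThree (t : List ℕ) : Prop :=
  (∃ b c s, t.Perm (b :: c :: s) ∧ b % 9 = 3 ∧ c % 9 = 6) ∨
  ∃ b c d s, t.Perm (b :: c :: d :: s) ∧ (b % 9 = 3 ∨ b % 9 = 6) ∧ (c % 9 = 3 ∨ c % 9 = 6) ∧
    (d % 9 = 3 ∨ d % 9 = 6 ∨ d % 27 = 9 ∨ d % 27 = 18)

theorem SuppliesThree.loc {m a : ℕ} (hm : 5 ≤ m) (hm3 : m % 3 ≠ 2) (ha : ¬ 3 ∣ a) {t : List ℕ}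
    (ht : SuppliesThree t) {N : ℤ} (hN : 0 ≤ N)
    (h : (m % 3 = 1 ∧ N % 3 = 0) ∨ (m % 3 = 0 ∧ (N - a) % 3 = 0)) : Loc m 3 (a :: t) N := by
  have hm2 : ¬ ((3 : ℕ) : ℤ) ∣ (m : ℤ) - 2 := by omega
  have hM : ∀ A : ℤ, (A - a) % 3 = 0 → (3 : ℤ) ∣ 8 * ((m : ℤ) - 2) * N + ((m : ℤ) - 4) ^ 2 * A := by
    intro A hA
    obtain ⟨j, hj⟩ : ∃ j, A = a + 3 * j := ⟨(A - a) / 3, by omega⟩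
    rcases h with ⟨h1, h2⟩ | ⟨h1, h2⟩
    · obtain ⟨n, rfl⟩ : ∃ n, N = 3 * n := ⟨N / 3, by omega⟩
      obtain ⟨i, rfl⟩ : ∃ i, m = 3 * i + 1 := ⟨m / 3, by omega⟩
      exact ⟨8 * (3 * i - 1) * n + 3 * (i - 1) ^ 2 * A, by push_cast; ring⟩
    · obtain ⟨n, hn⟩ : ∃ n, N = a + 3 * n := ⟨(N - a) / 3, by omega⟩
      obtain ⟨i, rfl⟩ : ∃ i, m = 3 * i := ⟨m / 3, by omega⟩
      exact ⟨8 * (3 * i - 2) * n + (3 * i - 4) ^ 2 * j + (8 * i + 3 * i ^ 2 - 8 * i) * a, by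
        rw [hj, hn]; push_cast; ring⟩
  have hpos : ∀ A : ℕ, 0 < A → 8 * ((m : ℤ) - 2) * N + ((m : ℤ) - 4) ^ 2 * A ≠ 0 := by
    intro A hA
    have h1 : (0 : ℤ) < ((m : ℤ) - 4) ^ 2 * A :=
      mul_pos (pow_pos (by omega) 2) (by exact_mod_cast hA)
    have h2 : 0 ≤ 8 * ((m : ℤ) - 2) * N := mul_nonneg (by omega) hN
    omega
  rcases ht with ⟨b, c, s, hs, hb, hc⟩ | ⟨b, c, d, s, hs, hb, hc, hd⟩
  · have h1 : Loc m 3 [a, b, c] N := Loc.of_qLoc_odd Nat.prime_three (by simp) hm2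
      (qLoc_three_isotropic hb hc (hM _ (by simp; omega)))
    exact (h1.append s).perm ((hs.symm.cons a))
  · have h1 : Loc m 3 [a, b, c, d] N := by
      refine Loc.of_qLoc_odd Nat.prime_three (by simp) hm2 ?_
      have h3 := hM (([a, b, c, d] : List ℕ).sum : ℕ) (by simp; omega)
      have h4 := hpos ([a, b, c, d] : List ℕ).sum (by simp; omega)
      by_cases h5 : d % 9 = 3 ∨ d % 9 = 6
      · exact qLoc_three_units hb hc h5 h3
      · exact qLoc_three_nine ha hb hc (by omega) h3 h4
    exact (h1.append s).perm (hs.symm.cons a)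

theorem Loc.three_one {m a : ℕ} (hm : m % 3 = 1) (ha : ¬ 3 ∣ a) {t : List ℕ} {N w : ℤ}
    (hw : Val (polygonal m) t w) (h : (N - w - a) % 3 = 0) : Loc m 3 (a :: t) N := by
  refine Loc.of_prime_unit Nat.prime_three (by simp) (by omega) ha (x := 1)
    (by omega) hw ?_
  rw [polygonal_one, Int.modEq_iff_dvd]
  omega

theorem Loc.three_zero {m a : ℕ} (hm : m % 3 = 0) (ha : ¬ 3 ∣ a) {t : List ℕ} {N w : ℤ}
    (hw : Val (polygonal m) t w) (h : (N - w) % 3 = 0) : Loc m 3 (a :: t) N := by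
  refine Loc.of_prime_unit Nat.prime_three (by simp) (by omega) ha (x := 0)
    (by omega) hw ?_
  rw [polygonal_zero, Int.modEq_iff_dvd]
  omega

/-! ### Small represented numbers -/

theorem polygonal_cases {m : ℕ} (hm : 4 ≤ m) (x : ℕ) :
    (x = 0 ∧ polygonal m x = 0) ∨ (x = 1 ∧ polygonal m x = 1) ∨
      (x = 2 ∧ polygonal m x = m) ∨ (3 ≤ x ∧ 3 * (m : ℤ) - 3 ≤ polygonal m x) := by
  rcases x with _ | _ | _ | x
  · exact Or.inl ⟨rfl, polygonal_zero m⟩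
  · exact Or.inr (Or.inl ⟨rfl, polygonal_one m⟩)
  · exact Or.inr (Or.inr (Or.inl ⟨rfl, polygonal_two m⟩))
  · refine Or.inr (Or.inr (Or.inr ⟨by omega, ?_⟩))
    rw [← polygonal_three]
    exact_mod_cast polygonal_mono hm (x := 3) (by omega)

theorem Rep.nonneg {m : ℕ} (hm : 4 ≤ m) {l : List ℕ} {N : ℤ} (h : Rep m l N) : 0 ≤ N := by
  induction l generalizing N with
  | nil => exact (show N = 0 from h).ge
  | cons c l ih =>
    obtain ⟨x, w, hw, rfl⟩ := h
    have := ih hw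
    have := mul_nonneg (Int.natCast_nonneg c) (polygonal_nonneg hm x)
    simp only
    omega

theorem Rep.cons_cases {m : ℕ} (hm : 4 ≤ m) {c : ℕ} {t : List ℕ} {N : ℤ} (h : Rep m (c :: t) N)
    (hN : N < c * m) : Rep m t N ∨ Rep m t (N - c) := by
  obtain ⟨x, w, hw, rfl⟩ := h
  have hw0 := Rep.nonneg hm hw
  have hc : (0 : ℤ) ≤ c := Int.natCast_nonneg c
  rcases polygonal_cases hm x with ⟨-, h⟩ | ⟨-, h⟩ | ⟨-, h⟩ | ⟨-, h⟩
  · simp only [h]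
    left; simpa [Rep] using hw
  · simp only [h]
    right; simpa [Rep] using hw
  · simp only [h] at hN
    omega
  · simp only at hN
    have : (c : ℤ) * m ≤ c * polygonal m x := by
      apply mul_le_mul_of_nonneg_left _ hc
      omega
    omega

theorem Rep.cons_small {m : ℕ} (hm : 4 ≤ m) {c : ℕ} {t : List ℕ} {N : ℤ} (h : Rep m (c :: t) N)
    (hN : N < m) : Rep m t N ∨ (Rep m t (N - c) ∧ (c : ℤ) ≤ N) := by
  rcases Nat.eq_zero_or_pos c with rfl | hc
  · obtain ⟨x, w, hw, rfl⟩ := h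
    left; simpa [Rep] using hw
  · rcases h.cons_cases hm (lt_of_lt_of_le hN (by nlinarith)) with h | h
    · exact Or.inl h
    · exact Or.inr ⟨h, by have := h.nonneg hm; omega⟩

/-- All elements of `t` are positive multiples of `d`. -/
def Multiples (d : ℕ) (t : List ℕ) : Prop := ∀ c ∈ t, 0 < c ∧ d ∣ c

theorem Multiples.mono {d e : ℕ} {t : List ℕ} (h : Multiples e t) (hd : d ∣ e) :
    Multiples d t := fun c hc => ⟨(h c hc).1, hd.trans (h c hc).2⟩

theorem Multiples.perm {d : ℕ} {t s : List ℕ} (h : Multiples d t) (hp : t.Perm s) :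
    Multiples d s := fun c hc => h c (hp.mem_iff.2 hc)

theorem Multiples.cons {d c : ℕ} {t : List ℕ} (hc : 0 < c ∧ d ∣ c) (ht : Multiples d t) :
    Multiples d (c :: t) := List.forall_mem_cons.2 ⟨hc, ht⟩

theorem Multiples.of_cons {d c : ℕ} {t : List ℕ} (h : Multiples d (c :: t)) :
    (0 < c ∧ d ∣ c) ∧ Multiples d t :=
  ⟨h c (by simp), fun e he => h e (by simp [he])⟩

/-- A positive number represented by a list of multiples of `d` is a multiple of `d`, and some
coefficient does not exceed it. -/
theorem Multiples.rep {m d : ℕ} (hm : 4 ≤ m) {t : List ℕ} (ht : Multiples d t) {w : ℤ}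
    (h : Rep m t w) : (d : ℤ) ∣ w ∧ (w = 0 ∨ (0 < w ∧ ∃ c s, t.Perm (c :: s) ∧ 0 < c ∧ (c : ℤ) ≤ w ∧
      d ∣ c ∧ Multiples d s)) := by
  refine ⟨Val.dvd (fun c hc => (ht c hc).2) h, ?_⟩
  have key : ∀ {t : List ℕ} {w : ℤ}, Rep m t w → w = 0 ∨ (0 < w ∧ ∃ c ∈ t, (c : ℤ) ≤ w) := by
    intro t
    induction t with
    | nil => exact fun h => Or.inl h
    | cons c t ih =>
      rintro w ⟨x, w, hw, rfl⟩
      have h1 := Rep.nonneg hm hw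
      have hc : (0 : ℤ) ≤ c := Int.natCast_nonneg c
      have h2 := polygonal_nonneg hm x
      have h3 : (0 : ℤ) ≤ c * polygonal m x := mul_nonneg hc h2
      simp only
      rcases ih hw with rfl | ⟨h4, e, he, h5⟩
      · rcases h3.eq_or_lt with h6 | h6
        · left; omega
        · refine Or.inr ⟨by omega, c, by simp, ?_⟩
          have : 0 < polygonal m x := by
            rcases h2.eq_or_lt with h7 | h7
            · rw [← h7] at h6; simp at h6
            · exact h7
          nlinarith
      · exact Or.inr ⟨by omega, e, by simp [he], by omega⟩
  rcases key h with rfl | ⟨h0, c, hc, hcw⟩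
  · exact Or.inl rfl
  · refine Or.inr ⟨h0, c, t.erase c, List.perm_cons_erase hc, (ht c hc).1, hcw, (ht c hc).2, ?_⟩
    exact fun e he => ht e (List.mem_of_mem_erase he)

theorem exists_perm_append (q : ℕ → Prop) (l : List ℕ) :
    ∃ s t : List ℕ, l.Perm (s ++ t) ∧ (∀ c ∈ s, q c) ∧ ∀ c ∈ t, ¬ q c := by
  classical
  refine ⟨l.filter (fun c => decide (q c)), l.filter (fun c => !decide (q c)),
    (List.filter_append_perm _ _).symm, ?_, ?_⟩
  · intro c hc
    simpa using (List.mem_filter.1 hc).2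
  · intro c hc
    simpa using (List.mem_filter.1 hc).2

/-! ### Forms that are not universal at the prime 3 only -/

theorem loc_three_of_three_units {m a b c : ℕ} (hm3 : m % 3 ≠ 2) (ha : ¬ 3 ∣ a) (hb : ¬ 3 ∣ b)
    (hc : ¬ 3 ∣ c) (t : List ℕ) (N : ℤ) : Loc m 3 (a :: b :: c :: t) N :=
  Loc.of_qLoc_odd Nat.prime_three (by simp) (by omega)
    (QLoc.three_units Nat.prime_three (by simp) ha hb hc _ t)

theorem loc_three_of_isotropic {m a b : ℕ} (hm3 : m % 3 ≠ 2) (ha : ¬ 3 ∣ a) (hb : ¬ 3 ∣ b)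
    (hab : a % 3 ≠ b % 3) (t : List ℕ) (N : ℤ) : Loc m 3 (a :: b :: t) N :=
  Loc.of_qLoc_odd Nat.prime_three (by simp) (by omega)
    (QLoc.isotropic Nat.prime_three (by simp) ha hb (y := 1) (by omega) t)

theorem loc_three_of_two_two {m a b c d : ℕ} (hm : 5 ≤ m) (hm3 : m % 3 ≠ 2) (ha : ¬ 3 ∣ a)
    (hb : ¬ 3 ∣ b) (hc : c % 9 = 3 ∨ c % 9 = 6) (hd : d % 9 = 3 ∨ d % 9 = 6) (t : List ℕ) {N : ℤ}
    (hN : 0 ≤ N) : Loc m 3 (a :: b :: c :: d :: t) N := by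
  obtain ⟨c, rfl⟩ : ∃ e, c = 3 * e := ⟨c / 3, by omega⟩
  obtain ⟨d, rfl⟩ : ∃ e, d = 3 * e := ⟨d / 3, by omega⟩
  have h1 : Loc m 3 [a, b, 3 * c, 3 * d] N := by
    refine Loc.of_qLoc_odd Nat.prime_three (by simp) (by omega)
      (qLoc_three_two_two ha hb (by omega) (by omega) _ ?_)
    have h1 : (0 : ℤ) < ((m : ℤ) - 4) ^ 2 * (([a, b, 3 * c, 3 * d] : List ℕ).sum : ℕ) :=
      mul_pos (pow_pos (by omega) 2) (by simp; omega)
    have h2 : 0 ≤ 8 * ((m : ℤ) - 2) * N := mul_nonneg (by omega) hN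
    omega
  exact h1.append t

/-- If the 3-adic condition fails for some number, then either a single coefficient is prime to 3,
or exactly two are, they are congruent modulo 3, and at most one further coefficient is not a
multiple of 9. -/
theorem three_structure {m : ℕ} (hm : 5 ≤ m) (hm3 : m % 3 ≠ 2) {l : List ℕ} (hpos : ∀ c ∈ l, 0 < c)
    (hu : ∃ c ∈ l, ¬ 3 ∣ c) (hbad : ¬ ∀ N : ℕ, Loc m 3 l N) :
    (∃ a t, l.Perm (a :: t) ∧ ¬ 3 ∣ a ∧ Multiples 3 t) ∨
    ∃ a b t, l.Perm (a :: b :: t) ∧ ¬ 3 ∣ a ∧ a % 3 = b % 3 ∧ Multiples 3 t ∧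
      (Multiples 9 t ∨ ∃ c s, t.Perm (c :: s) ∧ 0 < c ∧ (c % 9 = 3 ∨ c % 9 = 6) ∧
        Multiples 9 s) := by
  obtain ⟨s, t, hl, hs, ht⟩ := exists_perm_append (fun c => ¬ 3 ∣ c) l
  have ht3 : Multiples 3 t := fun c hc =>
    ⟨hpos c (hl.mem_iff.2 (by simp [hc])), by simpa using ht c hc⟩
  rcases s with _ | ⟨a, _ | ⟨b, _ | ⟨c, s⟩⟩⟩
  · obtain ⟨c, hc, hc3⟩ := hu
    exact absurd (ht3 c (by simpa using hl.mem_iff.1 hc)).2 hc3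
  · exact Or.inl ⟨a, t, hl, hs a (by simp), ht3⟩
  · have ha := hs a (by simp)
    have hb := hs b (by simp)
    right
    refine ⟨a, b, t, hl, ha, ?_, ht3, ?_⟩
    · by_contra hab
      exact hbad fun N => (loc_three_of_isotropic hm3 ha hb hab t N).perm hl.symm
    · obtain ⟨s', t', hl', hs', ht'⟩ := exists_perm_append (fun c => ¬ 9 ∣ c) t
      have h9 : Multiples 9 t' := fun c hc =>
        ⟨(ht3 c (hl'.mem_iff.2 (by simp [hc]))).1, by simpa using ht' c hc⟩
      have h36 : ∀ c ∈ s', c % 9 = 3 ∨ c % 9 = 6 := fun c hc => by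
        have h1 := hs' c hc
        have h2 := (ht3 c (hl'.mem_iff.2 (by simp [hc]))).2
        omega
      rcases s' with _ | ⟨c, _ | ⟨d, s'⟩⟩
      · exact Or.inl (h9.perm hl'.symm)
      · exact Or.inr ⟨c, t', hl', (ht3 c (hl'.mem_iff.2 (by simp))).1, h36 c (by simp), h9⟩
      · exact absurd (fun N : ℕ => (loc_three_of_two_two hm hm3 ha hb (h36 c (by simp))
          (h36 d (by simp)) (s' ++ t') (Int.natCast_nonneg N)).perm
            ((hl.trans ((hl'.cons b).cons a)).symm)) hbad
  · exact absurd (fun N : ℕ => (loc_three_of_three_units hm3 (hs a (by simp)) (hs b (by simp))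
      (hs c (by simp)) (s ++ t) N).perm hl.symm) hbad

/-- Two coefficients prime to 3: small locally represented numbers force `t` to represent 3 and 6,
which is impossible by `h9`. -/
theorem three_pair_false {m a b : ℕ} (hm : 9 ≤ m) (hm3 : m % 3 ≠ 2) {t : List ℕ} (ha0 : ¬ 3 ∣ a)
    (hab : a % 3 = b % 3) (ht : Multiples 3 t)
    (h9 : Multiples 9 t ∨ ∃ c s, t.Perm (c :: s) ∧ 0 < c ∧ (c % 9 = 3 ∨ c % 9 = 6) ∧
        Multiples 9 s)
    (H : ∀ N : ℕ, Loc m 3 (a :: b :: t) N → Rep m (a :: b :: t) N) : False := by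
  have hm4 : 4 ≤ m := by omega
  -- the multiples of 3 alone cannot represent both 3 and 6
  have h36 : Rep m t 3 → Rep m t 6 → False := by
    intro h3 h6
    rcases h9 with h9 | ⟨c, s, hs, hc0, hc, h9⟩
    · have := (h9.rep hm4 h3).1
      omega
    · rcases (h3.perm hs).cons_small hm4 (by omega) with h | ⟨h, -⟩ <;>
        have h1 := (h9.rep hm4 h).1 <;>
        rcases (h6.perm hs).cons_small hm4 (by omega) with h' | ⟨h', -⟩ <;>
        have h2 := (h9.rep hm4 h').1 <;> omega
  have small : ∀ N : ℕ, N < 9 → Rep m (a :: b :: t) N →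
      Rep m t N ∨ (Rep m t (N - a) ∧ a ≤ N) ∨ (Rep m t (N - b) ∧ b ≤ N) ∨
        (Rep m t (N - a - b) ∧ a + b ≤ N) := by
    intro N hN h
    rcases h.cons_small hm4 (by omega) with h | ⟨h, h1⟩ <;>
      rcases h.cons_small hm4 (by omega) with h | ⟨h, h2⟩
    · exact Or.inl h
    · exact Or.inr (Or.inr (Or.inl ⟨h, by omega⟩))
    · exact Or.inr (Or.inl ⟨h, by omega⟩)
    · exact Or.inr (Or.inr (Or.inr ⟨h, by omega⟩))
  rcases (by omega : m % 3 = 1 ∨ m % 3 = 0) with hm1 | hm0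
  · have L : ∀ N : ℕ, N % 3 ≠ 0 → Rep m (a :: b :: t) N := fun N hN => H N <| by
      have z := Val.zero (f := polygonal m) 0 (polygonal_zero m) t
      by_cases h : ((N : ℤ) - a) % 3 = 0
      · exact Loc.three_one hm1 ha0 (z.cons b 0) (by rw [polygonal_zero]; omega)
      · refine Loc.three_one hm1 ha0 (z.cons b 1) ?_
        rw [polygonal_one]
        rcases (by omega : a % 3 = 1 ∨ a % 3 = 2) with h1 | h1 <;> omega
    have d : ∀ {w : ℤ}, Rep m t w → w % 3 = 0 := fun h => by have := (ht.rep hm4 h).1; omega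
    -- 1 and 2 force `a = b = 1`
    have hab1 : a = 1 ∧ b = 1 := by
      rcases small 1 (by simp) (L 1 (by simp)) with h | ⟨h, h'⟩ | ⟨h, h'⟩ | ⟨h, h'⟩ <;>
        have := d h <;>
      rcases small 2 (by simp) (L 2 (by simp)) with h1 | ⟨h1, h1'⟩ | ⟨h1, h1'⟩ | ⟨h1, h1'⟩ <;>
        have := d h1 <;> omega
    obtain ⟨rfl, rfl⟩ := hab1
    refine h36 ?_ ?_
    · rcases small 4 (by simp) (L 4 (by simp)) with h | ⟨h, h'⟩ | ⟨h, h'⟩ | ⟨h, h'⟩ <;>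
        have := d h <;> first | omega | simpa using h
    · rcases small 7 (by simp) (L 7 (by simp)) with h | ⟨h, h'⟩ | ⟨h, h'⟩ | ⟨h, h'⟩ <;>
        have := d h <;> first | omega | simpa using h
  · have L : ∀ N : ℕ, N % 3 = 0 → Rep m (a :: b :: t) N := fun N hN => H N <|
      Loc.three_zero hm0 ha0 (Val.zero 0 (polygonal_zero m) _) (by omega)
    have d : ∀ {w : ℤ}, Rep m t w → w % 3 = 0 := fun h => by have := (ht.rep hm4 h).1; omega
    refine h36 ?_ ?_
    · rcases small 3 (by simp) (L 3 (by simp)) with h | ⟨h, h'⟩ | ⟨h, h'⟩ | ⟨h, h'⟩ <;>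
        have := d h <;> omega
    · rcases small 6 (by simp) (L 6 (by simp)) with h | ⟨h, h'⟩ | ⟨h, h'⟩ | ⟨h, h'⟩ <;>
        have := d h <;> omega

/-- Two elements from `{3, 6}` and one more small element supply the degenerate class. -/
theorem SuppliesThree.of_three {t s : List ℕ} {c d : ℕ} (hc : c = 3 ∨ c = 6)
    (hd : c = 6 ∨ (d % 3 = 0 ∧ 0 < d ∧ d ≤ 18)) (ht : t.Perm (3 :: c :: d :: s)) :
    SuppliesThree t := by
  rcases hc with rfl | rfl
  · by_cases h6 : d % 9 = 6
    · exact Or.inl ⟨3, d, 3 :: s, ht.trans (by grind), by simp, h6⟩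
    · exact Or.inr ⟨3, 3, d, s, ht, by simp, by simp, by omega⟩
  · exact Or.inl ⟨3, 6, d :: s, ht, by simp, by simp⟩

/-- A single coefficient prime to 3: the other coefficients have to supply the degenerate class, so
that two full residue classes modulo 3 are represented. -/
theorem three_single {m a : ℕ} (hm : 9 ≤ m) (hm3 : m % 3 ≠ 2) {t : List ℕ} (ha : ¬ 3 ∣ a)
    (ht : Multiples 3 t) (H : ∀ N : ℕ, Loc m 3 (a :: t) N → Rep m (a :: t) N) :
    (a = 1 ∨ a = 2) ∧ ∀ N : ℕ, N % 3 = a ∨ N % 3 = 0 → Rep m (a :: t) N := by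
  have hm4 : 4 ≤ m := by omega
  have ha0 : 0 < a := by omega
  -- from representations of 3, 6 and 9 (or 18) by the multiples of 3
  have supply : ∀ (h3 : Rep m t 3) (h6 : Rep m t 6)
      (h9 : Rep m t 9 ∨ Rep m t 18), SuppliesThree t := by
    intro h3 h6 h9
    rcases (ht.rep hm4 h3).2 with h | ⟨-, c, s, hs, hc0, hc, hc3, hs3⟩
    · omega
    obtain rfl : c = 3 := by omega
    rcases (h6.perm hs).cons_small hm4 (by omega) with h | ⟨h, -⟩ <;>
    · rcases (hs3.rep hm4 h).2 with h | ⟨-, d, u, hu, hd0, hd, hd3, hu3⟩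
      · omega
      have hdc : d = 3 ∨ d = 6 := by omega
      by_cases hd6 : d = 6
      · exact Or.inl ⟨3, d, u, hs.trans (hu.cons 3), by simp, by omega⟩
      obtain rfl : d = 3 := by omega
      have h18 : ∃ w : ℤ, 0 < w ∧ w ≤ 18 ∧ Rep m u w := by
        have hp := hs.trans (hu.cons 3)
        have aux : ∀ N : ℤ, 6 < N → N ≤ 18 → Rep m t N → ∃ w : ℤ, 0 < w ∧ w ≤ 18 ∧ Rep m u w := by
          intro N hN0 hN h
          rcases (h.perm hp).cons_cases hm4 (by omega) with h | h <;>
            rcases h.cons_cases hm4 (by omega) with h | h <;>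
            exact ⟨_, by omega, by omega, h⟩
        rcases h9 with h9 | h9
        · exact aux 9 (by simp) (by simp) h9
        · exact aux 18 (by simp) (by simp) h9
      obtain ⟨w, hw0, hw, h18⟩ := h18
      rcases (hu3.rep hm4 h18).2 with h | ⟨-, e, v, hv, he0, he, he3, -⟩
      · omega
      exact SuppliesThree.of_three (Or.inl rfl) (Or.inr ⟨by omega, he0, by omega⟩)
        (hs.trans ((hu.trans (hv.cons 3)).cons 3))
  rcases (by omega : m % 3 = 1 ∨ m % 3 = 0) with hm1 | hm0
  · have L : ∀ N : ℕ, N % 3 = a % 3 → Rep m (a :: t) N := fun N hN => H N <|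
      Loc.three_one hm1 ha (Val.zero 0 (polygonal_zero m) t) (by omega)
    have ha12 : a = 1 ∨ a = 2 := by
      rcases (L (a % 3) (by omega)).cons_small hm4 (by omega) with h | ⟨h, h'⟩
      · have := (ht.rep hm4 h).1
        omega
      · omega
    have key : ∀ i : ℕ, a + 3 * i < a * m → Rep m t (3 * i) := by
      intro i hi
      rcases (L (a + 3 * i) (by omega)).cons_cases hm4 (by exact_mod_cast hi) with h | h
      · have := (ht.rep hm4 h).1
        omega
      · simpa using h
    have h9 : Rep m t 9 ∨ Rep m t 18 := by
      by_cases hma : a + 9 < a * m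
      · exact Or.inl (key 3 hma)
      · -- here `a = 1`, `m = 10` and the number `a + 9 = m` is a polygonal number
        obtain rfl : a = 1 := by
          rcases ha12 with h | rfl
          · exact h
          · omega
        obtain rfl : m = 10 := by omega
        obtain ⟨x, w, hw, h19⟩ := L 19 (by simp)
        have hw0 := Rep.nonneg hm4 hw
        have hw3 := (ht.rep hm4 hw).1
        simp only [Nat.cast_one, one_mul] at h19
        rcases polygonal_cases hm4 x with ⟨-, h⟩ | ⟨-, h⟩ | ⟨-, h⟩ | ⟨-, h⟩
        · rw [h] at h19; omega
        · obtain rfl : w = 18 := by rw [h] at h19; push_cast at h19; omega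
          exact Or.inr hw
        · obtain rfl : w = 9 := by rw [h] at h19; push_cast at h19; omega
          exact Or.inl hw
        · push_cast at h19 h; omega
    have hS := supply (key 1 (by rcases ha12 with rfl | rfl <;> omega))
      (key 2 (by rcases ha12 with rfl | rfl <;> omega)) h9
    refine ⟨ha12, fun N hN => ?_⟩
    rcases hN with hN | hN
    · exact L N (by omega)
    · exact H N (hS.loc (by omega) hm3 ha (by omega) (Or.inl ⟨hm1, by omega⟩))
  · have L : ∀ N : ℕ, N % 3 = 0 → Rep m (a :: t) N := fun N hN => H N <|
      Loc.three_zero hm0 ha (Val.zero 0 (polygonal_zero m) t) (by omega)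
    have key : ∀ i : ℕ, 3 * i < a * m → Rep m t (3 * i) := by
      intro i hi
      rcases (L (3 * i) (by omega)).cons_cases hm4 (by exact_mod_cast hi) with h | h
      · simpa using h
      · have := (ht.rep hm4 h).1
        omega
    have h9 : Rep m t 9 ∨ Rep m t 18 := by
      by_cases hma : 9 < a * m
      · exact Or.inl (key 3 hma)
      · -- here `a = 1`, `m = 9` and the number `9 = m` is a polygonal number
        obtain rfl : a = 1 := by
          by_contra h
          have : 2 * 9 ≤ a * m := Nat.mul_le_mul (by omega) hm
          omega
        obtain rfl : m = 9 := by omega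
        obtain ⟨x, w, hw, h18⟩ := L 18 (by simp)
        have hw0 := Rep.nonneg hm4 hw
        have hw3 := (ht.rep hm4 hw).1
        simp only [Nat.cast_one, one_mul] at h18
        rcases polygonal_cases hm4 x with ⟨-, h⟩ | ⟨-, h⟩ | ⟨-, h⟩ | ⟨-, h⟩
        · obtain rfl : w = 18 := by rw [h] at h18; push_cast at h18; omega
          exact Or.inr hw
        · rw [h] at h18; omega
        · obtain rfl : w = 9 := by rw [h] at h18; push_cast at h18; omega
          exact Or.inl hw
        · push_cast at h18 h; omega
    have hS := supply (key 1 (by nlinarith)) (key 2 (by nlinarith)) h9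
    have L2 : ∀ N : ℕ, N % 3 = a % 3 → Rep m (a :: t) N := fun N hN =>
      H N (hS.loc (by omega) hm3 ha (by omega) (Or.inr ⟨hm0, by omega⟩))
    have ha12 : a = 1 ∨ a = 2 := by
      rcases (L2 (a % 3) (by omega)).cons_small hm4 (by omega) with h | ⟨h, h'⟩
      · have := (ht.rep hm4 h).1
        omega
      · omega
    refine ⟨ha12, fun N hN => ?_⟩
    rcases hN with hN | hN
    · exact L2 N (by omega)
    · exact L N hN

/-! ### Local solvability at the prime 2 when `m = 4 v + 4` -/

/-- A further odd coefficient `b` lets `a` reach a whole residue class modulo 4. -/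
theorem Loc.two_odd {v a b : ℕ} {t : List ℕ} {N w : ℤ} (ha : a % 2 = 1) (hb : b % 2 = 1)
    (hw : Val (polygonal (4 * v + 4)) t w) (h : (N - w - a) % 4 = 0) :
    Loc (4 * v + 4) 2 (a :: b :: t) N := by
  obtain ⟨i, rfl⟩ : ∃ i, a = 2 * i + 1 := ⟨a / 2, by omega⟩
  obtain ⟨j, rfl⟩ : ∃ j, b = 2 * j + 1 := ⟨b / 2, by omega⟩
  rcases Nat.even_or_odd' v with ⟨e, rfl | rfl⟩
  · by_cases h8 : (N - w - (2 * i + 1 : ℕ)) % 8 = 0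
    · exact Loc.of_two_unit_even (by omega) ha (hw.cons (2 * j + 1) 0)
        (by rw [polygonal_zero]; push_cast at h8 ⊢; omega)
    · refine Loc.of_two_unit_even (by omega) ha (hw.cons (2 * j + 1) 2) ?_
      rw [polygonal_two]
      have : ((2 * j + 1 : ℕ) : ℤ) * ((4 * (2 * e) + 4 : ℕ) : ℤ) = 8 * (2 * j * e + e + j) + 4 := by
        push_cast; ring
      rw [this]
      omega
  · suffices hs : Loc (4 * (2 * e + 1) + 4) 2 ((2 * j + 1) :: (2 * i + 1) :: t) N from
      hs.perm (by grind)
    by_cases h8 : (N - w - (2 * i + 1 : ℕ)) % 8 = 0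
    · exact Loc.of_two_unit_odd (by omega) hb (hw.cons (2 * i + 1) 1)
        (by rw [polygonal_one]; push_cast at h8 ⊢; omega)
    · refine Loc.of_two_unit_odd (by omega) hb (hw.cons (2 * i + 1) (-1)) ?_
      rw [polygonal_neg_one]
      have : ((2 * i + 1 : ℕ) : ℤ) * (((4 * (2 * e + 1) + 4 : ℕ) : ℤ) - 3) =
          8 * (2 * i * e + e + i) + 2 * i + 1 + 4 := by
        push_cast; ring
      rw [this]
      omega

theorem Loc.even_four {v a d : ℕ} (hv : v % 2 = 0) {t : List ℕ} {N w : ℤ} (ha : a % 2 = 1)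
    (hd : d % 8 = 4) (hw : Val (polygonal (4 * v + 4)) t w) (h : (N - w - a) % 4 = 0) :
    Loc (4 * v + 4) 2 (a :: d :: t) N := by
  by_cases h8 : (N - w - a) % 8 = 0
  · exact Loc.of_two_unit_even hv ha (hw.cons d 0) (by rw [polygonal_zero]; omega)
  · exact Loc.of_two_unit_even hv ha (hw.cons d 1) (by rw [polygonal_one]; omega)

theorem Loc.odd_four {v a d : ℕ} (hv : v % 2 = 1) {t : List ℕ} {N w : ℤ} (ha : a % 2 = 1)
    (hd : d % 8 = 4) (hw : Val (polygonal (4 * v + 4)) t w) (h : (N - w) % 4 = 0) :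
    Loc (4 * v + 4) 2 (a :: d :: t) N := by
  by_cases h8 : (N - w) % 8 = 0
  · exact Loc.of_two_unit_odd hv ha (hw.cons d 0) (by rw [polygonal_zero]; omega)
  · exact Loc.of_two_unit_odd hv ha (hw.cons d 1) (by rw [polygonal_one]; omega)

theorem QLoc.mul_four {l l' : List ℕ} {M : ℤ} (h : QLoc 2 (l ++ l') M) :
    QLoc 2 (l ++ l'.map (4 * ·)) (4 * M) := by
  have h1 := QLoc.mul_prime (p := 2) (l := []) (l' := l ++ l') (by simpa using h)
  have h2 := QLoc.mul_prime (p := 2) (l := l) (l' := l'.map (2 * ·)) (by simpa using h1)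
  have h3 : (l'.map (2 * ·)).map (2 * ·) = l'.map (4 * ·) := by
    rw [List.map_map]
    congr 1
    funext c
    simp only [Function.comp]
    ring
  rw [h3] at h2
  convert h2 using 1
  push_cast
  ring

/-- The class on which all arguments of the odd coefficients are degenerate. -/
theorem Loc.of_mul_four {v : ℕ} {l l' : List ℕ} {N : ℤ}
    (hN : (v % 2 = 0 ∧ N % 4 = 0) ∨ (v % 2 = 1 ∧ (N - l.sum) % 4 = 0))
    (h : ∀ M : ℤ, 4 * M = (2 * v + 1) * N + v ^ 2 * (l ++ l'.map (4 * ·)).sum →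
      QLoc 2 (l ++ l') M) : Loc (4 * v + 4) 2 (l ++ l'.map (4 * ·)) N := by
  have hM : ∃ M : ℤ, 4 * M = (2 * v + 1) * N + v ^ 2 * (l ++ l'.map (4 * ·)).sum := by
    have h4 : (l'.map (4 * ·)).sum = 4 * l'.sum := by
      clear h hN
      induction l' with
      | nil => rfl
      | cons c l' ih => simp [mul_add, ih]
    rw [List.sum_append, h4]
    rcases hN with ⟨h1, h2⟩ | ⟨h1, h2⟩
    · obtain ⟨j, rfl⟩ : ∃ j, v = 2 * j := ⟨v / 2, by omega⟩
      obtain ⟨n, rfl⟩ : ∃ n, N = 4 * n := ⟨N / 4, by omega⟩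
      exact ⟨(4 * j + 1) * n + j ^ 2 * (l.sum + 4 * l'.sum), by push_cast; ring⟩
    · obtain ⟨j, rfl⟩ : ∃ j, v = 2 * j + 1 := ⟨v / 2, by omega⟩
      obtain ⟨n, hn⟩ : ∃ n, N = l.sum + 4 * n := ⟨(N - l.sum) / 4, by omega⟩
      rw [hn]
      exact ⟨(4 * j + 3) * n + (2 * j + 1) ^ 2 * l'.sum + (j ^ 2 + 2 * j + 1) * l.sum, by
        push_cast; ring⟩
  obtain ⟨M, hM⟩ := hM
  have h1 := (h M hM).mul_four
  rw [hM] at h1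
  exact Loc.of_qLoc_two h1

/-! ### Shapes of the forms that are not universal at the prime 2 -/

/-- The possible shapes of the coefficients when some number is excluded by the 2-adic condition. -/
inductive TwoShape (l : List ℕ) : Prop
  | one (a : ℕ) (t : List ℕ) (hl : l.Perm (a :: t)) (ha : a % 2 = 1) (ht : Multiples 4 t)
  | one_two (a b : ℕ) (t : List ℕ) (hl : l.Perm (a :: b :: t)) (ha : a % 2 = 1) (hb : b % 4 = 2)
      (ht : Multiples 8 t)
  | one_two_four (a b c : ℕ) (t : List ℕ) (hl : l.Perm (a :: b :: c :: t)) (ha : a % 2 = 1)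
      (hb : b % 4 = 2) (hc : c % 8 = 4) (ht : Multiples 8 t)
  | one_two_two (a b c : ℕ) (t : List ℕ) (hl : l.Perm (a :: b :: c :: t)) (ha : a % 2 = 1)
      (hb : b % 4 = 2) (hc : c % 4 = 2) (ht : Multiples 8 t)
  | two (a b : ℕ) (t : List ℕ) (hl : l.Perm (a :: b :: t)) (ha : a % 2 = 1) (hb : b % 2 = 1)
      (ht : Multiples 4 t)
  | two_two (a b c : ℕ) (t : List ℕ) (hl : l.Perm (a :: b :: c :: t)) (ha : a % 2 = 1)
      (hb : b % 2 = 1) (hc : c % 4 = 2) (ht : Multiples 8 t)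
  | three (a b c : ℕ) (t : List ℕ) (hl : l.Perm (a :: b :: c :: t)) (ha : a % 2 = 1)
      (hb : b % 4 = a % 4) (hc : c % 4 = a % 4) (ht : Multiples 8 t)

theorem twoShape {v : ℕ} {l : List ℕ} (hpos : ∀ c ∈ l, 0 < c) (hu : ∃ c ∈ l, ¬ 2 ∣ c)
    (hbad : ¬ ∀ N : ℕ, Loc (4 * v + 4) 2 l N) : TwoShape l := by
  have no : ∀ {a b c d : ℕ} {t : List ℕ}, l.Perm (a :: b :: c :: d :: t) →
      (∀ M, QLoc 2 [a, b, c, d] M) → False := fun hl h =>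
    hbad fun N => loc_all_of_qLoc_two h _ hl.symm N
  obtain ⟨s, r, hl, hs, hr⟩ := exists_perm_append (fun c => c % 2 = 1) l
  obtain ⟨s₂, r₂, hl₂, hs₂, hr₂⟩ := exists_perm_append (fun c => c % 4 = 2) r
  obtain ⟨s₄, r₄, hl₄, hs₄, hr₄⟩ := exists_perm_append (fun c => c % 8 = 4) r₂
  have hr' : ∀ c ∈ r, c % 2 = 0 := fun c hc => by have := hr c hc; omega
  have hr₂' : ∀ c ∈ r₂, c % 4 = 0 := fun c hc => by
    have := hr₂ c hc
    have := hr' c (hl₂.mem_iff.2 (by simp [hc]))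
    omega
  have hr₄' : ∀ c ∈ r₄, c % 8 = 0 := fun c hc => by
    have := hr₄ c hc
    have := hr₂' c (hl₄.mem_iff.2 (by simp [hc]))
    omega
  have hp : ∀ c ∈ r, 0 < c := fun c hc => hpos c (hl.mem_iff.2 (by simp [hc]))
  have hp₂ : ∀ c ∈ r₂, 0 < c := fun c hc => hp c (hl₂.mem_iff.2 (by simp [hc]))
  have M4 : Multiples 4 r₂ := fun c hc => ⟨hp₂ c hc, by have := hr₂' c hc; omega⟩
  have M8 : Multiples 8 r₄ := fun c hc => ⟨hp₂ c (hl₄.mem_iff.2 (by simp [hc])), by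
    have := hr₄' c hc; omega⟩
  have hall : l.Perm (s ++ (s₂ ++ (s₄ ++ r₄))) :=
    hl.trans (((hl₂.trans (hl₄.append_left s₂))).append_left s)
  have h2all : l.Perm (s ++ (s₂ ++ r₂)) := hl.trans (hl₂.append_left s)
  rcases s with _ | ⟨a, s⟩
  · obtain ⟨c, hc, hc2⟩ := hu
    have := hr' c (by simpa using hl.mem_iff.1 hc)
    omega
  have ha := hs a (by simp)
  rcases s with _ | ⟨b, s⟩
  · rcases s₂ with _ | ⟨b, s₂⟩
    · exact .one a r₂ (by simpa using h2all) ha M4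
    have hb := hs₂ b (by simp)
    rcases s₂ with _ | ⟨c, s₂⟩
    · rcases s₄ with _ | ⟨c, s₄⟩
      · exact .one_two a b r₄ (by simpa using hall) ha hb M8
      have hc := hs₄ c (by simp)
      rcases s₄ with _ | ⟨d, s₄⟩
      · exact .one_two_four a b c r₄ (by simpa using hall) ha hb hc M8
      · exact (no (t := s₄ ++ r₄) (by simpa using hall)
          (qLoc_odd_two_four2 ha hb hc (hs₄ d (by simp)))).elim
    have hc := hs₂ c (by simp)
    rcases s₂ with _ | ⟨d, s₂⟩
    · rcases s₄ with _ | ⟨d, s₄⟩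
      · exact .one_two_two a b c r₄ (by simpa using hall) ha hb hc M8
      · exact (no (t := s₄ ++ r₄) (by simpa using hall)
          (qLoc_odd_two2_four ha hb hc (hs₄ d (by simp)))).elim
    · exact (no (t := s₂ ++ (s₄ ++ r₄)) (by simpa using hall)
        (qLoc_odd_two3 ha hb hc (hs₂ d (by simp)))).elim
  have hb := hs b (by simp)
  rcases s with _ | ⟨c, s⟩
  · rcases s₂ with _ | ⟨c, s₂⟩
    · exact .two a b r₂ (by simpa using h2all) ha hb M4
    have hc := hs₂ c (by simp)
    rcases s₂ with _ | ⟨d, s₂⟩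
    · rcases s₄ with _ | ⟨d, s₄⟩
      · exact .two_two a b c r₄ (by simpa using hall) ha hb hc M8
      · exact (no (t := s₄ ++ r₄) (by simpa using hall)
          (qLoc_odd2_two_four ha hb hc (hs₄ d (by simp)))).elim
    · exact (no (t := s₂ ++ (s₄ ++ r₄)) (by simpa using hall)
        (qLoc_odd2_two2 ha hb hc (hs₂ d (by simp)))).elim
  have hc := hs c (by simp)
  rcases s with _ | ⟨d, s⟩
  · rcases s₂ with _ | ⟨d, s₂⟩
    · rcases s₄ with _ | ⟨d, s₄⟩
      · have mixed : ∀ {x y z : ℕ}, l.Perm (x :: y :: z :: r₄) → x % 2 = 1 → y % 2 = 1 →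
            z % 2 = 1 → x % 4 ≠ y % 4 → False := fun h hx hy hz hxy =>
          hbad fun N => loc_all_of_qLoc_two (qLoc_odd3_mixed hx hy hz hxy) r₄ h.symm N
        have hl3 : l.Perm (a :: b :: c :: r₄) := by simpa using hall
        refine .three a b c r₄ hl3 ha ?_ ?_ M8
        · by_contra h
          exact mixed hl3 ha hb hc (Ne.symm h)
        · by_contra h
          exact mixed (hl3.trans (by grind)) ha hc hb (Ne.symm h)
      · exact (no (t := s₄ ++ r₄) (by simpa using hall)
          (qLoc_odd3_four ha hb hc (hs₄ d (by simp)))).elim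
    · exact (no (t := s₂ ++ (s₄ ++ r₄)) (by simpa using hall)
        (qLoc_odd3_two ha hb hc (hs₂ d (by simp)))).elim
  · exact (no (t := s ++ (s₂ ++ (s₄ ++ r₄))) (by simpa using hall)
      (qLoc_odd4 ha hb hc (hs d (by simp)))).elim

/-! ### Forms that are regular at the prime 2 up to a small bound -/

theorem val_polygonal_zero (m : ℕ) (t : List ℕ) : Val (polygonal m) t 0 :=
  Val.zero 0 (polygonal_zero m) t

theorem Val.skip {m : ℕ} {t : List ℕ} {w : ℤ} (h : Val (polygonal m) t w) (c : ℕ) :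
    Val (polygonal m) (c :: t) w := by
  simpa [polygonal_zero] using h.cons c 0

theorem Val.take {m : ℕ} {t : List ℕ} {w : ℤ} (h : Val (polygonal m) t w) (c : ℕ) :
    Val (polygonal m) (c :: t) (w + c) := by
  simpa [polygonal_one, add_comm] using h.cons c 1

/-- The list represents every locally represented number below 32, and also 32 in the cases where
this number is needed below. -/
def TwoRegular (v : ℕ) (l : List ℕ) : Prop :=
  ∀ N : ℕ, N < 32 ∨ (N = 32 ∧ (v % 2 = 1 ∨
      ∃ a s, a % 2 = 1 ∧ Multiples 8 s ∧ l.Perm (a :: 8 :: 16 :: s))) →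
    Loc (4 * v + 4) 2 l N → Rep (4 * v + 4) l N

theorem TwoRegular.perm {v : ℕ} {l l' : List ℕ} (h : TwoRegular v l) (hp : l.Perm l') :
    TwoRegular v l' := fun N hN hL =>
  (h N (hN.imp id fun ⟨h1, h2⟩ => ⟨h1, h2.imp id fun ⟨a, s, ha, h8, hs⟩ =>
    ⟨a, s, ha, h8, hp.trans hs⟩⟩)
    (hL.perm hp.symm)).perm hp

theorem TwoRegular.rep {v : ℕ} {l : List ℕ} (h : TwoRegular v l) {N : ℤ} (hN0 : 0 ≤ N)
    (hN : N < 32) (hL : Loc (4 * v + 4) 2 l N) : Rep (4 * v + 4) l N := by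
  obtain ⟨N, rfl⟩ := Int.eq_ofNat_of_zero_le hN0
  exact h N (Or.inl (by exact_mod_cast hN)) hL

theorem Multiples.pull {m d : ℕ} (hm : 4 ≤ m) {t : List ℕ} (ht : Multiples d t) {w : ℤ}
    (h : Rep m t w) (hw : w ≠ 0) :
    ∃ c s, t.Perm (c :: s) ∧ 0 < c ∧ (c : ℤ) ≤ w ∧ d ∣ c ∧ Multiples d s := by
  rcases (ht.rep hm h).2 with h | ⟨-, h⟩
  · exact absurd h hw
  · exact h

theorem Rep.small {m d a : ℕ} (hm : 4 ≤ m) {t : List ℕ} (ht : Multiples d t) {N : ℤ}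
    (h : Rep m (a :: t) N) (hN : N < m) :
    ∃ w, Rep m t w ∧ 0 ≤ w ∧ (d : ℤ) ∣ w ∧ (N = w ∨ N = w + a) := by
  rcases h.cons_small hm hN with h | ⟨h, -⟩
  · exact ⟨_, h, h.nonneg hm, (ht.rep hm h).1, by omega⟩
  · exact ⟨_, h, h.nonneg hm, (ht.rep hm h).1, by omega⟩

theorem Rep.small₂ {m d a b : ℕ} (hm : 4 ≤ m) {t : List ℕ} (ht : Multiples d t) {N : ℤ}
    (h : Rep m (a :: b :: t) N) (hN : N < m) :
    ∃ w, Rep m t w ∧ 0 ≤ w ∧ (d : ℤ) ∣ w ∧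
      (N = w ∨ N = w + a ∨ N = w + b ∨ N = w + a + b) := by
  rcases h.cons_small hm hN with h | ⟨h, -⟩ <;>
    obtain ⟨w, hw, hw0, hd, hw'⟩ := h.small hm ht (by omega) <;>
    exact ⟨w, hw, hw0, hd, by omega⟩

theorem Rep.small₃ {m d a b c : ℕ} (hm : 4 ≤ m) {t : List ℕ} (ht : Multiples d t) {N : ℤ}
    (h : Rep m (a :: b :: c :: t) N) (hN : N < m) :
    ∃ w, Rep m t w ∧ 0 ≤ w ∧ (d : ℤ) ∣ w ∧
      (N = w ∨ N = w + a ∨ N = w + b ∨ N = w + a + b ∨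
        N = w + c ∨ N = w + a + c ∨ N = w + b + c ∨ N = w + a + b + c) := by
  rcases h.cons_small hm hN with h | ⟨h, -⟩ <;>
    obtain ⟨w, hw, hw0, hd, hw'⟩ := h.small₂ hm ht (by omega) <;>
    exact ⟨w, hw, hw0, hd, by omega⟩

theorem polygonal_emod_two {m : ℕ} (hm : m % 4 = 0) (x : ℤ) : polygonal m x % 2 = x % 2 := by
  obtain ⟨v, rfl⟩ : ∃ v, m = 4 * v := ⟨m / 4, by omega⟩
  have h := two_mul_polygonal (4 * v) x
  push_cast at h
  rcases Int.even_or_odd' x with ⟨y, rfl | rfl⟩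
  · have : polygonal (4 * v) (2 * y) = 2 * ((4 * v - 2) * y ^ 2 - (2 * v - 2) * y) := by linarith
    omega
  · have : polygonal (4 * v) (2 * y + 1) =
        2 * ((4 * v - 2) * (y ^ 2 + y) - (2 * v - 2) * y) + 1 := by linarith
    omega

/-- The only odd coefficient has to carry an odd number. -/
theorem Rep.single_odd {m a : ℕ} (hm : m % 4 = 0) (hm' : 12 ≤ m) {t : List ℕ} (ht : Multiples 2 t)
    (ha : a % 2 = 1) {N : ℤ} (h : Rep m (a :: t) N) (hN : N % 2 = 1) (hN' : N < 33 * a) :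
    Rep m t (N - a) := by
  obtain ⟨x, w, hw, rfl⟩ := h
  have hw2 := (ht.rep (by omega) hw).1
  have hw0 := Rep.nonneg (by omega : 4 ≤ m) hw
  have hx := polygonal_emod_two hm x
  simp only at hN hN' ⊢
  rcases polygonal_cases (by omega : 4 ≤ m) x with ⟨-, h⟩ | ⟨-, h⟩ | ⟨rfl, h⟩ | ⟨-, h⟩
  · rw [h] at hN; omega
  · rw [h]
    simpa [Rep] using hw
  · rw [h] at hN
    obtain ⟨q, rfl⟩ : ∃ q, m = 2 * q := ⟨m / 2, by omega⟩
    have : (a : ℤ) * ((2 * q : ℕ) : ℤ) = 2 * (a * q) := by push_cast; ring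
    omega
  · have : (a : ℤ) * 33 ≤ a * polygonal m x :=
      mul_le_mul_of_nonneg_left (by omega) (Int.natCast_nonneg a)
    omega

theorem Rep.single_even {m a : ℕ} (hm : m % 4 = 0) (hm' : 12 ≤ m) {t : List ℕ} (ht : Multiples 2 t)
    (ha : a % 2 = 1) {N : ℤ} (h : Rep m (a :: t) N) (hN : N % 2 = 0) (hN' : N < 33 * a) :
    Rep m t N ∨ Rep m t (N - a * m) := by
  obtain ⟨x, w, hw, rfl⟩ := h
  have hw2 := (ht.rep (by omega) hw).1
  have hw0 := Rep.nonneg (by omega : 4 ≤ m) hw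
  have hx := polygonal_emod_two hm x
  simp only at hN hN' ⊢
  rcases polygonal_cases (by omega : 4 ≤ m) x with ⟨-, h⟩ | ⟨-, h⟩ | ⟨rfl, h⟩ | ⟨-, h⟩
  · left
    rw [h]
    simpa [Rep] using hw
  · rw [h] at hN
    omega
  · right
    rw [h]
    simpa [Rep] using hw
  · have : (a : ℤ) * 33 ≤ a * polygonal m x :=
      mul_le_mul_of_nonneg_left (by omega) (Int.natCast_nonneg a)
    omega

theorem QLoc.odd2_two {a b c : ℕ} (ha : a % 2 = 1) (hb : b % 2 = 1) (hc : c % 4 = 2) {M : ℤ}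
    (hM : M % 2 = 1) : QLoc 2 [a, b, c] M := by
  have w : ∀ y z : ℤ, Val (fun y : ℤ => y ^ 2) [b, c] (b * y ^ 2 + (c * z ^ 2 + 0)) := fun y z =>
    ((show Val (fun y : ℤ => y ^ 2) [] 0 from rfl).cons c z).cons b y
  have : (M - a) % 8 = 0 ∨ (M - c - a) % 8 = 0 ∨ (M - 4 * b - a) % 8 = 0 ∨
      (M - 4 * b - c - a) % 8 = 0 := by omega
  rcases this with h | h | h | h
  · exact QLoc.of_two_unit ha (w 0 0) (by omega)
  · exact QLoc.of_two_unit ha (w 0 1) (by omega)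
  · exact QLoc.of_two_unit ha (w 2 0) (by omega)
  · exact QLoc.of_two_unit ha (w 2 1) (by omega)

theorem QLoc.odd_two_four {a b c : ℕ} (ha : a % 2 = 1) (hb : b % 4 = 2) (hc : c % 8 = 4) {M : ℤ}
    (hM : M % 2 = 1) : QLoc 2 [a, b, c] M := by
  have w : ∀ y z : ℤ, Val (fun y : ℤ => y ^ 2) [b, c] (b * y ^ 2 + (c * z ^ 2 + 0)) := fun y z =>
    ((show Val (fun y : ℤ => y ^ 2) [] 0 from rfl).cons c z).cons b y
  have : (M - a) % 8 = 0 ∨ (M - c - a) % 8 = 0 ∨ (M - b - a) % 8 = 0 ∨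
      (M - b - c - a) % 8 = 0 := by omega
  rcases this with h | h | h | h
  · exact QLoc.of_two_unit ha (w 0 0) (by omega)
  · exact QLoc.of_two_unit ha (w 0 1) (by omega)
  · exact QLoc.of_two_unit ha (w 1 0) (by omega)
  · exact QLoc.of_two_unit ha (w 1 1) (by omega)

/-- What remains of the 2-adically exceptional forms that are regular. -/
inductive TwoExceptional (v : ℕ) (l : List ℕ) : Prop
  | one (a c : ℕ) (t : List ℕ) (hl : l.Perm (a :: 4 :: c :: t)) (ha : a = 1 ∨ a = 3)
      (hc : c = 4 ∨ c = 8) (ht : Multiples 4 t)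
      (h : ∀ N : ℕ, N % 4 = a ∨ N % 4 = 0 → Loc (4 * v + 4) 2 l N)
  | one_three (t : List ℕ) (hl : l.Perm (1 :: 3 :: 4 :: t)) (ht : Multiples 4 t)
      (h : ∀ N : ℕ, N % 4 ≠ 2 → Loc (4 * v + 4) 2 l N)
  | one_one (c : ℕ) (t : List ℕ) (hl : l.Perm (1 :: 1 :: 4 :: c :: t)) (hc : c = 4 ∨ c = 8)
      (ht : Multiples 4 t) (h : ∀ N : ℕ, N % 4 ≠ 3 → Loc (4 * v + 4) 2 l N)

theorem TwoExceptional.perm {v : ℕ} {l l' : List ℕ} (hl : l'.Perm l) (h : TwoExceptional v l) :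
    TwoExceptional v l' := by
  rcases h with ⟨a, c, t, h1, h2, h3, h4, h5⟩ | ⟨t, h1, h2, h3⟩ | ⟨c, t, h1, h2, h3, h4⟩
  · exact .one a c t (hl.trans h1) h2 h3 h4 fun N hN => (h5 N hN).perm hl.symm
  · exact .one_three t (hl.trans h1) h2 fun N hN => (h3 N hN).perm hl.symm
  · exact .one_one c t (hl.trans h1) h2 h3 fun N hN => (h4 N hN).perm hl.symm

/-! ### Three odd coefficients, or two odd coefficients and one that is 2 modulo 4 -/

theorem TwoRegular.three_false {v a b c : ℕ} {t : List ℕ} (hv : 2 ≤ v)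
    (H : TwoRegular v (a :: b :: c :: t)) (ha : a % 2 = 1) (hb : b % 4 = a % 4)
    (hc : c % 4 = a % 4) (ht : Multiples 8 t) : False := by
  have hm4 : 4 ≤ 4 * v + 4 := by omega
  have main : ∀ {c : ℕ}, c % 4 = 1 → TwoRegular v (1 :: 1 :: c :: t) → False := by
    clear H hc
    intro c hc H
    have L1 : ∀ N : ℕ, N < 32 → N % 4 = 1 → Rep (4 * v + 4) (1 :: 1 :: c :: t) N := fun N hN h =>
      H N (Or.inl hN) (Loc.two_odd rfl rfl (val_polygonal_zero _ _) (by omega))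
    have L2 : ∀ N : ℕ, N < 32 → N % 4 = 2 → Rep (4 * v + 4) (1 :: 1 :: c :: t) N := fun N hN h =>
      H N (Or.inl hN) (Loc.two_odd rfl rfl ((val_polygonal_zero _ t).take c) (by omega))
    obtain ⟨w, hw, hw0, hd, hw'⟩ := (L1 5 (by simp) rfl).small₃ hm4 ht (by omega)
    obtain rfl : c = 5 := by omega
    obtain ⟨w, hw, hw0, hd, hw'⟩ := (L2 10 (by simp) rfl).small₃ hm4 ht (by omega)
    obtain rfl : w = 8 := by omega
    obtain ⟨c, s, hs, hc0, hc1, hc2, hs8⟩ := ht.pull hm4 hw (by simp)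
    obtain rfl : c = 8 := by omega
    have Lo : ∀ N : ℤ, (v % 2 = 0 ∧ N % 4 = 0) ∨ (v % 2 = 1 ∧ (N - 7) % 4 = 0) →
        Loc (4 * v + 4) 2 (1 :: 1 :: 5 :: t) N := fun N hN =>
      ((Loc.of_mul_four (l := [1, 1, 5]) (l' := [2]) (by simpa using hN) fun M _ =>
        qLoc_odd3_two rfl rfl rfl rfl M).append s).perm (by simpa using hs.symm)
    rcases (by omega : v % 2 = 0 ∨ v % 2 = 1) with h | h
    · obtain ⟨w, hw, hw0, hd, hw'⟩ := (H.rep (by simp) (by simp)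
        (Lo 4 (by omega))).small₃ hm4 ht (by omega)
      omega
    · obtain ⟨w, hw, hw0, hd, hw'⟩ := (H.rep (by simp) (by simp)
        (Lo 3 (by omega))).small₃ hm4 ht (by omega)
      omega
  have L2 : Rep (4 * v + 4) (a :: b :: c :: t) 2 := H.rep (by simp) (by simp)
    (Loc.two_odd ha (by omega) ((val_polygonal_zero _ t).take c) (by omega))
  obtain ⟨w, hw, hw0, hd, hw'⟩ := L2.small₃ hm4 ht (by omega)
  have : (a = 1 ∧ b = 1) ∨ (a = 1 ∧ c = 1) ∨ (b = 1 ∧ c = 1) := by omega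
  rcases this with ⟨rfl, rfl⟩ | ⟨rfl, rfl⟩ | ⟨rfl, rfl⟩
  · exact main (by omega) H
  · exact main (c := b) (by omega) (H.perm (by grind))
  · exact main (c := a) (by omega) (H.perm (by grind))

theorem TwoRegular.two_two_false {v a b c : ℕ} {t : List ℕ} (hv : 2 ≤ v)
    (H : TwoRegular v (a :: b :: c :: t)) (ha : a % 2 = 1) (hb : b % 2 = 1)
    (hc : c % 4 = 2) (ht : Multiples 8 t)
    (hbad : ¬ ∀ N : ℕ, Loc (4 * v + 4) 2 (a :: b :: c :: t) N) : False := by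
  have hm4 : 4 ≤ 4 * v + 4 := by omega
  have L : ∀ N : ℕ, N < 12 → N % 2 = 1 → ∃ w, Rep (4 * v + 4) t w ∧ 0 ≤ w ∧ ((8 : ℕ) : ℤ) ∣ w ∧
      ((N : ℤ) = w ∨ (N : ℤ) = w + a ∨ (N : ℤ) = w + b ∨ (N : ℤ) = w + a + b ∨
        (N : ℤ) = w + c ∨ (N : ℤ) = w + a + c ∨ (N : ℤ) = w + b + c ∨
          (N : ℤ) = w + a + b + c) := by
    intro N hN hN2
    refine (H N (Or.inl (by omega)) ?_).small₃ hm4 ht (by omega)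
    by_cases h : ((N : ℤ) - a) % 4 = 0
    · exact Loc.two_odd ha hb (val_polygonal_zero _ _) (by omega)
    · exact Loc.two_odd ha hb ((val_polygonal_zero _ t).take c) (by omega)
  obtain ⟨w1, h1, h1', h1'', e1⟩ := L 1 (by simp) rfl
  obtain ⟨w3, h3, h3', h3'', e3⟩ := L 3 (by simp) rfl
  obtain ⟨w5, h5, h5', h5'', e5⟩ := L 5 (by simp) rfl
  obtain ⟨w7, h7, h7', h7'', e7⟩ := L 7 (by simp) rfl
  obtain ⟨w9, h9, h9', h9'', e9⟩ := L 9 (by simp) rfl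
  obtain rfl : w1 = 0 := by omega
  obtain rfl : w3 = 0 := by omega
  obtain rfl : w5 = 0 := by omega
  obtain rfl : w7 = 0 := by omega
  have hab : a = 1 ∨ b = 1 := by omega
  have hab' : a + b = 6 ∧ c = 2 := by
    have : (a = 1 ∧ b = 3) ∨ (a = 3 ∧ b = 1) ∨ c = 2 := by omega
    rcases this with ⟨rfl, rfl⟩ | ⟨rfl, rfl⟩ | rfl
    · omega
    · omega
    · rcases hab with rfl | rfl <;> omega
  obtain rfl : w9 = 8 := by
    obtain ⟨h1, rfl⟩ := hab'
    rcases hab with rfl | rfl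
    · obtain rfl : b = 5 := by omega
      omega
    · obtain rfl : a = 5 := by omega
      omega
  obtain ⟨d, s, hs, hd0, hd1, hd2, hs8⟩ := ht.pull hm4 h9 (by simp)
  obtain rfl : d = 8 := by omega
  exact hbad fun N => loc_all_of_qLoc_two (qLoc_odd2_two_eight ha hb hc (d := 8) rfl) s
    (by simpa using hs.symm) N

/-! ### Two odd coefficients and multiples of 4 -/

/-- With two odd coefficients that are distinct modulo 4 and a coefficient that is 4 modulo 8,
all residue classes but one modulo 4 are locally represented. -/
theorem loc_two_ne {v a b d : ℕ} (ha : a % 2 = 1) (hb : b % 2 = 1) (hab : a % 4 ≠ b % 4)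
    (hd : d % 8 = 4) (t : List ℕ) {N : ℤ} (hN : N % 4 ≠ 2) :
    Loc (4 * v + 4) 2 (a :: b :: d :: t) N := by
  have z := val_polygonal_zero (4 * v + 4) t
  rcases (by omega : (N - a) % 4 = 0 ∨ (N - b) % 4 = 0 ∨ N % 4 = 0) with h | h | h
  · exact Loc.two_odd ha hb (z.skip d) (by omega)
  · exact (Loc.two_odd hb ha (z.skip d) (by omega)).perm (.swap _ _ _)
  · rcases (by omega : v % 2 = 0 ∨ v % 2 = 1) with hv | hv
    · exact (Loc.even_four hv ha hd (z.take b) (by omega)).perm ((List.Perm.swap _ _ _).cons a)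
    · exact (Loc.odd_four hv ha hd (z.skip b) (by omega)).perm ((List.Perm.swap _ _ _).cons a)

/-- The class on which the arguments of `a` and `b` are degenerate. -/
theorem loc_two_degenerate {v a b c d : ℕ} (ha : a % 2 = 1) (hb : b % 2 = 1) (hd : d % 8 = 4)
    (hc : c % 8 = 4 ∨ c % 16 = 8)
    (t : List ℕ) {N : ℤ} (hN : (v % 2 = 0 ∧ N % 4 = 0) ∨ (v % 2 = 1 ∧ (N - a - b) % 4 = 0)) :
    Loc (4 * v + 4) 2 (a :: b :: d :: c :: t) N := by
  have hN' : (v % 2 = 0 ∧ N % 4 = 0) ∨ (v % 2 = 1 ∧ (N - ([a, b] : List ℕ).sum) % 4 = 0) := by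
    simp only [List.sum_cons, List.sum_nil]
    omega
  have h := Loc.of_mul_four (l := [a, b]) (l' := [d / 4, c / 4]) hN' fun M _ => by
    rcases hc with hc | hc
    · exact qLoc_odd4 ha hb (by omega) (by omega) M
    · exact qLoc_odd3_two ha hb (by omega) (by omega) M
  have e1 : 4 * (d / 4) = d := by omega
  have e2 : 4 * (c / 4) = c := by omega
  simp only [List.map, e1, e2] at h
  exact h.append t

theorem TwoRegular.two_ne {v a b : ℕ} {t : List ℕ} (hv : 2 ≤ v)
    (H : TwoRegular v (a :: b :: t)) (ha : a % 4 = 1) (hb : b % 4 = 3)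
    (ht : Multiples 4 t) : TwoExceptional v (a :: b :: t) := by
  have hm4 : 4 ≤ 4 * v + 4 := by omega
  have L : ∀ N : ℕ, N < 12 → N % 2 = 1 → ∃ w, Rep (4 * v + 4) t w ∧ 0 ≤ w ∧ ((4 : ℕ) : ℤ) ∣ w ∧
      ((N : ℤ) = w ∨ (N : ℤ) = w + a ∨ (N : ℤ) = w + b ∨ (N : ℤ) = w + a + b) := by
    intro N hN hN2
    refine (H N (Or.inl (by omega)) ?_).small₂ hm4 ht (by omega)
    by_cases h : ((N : ℤ) - a) % 4 = 0
    · exact Loc.two_odd (by omega) (by omega) (val_polygonal_zero _ _) (by omega)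
    · exact (Loc.two_odd (a := b) (b := a) (by omega) (by omega) (val_polygonal_zero _ t)
        (by omega)).perm (by grind)
  obtain ⟨w1, h1, h1', h1'', e1⟩ := L 1 (by simp) rfl
  obtain ⟨w3, h3, h3', h3'', e3⟩ := L 3 (by simp) rfl
  obtain ⟨w5, h5, h5', h5'', e5⟩ := L 5 (by simp) rfl
  obtain rfl : a = 1 := by omega
  obtain rfl : b = 3 := by omega
  obtain rfl : w5 = 4 := by omega
  obtain ⟨d, s, hs, hd0, hd1, hd2, hs4⟩ := ht.pull hm4 h5 (by simp)
  obtain rfl : d = 4 := by omega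
  refine .one_three s (by grind) hs4 fun N hN => ?_
  exact (loc_two_ne (a := 1) (b := 3) (d := 4) rfl rfl (by simp) rfl s (by omega)).perm
    (by grind)

theorem TwoRegular.two_eq_four {v a b : ℕ} {t : List ℕ} (hv : 2 ≤ v)
    (H : TwoRegular v (a :: b :: 4 :: t)) (ha : a % 2 = 1) (hb : b % 4 = a % 4)
    (ht : Multiples 4 t) : TwoExceptional v (a :: b :: 4 :: t) := by
  have hm4 : 4 ≤ 4 * v + 4 := by omega
  have z := val_polygonal_zero (4 * v + 4) t
  have hb2 : b % 2 = 1 := by omega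
  have S := fun (N : ℕ) (hN : N < 12) (hL : Loc (4 * v + 4) 2 (a :: b :: 4 :: t) N) =>
    (H N (Or.inl (by omega)) hL).small₃ hm4 ht (by omega)
  have L1 : ∀ N : ℕ, N % 4 = a % 4 → Loc (4 * v + 4) 2 (a :: b :: 4 :: t) N := fun N hN =>
    Loc.two_odd ha hb2 (z.skip 4) (by omega)
  rcases (by omega : v % 2 = 0 ∨ v % 2 = 1) with hv2 | hv2
  · have L2 : ∀ N : ℕ, N % 4 = 2 → Loc (4 * v + 4) 2 (a :: b :: 4 :: t) N := fun N hN =>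
      (Loc.even_four (a := a) (d := 4) hv2 ha rfl (z.take b) (by omega)).perm (by grind)
    obtain ⟨w, hw, hw0, hd, e⟩ := S 2 (by simp) (L2 2 rfl)
    push_cast at hd e
    obtain ⟨rfl, rfl⟩ : a = 1 ∧ b = 1 := by omega
    obtain ⟨w, hw, hw0, hd, e⟩ := S 9 (by simp) (L1 9 rfl)
    push_cast at hd e
    have : w = 8 ∨ w = 4 := by omega
    obtain ⟨c, s, hs, hc0, hc1, hc2, hs4⟩ := ht.pull hm4 hw (by omega)
    have hc : c = 4 ∨ c = 8 := by omega
    refine .one_one c s (by grind) hc hs4 fun N hN => ?_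
    rcases (by omega : N % 4 = 1 ∨ N % 4 = 2 ∨ N % 4 = 0) with h | h | h
    · exact L1 N h
    · exact L2 N h
    · exact (loc_two_degenerate (a := 1) (b := 1) (d := 4) (c := c) rfl rfl rfl (by omega) s
        (by omega)).perm (by grind)
  · have L0 : ∀ N : ℕ, N % 4 = 0 → Loc (4 * v + 4) 2 (a :: b :: 4 :: t) N := fun N hN =>
      (Loc.odd_four (a := a) (d := 4) hv2 ha rfl (z.skip b) (by omega)).perm (by grind)
    obtain ⟨w, hw, hw0, hd, e⟩ := S 8 (by simp) (L0 8 rfl)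
    push_cast at hd e
    have : w = 8 ∨ w = 4 := by omega
    obtain ⟨c, s, hs, hc0, hc1, hc2, hs4⟩ := ht.pull hm4 hw (by omega)
    have hc : c = 4 ∨ c = 8 := by omega
    have L2 : ∀ N : ℕ, N % 4 = 2 → Loc (4 * v + 4) 2 (a :: b :: 4 :: t) N := fun N hN =>
      (loc_two_degenerate (d := 4) (c := c) ha hb2 rfl (by omega) s (by omega)).perm (by grind)
    obtain ⟨w, hw, hw0, hd, e⟩ := S 2 (by simp) (L2 2 rfl)
    push_cast at hd e
    obtain ⟨rfl, rfl⟩ : a = 1 ∧ b = 1 := by omega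
    refine .one_one c s (by grind) hc hs4 fun N hN => ?_
    rcases (by omega : N % 4 = 1 ∨ N % 4 = 2 ∨ N % 4 = 0) with h | h | h
    · exact L1 N h
    · exact L2 N h
    · exact L0 N h

theorem TwoRegular.two_eq_no_four {v a b : ℕ} {t : List ℕ} (hv : 2 ≤ v)
    (H : TwoRegular v (a :: b :: t)) (ha : a = 1 ∨ a = 3) (hb : b % 4 = a)
    (ht : Multiples 4 t) (h4 : ∀ s, ¬ t.Perm (4 :: s)) : False := by
  have hm4 : 4 ≤ 4 * v + 4 := by omega
  have z := val_polygonal_zero (4 * v + 4) t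
  have S := fun (N : ℕ) (hN : N < 12) (hL : Loc (4 * v + 4) 2 (a :: b :: t) N) =>
    (H N (Or.inl (by omega)) hL).small₂ hm4 ht (by omega)
  have R4 : ¬ Rep (4 * v + 4) t 4 := fun h => by
    obtain ⟨c, s, hs, hc0, hc1, hc2, -⟩ := ht.pull hm4 h (by simp)
    obtain rfl : c = 4 := by omega
    exact h4 s hs
  have R8 : Rep (4 * v + 4) t 8 → ∃ s, t.Perm (8 :: s) := fun h => by
    obtain ⟨c, s, hs, hc0, hc1, hc2, -⟩ := ht.pull hm4 h (by simp)
    obtain rfl | rfl : c = 4 ∨ c = 8 := by omega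
    · exact absurd hs (h4 s)
    · exact ⟨s, hs⟩
  have L1 : ∀ N : ℕ, N % 4 = a → Loc (4 * v + 4) 2 (a :: b :: t) N := fun N hN =>
    Loc.two_odd (by omega) (by omega) z (by omega)
  obtain ⟨w, hw, hw0, hd, e⟩ := S (a + 4) (by omega) (L1 _ (by omega))
  have hw4 : w ≠ 4 := fun h => R4 (h ▸ hw)
  obtain rfl : b = a + 4 := by omega
  clear hw hw0 hd e hw4 w
  rcases ha with rfl | rfl
  · obtain ⟨w, hw, hw0, hd, e⟩ := S 9 (by omega) (L1 _ (by omega))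
    have hw4 : w ≠ 4 := fun h => R4 (h ▸ hw)
    obtain rfl : w = 8 := by omega
    obtain ⟨s, hs⟩ := R8 hw
    have key : ∀ N : ℤ, (v % 2 = 0 ∧ N = 4) ∨ (v % 2 = 1 ∧ N = 2) →
        Loc (4 * v + 4) 2 (1 :: (1 + 4) :: t) N := by
      intro N hN
      refine ((Loc.of_mul_four (l := [1, 5]) (l' := [2]) (by simp; omega) fun M hM =>
        QLoc.odd2_two rfl rfl rfl ?_).append s).perm (by simpa using hs.symm)
      rcases hN with ⟨h, rfl⟩ | ⟨h, rfl⟩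
      · obtain ⟨j, rfl⟩ : ∃ j, v = 2 * j := ⟨v / 2, by omega⟩
        have : M = 2 * (2 * j + 7 * j ^ 2) + 1 := by simp at hM; linarith
        omega
      · obtain ⟨j, rfl⟩ : ∃ j, v = 2 * j + 1 := ⟨v / 2, by omega⟩
        have : M = 2 * (2 + 8 * j + 7 * j ^ 2) + 1 := by simp at hM; linarith
        omega
    rcases (by omega : v % 2 = 0 ∨ v % 2 = 1) with hv2 | hv2
    · obtain ⟨w, hw, hw0, hd, e⟩ := S 4 (by omega) (key 4 (by omega))
      have hw4 : w ≠ 4 := fun h => R4 (h ▸ hw)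
      omega
    · obtain ⟨w, hw, hw0, hd, e⟩ := S 2 (by omega) (key 2 (by omega))
      omega
  · rcases (by omega : v % 2 = 0 ∨ v % 2 = 1) with hv2 | hv2
    · obtain ⟨w, hw, hw0, hd, e⟩ := S 2 (by omega)
        (Loc.of_two_unit_even hv2 rfl (z.take 7) (by simp))
      omega
    · obtain ⟨w, hw, hw0, hd, e⟩ := S 8 (by omega)
        (Loc.of_two_unit_odd hv2 rfl (z.skip 7) (by simp))
      obtain rfl : w = 8 := by omega
      obtain ⟨s, hs⟩ := R8 hw
      have key : Loc (4 * v + 4) 2 (3 :: (3 + 4) :: t) (6 : ℕ) := by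
        refine ((Loc.of_mul_four (l := [3, 7]) (l' := [2]) (by simp; omega) fun M hM =>
          QLoc.odd2_two rfl rfl rfl ?_).append s).perm (by simpa using hs.symm)
        obtain ⟨j, rfl⟩ : ∃ j, v = 2 * j + 1 := ⟨v / 2, by omega⟩
        have : M = 2 * (4 + 12 * j + 9 * j ^ 2) + 1 := by simp at hM; linarith
        omega
      obtain ⟨w, hw, hw0, hd, e⟩ := S 6 (by omega) key
      omega

theorem TwoRegular.two {v a b : ℕ} {t : List ℕ} (hv : 2 ≤ v)
    (H : TwoRegular v (a :: b :: t)) (ha : a % 2 = 1) (hb : b % 2 = 1)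
    (ht : Multiples 4 t) : TwoExceptional v (a :: b :: t) := by
  have hm4 : 4 ≤ 4 * v + 4 := by omega
  by_cases hab : b % 4 = a % 4
  · by_cases h4 : ∃ s, t.Perm (4 :: s)
    · obtain ⟨s, hs⟩ := h4
      have hp : (a :: b :: t).Perm (a :: b :: 4 :: s) := (hs.cons b).cons a
      exact ((H.perm hp).two_eq_four hv ha hab (ht.perm hs).of_cons.2).perm hp
    · exfalso
      push Not at h4
      obtain ⟨w, hw, hw0, hd, e⟩ := (H (a % 4) (Or.inl (by omega)) (Loc.two_odd ha hb
        (val_polygonal_zero _ _) (by omega))).small₂ hm4 ht (by omega)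
      have : a = a % 4 ∨ b = a % 4 := by omega
      rcases this with h | h
      · exact H.two_eq_no_four hv (by omega) (by omega) ht h4
      · exact (H.perm (.swap b a t)).two_eq_no_four hv (by omega) (by omega) ht h4
  · rcases (by omega : a % 4 = 1 ∧ b % 4 = 3 ∨ b % 4 = 1 ∧ a % 4 = 3) with ⟨h1, h2⟩ | ⟨h1, h2⟩
    · exact H.two_ne hv h1 h2 ht
    · exact ((H.perm (.swap b a t)).two_ne hv h1 h2 ht).perm (.swap b a t)

/-! ### One odd coefficient and coefficients that are 2 modulo 4 -/

theorem QLoc.odd_two2_of_two {a b c : ℕ} (ha : a % 2 = 1) (hb : b % 4 = 2) (hc : c % 4 = 2) {M : ℤ}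
    (hM : M % 4 = 2) : QLoc 2 [a, b, c] M := by
  obtain ⟨b, rfl⟩ : ∃ e, b = 2 * e := ⟨b / 2, by omega⟩
  obtain ⟨c, rfl⟩ : ∃ e, c = 2 * e := ⟨c / 2, by omega⟩
  obtain ⟨M, rfl⟩ : ∃ e, M = 2 * e := ⟨M / 2, by omega⟩
  exact QLoc.mul_prime (p := 2) (l := [a]) (l' := [b, c])
    ((QLoc.odd2_two (a := b) (b := c) (c := 2 * a) (by omega) (by omega) (by omega)
      (by omega)).perm (by simp only [List.map, List.cons_append, List.nil_append]; grind))

theorem QLoc.odd_two_eight_of_two {a b c : ℕ} (ha : a % 2 = 1) (hb : b % 4 = 2) (hc : c % 16 = 8)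
    {M : ℤ} (hM : M % 4 = 2) : QLoc 2 [a, b, c] M := by
  obtain ⟨b, rfl⟩ : ∃ e, b = 2 * e := ⟨b / 2, by omega⟩
  obtain ⟨c, rfl⟩ : ∃ e, c = 2 * e := ⟨c / 2, by omega⟩
  obtain ⟨M, rfl⟩ : ∃ e, M = 2 * e := ⟨M / 2, by omega⟩
  exact QLoc.mul_prime (p := 2) (l := [a]) (l' := [b, c])
    ((QLoc.odd_two_four (a := b) (b := 2 * a) (c := c) (by omega) (by omega) (by omega)
      (by omega)).perm (by simp only [List.map, List.cons_append, List.nil_append]; grind))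

theorem QLoc.odd_two_six_eight_of_even {a : ℕ} (ha : a % 2 = 1) {M : ℤ}
    (hM : M % 2 = 0) : QLoc 2 [a, 2, 6, 8] M := by
  obtain ⟨M, rfl⟩ : ∃ e, M = 2 * e := ⟨M / 2, by omega⟩
  exact QLoc.mul_prime (p := 2) (l := [a]) (l' := [1, 3, 4])
    ((qLoc_odd2_two_four (a := 1) (b := 3) (c := 2 * a) (d := 4) rfl rfl (by omega) rfl _).perm
      (by simp only [List.map, List.cons_append, List.nil_append]; grind))

/-- The residue of `(2 v + 1) N + v ^ 2 S` modulo 4. -/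
theorem completed_emod_four (v : ℕ) (N S : ℤ) :
    (v % 2 = 0 ∧ ((2 * v + 1) * N + v ^ 2 * S - N) % 4 = 0) ∨
      (v % 2 = 1 ∧ ((2 * v + 1) * N + v ^ 2 * S - 3 * N - S) % 4 = 0) := by
  rcases Nat.even_or_odd' v with ⟨j, rfl | rfl⟩
  · left
    have : (2 * ((2 * j : ℕ) : ℤ) + 1) * N + ((2 * j : ℕ) : ℤ) ^ 2 * S - N =
        4 * (j * N + j ^ 2 * S) := by push_cast; ring
    omega
  · right
    have : (2 * ((2 * j + 1 : ℕ) : ℤ) + 1) * N + ((2 * j + 1 : ℕ) : ℤ) ^ 2 * S - 3 * N - S =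
        4 * (j * N + (j ^ 2 + j) * S) := by push_cast; ring
    omega

theorem loc_one_two_two {v a b c : ℕ} (ha : a % 2 = 1) (hb : b % 4 = 2) (hc : c % 4 = 2)
    (t : List ℕ) {N : ℤ} (hN : (v % 2 = 0 ∧ N % 4 = 2) ∨ (v % 2 = 1 ∧ (N - a) % 4 = 2)) :
    Loc (4 * v + 4) 2 (a :: b :: c :: t) N := by
  refine (Loc.of_qLoc_two (l := [a, b, c]) (QLoc.odd_two2_of_two ha hb hc ?_)).append t
  have h1 := completed_emod_four v N ([a, b, c] : List ℕ).sum
  have h2 : (([a, b, c] : List ℕ).sum : ℤ) = a + b + c := by simp [add_assoc]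
  omega

theorem loc_two_six_eight {v a : ℕ} (ha : a % 2 = 1) (t : List ℕ) {N : ℤ}
    (hN : (v % 2 = 0 ∧ N % 2 = 0) ∨ (v % 2 = 1 ∧ N % 2 = 1)) :
    Loc (4 * v + 4) 2 (a :: 2 :: 6 :: 8 :: t) N := by
  refine (Loc.of_qLoc_two (l := [a, 2, 6, 8]) (QLoc.odd_two_six_eight_of_even ha ?_)).append t
  have h1 := completed_emod_four v N ([a, 2, 6, 8] : List ℕ).sum
  have h2 : (([a, 2, 6, 8] : List ℕ).sum : ℤ) = a + 16 := by simp
  omega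

theorem loc_one_two_four {v a b c : ℕ} (ha : a % 2 = 1) (hb : b % 4 = 2) (hc : c % 8 = 4)
    (t : List ℕ) {N : ℤ} (hN : (v % 2 = 0 ∧ N % 2 = 1) ∨ (v % 2 = 1 ∧ N % 2 = 0)) :
    Loc (4 * v + 4) 2 (a :: b :: c :: t) N := by
  have z := val_polygonal_zero (4 * v + 4) t
  rcases hN with ⟨hv2, hN⟩ | ⟨hv2, hN⟩
  · have : (N - a) % 8 = 0 ∨ (N - c - a) % 8 = 0 ∨ (N - b - a) % 8 = 0 ∨
      (N - c - b - a) % 8 = 0 := by omega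
    rcases this with h | h | h | h
    · exact Loc.of_two_unit_even hv2 ha ((z.skip c).skip b) (by omega)
    · exact Loc.of_two_unit_even hv2 ha ((z.take c).skip b) (by omega)
    · exact Loc.of_two_unit_even hv2 ha ((z.skip c).take b) (by omega)
    · exact Loc.of_two_unit_even hv2 ha ((z.take c).take b) (by omega)
  · have : N % 8 = 0 ∨ (N - c) % 8 = 0 ∨ (N - b) % 8 = 0 ∨ (N - c - b) % 8 = 0 := by omega
    rcases this with h | h | h | h
    · exact Loc.of_two_unit_odd hv2 ha ((z.skip c).skip b) (by omega)
    · exact Loc.of_two_unit_odd hv2 ha ((z.take c).skip b) (by omega)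
    · exact Loc.of_two_unit_odd hv2 ha ((z.skip c).take b) (by omega)
    · exact Loc.of_two_unit_odd hv2 ha ((z.take c).take b) (by omega)

/-- With two odd coefficients and one that is 2 modulo 4, all odd numbers are locally
represented. -/
theorem loc_two_two {v a b c : ℕ} (ha : a % 2 = 1) (hb : b % 2 = 1) (hc : c % 4 = 2)
    (t : List ℕ) {N : ℤ} (hN : N % 2 = 1) : Loc (4 * v + 4) 2 (a :: b :: c :: t) N := by
  have z := val_polygonal_zero (4 * v + 4) t
  by_cases h : (N - a) % 4 = 0
  · exact Loc.two_odd ha hb (z.skip c) (by omega)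
  · exact Loc.two_odd ha hb (z.take c) (by omega)

theorem TwoRegular.one_two_two_false {v a b c : ℕ} {t : List ℕ} (hv : 2 ≤ v)
    (H : TwoRegular v (a :: b :: c :: t)) (ha : a % 2 = 1) (hb : b % 4 = 2) (hc : c % 4 = 2)
    (ht : Multiples 8 t) : False := by
  have hm4 : 4 ≤ 4 * v + 4 := by omega
  have S : ∀ {b c : ℕ}, TwoRegular v (a :: b :: c :: t) → ∀ N : ℕ, N < 12 →
      Loc (4 * v + 4) 2 (a :: b :: c :: t) N → _ := fun {b c} H N hN hL =>
    (H N (Or.inl (by omega)) hL).small₃ hm4 ht (by omega)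
  have R8 : Rep (4 * v + 4) t 8 → ∃ s, t.Perm (8 :: s) := fun h => by
    obtain ⟨c, s, hs, hc0, hc1, hc2, -⟩ := ht.pull hm4 h (by simp)
    obtain rfl : c = 8 := by omega
    exact ⟨s, hs⟩
  -- once the coefficients 2, 6, 8 are known, too much is locally represented
  have key8 : ∀ s, t.Perm (8 :: s) → ∀ N : ℤ, (v % 2 = 0 ∧ N % 2 = 0) ∨ (v % 2 = 1 ∧ N % 2 = 1) →
      Loc (4 * v + 4) 2 (a :: 2 :: 6 :: t) N := by
    exact fun s hs N hN => (loc_two_six_eight ha s hN).perm (((hs.symm.cons 6).cons 2).cons a)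
  have loc : ∀ {b c : ℕ}, b % 4 = 2 → c % 4 = 2 → ∀ N : ℤ,
      (v % 2 = 0 ∧ N % 4 = 2) ∨ (v % 2 = 1 ∧ (N - a) % 4 = 2) →
      Loc (4 * v + 4) 2 (a :: b :: c :: t) N := by
    exact fun hb hc N hN => loc_one_two_two ha hb hc t hN
  rcases (by omega : v % 2 = 0 ∨ v % 2 = 1) with hv2 | hv2
  · have main : ∀ {c : ℕ}, c % 4 = 2 → TwoRegular v (a :: 2 :: c :: t) → False := by
      clear! b c
      intro c hc H
      obtain ⟨w, hw, hw0, hd, e⟩ := S H 6 (by simp) (loc rfl hc _ (by omega))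
      obtain rfl : c = 6 := by omega
      obtain ⟨w, hw, hw0, hd, e⟩ := S H 10 (by simp) (loc rfl hc _ (by omega))
      obtain rfl : w = 8 := by omega
      obtain ⟨s, hs⟩ := R8 hw
      obtain ⟨w, hw, hw0, hd, e⟩ := S H 4 (by simp) (key8 s hs _ (by omega))
      omega
    obtain ⟨w, hw, hw0, hd, e⟩ := S H 2 (by simp) (loc hb hc _ (by omega))
    obtain rfl | rfl : b = 2 ∨ c = 2 := by omega
    · exact main hc H
    · exact main hb (H.perm (by grind))
  · rcases (by omega : a % 4 = 3 ∨ a % 4 = 1) with ha4 | ha4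
    · obtain ⟨w, hw, hw0, hd, e⟩ := S H 1 (by simp) (loc hb hc _ (by omega))
      omega
    have main : ∀ {c : ℕ}, c % 4 = 2 → a = 1 → TwoRegular v (a :: 2 :: c :: t) → False := by
      clear! b c
      intro c hc ha1 H
      obtain ⟨w, hw, hw0, hd, e⟩ := S H 7 (by simp) (loc rfl hc _ (by omega))
      obtain rfl : c = 6 := by omega
      obtain ⟨w, hw, hw0, hd, e⟩ := S H 11 (by simp) (loc rfl hc _ (by omega))
      obtain rfl : w = 8 := by omega
      obtain ⟨s, hs⟩ := R8 hw
      obtain ⟨w, hw, hw0, hd, e⟩ := S H 5 (by simp) (key8 s hs _ (by omega))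
      omega
    obtain ⟨w, hw, hw0, hd, e⟩ := S H 3 (by simp) (loc hb hc _ (by omega))
    have : a = 1 ∧ (b = 2 ∨ c = 2) := by omega
    obtain ⟨ha1, rfl | rfl⟩ := this
    · exact main hc ha1 H
    · exact main hb ha1 (H.perm (by grind))

theorem TwoRegular.one_two_four_false {v a b c : ℕ} {t : List ℕ} (hv : 2 ≤ v)
    (H : TwoRegular v (a :: b :: c :: t)) (ha : a % 2 = 1) (hb : b % 4 = 2) (hc : c % 8 = 4)
    (ht : Multiples 8 t) (hbad : ¬ ∀ N : ℕ, Loc (4 * v + 4) 2 (a :: b :: c :: t) N) : False := by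
  have hm4 : 4 ≤ 4 * v + 4 := by omega
  have S := fun (N : ℕ) (hN : N < 12) (hL : Loc (4 * v + 4) 2 (a :: b :: c :: t) N) =>
    (H N (Or.inl (by omega)) hL).small₃ hm4 ht (by omega)
  have key : b = 2 → c = 4 → ¬ Rep (4 * v + 4) t 8 := by
    rintro rfl rfl h
    obtain ⟨c, s, hs, hc0, hc1, hc2, -⟩ := ht.pull hm4 h (by simp)
    obtain rfl : c = 8 := by omega
    exact hbad fun N => loc_all_of_qLoc_two (qLoc_odd_two_four_eight ha (b := 2) (c := 4) (d := 8) rfl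
      rfl rfl) s
      (by simpa using hs.symm) N
  rcases (by omega : v % 2 = 0 ∨ v % 2 = 1) with hv2 | hv2
  · have L : ∀ N : ℕ, N % 2 = 1 → Loc (4 * v + 4) 2 (a :: b :: c :: t) N := fun N hN =>
      loc_one_two_four ha hb hc t (by omega)
    obtain ⟨w, hw, hw0, hd, e⟩ := S 1 (by simp) (L 1 rfl)
    obtain rfl : a = 1 := by omega
    obtain ⟨w, hw, hw0, hd, e⟩ := S 3 (by simp) (L 3 rfl)
    obtain rfl : b = 2 := by omega
    obtain ⟨w, hw, hw0, hd, e⟩ := S 5 (by simp) (L 5 rfl)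
    obtain rfl : c = 4 := by omega
    obtain ⟨w, hw, hw0, hd, e⟩ := S 9 (by simp) (L 9 rfl)
    obtain rfl : w = 8 := by omega
    exact key rfl rfl hw
  · have L : ∀ N : ℕ, N % 2 = 0 → Loc (4 * v + 4) 2 (a :: b :: c :: t) N := fun N hN =>
      loc_one_two_four ha hb hc t (by omega)
    obtain ⟨w, hw, hw0, hd, e⟩ := S 2 (by simp) (L 2 rfl)
    obtain rfl : b = 2 := by omega
    obtain ⟨w, hw, hw0, hd, e⟩ := S 4 (by simp) (L 4 rfl)
    obtain rfl : c = 4 := by omega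
    obtain ⟨w, hw, hw0, hd, e⟩ := S 8 (by simp) (L 8 rfl)
    obtain rfl : w = 8 := by omega
    exact key rfl rfl hw

theorem TwoRegular.one_two_false {v a b : ℕ} {t : List ℕ} (hv : 2 ≤ v)
    (H : TwoRegular v (a :: b :: t)) (ha : a % 2 = 1) (hb : b % 4 = 2)
    (ht : Multiples 8 t) : False := by
  have hm4 : 4 ≤ 4 * v + 4 := by omega
  have z := val_polygonal_zero (4 * v + 4) (b :: t)
  have S := fun (N : ℕ) (hN : N < 12) (hL : Loc (4 * v + 4) 2 (a :: b :: t) N) =>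
    (H N (Or.inl (by omega)) hL).small₂ hm4 ht (by omega)
  have loc : Rep (4 * v + 4) t 8 → ∀ N : ℤ,
      (v % 2 = 0 ∧ N % 4 = 2) ∨ (v % 2 = 1 ∧ (N - a) % 4 = 0) →
      Loc (4 * v + 4) 2 (a :: b :: t) N := by
    intro h N hN
    obtain ⟨c, s, hs, hc0, hc1, hc2, -⟩ := ht.pull hm4 h (by simp)
    obtain rfl : c = 8 := by omega
    refine ((Loc.of_qLoc_two (l := [a, b, 8]) (QLoc.odd_two_eight_of_two ha hb rfl ?_)).append
      s).perm ((hs.symm.cons b).cons a)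
    have h1 := completed_emod_four v N ([a, b, 8] : List ℕ).sum
    have h2 : (([a, b, 8] : List ℕ).sum : ℤ) = a + b + 8 := by simp [add_assoc]
    omega
  rcases (by omega : v % 2 = 0 ∨ v % 2 = 1) with hv2 | hv2
  · have L : ∀ N : ℕ, N % 8 = a % 8 → Loc (4 * v + 4) 2 (a :: b :: t) N := fun N hN =>
      Loc.of_two_unit_even hv2 ha z (by omega)
    obtain ⟨w, hw, hw0, hd, e⟩ := S (a % 8) (by omega) (L _ (by omega))
    have ha8 : a < 8 := by omega
    have h8 : Rep (4 * v + 4) (b :: t) (((a + 8 : ℕ) : ℤ) - a) :=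
      Rep.single_odd (by omega) (by omega)
        (.cons (by omega) (ht.mono (by simp))) ha
        (H (a + 8) (Or.inl (by omega)) (L _ (by omega))) (by omega) (by omega)
    obtain ⟨w, hw, hw0, hd, e⟩ := h8.small hm4 ht (by omega)
    obtain rfl : w = 8 := by omega
    obtain ⟨u, hu, hu0, hd, e⟩ := S 2 (by simp) (loc hw _ (by omega))
    obtain rfl : b = 2 := by omega
    obtain ⟨u, hu, hu0, hd, e⟩ := S 6 (by simp) (loc hw _ (by omega))
    omega
  · obtain ⟨w, hw, hw0, hd, e⟩ := S 8 (by omega) (Loc.of_two_unit_odd hv2 ha z (by simp))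
    obtain rfl : w = 8 := by omega
    obtain ⟨u, hu, hu0, hd, e⟩ := S (a % 4) (by omega) (loc hw _ (by omega))
    obtain ⟨u', hu', hu0', hd', e'⟩ := S (a % 4 + 4) (by omega) (loc hw _ (by omega))
    have : a = a % 4 := by omega
    omega

/-! ### A single odd coefficient -/

theorem loc_one_degenerate {v a d : ℕ} (ha : a % 2 = 1) (hd0 : 0 < d) (hd : d ≤ 8) {c : ℕ}
    (hc : c = 4 ∧ d ≤ 3 ∨ c = 8) (t : List ℕ) {N : ℤ}
    (hN : (v % 2 = 0 ∧ N % 4 = 0) ∨ (v % 2 = 1 ∧ (N - a) % 4 = 0)) :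
    Loc (4 * v + 4) 2 (a :: 4 :: c :: (4 * d) :: t) N := by
  have hN' : (v % 2 = 0 ∧ N % 4 = 0) ∨ (v % 2 = 1 ∧ (N - ([a] : List ℕ).sum) % 4 = 0) := by
    simpa using hN
  rcases hc with ⟨rfl, hd3⟩ | rfl
  · refine (Loc.of_mul_four (l := [a]) (l' := [1, 1, d]) hN' fun M _ => ?_).append t
    obtain h | rfl : d % 2 = 1 ∨ d = 2 := by omega
    · exact qLoc_odd4 ha rfl rfl h M
    · exact qLoc_odd3_two ha rfl rfl rfl M
  · refine (Loc.of_mul_four (l := [a]) (l' := [1, 2, d]) hN' fun M _ => ?_).append t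
    obtain h | h | rfl | rfl : d % 2 = 1 ∨ d % 4 = 2 ∨ d = 4 ∨ d = 8 := by omega
    · exact (qLoc_odd3_two (a := a) (b := 1) (c := d) (d := 2) ha rfl h rfl M).perm
        (by simp only [List.cons_append, List.nil_append]; grind)
    · exact qLoc_odd2_two2 ha rfl rfl h M
    · exact qLoc_odd2_two_four ha rfl rfl rfl M
    · exact qLoc_odd2_two_eight ha rfl rfl rfl M

/-- The multiples of 4 that represent 4, 8, 12 and one of 16, 32. -/
theorem Multiples.exists_four_eight {m : ℕ} (hm : 12 ≤ m) {t : List ℕ} (ht : Multiples 4 t)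
    (h4 : Rep m t 4) (h8 : Rep m t 8) (h12 : Rep m t 12) (h16 : Rep m t 16 ∨ Rep m t 32) :
    ∃ c d s, t.Perm (4 :: c :: (4 * d) :: s) ∧ (c = 4 ∧ d ≤ 3 ∨ c = 8) ∧ 0 < d ∧ d ≤ 8 ∧
      Multiples 4 (4 * d :: s) := by
  have hm4 : 4 ≤ m := by omega
  obtain ⟨c, t1, h1, hc0, hc1, hc2, ht1⟩ := ht.pull hm4 h4 (by simp)
  obtain rfl : c = 4 := by omega
  have hc : ∃ c s, t1.Perm (c :: s) ∧ (c = 4 ∨ c = 8) ∧ Multiples 4 s := by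
    obtain ⟨w, hw, hw0, hd, e⟩ := (h8.perm h1).small hm4 ht1 (by omega)
    obtain ⟨c, s, hs, hc0, hc1, hc2, hs4⟩ := ht1.pull hm4 hw (by omega)
    exact ⟨c, s, hs, by omega, hs4⟩
  obtain ⟨c, s, hs, hc, hs4⟩ := hc
  have hp := h1.trans (hs.cons 4)
  have fin : ∀ w : ℤ, Rep m s w → w ≠ 0 → w ≤ 32 → (c = 4 → w ≤ 12) →
      ∃ c d s, t.Perm (4 :: c :: (4 * d) :: s) ∧ (c = 4 ∧ d ≤ 3 ∨ c = 8) ∧ 0 < d ∧ d ≤ 8 ∧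
        Multiples 4 (4 * d :: s) := by
    intro w hw hw0 hw32 hw12
    obtain ⟨e, u, hu, he0, he1, ⟨d, rfl⟩, hu4⟩ := hs4.pull hm4 hw hw0
    exact ⟨c, d, u, hp.trans ((hu.cons c).cons 4), by omega, by omega, by omega, hs4.perm hu⟩
  have aux : ∀ N : ℤ, N < 4 * m → Rep m t N →
      Rep m s N ∨ Rep m s (N - c) ∨ Rep m s (N - 4) ∨ Rep m s (N - 4 - c) := by
    intro N hN h
    have hcm : (4 * m : ℤ) ≤ c * m := by rcases hc with rfl | rfl <;> push_cast <;> omega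
    rcases (h.perm hp).cons_cases hm4 hN with h | h <;>
      rcases h.cons_cases hm4 (by omega) with h | h
    · exact Or.inl h
    · exact Or.inr (Or.inl h)
    · exact Or.inr (Or.inr (Or.inl h))
    · exact Or.inr (Or.inr (Or.inr h))
  rcases hc with rfl | rfl
  · rcases aux 12 (by omega) h12 with h | h | h | h <;> exact fin _ h (by simp) (by simp)
      (by simp)
  · rcases h16 with h | h
    · rcases aux 16 (by omega) h with h | h | h | h <;> exact fin _ h (by simp) (by simp)
        (by simp)
    · rcases aux 32 (by omega) h with h | h | h | h <;> exact fin _ h (by simp) (by simp)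
        (by simp)

theorem TwoRegular.one_four {v a c : ℕ} {t : List ℕ} (hv : 2 ≤ v)
    (H : TwoRegular v (a :: c :: t)) (ha : a % 2 = 1) (hc : c % 8 = 4)
    (ht : Multiples 4 t) : TwoExceptional v (a :: c :: t) := by
  have hm4 : 4 ≤ 4 * v + 4 := by omega
  have z := val_polygonal_zero (4 * v + 4) t
  have ht' : Multiples 4 (c :: t) := .cons (by omega) ht
  have ht2 : Multiples 2 (c :: t) := ht'.mono (by simp)
  have S := fun (N : ℕ) (hN : N < 12) (hL : Loc (4 * v + 4) 2 (a :: c :: t) N) =>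
    (H N (Or.inl (by omega)) hL).small hm4 ht' (by omega)
  have small : (∀ N : ℕ, N % 4 = a % 4 → Loc (4 * v + 4) 2 (a :: c :: t) N) → a = 1 ∨ a = 3 := by
    intro h
    obtain ⟨w, hw, hw0, hd, e⟩ := S (a % 4) (by omega) (h (a % 4) (by omega))
    omega
  rcases (by omega : v % 2 = 0 ∨ v % 2 = 1) with hv2 | hv2
  · have L : ∀ N : ℕ, N % 4 = a % 4 → Loc (4 * v + 4) 2 (a :: c :: t) N := fun N hN =>
      Loc.even_four hv2 ha hc z (by omega)
    have ha13 := small L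
    have key : ∀ i : ℕ, i ≤ 4 → Rep (4 * v + 4) (c :: t) (4 * i) := fun i hi => by
      have := Rep.single_odd (by omega) (by omega) ht2 ha
        (H (a + 4 * i) (Or.inl (by omega)) (L _ (by omega))) (by omega) (by omega)
      simpa using this
    obtain ⟨e, d, s, hs, he, hd0, hd, hs4⟩ := ht'.exists_four_eight (m := 4 * v + 4) (by omega)
      (by simpa using key 1 (by simp)) (by simpa using key 2 (by simp))
      (by simpa using key 3 (by simp)) (Or.inl (by simpa using key 4 (by simp)))
    refine .one a e (4 * d :: s) (hs.cons a) ha13 (by omega) hs4 fun N hN => ?_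
    rcases hN with hN | hN
    · exact L N (by omega)
    · exact (loc_one_degenerate ha hd0 hd he s (by omega)).perm (hs.symm.cons a)
  · have L : ∀ N : ℕ, N % 4 = 0 → Loc (4 * v + 4) 2 (a :: c :: t) N := fun N hN =>
      Loc.odd_four hv2 ha hc z (by omega)
    have key : ∀ i : ℕ, i ≤ 2 → Rep (4 * v + 4) (c :: t) (4 * i) := fun i hi => by
      obtain ⟨w, hw, hw0, hd, e⟩ := S (4 * i) (by omega) (L _ (by omega))
      obtain rfl : w = (4 * i : ℕ) := by omega
      exact_mod_cast hw
    have even := fun (N : ℕ) (hN : N < 33) (h : N % 4 = 0) => Rep.single_even (by omega) (by omega)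
      ht2 ha (H N (by omega) (L N h)) (by omega) (by omega)
    have h12 : Rep (4 * v + 4) (c :: t) 12 := by
      have : (a : ℤ) * ((4 * v + 4 : ℕ) : ℤ) ≥ 1 * 16 :=
        mul_le_mul (by omega) (by omega) (by simp) (by omega)
      rcases even 12 (by simp) rfl with h | h
      · exact h
      · have := h.nonneg hm4
        omega
    have h16 : Rep (4 * v + 4) (c :: t) 16 ∨ Rep (4 * v + 4) (c :: t) 32 := by
      rcases even 16 (by simp) rfl with h | h
      · exact Or.inl h
      · rcases even 32 (by simp) rfl with h' | h'
        · exact Or.inr h'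
        · have := h.nonneg hm4
          have : (a : ℤ) * ((4 * v + 4 : ℕ) : ℤ) ≥ 1 * 16 :=
            mul_le_mul (by omega) (by omega) (by simp) (by omega)
          left
          convert h' using 1
          omega
    obtain ⟨e, d, s, hs, he, hd0, hd, hs4⟩ := ht'.exists_four_eight (m := 4 * v + 4) (by omega)
      (by simpa using key 1 (by simp)) (by simpa using key 2 (by simp)) h12 h16
    have L' : ∀ N : ℕ, N % 4 = a % 4 → Loc (4 * v + 4) 2 (a :: c :: t) N := fun N hN =>
      (loc_one_degenerate ha hd0 hd he s (by omega)).perm (hs.symm.cons a)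
    have ha13 := small L'
    refine .one a e (4 * d :: s) (hs.cons a) ha13 (by omega) hs4 fun N hN => ?_
    rcases hN with hN | hN
    · exact L' N (by omega)
    · exact L N hN

theorem TwoRegular.one_even_false {v a : ℕ} {t : List ℕ} (hv : 2 ≤ v) (hv2 : v % 2 = 0)
    (H : TwoRegular v (a :: t)) (ha : a % 2 = 1) (ht : Multiples 8 t) : False := by
  have hm4 : 4 ≤ 4 * v + 4 := by omega
  have ht2 : Multiples 2 t := ht.mono (by simp)
  have z := val_polygonal_zero (4 * v + 4) t
  have L : ∀ N : ℕ, N % 8 = a % 8 → Loc (4 * v + 4) 2 (a :: t) N := fun N hN =>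
    Loc.of_two_unit_even hv2 ha z (by omega)
  have no4 : ¬ Loc (4 * v + 4) 2 (a :: t) (4 : ℕ) := fun h => by
    obtain ⟨w, hw, hw0, hd, e⟩ := (H 4 (by simp) h).small hm4 ht (by omega)
    omega
  have ha8 : a < 8 := by
    obtain ⟨w, hw, hw0, hd, e⟩ := (H (a % 8) (by omega) (L _ (by omega))).small hm4 ht
      (by omega)
    omega
  have key : ∀ i : ℕ, i ≤ 3 → Rep (4 * v + 4) t (8 * i) := fun i hi => by
    have := Rep.single_odd (by omega) (by omega) ht2 ha
      (H (a + 8 * i) (Or.inl (by omega)) (L _ (by omega))) (by omega) (by omega)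
    simpa using this
  obtain ⟨c, t1, h1, hc0, hc1, hc2, ht1⟩ := ht.pull hm4 (key 1 (by simp)) (by simp)
  obtain rfl : c = 8 := by omega
  have hc : ∃ c s, t1.Perm (c :: s) ∧ (c = 8 ∨ c = 16) ∧ Multiples 8 s := by
    rcases ((key 2 (by simp)).perm h1).cons_cases hm4 (by omega) with h | h <;>
      obtain ⟨c, s, hs, hc0, hc1, hc2, hs4⟩ := ht1.pull hm4 h (by simp) <;>
      exact ⟨c, s, hs, by push_cast at hc1; omega, hs4⟩
  obtain ⟨c, s, hs, hc, hs8⟩ := hc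
  have hp := h1.trans (hs.cons 8)
  have deg : ∀ e u, s.Perm (e :: u) → ∀ N : ℕ, N % 4 = 0 →
      (∀ M : ℤ, 4 * M = (2 * v + 1) * N + v ^ 2 * (a + 8 + c + 4 * (e / 4 : ℕ)) →
        QLoc 2 [a, 2, c / 4, e / 4] M) → Loc (4 * v + 4) 2 (a :: t) N := by
    intro e u hu N hN h
    have he := (hs8.perm hu).of_cons.1
    have h1 := (Loc.of_mul_four (v := v) (N := N) (l := [a]) (l' := [2, c / 4, e / 4])
      (by omega) (fun M hM => h M (by
        rw [hM]
        have : 4 * (c / 4) = c := by omega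
        simp only [List.map, this, List.cons_append, List.nil_append, List.sum_cons, List.sum_nil]
        push_cast
        ring))).append u
    have e1 : 4 * (c / 4) = c := by omega
    have e2 : 4 * (e / 4) = e := by omega
    simp only [List.map, e1, e2, List.cons_append, List.nil_append] at h1
    exact h1.perm ((hp.trans ((hu.cons c).cons 8)).symm.cons a)
  rcases hc with rfl | rfl
  · have hw : ∃ w : ℤ, Rep (4 * v + 4) s w ∧ 8 ≤ w ∧ w ≤ 24 := by
      rcases ((key 3 (by simp)).perm hp).cons_cases hm4 (by omega) with h | h <;>
        rcases h.cons_cases hm4 (by omega) with h | h <;>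
        exact ⟨_, h, by simp, by simp⟩
    obtain ⟨w, hw, hw1, hw2⟩ := hw
    obtain ⟨e, u, hu, he0, he1, he2, hu8⟩ := hs8.pull hm4 hw (by omega)
    refine no4 (deg e u hu 4 rfl fun M _ => ?_)
    obtain h | h : e / 4 % 4 = 2 ∨ e / 4 % 8 = 4 := by omega
    · exact qLoc_odd_two3 ha rfl rfl h M
    · exact qLoc_odd_two2_four ha rfl rfl h M
  · have deg' : ∀ N : ℕ, N % 4 = 0 →
        (∀ M : ℤ, 4 * M = (2 * v + 1) * N + v ^ 2 * (a + 24) → M % 2 = 1) →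
        Loc (4 * v + 4) 2 (a :: t) N := by
      intro N hN h
      refine ((Loc.of_mul_four (v := v) (N := N) (l := [a]) (l' := [2, 4]) (by omega)
        (fun M hM => QLoc.odd_two_four ha rfl rfl (h M (by rw [hM]; simp)))).append s).perm
        (hp.symm.cons a)
    obtain ⟨j, rfl⟩ : ∃ j, v = 2 * j := ⟨v / 2, by omega⟩
    rcases Nat.even_or_odd' j with ⟨i, rfl | rfl⟩
    · refine no4 (deg' 4 rfl fun M hM => ?_)
      have : M = 2 * (4 * i + 2 * i ^ 2 * (a + 24)) + 1 := by
        push_cast at hM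
        linarith
      omega
    · have L32 : Rep (4 * (2 * (2 * i + 1)) + 4) (a :: t) (32 : ℕ) := by
        refine H 32 (Or.inr ⟨rfl, Or.inr ⟨a, s, ha, hs8, hp.cons a⟩⟩) (deg' 32 rfl fun M hM => ?_)
        have : M = 2 * (4 * (8 * i + 5) + (2 * i ^ 2 + 2 * i) * (a + 24) + 12) + a := by
          push_cast at hM
          linarith
        omega
      have h32 : Rep (4 * (2 * (2 * i + 1)) + 4) t 32 := by
        rcases Rep.single_even (by omega) (by omega) ht2 ha L32 (by simp) (by omega) with h | h
        · exact h
        · have h8 := (ht.rep hm4 h).1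
          have : (a : ℤ) * ((4 * (2 * (2 * i + 1)) + 4 : ℕ) : ℤ) = 8 * (a * (2 * i + 1)) + 4 * a := by
            push_cast
            ring
          omega
      have hw : ∃ w : ℤ, Rep (4 * (2 * (2 * i + 1)) + 4) s w ∧ 8 ≤ w ∧ w ≤ 32 := by
        rcases (h32.perm hp).cons_cases hm4 (by omega) with h | h <;>
          rcases h.cons_cases hm4 (by omega) with h | h <;>
          exact ⟨_, h, by simp, by simp⟩
      obtain ⟨w, hw, hw1, hw2⟩ := hw
      obtain ⟨e, u, hu, he0, he1, he2, hu8⟩ := hs8.pull hm4 hw (by omega)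
      refine no4 (deg e u hu 4 rfl fun M _ => ?_)
      obtain h | h | h : e / 4 % 4 = 2 ∨ e / 4 % 8 = 4 ∨ e / 4 % 16 = 8 := by omega
      · exact (qLoc_odd_two2_four (a := a) (b := 2) (c := e / 4) (d := 4) ha rfl h rfl M).perm
          (((List.Perm.swap 4 _ []).cons 2).cons a)
      · exact qLoc_odd_two_four2 ha rfl rfl h M
      · exact qLoc_odd_two_four_eight ha rfl rfl h M

/-- A represented odd number below 32 has argument 1 at `a`, so that it lies in the class of `a`
modulo 8. -/
theorem TwoRegular.not_loc_add_four {v a : ℕ} {t : List ℕ} (hv : 2 ≤ v)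
    (H : TwoRegular v (a :: t)) (ha : a % 2 = 1) (ht : Multiples 8 t) {N : ℤ} (hN0 : 0 ≤ N)
    (hN : N < 32) (h : (N - a - 4) % 8 = 0) : ¬ Loc (4 * v + 4) 2 (a :: t) N := by
  intro hL
  have h1 := Rep.single_odd (by omega) (by omega) (ht.mono (by simp)) ha (H.rep hN0 hN hL)
    (by omega) (by omega)
  have := (ht.rep (by omega) h1).1
  omega

theorem QLoc.odd_eight_of_eight {a c : ℕ} {M : ℤ} (hM : M % 2 = 1)
    (hc : c = 8 ∧ a % 2 = 1 ∨ c = 16 ∧ ((M - 1) % 8 = 0 ∨ (M - 2 - 1) % 8 = 0 ∨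
      (M - 2 * a - 1) % 8 = 0 ∨ (M - 2 - 2 * a - 1) % 8 = 0)) : QLoc 2 [a, 8, c] (8 * M) := by
  have h : QLoc 2 [2 * a, 1, c / 8] M := by
    rcases hc with ⟨rfl, ha⟩ | ⟨rfl, h⟩
    · exact (QLoc.odd2_two (a := 1) (b := 1) (c := 2 * a) rfl rfl (by omega) hM).perm (by grind)
    · have w : ∀ y z : ℤ, Val (fun y : ℤ => y ^ 2) [2, 2 * a]
          ((2 : ℕ) * y ^ 2 + ((2 * a : ℕ) * z ^ 2 + 0)) := fun y z =>
        ((show Val (fun y : ℤ => y ^ 2) [] 0 from rfl).cons (2 * a) z).cons 2 y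
      suffices QLoc 2 [1, 2, 2 * a] M from this.perm (by grind)
      rcases h with h | h | h | h
      · exact QLoc.of_two_unit rfl (w 0 0) (by omega)
      · exact QLoc.of_two_unit rfl (w 1 0) (by omega)
      · exact QLoc.of_two_unit rfl (w 0 1) (by omega)
      · exact QLoc.of_two_unit rfl (w 1 1) (by omega)
  have h1 := QLoc.mul_prime (p := 2) (l := [a]) (l' := [1, c / 8]) h
  have h2 := QLoc.mul_four (l := [a]) (l' := [2 * 1, 2 * (c / 8)]) h1
  have h3 : 4 * (2 * (c / 8)) = c := by omega
  simp only [List.map, h3, List.cons_append, List.nil_append] at h2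
  convert h2 using 1
  push_cast
  ring

theorem TwoRegular.one_odd_false {v a : ℕ} {t : List ℕ} (hv : 2 ≤ v) (hv2 : v % 2 = 1)
    (H : TwoRegular v (a :: t)) (ha : a % 2 = 1) (ht : Multiples 8 t) : False := by
  have hm4 : 4 ≤ 4 * v + 4 := by omega
  have z := val_polygonal_zero (4 * v + 4) t
  rcases (by omega : v % 4 = 3 ∨ v % 4 = 1) with hv4 | hv4
  · obtain ⟨i, rfl⟩ : ∃ i, v = 4 * i + 3 := ⟨v / 4, by omega⟩
    -- `23 - 8 i` is the inverse of `2 v + 1` modulo 32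
    set X : ℤ := (23 - 8 * i) * ((4 - (4 * i + 3) ^ 2) * a) with hX
    have hX8 : X = 5 * a + 8 * (a * (-15 - 64 * i - 22 * i ^ 2 + 16 * i ^ 3)) := by
      rw [hX]; ring
    refine H.not_loc_add_four hv ha ht (N := X % 32) (by omega) (by omega) (by omega) ?_
    obtain ⟨q, hq⟩ : ∃ q, X % 32 = X + 32 * q := ⟨-(X / 32), by omega⟩
    refine (Loc.of_qLoc_two (l := [a]) ?_).append t
    have h1 : QLoc 2 [a] (a + 8 * ((4 - (4 * i + 3) ^ 2) * a * (5 + 4 * i - 2 * i ^ 2) +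
        (8 * i + 7) * q)) := QLoc.of_two_unit ha (w := 0) rfl (by omega)
    convert h1.mul_sq using 1
    rw [hq, hX]
    simp only [List.sum_cons, List.sum_nil]
    push_cast
    ring
  · obtain ⟨i, rfl⟩ : ∃ i, v = 4 * i + 1 := ⟨v / 4, by omega⟩
    have key : ∀ N : ℕ, N = 8 ∨ N = 16 → Rep (4 * (4 * i + 1) + 4) t N := by
      intro N hN
      obtain ⟨w, hw, hw0, hd, e⟩ := (H N (by omega) (Loc.of_two_unit_odd hv2 ha z
        (by omega))).small hm4 ht (by omega)
      obtain rfl : w = N := by omega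
      exact hw
    obtain ⟨c, t1, h1, hc0, hc1, hc2, ht1⟩ := ht.pull hm4 (key 8 (Or.inl rfl)) (by simp)
    obtain rfl : c = 8 := by omega
    have hc : ∃ c s, t1.Perm (c :: s) ∧ (c = 8 ∨ c = 16) := by
      rcases ((key 16 (Or.inr rfl)).perm h1).cons_cases hm4 (by omega) with h | h <;>
        obtain ⟨c, s, hs, hc0, hc1, hc2, hs4⟩ := ht1.pull hm4 h (by simp) <;>
        exact ⟨c, s, hs, by push_cast at hc1; omega⟩
    obtain ⟨c, s, hs, hc⟩ := hc
    have hp := h1.trans (hs.cons 8)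
    obtain ⟨e, rfl⟩ : ∃ e, c = 8 * e := ⟨c / 8, by omega⟩
    set S : ℤ := a + 8 * (e + 1) with hS
    -- `8 i + 11` is the inverse of `2 v + 1` modulo 16
    set Y : ℤ := (8 * i + 11) * (8 - (4 * i + 1) ^ 2 * S) with hY
    have hY8 : Y = -3 * a + 8 * ((8 * i + 11) - (8 * i + 11) * (2 * i ^ 2 + i) * S - i * a - a -
        (8 * i + 11) * (e + 1)) := by
      rw [hY, hS]; ring
    set k : ℤ := (4 * i ^ 2 + 7 * i + 2) * (8 - (4 * i + 1) ^ 2 * S) with hk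
    have main : ∀ q : ℤ, 0 ≤ Y + 16 * q → Y + 16 * q < 32 →
        ((8 * e = 8 ∧ a % 2 = 1) ∨ 8 * e = 16 ∧
          ((1 + 2 * (k + (8 * i + 3) * q) - 1) % 8 = 0 ∨
            (1 + 2 * (k + (8 * i + 3) * q) - 2 - 1) % 8 = 0 ∨
            (1 + 2 * (k + (8 * i + 3) * q) - 2 * a - 1) % 8 = 0 ∨
            (1 + 2 * (k + (8 * i + 3) * q) - 2 - 2 * a - 1) % 8 = 0)) → False := by
      intro q hq0 hq1 h
      refine H.not_loc_add_four hv ha ht hq0 hq1 (by omega) ?_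
      refine ((Loc.of_qLoc_two (l := [a, 8, 8 * e]) ?_).append s).perm (hp.symm.cons a)
      convert QLoc.odd_eight_of_eight (a := a) (c := 8 * e) (by omega) h using 1
      rw [hk, hY, hS]
      simp only [List.sum_cons, List.sum_nil]
      push_cast
      ring
    have h0 : Y + 16 * (-(Y / 16)) = Y % 16 := by omega
    have h1 : Y + 16 * (-(Y / 16) + 1) = Y % 16 + 16 := by omega
    rcases hc with hc | hc
    · exact main (-(Y / 16)) (by omega) (by omega) (Or.inl ⟨hc, ha⟩)
    · set r : ℤ := k + (8 * i + 3) * (-(Y / 16)) with hr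
      have hr' : k + (8 * i + 3) * (-(Y / 16) + 1) = r + 8 * i + 3 := by rw [hr]; ring
      have m0 := main (-(Y / 16)) (by omega) (by omega)
      have m1 := main (-(Y / 16) + 1) (by omega) (by omega)
      rw [hr'] at m1
      rw [← hr] at m0
      by_cases h : ((1 + 2 * r - 1) % 8 = 0 ∨ (1 + 2 * r - 2 - 1) % 8 = 0 ∨
            (1 + 2 * r - 2 * a - 1) % 8 = 0 ∨ (1 + 2 * r - 2 - 2 * a - 1) % 8 = 0)
      · exact m0 (Or.inr ⟨hc, h⟩)
      · exact m1 (Or.inr ⟨hc, by omega⟩)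

theorem TwoShape.twoExceptional {v : ℕ} {l : List ℕ} (hv : 2 ≤ v) (hs : TwoShape l)
    (hbad : ¬ ∀ N : ℕ, Loc (4 * v + 4) 2 l N) (H : TwoRegular v l) : TwoExceptional v l := by
  have bad : ∀ {l'}, l.Perm l' → ¬ ∀ N : ℕ, Loc (4 * v + 4) 2 l' N := fun hl h =>
    hbad fun N => (h N).perm hl.symm
  rcases hs with ⟨a, t, hl, ha, ht⟩ | ⟨a, b, t, hl, ha, hb, ht⟩ | ⟨a, b, c, t, hl, ha, hb, hc, ht⟩ |
    ⟨a, b, c, t, hl, ha, hb, hc, ht⟩ | ⟨a, b, t, hl, ha, hb, ht⟩ | ⟨a, b, c, t, hl, ha, hb, hc, ht⟩ |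
    ⟨a, b, c, t, hl, ha, hb, hc, ht⟩
  · by_cases h4 : ∃ c ∈ t, c % 8 = 4
    · obtain ⟨c, hc, hc8⟩ := h4
      obtain ⟨s, hs⟩ : ∃ s, t.Perm (c :: s) := ⟨t.erase c, List.perm_cons_erase hc⟩
      have hl' := hl.trans (hs.cons a)
      exact ((H.perm hl').one_four hv ha hc8 (ht.perm hs).of_cons.2).perm hl'
    · push Not at h4
      have ht8 : Multiples 8 t := fun c hc => by
        have h1 := ht c hc
        have h2 := h4 c hc
        exact ⟨h1.1, by omega⟩
      rcases (by omega : v % 2 = 0 ∨ v % 2 = 1) with hv2 | hv2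
      · exact ((H.perm hl).one_even_false hv hv2 ha ht8).elim
      · exact ((H.perm hl).one_odd_false hv hv2 ha ht8).elim
  · exact ((H.perm hl).one_two_false hv ha hb ht).elim
  · exact ((H.perm hl).one_two_four_false hv ha hb hc ht (bad hl)).elim
  · exact ((H.perm hl).one_two_two_false hv ha hb hc ht).elim
  · exact ((H.perm hl).two hv ha hb ht).perm hl
  · exact ((H.perm hl).two_two_false hv ha hb hc ht (bad hl)).elim
  · exact ((H.perm hl).three_false hv ha hb hc ht).elim

/-! ### Forms with a single coefficient prime to 3 -/

theorem map_perm_cons {d o : ℕ} {G u : List ℕ} (h : (G.map (fun c => d * c)).Perm (o :: u)) :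
    ∃ e G', G.Perm (e :: G') ∧ o = d * e ∧ u.Perm (G'.map (fun c => d * c)) := by
  obtain ⟨e, he, rfl⟩ := List.mem_map.1 (h.mem_iff.2 (List.mem_cons_self (a := o)))
  have hs := List.perm_cons_erase he
  exact ⟨e, _, hs, rfl, ((hs.map _).symm.trans h).cons_inv.symm⟩

theorem Multiples.exists_map {d : ℕ} {t : List ℕ} (ht : Multiples d t) :
    ∃ G : List ℕ, t = G.map (fun c => d * c) ∧ ∀ c ∈ G, 0 < c := by
  induction t with
  | nil => exact ⟨[], rfl, by simp⟩
  | cons c t ih =>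
    obtain ⟨⟨hc, e, rfl⟩, ht'⟩ := ht.of_cons
    obtain ⟨G, rfl, hG⟩ := ih ht'
    exact ⟨e :: G, rfl, List.forall_mem_cons.2 ⟨Nat.pos_of_mul_pos_left hc, hG⟩⟩

theorem Multiples.of_map {d e : ℕ} (hde : Nat.Coprime d e) {G : List ℕ}
    (h : Multiples d (G.map (fun c => e * c))) : Multiples d G := fun c hc =>
  have h1 := h _ (List.mem_map_of_mem hc)
  ⟨Nat.pos_of_ne_zero fun h0 => by simp [h0] at h1, hde.dvd_of_dvd_mul_left h1.2⟩

theorem Multiples.map {d e : ℕ} (he : 0 < e) {G : List ℕ} (h : Multiples d G) :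
    Multiples (e * d) (G.map (fun c => e * c)) := fun c hc => by
  obtain ⟨b, hb, rfl⟩ := List.mem_map.1 hc
  exact ⟨Nat.mul_pos he (h b hb).1, Nat.mul_dvd_mul_left e (h b hb).2⟩

theorem Loc.skip {m p : ℕ} {t : List ℕ} {N : ℤ} (h : Loc m p t N) (a : ℕ) :
    Loc m p (a :: t) N := fun k =>
  let ⟨w, hw, hk⟩ := h k; ⟨w, hw.skip a, hk⟩

theorem Loc.take {m p : ℕ} {t : List ℕ} {N : ℤ} (h : Loc m p t N) (a : ℕ) :
    Loc m p (a :: t) (N + a) := fun k =>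
  let ⟨w, hw, hk⟩ := h k; ⟨w + a, hw.take a, hk.add_right _⟩

/-- Multiplication by 3 is invertible 2-adically. -/
theorem Loc.map_three {m : ℕ} {G : List ℕ} {N : ℤ}
    (h : ∀ N' : ℕ, (3 * (N' : ℤ) - N) % 4 = 0 → Loc m 2 G N') :
    Loc m 2 (G.map (3 * ·)) N := by
  intro k
  obtain ⟨q, hq⟩ : ∃ q : ℤ, (4 : ℤ) ^ (k + 1) = 3 * q + 1 := by
    obtain ⟨q, hq⟩ := sub_one_dvd_pow_sub_one (4 : ℤ) (k + 1)
    exact ⟨q, by linarith⟩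
  -- `-q` is the inverse of 3
  set N' : ℕ := ((-q * N) % (4 : ℤ) ^ (k + 1)).toNat with hN'
  have h4 : (0 : ℤ) < 4 ^ (k + 1) := by positivity
  have e1 : (N' : ℤ) = (-q * N) % (4 : ℤ) ^ (k + 1) :=
    Int.toNat_of_nonneg (Int.emod_nonneg _ h4.ne')
  obtain ⟨r, hr⟩ : ∃ r, (N' : ℤ) = -q * N + 4 ^ (k + 1) * r :=
    ⟨-((-q * N) / 4 ^ (k + 1)), by rw [e1, Int.emod_def]; ring⟩
  have e2 : 3 * (N' : ℤ) - N = 4 ^ (k + 1) * (3 * r - N) := by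
    rw [hr]
    linear_combination N * hq
  have e4 : 3 * (N' : ℤ) - N = 4 * (4 ^ k * (3 * r - N)) := by
    rw [e2]
    ring
  obtain ⟨w, hw, hk⟩ := h N' (by omega) k
  refine ⟨3 * w, hw.scale 3, (hk.mul_left 3).trans ?_⟩
  rw [Int.modEq_iff_dvd]
  have e3 : N - 3 * N' = 2 ^ k * (2 ^ (k + 2) * -(3 * r - N)) := by
    have : (4 : ℤ) ^ (k + 1) = 2 ^ k * 2 ^ (k + 2) := by
      rw [← pow_add, show k + (k + 2) = 2 * (k + 1) by ring, pow_mul]; norm_num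
    rw [this] at e2
    linear_combination -e2
  push_cast
  exact Dvd.intro _ e3.symm

/-- If the single coefficient prime to 3 is `a`, a represented number congruent to `e a` modulo 3
leaves a number represented by the remaining coefficients, divided by 3. Here `e` is the value
modulo 3 of `polygonal m` that is attained at the non-degenerate arguments. -/
def DescendsThree (m a e : ℕ) (G : List ℕ) : Prop :=
  ∀ N : ℕ, 3 * N + e * a < a * m → Loc m 2 (a :: G.map (3 * ·)) ((3 * N + e * a : ℕ) : ℤ) →
    Rep m G N

/-- The non-degenerate value of `polygonal m` modulo 3. -/
def IsNondegThree (m e : ℕ) : Prop := (m % 3 = 1 ∧ e = 1) ∨ (m % 3 = 0 ∧ e = 0)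

theorem DescendsThree.of_regular {m a e : ℕ} {G : List ℕ} (hm : 5 ≤ m) (he : IsNondegThree m e)
    (ha : ¬ 3 ∣ a)
    (H : ∀ N : ℕ, Loc m 2 (a :: G.map (3 * ·)) N → Loc m 3 (a :: G.map (3 * ·)) N →
      Rep m (a :: G.map (3 * ·)) N) : DescendsThree m a e G := by
  intro N hN hL
  have z := val_polygonal_zero m (G.map (3 * ·))
  have h3 : Loc m 3 (a :: G.map (3 * ·)) ((3 * N + e * a : ℕ) : ℤ) := by
    rcases he with ⟨h, rfl⟩ | ⟨h, rfl⟩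
    · exact Loc.three_one h ha z (by omega)
    · exact Loc.three_zero h ha z (by omega)
  have d : ∀ w : ℤ, Rep m (G.map (3 * ·)) w → (3 : ℤ) ∣ w := fun w hw =>
    Val.dvd (d := 3) (fun c hc => by obtain ⟨b, -, rfl⟩ := List.mem_map.1 hc; exact ⟨b, rfl⟩) hw
  suffices Rep m (G.map (3 * ·)) ((3 : ℕ) * (N : ℤ)) from Val.unscale (by simp) this
  rcases (H _ hL h3).cons_cases (by omega) (by exact_mod_cast hN) with h | h <;> have := d _ h <;>
    rcases he with ⟨-, rfl⟩ | ⟨-, rfl⟩ <;> push_cast at h this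
  · omega
  · simpa using h
  · simpa using h
  · omega

theorem SuppliesThree.loc_all {m a : ℕ} (hm : 5 ≤ m) (hm3 : m % 3 ≠ 2) (ha : ¬ 3 ∣ a) {t : List ℕ}
    (ht : SuppliesThree t) (N : ℕ) (hN : N % 3 = 0 ∨ N % 3 = a % 3) : Loc m 3 (a :: t) N := by
  have z := val_polygonal_zero m t
  rcases (by omega : m % 3 = 1 ∨ m % 3 = 0) with h1 | h1 <;> rcases hN with h2 | h2
  · exact ht.loc hm hm3 ha (by omega) (Or.inl ⟨h1, by omega⟩)
  · exact Loc.three_one h1 ha z (by omega)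
  · exact Loc.three_zero h1 ha z (by omega)
  · exact ht.loc hm hm3 ha (by omega) (Or.inr ⟨h1, by omega⟩)

/-- What remains of the regular forms that are exceptional at both 2 and 3. -/
inductive TwoThreeExceptional (m : ℕ) (l : List ℕ) : Prop
  | three_four (t : List ℕ) (hl : l.Perm (3 :: 4 :: t)) (ht : Multiples 12 t)
      (h : ∀ N : ℕ, N % 4 = 0 ∨ N % 4 = 3 → N % 3 = 0 ∨ N % 3 = 1 → Rep m l N)
  | three_eight (t : List ℕ) (hl : l.Perm (3 :: 8 :: t)) (ht : Multiples 12 t)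
      (h : ∀ N : ℕ, N % 4 = 0 ∨ N % 4 = 3 → N % 3 = 0 ∨ N % 3 = 2 → Rep m l N)
  | three_three_four (t : List ℕ) (hl : l.Perm (3 :: 3 :: 4 :: t)) (ht : Multiples 12 t)
      (h : ∀ N : ℕ, N % 4 ≠ 1 → N % 3 = 0 ∨ N % 3 = 1 → Rep m l N)

theorem TwoThreeExceptional.perm {m : ℕ} {l l' : List ℕ} (hl : l'.Perm l)
    (h : TwoThreeExceptional m l) : TwoThreeExceptional m l' := by
  rcases h with ⟨t, h1, h2, h3⟩ | ⟨t, h1, h2, h3⟩ | ⟨t, h1, h2, h3⟩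
  · exact .three_four t (hl.trans h1) h2 fun N a b => (h3 N a b).perm hl.symm
  · exact .three_eight t (hl.trans h1) h2 fun N a b => (h3 N a b).perm hl.symm
  · exact .three_three_four t (hl.trans h1) h2 fun N a b => (h3 N a b).perm hl.symm

/-- The last step: coefficients `a, 3 e` with `a` a multiple of 4 and multiples of 12. -/
theorem twoThree_one {m a e : ℕ} (hm : 12 ≤ m) (ha4 : a % 4 = 0) (ha3 : ¬ 3 ∣ a)
    (he : e % 2 = 1) {t : List ℕ} (ht : Multiples 12 t)
    (h : ∀ N : ℕ, N % 4 = 0 ∨ N % 4 = 3 * e % 4 → N % 3 = 0 ∨ N % 3 = a % 3 →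
      Rep m (a :: (3 * e) :: t) N) : TwoThreeExceptional m (a :: (3 * e) :: t) := by
  have S := fun (N : ℕ) (hN : N < 12) h1 h2 =>
    (h N h1 h2).small₂ (by omega) ht (by omega)
  obtain ⟨w, -, h0, h1, h2⟩ := S (if e % 4 = 1 then 3 else 9) (by split_ifs <;> omega)
    (by split_ifs <;> omega) (by split_ifs <;> omega)
  obtain ⟨w', -, h0', h1', h2'⟩ := S (if a % 3 = 1 then 4 else 8) (by split_ifs <;> omega)
    (by split_ifs <;> omega) (by split_ifs <;> omega)
  have ha48 : a = 4 ∨ a = 8 := by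
    split_ifs at h2' <;> omega
  have he13 : e = 1 ∨ e = 3 := by
    rcases ha48 with rfl | rfl <;> split_ifs at h2 <;> omega
  obtain ⟨w'', -, h0'', h1'', h2''⟩ := S (if e = 1 then 3 else if a = 4 then 1 else 5)
    (by split_ifs <;> omega) (by split_ifs <;> omega) (by split_ifs <;> omega)
  have he1 : e = 1 := by
    by_contra h
    obtain rfl : e = 3 := by omega
    rcases ha48 with rfl | rfl <;> simp at h2'' <;> omega
  subst he1
  rcases ha48 with rfl | rfl
  · exact .three_four t (.swap _ _ _) ht fun N a b => h N (by omega) (by omega)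
  · exact .three_eight t (.swap _ _ _) ht fun N a b => h N (by omega) (by omega)

theorem twoThree_two_ne_false {m a : ℕ} (hm : 12 ≤ m) (ha4 : a % 4 = 0) (ha3 : ¬ 3 ∣ a)
    {t : List ℕ} (ht : Multiples 12 t)
    (h : ∀ N : ℕ, N % 4 ≠ 2 → N % 3 = 0 ∨ N % 3 = a % 3 → Rep m (a :: 3 :: 9 :: t) N) : False := by
  have S := fun (N : ℕ) (hN : N < 12) h1 h2 => (h N h1 h2).small₃ (by omega) ht (by omega)
  obtain ⟨w', -, h0', h1', h2'⟩ := S (if a % 3 = 1 then 1 else 5) (by split_ifs <;> omega)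
    (by split_ifs <;> omega) (by split_ifs <;> omega)
  split_ifs at h2' <;> omega

theorem twoThree_two_eq {m a : ℕ} (hm : 12 ≤ m) (ha4 : a % 4 = 0) (ha0 : 0 < a) (ha3 : ¬ 3 ∣ a)
    {t : List ℕ} (ht : Multiples 12 t)
    (h : ∀ N : ℕ, N % 4 ≠ 1 → N % 3 = 0 ∨ N % 3 = a % 3 → Rep m (a :: 3 :: 3 :: t) N) :
    TwoThreeExceptional m (a :: 3 :: 3 :: t) := by
  have S := fun (N : ℕ) (hN : N < 12) h1 h2 => (h N h1 h2).small₃ (by omega) ht (by omega)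
  obtain ⟨w', -, h0', h1', h2'⟩ := S (if a % 3 = 1 then 4 else 2) (by split_ifs <;> omega)
    (by split_ifs <;> omega) (by split_ifs <;> omega)
  obtain rfl : a = 4 := by split_ifs at h2' <;> omega
  exact .three_three_four t (by grind) ht fun N a b => h N a (by omega)

/-! ### The coefficient prime to 3 is a multiple of 4 -/

theorem perm_rotate {a b c : ℕ} {t : List ℕ} : (b :: c :: a :: t).Perm (a :: b :: c :: t) :=
  List.perm_append_comm (l₁ := [b, c]) (l₂ := [a]) |>.append_right t

theorem suppliesThree_triple {b c : ℕ} (hb : b = 1 ∨ b = 3) (hc : c = 4 ∨ c = 8) (s : List ℕ) :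
    SuppliesThree ((3 * b) :: 12 :: (3 * c) :: s) := by
  rcases hb with rfl | rfl <;> rcases hc with rfl | rfl
  · exact Or.inr ⟨_, _, _, _, .refl _, by simp, by simp, by simp⟩
  · exact Or.inl ⟨3, 24, 12 :: s, by grind, by simp, by simp⟩
  · exact Or.inr ⟨12, 12, 9, s, by grind, by simp, by simp, by simp⟩
  · exact Or.inl ⟨12, 24, 9 :: s, by grind, by simp, by simp⟩

theorem suppliesThree_three_nine (s : List ℕ) : SuppliesThree (3 :: 9 :: 12 :: s) :=
  Or.inr ⟨3, 12, 9, s, by grind, by simp, by simp, by simp⟩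

theorem suppliesThree_three_three (s : List ℕ) : SuppliesThree (3 :: 3 :: 12 :: s) :=
  Or.inr ⟨3, 3, 12, s, .refl _, by simp, by simp, by simp⟩

theorem Multiples.map_three {G : List ℕ} (h : Multiples 4 G) :
    Multiples 12 (G.map (3 * ·)) := Multiples.map (d := 4) (e := 3) (by simp) h

/-- The form `⟨a, 3 G⟩`, with `a` prime to 3, is exceptional at 2 and represents every number that
is locally represented at 2 and 3. -/
structure ThreeSingle (v a ε : ℕ) (G : List ℕ) : Prop where
  two_le : 2 ≤ v
  nondeg : IsNondegThree (4 * v + 4) ε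
  pos : 0 < a
  not_dvd : ¬ 3 ∣ a
  forall_pos : ∀ c ∈ G, 0 < c
  bad : ¬ ∀ N : ℕ, Loc (4 * v + 4) 2 (a :: G.map (3 * ·)) N
  regular : ∀ N : ℕ, Loc (4 * v + 4) 2 (a :: G.map (3 * ·)) N →
    Loc (4 * v + 4) 3 (a :: G.map (3 * ·)) N →
    Rep (4 * v + 4) (a :: G.map (3 * ·)) N

namespace ThreeSingle

variable {v a ε : ℕ} {G : List ℕ}

theorem perm {G' : List ℕ} (h : ThreeSingle v a ε G) (hp : G.Perm G') : ThreeSingle v a ε G' := by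
  have hp' : (a :: G.map (3 * ·)).Perm (a :: G'.map (3 * ·)) :=
    (hp.map _).cons a
  exact ⟨h.1, h.2, h.3, h.4, fun c hc => h.5 c (hp.mem_iff.2 hc),
    fun hb => h.6 fun N => (hb N).perm hp'.symm,
    fun N h2 h3 => (h.7 N (h2.perm hp'.symm) (h3.perm hp'.symm)).perm hp'⟩

theorem mod_three (h : ThreeSingle v a ε G) : (4 * v + 4) % 3 ≠ 2 := by
  rcases h.nondeg with ⟨h, -⟩ | ⟨h, -⟩ <;> omega

theorem descends (h : ThreeSingle v a ε G) : DescendsThree (4 * v + 4) a ε G :=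
  DescendsThree.of_regular (by have := h.two_le; omega) h.nondeg h.not_dvd h.regular

theorem rep (h : ThreeSingle v a ε G) {N : ℕ} (hN : N < 4 * a)
    (hL : Loc (4 * v + 4) 2 (a :: G.map (3 * ·)) ((3 * N + ε * a : ℕ) : ℤ)) :
    Rep (4 * v + 4) G N := by
  have hv := h.two_le
  refine h.descends N ?_ hL
  rcases h.nondeg with ⟨h1, rfl⟩ | ⟨h1, rfl⟩
  · have : a * 16 ≤ a * (4 * v + 4) := Nat.mul_le_mul le_rfl (by omega)
    omega
  · have : a * 12 ≤ a * (4 * v + 4) := Nat.mul_le_mul le_rfl (by omega)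
    omega

/-- Numbers in the residue classes of `0` and `a` modulo 3 are represented as soon as they are
locally represented at 2. -/
theorem rep_of_supplies (h : ThreeSingle v a ε G) (hs : SuppliesThree (G.map (3 * ·)))
    (N : ℕ) (hN : N % 3 = 0 ∨ N % 3 = a % 3)
    (hL : Loc (4 * v + 4) 2 (a :: G.map (3 * ·)) N) :
    Rep (4 * v + 4) (a :: G.map (3 * ·)) N :=
  h.regular N hL (hs.loc_all (by have := h.two_le; omega) h.mod_three h.not_dvd N hN)

theorem one {e c : ℕ} {t : List ℕ} (h : ThreeSingle v a ε (e :: 4 :: c :: t)) (ha : a % 4 = 0)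
    (he : e = 1 ∨ e = 3) (hc : c = 4 ∨ c = 8) (ht : Multiples 4 t)
    (hL : ∀ N : ℕ, N % 4 = 0 ∨ N % 4 = 3 * e % 4 →
      Loc (4 * v + 4) 2 (a :: (e :: 4 :: c :: t).map (3 * ·)) N) :
    TwoThreeExceptional (4 * v + 4) (a :: (e :: 4 :: c :: t).map (3 * ·)) := by
  have hv := h.two_le
  exact twoThree_one (by omega) ha h.not_dvd (by omega) (t := (4 :: c :: t).map (3 * ·))
    (.map_three (.cons (by simp) (.cons (by omega) ht))) fun N h1 h2 =>
      h.rep_of_supplies (suppliesThree_triple he hc _) N h2 (hL N h1)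

theorem two_ne_false {t : List ℕ} (h : ThreeSingle v a ε (1 :: 3 :: 4 :: t)) (ha : a % 4 = 0)
    (ht : Multiples 4 t)
    (hL : ∀ N : ℕ, N % 4 ≠ 2 →
      Loc (4 * v + 4) 2 (a :: (1 :: 3 :: 4 :: t).map (3 * ·)) N) : False := by
  have hv := h.two_le
  exact twoThree_two_ne_false (m := 4 * v + 4) (a := a)
    (t := (4 :: t).map (3 * ·)) (by omega) ha h.not_dvd (.map_three (.cons (by simp) ht))
    fun N h1 h2 => h.rep_of_supplies (suppliesThree_three_nine _) N h2 (hL N h1)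

theorem two_eq {t : List ℕ} (h : ThreeSingle v a ε (1 :: 1 :: 4 :: t)) (ha : a % 4 = 0)
    (ht : Multiples 4 t)
    (hL : ∀ N : ℕ, N % 4 ≠ 1 →
      Loc (4 * v + 4) 2 (a :: (1 :: 1 :: 4 :: t).map (3 * ·)) N) :
    TwoThreeExceptional (4 * v + 4) (a :: (1 :: 1 :: 4 :: t).map (3 * ·)) := by
  have hv := h.two_le
  exact twoThree_two_eq (m := 4 * v + 4) (a := a)
    (t := (4 :: t).map (3 * ·)) (by omega) ha h.pos h.not_dvd (.map_three (.cons (by simp) ht))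
    fun N h1 h2 => h.rep_of_supplies (suppliesThree_three_three _) N h2 (hL N h1)

theorem twoRegular (h : ThreeSingle v a ε G) (ha : a % 8 = 0) : TwoRegular v G := by
  have hv := h.two_le
  have ha0 := h.pos
  have he := h.nondeg
  have locG : ∀ N : ℕ, Loc (4 * v + 4) 2 G N →
      Loc (4 * v + 4) 2 (a :: G.map (3 * ·)) ((3 * N + ε * a : ℕ) : ℤ) := by
    intro N hN
    rcases he with ⟨-, rfl⟩ | ⟨-, rfl⟩
    · simpa using (hN.scale 3).take a
    · simpa using (hN.scale 3).skip a
  intro N hN hL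
  rcases hN with hN | ⟨rfl, hN⟩
  · exact h.rep (by omega) (locG N hL)
  by_cases ha8 : a = 8 ∧ v = 2
  · -- here 12 is locally represented, but not represented
    exfalso
    obtain ⟨rfl, rfl⟩ := ha8
    rcases hN with hN | ⟨o, s, ho, hs8, hs⟩
    · omega
    have h' := h.perm hs
    have h12 := h'.regular 12
      (((((Loc.of_mul_four (v := 2) (N := 12) (l := [3 * o]) (l' := [2, 6, 12]) (by simp)
        fun M _ => qLoc_odd_two2_four (by omega) rfl rfl rfl M).append
        (s.map (3 * ·))).perm (.swap _ _ _))))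
      (Loc.three_zero rfl (by simp) (val_polygonal_zero _ _) (by simp))
    have h24 : Multiples 24 ((8 :: 16 :: s).map (3 * ·)) :=
      Multiples.map (d := 8) (e := 3) (by simp)
        (.cons (by simp) (.cons (by simp) hs8))
    rcases h12.cons_cases (by simp) (by simp) with h | h <;>
      rcases h.cons_cases (by norm_num) (by push_cast; omega) with h | h <;>
      have h1 := (h24.rep (by simp) h).1 <;>
      have h2 := h.nonneg (by simp) <;> push_cast at h1 h2 <;> omega
  · refine h.descends 32 ?_ (locG 32 hL)
    have hv5 : 5 ≤ v ∨ v < 5 := by omega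
    rcases he with ⟨h, rfl⟩ | ⟨h, rfl⟩
    · have : 8 * 16 ≤ a * (4 * v + 4) := Nat.mul_le_mul (by omega) (by omega)
      have : a * 16 ≤ a * (4 * v + 4) := Nat.mul_le_mul le_rfl (by omega)
      omega
    · rcases hv5 with hv5 | hv5
      · have : 8 * 24 ≤ a * (4 * v + 4) := Nat.mul_le_mul (by omega) (by omega)
        omega
      · have : 16 * 12 ≤ a * (4 * v + 4) := Nat.mul_le_mul (by omega) (by omega)
        omega

theorem of_eight_dvd (h : ThreeSingle v a ε G) (ha : a % 8 = 0) (hodd : ∃ c ∈ G, ¬ 2 ∣ c) :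
    TwoThreeExceptional (4 * v + 4) (a :: G.map (3 * ·)) := by
  have hv := h.two_le
  have hbadG : ¬ ∀ N : ℕ, Loc (4 * v + 4) 2 G N := fun hG =>
    h.bad fun N => (Loc.map_three fun N' _ => hG N').skip a
  rcases (twoShape h.forall_pos hodd hbadG).twoExceptional hv hbadG (h.twoRegular ha) with
    ⟨o, c, t, hl, ho, hc, ht, hL⟩ | ⟨t, hl, ht, hL⟩ | ⟨c, t, hl, hc, ht, hL⟩
  · exact ((h.perm hl).one (by omega) ho hc ht fun N hN => Loc.skip (Loc.map_three fun N' hN' =>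
      (hL N' (by omega)).perm hl) a).perm ((hl.map _).cons a)
  · exact ((h.perm hl).two_ne_false (by omega) ht fun N hN => Loc.skip (Loc.map_three fun N' hN' =>
      (hL N' (by omega)).perm hl) a).elim
  · exact ((h.perm hl).two_eq (by omega) (.cons (by omega) ht) fun N hN => Loc.skip
      (Loc.map_three fun N' hN' => (hL N' (by omega)).perm hl) a).perm ((hl.map _).cons a)

theorem of_four_one {e : ℕ} (h : ThreeSingle v a ε (e :: G)) (ha : a % 8 = 4) (he : e % 2 = 1)
    (hG : Multiples 4 G) :
    TwoThreeExceptional (4 * v + 4) (a :: (e :: G).map (3 * ·)) := by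
  have hv := h.two_le
  have ha0 := h.pos
  have hm4 : 4 ≤ 4 * v + 4 := by omega
  have z := val_polygonal_zero (4 * v + 4) (G.map (3 * ·))
  have L1 : ∀ N : ℕ, (v % 2 = 0 ∧ N % 4 = 3 * e % 4) ∨ (v % 2 = 1 ∧ N % 4 = 0) →
      Loc (4 * v + 4) 2 (a :: (e :: G).map (3 * ·)) N := by
    intro N hN
    rcases hN with ⟨hv2, hN⟩ | ⟨hv2, hN⟩
    · exact (Loc.even_four hv2 (a := 3 * e) (by omega) ha z (by omega)).perm (.swap _ _ _)
    · exact (Loc.odd_four hv2 (a := 3 * e) (by omega) ha z (by omega)).perm (.swap _ _ _)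
  have S := fun (N : ℕ) (hN : N < 12)
      (hN' : (v % 2 = 0 ∧ N % 4 = e % 4) ∨ (v % 2 = 1 ∧ N % 4 = 0)) =>
    (h.rep (N := N) (by omega) (L1 _ (by
      rcases h.nondeg with ⟨-, rfl⟩ | ⟨-, rfl⟩ <;> omega))).small hm4 hG (by omega)
  have R48 : Rep (4 * v + 4) G 4 ∧ Rep (4 * v + 4) G 8 := by
    rcases (by omega : v % 2 = 0 ∨ v % 2 = 1) with hv2 | hv2
    · obtain ⟨w, hw, hw0, hd, h0⟩ := S (e % 4) (by omega) (by omega)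
      obtain ⟨w1, hw1, hw10, hd1, h1⟩ := S (e % 4 + 4) (by omega) (by omega)
      obtain ⟨w2, hw2, hw20, hd2, h2⟩ := S (e % 4 + 8) (by omega) (by omega)
      obtain rfl : w1 = 4 := by omega
      obtain rfl : w2 = 8 := by omega
      exact ⟨hw1, hw2⟩
    · obtain ⟨w1, hw1, hw10, hd1, h1⟩ := S 4 (by omega) (by omega)
      obtain ⟨w2, hw2, hw20, hd2, h2⟩ := S 8 (by omega) (by omega)
      obtain rfl : w1 = 4 := by omega
      obtain rfl : w2 = 8 := by omega
      exact ⟨hw1, hw2⟩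
  obtain ⟨x, t1, h1, hx0, hx1, hx2, ht1⟩ := hG.pull hm4 R48.1 (by simp)
  obtain rfl : x = 4 := by omega
  obtain ⟨w, hw, hw0, hd, h0⟩ := (R48.2.perm h1).small hm4 ht1 (by omega)
  obtain ⟨c, t, h2, hc0, hc1, hc2, ht⟩ := ht1.pull hm4 hw (by omega)
  have hc : c = 4 ∨ c = 8 := by omega
  have hp : (e :: G).Perm (e :: 4 :: c :: t) := (h1.trans (h2.cons 4)).cons e
  have h' := h.perm hp
  have L : ∀ N : ℕ, N % 4 = 0 ∨ N % 4 = 3 * e % 4 →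
      Loc (4 * v + 4) 2 (a :: (e :: 4 :: c :: t).map (3 * ·)) N := by
    intro N hN
    by_cases hN' : (v % 2 = 0 ∧ N % 4 = 3 * e % 4) ∨ (v % 2 = 1 ∧ N % 4 = 0)
    · exact (L1 N hN').perm ((hp.map _).cons a)
    · have h3 := Loc.of_mul_four (v := v) (N := N) (l := [3 * e]) (l' := [a / 4, 3, 3 * c / 4])
        (by simp only [List.sum_cons, List.sum_nil]; omega) fun M _ => by
          rcases hc with rfl | rfl
          · exact qLoc_odd4 (by omega) (by omega) rfl rfl M
          · exact qLoc_odd3_two (by omega) (by omega) rfl rfl M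
      have e1 : 4 * (a / 4) = a := by omega
      have e2 : 4 * (3 * c / 4) = 3 * c := by omega
      simp only [List.map, e1, e2] at h3
      exact (h3.append (t.map (3 * ·))).perm (.swap _ _ _)
  have he13 : e = 1 ∨ e = 3 := by
    obtain ⟨w, hw, hw0, hd, h0⟩ := (h'.rep (N := e % 4) (by omega) (L _ (by
      rcases h.nondeg with ⟨-, rfl⟩ | ⟨-, rfl⟩ <;> omega))).small hm4
        (.cons (by simp) (.cons (by omega) ht)) (by omega)
    omega
  exact (h'.one (by omega) he13 hc ht L).perm ((hp.map _).cons a)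

theorem four_one_two_false {e f : ℕ} (h : ThreeSingle v a ε (e :: f :: G)) (ha : a % 8 = 4)
    (he : e % 2 = 1) (hf : f % 4 = 2) (hG : Multiples 8 G) : False := by
  have hv := h.two_le
  have S := fun (N : ℕ) (hN : N < 12)
      (hN' : (v % 2 = 0 ∧ N % 2 = 1) ∨ (v % 2 = 1 ∧ N % 2 = 0)) =>
    (h.rep (N := N) (by omega) ((loc_one_two_four (a := 3 * e) (b := 3 * f) (c := a) (by omega)
      (by omega) ha _ (by rcases h.nondeg with ⟨-, rfl⟩ | ⟨-, rfl⟩ <;> omega)).perm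
        perm_rotate)).small₂ (by omega) hG (by omega)
  rcases (by omega : v % 2 = 0 ∨ v % 2 = 1) with hv2 | hv2
  · obtain ⟨w, -, h1, h2, h3⟩ := S 1 (by simp) (by omega)
    obtain ⟨w, -, h1, h2, h3⟩ := S 3 (by simp) (by omega)
    obtain ⟨w, -, h1, h2, h3⟩ := S 5 (by simp) (by omega)
    omega
  · obtain ⟨w, -, h1, h2, h3⟩ := S 2 (by simp) (by omega)
    obtain ⟨w, -, h1, h2, h3⟩ := S 4 (by simp) (by omega)
    omega

theorem four_two_ne_false {e f : ℕ} (h : ThreeSingle v a ε (e :: f :: G)) (ha : a % 8 = 4)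
    (he : e % 4 = 1) (hf : f % 4 = 3) (hG : Multiples 4 G) : False := by
  have hv := h.two_le
  have L : ∀ N : ℕ, N % 4 ≠ 2 →
      Loc (4 * v + 4) 2 (a :: (e :: f :: G).map (3 * ·)) N := fun N hN =>
    (loc_two_ne (a := 3 * e) (b := 3 * f) (d := a) (by omega) (by omega) (by omega) ha _
      (by omega)).perm perm_rotate
  have S := fun (N : ℕ) (hN : N < 12) (hN' : N % 2 = 1) =>
    (h.rep (N := N) (by omega) (L _ (by
      rcases h.nondeg with ⟨-, rfl⟩ | ⟨-, rfl⟩ <;> omega))).small₂ (by omega) hG (by omega)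
  obtain ⟨w1, -, h1, h1', h1''⟩ := S 1 (by simp) rfl
  obtain rfl : e = 1 := by omega
  obtain ⟨w3, -, h3, h3', h3''⟩ := S 3 (by simp) rfl
  obtain rfl : f = 3 := by omega
  obtain ⟨w, hw, h5, h5', h5''⟩ := S 5 (by simp) rfl
  obtain rfl : w = 4 := by omega
  obtain ⟨x, t, ht, hx0, hx1, hx2, ht4⟩ := hG.pull (by omega) hw (by simp)
  obtain rfl : x = 4 := by omega
  have hp : (1 :: 3 :: G).Perm (1 :: 3 :: 4 :: t) := (ht.cons 3).cons 1
  exact (h.perm hp).two_ne_false (by omega) ht4 fun N hN => (L N hN).perm ((hp.map _).cons a)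

theorem of_four_two_eq {e f : ℕ} (h : ThreeSingle v a ε (e :: f :: G)) (ha : a % 8 = 4)
    (he : e % 2 = 1) (hf : f % 4 = e % 4) (hG : Multiples 4 G) :
    TwoThreeExceptional (4 * v + 4) (a :: (e :: f :: G).map (3 * ·)) := by
  have hv := h.two_le
  have z := val_polygonal_zero (4 * v + 4) (G.map (3 * ·))
  have sw : ∀ {G : List ℕ}, ((3 * e) :: (3 * f) :: a :: G.map (3 * ·)).Perm
      (a :: (e :: f :: G).map (3 * ·)) := perm_rotate
  have L : ∀ N : ℕ, N % 4 = 3 * e % 4 ∨ (v % 2 = 0 ∧ N % 4 = 2) ∨ (v % 2 = 1 ∧ N % 4 = 0) →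
      Loc (4 * v + 4) 2 (a :: (e :: f :: G).map (3 * ·)) N := by
    intro N hN
    suffices Loc (4 * v + 4) 2 ((3 * e) :: (3 * f) :: a :: G.map (3 * ·)) N from
      this.perm sw
    rcases hN with hN | ⟨hv2, hN⟩ | ⟨hv2, hN⟩
    · exact Loc.two_odd (by omega) (by omega) (z.skip a) (by omega)
    · exact (Loc.even_four hv2 (a := 3 * e) (d := a) (by omega) ha (z.take (3 * f))
        (by omega)).perm ((List.Perm.swap _ _ _).cons _)
    · exact (Loc.odd_four hv2 (a := 3 * e) (d := a) (by omega) ha (z.skip (3 * f))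
        (by omega)).perm ((List.Perm.swap _ _ _).cons _)
  have S := fun (N : ℕ) (hN : N < 12)
      (hN' : N % 4 = e % 4 ∨ (v % 2 = 0 ∧ N % 4 = 2) ∨ (v % 2 = 1 ∧ N % 4 = 0)) =>
    (h.rep (N := N) (by omega) (L _ (by
      rcases h.nondeg with ⟨-, rfl⟩ | ⟨-, rfl⟩ <;> omega))).small₂ (by omega) hG (by omega)
  have h4 : Rep (4 * v + 4) G 4 := by
    rcases (by omega : v % 2 = 0 ∨ v % 2 = 1) with hv2 | hv2
    · obtain ⟨w2, -, h2, h2', h2''⟩ := S 2 (by simp) (by omega)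
      obtain ⟨rfl, rfl⟩ : e = 1 ∧ f = 1 := by omega
      obtain ⟨w, hw, h5, h5', h5''⟩ := S 5 (by simp) (by omega)
      obtain rfl : w = 4 := by omega
      exact hw
    · obtain ⟨w, hw, h5, h5', h5''⟩ := S 4 (by simp) (by omega)
      obtain rfl : w = 4 := by omega
      exact hw
  obtain ⟨x, t, ht, hx0, hx1, hx2, ht4⟩ := hG.pull (by omega) h4 (by simp)
  obtain rfl : x = 4 := by omega
  have hp : (e :: f :: G).Perm (e :: f :: 4 :: t) := (ht.cons f).cons e
  have L' : ∀ N : ℕ, N % 4 = 3 * e % 4 ∨ N % 2 = 0 →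
      Loc (4 * v + 4) 2 (a :: (e :: f :: 4 :: t).map (3 * ·)) N := by
    intro N hN
    by_cases hN' : N % 4 = 3 * e % 4 ∨ (v % 2 = 0 ∧ N % 4 = 2) ∨ (v % 2 = 1 ∧ N % 4 = 0)
    · exact (L N hN').perm ((hp.map _).cons a)
    · exact (loc_two_degenerate (a := 3 * e) (b := 3 * f) (d := a) (c := 12) (by omega) (by omega)
        ha (by simp) (t.map (3 * ·)) (by omega)).perm (sw (G := 4 :: t))
  obtain ⟨w2, -, h2, h2', h2''⟩ := ((h.perm hp).rep (N := 2) (by omega) (L' _ (by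
      rcases h.nondeg with ⟨-, rfl⟩ | ⟨-, rfl⟩ <;> omega))).small₂ (by omega) (hG.perm ht)
        (by omega)
  obtain ⟨rfl, rfl⟩ : e = 1 ∧ f = 1 := by omega
  exact ((h.perm hp).two_eq (by omega) ht4 fun N hN => L' N (by omega)).perm ((hp.map _).cons a)

/-! ### The coefficient prime to 3 is 2 modulo 4 -/

theorem two_one_false {e : ℕ} (h : ThreeSingle v a ε (e :: G)) (ha : a % 4 = 2)
    (he : e % 2 = 1) (hG : Multiples 8 G) : False := by
  have hv := h.two_le
  have z := val_polygonal_zero (4 * v + 4) (G.map (3 * ·))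
  have key : ∃ N : ℕ, N < 8 ∧ N ≠ 0 ∧ N % 8 ≠ e % 8 ∧
      Loc (4 * v + 4) 2 (a :: (e :: G).map (3 * ·)) ((3 * N + ε * a : ℕ) : ℤ) := by
    rcases (by omega : v % 2 = 0 ∨ v % 2 = 1) with hv2 | hv2 <;>
      rcases h.nondeg with ⟨-, rfl⟩ | ⟨-, rfl⟩
    · exact ⟨(e + 5 * a) % 8, by omega, by omega, by omega, (Loc.of_two_unit_even hv2
        (a := 3 * e) (by omega) (z.skip a) (by omega)).perm (.swap _ _ _)⟩
    · exact ⟨(e + 3 * a) % 8, by omega, by omega, by omega, (Loc.of_two_unit_even hv2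
        (a := 3 * e) (by omega) (z.take a) (by omega)).perm (.swap _ _ _)⟩
    · exact ⟨(5 * a) % 8, by omega, by omega, by omega, (Loc.of_two_unit_odd hv2
        (a := 3 * e) (by omega) (z.skip a) (by omega)).perm (.swap _ _ _)⟩
    · exact ⟨(3 * a) % 8, by omega, by omega, by omega, (Loc.of_two_unit_odd hv2
        (a := 3 * e) (by omega) (z.take a) (by omega)).perm (.swap _ _ _)⟩
  obtain ⟨N, hN8, hN0, hNe, hL⟩ := key
  obtain ⟨w, -, h1, h2, h3⟩ := (h.rep (by omega) hL).small (by omega) hG (by omega)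
  omega

theorem two_one_four_false {e f : ℕ} (h : ThreeSingle v a ε (e :: f :: G)) (ha : a % 4 = 2)
    (he : e % 2 = 1) (hf : f % 8 = 4) (hG : Multiples 8 G) : False := by
  have hv := h.two_le
  have S := fun (N : ℕ) (hN : N < 8)
      (hN' : (v % 2 = 0 ∧ N % 2 = 1) ∨ (v % 2 = 1 ∧ N % 2 = 0)) =>
    (h.rep (N := N) (by omega) ((loc_one_two_four (a := 3 * e) (b := a) (c := 3 * f) (by omega) ha
      (by omega) _ (by rcases h.nondeg with ⟨-, rfl⟩ | ⟨-, rfl⟩ <;> omega)).perm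
        (.swap _ _ _))).small₂ (by omega) hG (by omega)
  rcases (by omega : v % 2 = 0 ∨ v % 2 = 1) with hv2 | hv2
  · obtain ⟨w, -, h1, h2, h3⟩ := S 1 (by simp) (by omega)
    obtain ⟨w, -, h1, h2, h3⟩ := S 3 (by simp) (by omega)
    omega
  · obtain ⟨w, -, h1, h2, h3⟩ := S 2 (by simp) (by omega)
    omega

theorem two_one_two_false {e f : ℕ} (h : ThreeSingle v a ε (e :: f :: G)) (ha : a % 4 = 2)
    (he : e % 2 = 1) (hf : f % 4 = 2) (hG : Multiples 8 G) : False := by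
  have hv := h.two_le
  have z := val_polygonal_zero (4 * v + 4) (G.map (3 * ·))
  have S := fun (N : ℕ) (hN : N < 8)
      (hL : Loc (4 * v + 4) 2 (a :: (e :: f :: G).map (3 * ·)) ((3 * N + ε * a : ℕ) : ℤ)) =>
    (h.rep (by omega) hL).small₂ (by omega) hG (by omega)
  have L : ∀ N : ℕ, v % 2 = 0 → N % 4 = 2 →
      Loc (4 * v + 4) 2 (a :: (e :: f :: G).map (3 * ·)) N := fun N hv2 hN =>
    (loc_one_two_two (a := 3 * e) (b := a) (c := 3 * f) (by omega) ha (by omega) _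
      (by omega)).perm (.swap _ _ _)
  have L' : ∀ (N : ℕ) (w : ℤ), Val (polygonal (4 * v + 4)) (a :: (3 * f) :: G.map (3 * ·)) w →
      v % 2 = 1 → ((N : ℤ) - w) % 8 = 0 →
      Loc (4 * v + 4) 2 (a :: (e :: f :: G).map (3 * ·)) N := fun N w hw hv2 hN =>
    (Loc.of_two_unit_odd hv2 (a := 3 * e) (by omega) hw hN).perm (.swap _ _ _)
  rcases (by omega : v % 2 = 0 ∨ v % 2 = 1) with hv2 | hv2 <;>
    rcases h.nondeg with ⟨-, rfl⟩ | ⟨-, rfl⟩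
  · obtain ⟨w, -, h1, h2, h3⟩ := S 4 (by simp) (L _ hv2 (by omega))
    omega
  · obtain ⟨w, -, h1, h2, h3⟩ := S 2 (by simp) (L _ hv2 (by omega))
    obtain ⟨w, -, h1, h2, h3⟩ := S 6 (by simp) (L _ hv2 (by omega))
    omega
  · by_cases hfa : (3 * f + a) % 8 = 0
    · obtain ⟨w, -, h1, h2, h3⟩ := S 4 (by simp)
        (L' _ _ ((z.take (3 * f)).skip a) hv2 (by omega))
      omega
    · obtain ⟨w, -, h1, h2, h3⟩ := S (5 * a % 8) (by omega)
        (L' _ _ ((z.skip (3 * f)).skip a) hv2 (by omega))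
      omega
  · by_cases hfa : (3 * f + 7 * a) % 8 = 0
    · obtain ⟨w, -, h1, h2, h3⟩ := S 4 (by simp)
        (L' _ _ ((z.take (3 * f)).take a) hv2 (by omega))
      omega
    · obtain ⟨w, -, h1, h2, h3⟩ := S (3 * a % 8) (by omega)
        (L' _ _ ((z.skip (3 * f)).take a) hv2 (by omega))
      omega

theorem two_two_false {e f : ℕ} (h : ThreeSingle v a ε (e :: f :: G)) (ha : a % 4 = 2)
    (he : e % 2 = 1) (hf : f % 2 = 1) (hG : Multiples 8 G) : False := by
  have hv := h.two_le
  have S := fun (N : ℕ) (hN : N < 8) (hN' : N % 2 = 1) =>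
    (h.rep (N := N) (by omega) ((loc_two_two (a := 3 * e) (b := 3 * f) (c := a) (by omega)
      (by omega) ha _ (by rcases h.nondeg with ⟨-, rfl⟩ | ⟨-, rfl⟩ <;> omega)).perm
        perm_rotate)).small₂ (by omega) hG (by omega)
  obtain ⟨w, -, h1, h1', h1''⟩ := S 1 (by simp) rfl
  obtain ⟨w, -, h3, h3', h3''⟩ := S 3 (by simp) rfl
  obtain ⟨w, -, h5, h5', h5''⟩ := S 5 (by simp) rfl
  obtain rfl | rfl : e = 1 ∨ f = 1 := by omega
  · omega
  · omega

end ThreeSingle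

/-! ### The coefficient prime to 3 is odd -/

theorem Rep.single_odd_of_lt {m a : ℕ} (hm : m % 4 = 0) (hm' : 4 ≤ m) {t : List ℕ}
    (ht : Multiples 2 t) {N : ℤ} (h : Rep m (a :: t) N) (hN : N % 2 = 1)
    (hN' : N < a * (3 * m - 3)) : Rep m t (N - a) := by
  obtain ⟨x, w, hw, rfl⟩ := h
  have hw2 := (ht.rep (by omega) hw).1
  have hw0 := Rep.nonneg (by omega : 4 ≤ m) hw
  simp only at hN hN' ⊢
  rcases polygonal_cases (by omega : 4 ≤ m) x with ⟨-, h⟩ | ⟨-, h⟩ | ⟨rfl, h⟩ | ⟨-, h⟩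
  · rw [h] at hN; omega
  · rw [h]
    simpa [Rep] using hw
  · rw [h] at hN
    obtain ⟨q, rfl⟩ : ∃ q, m = 2 * q := ⟨m / 2, by omega⟩
    have : (a : ℤ) * ((2 * q : ℕ) : ℤ) = 2 * (a * q) := by push_cast; ring
    omega
  · have : (a : ℤ) * (3 * m - 3) ≤ a * polygonal m x :=
      mul_le_mul_of_nonneg_left (by omega) (Int.natCast_nonneg a)
    omega

theorem exists_congr_thirty_two (v : ℕ) (T r : ℤ) :
    ∃ N : ℕ, N < 96 ∧ (N : ℤ) % 3 = r % 3 ∧ ((2 * v + 1) * (N : ℤ) - T) % 32 = 0 := by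
  obtain ⟨e, he⟩ := (Int.even_mul_succ_self (v : ℤ)).two_dvd
  -- the seventh power is the inverse of an odd number modulo 32
  set X : ℤ := 33 * ((2 * v + 1) ^ 7 * T) + 64 * r with hX
  have h8 : (2 * (v : ℤ) + 1) ^ 8 = 1 + 32 * (e + 4 * e ^ 2 + 8 * (e + 4 * e ^ 2) ^ 2 - 0) := by
    have h2 : (2 * (v : ℤ) + 1) ^ 2 = 1 + 8 * e := by linear_combination 4 * he
    calc (2 * (v : ℤ) + 1) ^ 8 = ((2 * (v : ℤ) + 1) ^ 2) ^ 4 := by ring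
      _ = _ := by rw [h2]; ring
  have h1 : (2 * v + 1) * X - T =
      32 * (33 * (e + 4 * e ^ 2 + 8 * (e + 4 * e ^ 2) ^ 2) * T + T + 2 * r * (2 * v + 1)) := by
    rw [hX]
    linear_combination 33 * T * h8
  have hX3 : X = 3 * (11 * ((2 * v + 1) ^ 7 * T) + 21 * r) + r := by rw [hX]; ring
  obtain ⟨q, hq⟩ : ∃ q, X % 96 = X + 96 * q := ⟨-(X / 96), by omega⟩
  refine ⟨(X % 96).toNat, by omega, by omega, ?_⟩
  rw [Int.toNat_of_nonneg (by omega), hq]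
  have : (2 * v + 1) * (X + 96 * q) - T = ((2 * v + 1) * X - T) + 32 * (3 * q * (2 * v + 1)) := by
    ring
  omega

/-- Here the argument of `a` is chosen such that the derivative is 2 modulo 4. -/
theorem loc_one_of_thirty_two {v a N : ℕ} (ha : a % 2 = 1)
    (h : ((2 * v + 1) * (N : ℤ) - (4 - v ^ 2) * a) % 32 = 0) (t : List ℕ) :
    Loc (4 * v + 4) 2 (a :: t) N := by
  obtain ⟨q, hq⟩ := Int.dvd_of_emod_eq_zero h
  refine (Loc.of_qLoc_two (l := [a]) ?_).append t
  have h1 : QLoc 2 [a] (a + 8 * q) := QLoc.of_two_unit ha (w := 0) rfl (by omega)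
  convert h1.mul_sq using 1
  simp only [List.sum_cons, List.sum_nil]
  push_cast
  linear_combination hq

/-- If `m` is 4 modulo 12 and the coefficients except 1 are multiples of 6, the argument of 1 is
odd and prime to 3, hence equal to 1 or at least 5. -/
theorem Rep.single_one {m : ℕ} (hm : m % 12 = 4) (hm' : 28 ≤ m) {G : List ℕ} (hG : Multiples 2 G)
    {N : ℕ} (h : Rep m (1 :: G.map (3 * ·)) ((3 * N + 1 : ℕ) : ℤ)) (hN : N % 2 = 0)
    (hN' : N < 88) : Rep m G N := by
  obtain ⟨x, w, hw, e⟩ := h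
  have h6 : Multiples 6 (G.map (3 * ·)) := Multiples.map (d := 2) (e := 3) (by simp) hG
  have hd := (h6.rep (by omega) hw).1
  have hw0 := Rep.nonneg (by omega : 4 ≤ m) hw
  suffices hx : x = 1 by
    subst hx
    refine Val.unscale (d := 3) (by simp) ?_
    have h1 : polygonal m 1 = 1 := by
      have := two_mul_polygonal m 1
      linarith
    have hw3 : w = ((3 : ℕ) : ℤ) * N := by
      simp only [Nat.cast_one, h1] at e
      push_cast at e ⊢
      omega
    rwa [hw3] at hw
  push_cast at e hd
  have hx5 : x < 5 := by
    by_contra hx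
    have := polygonal_mono (by omega : 4 ≤ m) (show 5 ≤ x by omega)
    have h5 := polygonal_five m
    push_cast at this
    omega
  have h2 := polygonal_emod_two (by omega : m % 4 = 0) x
  have h3 := polygonal_three m
  have : x = 0 ∨ x = 1 ∨ x = 2 ∨ x = 3 ∨ x = 4 := by omega
  rcases this with rfl | rfl | rfl | rfl | rfl
  · omega
  · rfl
  · omega
  · push_cast at e
    omega
  · omega

theorem loc_one_degenerate_three {v a d : ℕ} (ha : a % 2 = 1) (hd0 : 0 < d) (hd : d ≤ 8) {c : ℕ}
    (hc : c = 4 ∧ d ≤ 3 ∨ c = 8) (t : List ℕ) {N : ℤ}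
    (hN : (v % 2 = 0 ∧ N % 4 = 0) ∨ (v % 2 = 1 ∧ (N - a) % 4 = 0)) :
    Loc (4 * v + 4) 2 (a :: (4 :: c :: (4 * d) :: t).map (3 * ·)) N := by
  have hN' : (v % 2 = 0 ∧ N % 4 = 0) ∨ (v % 2 = 1 ∧ (N - ([a] : List ℕ).sum) % 4 = 0) := by
    simpa using hN
  have e3 : 3 * (4 * d) = 4 * (3 * d) := by ring
  simp only [List.map, e3]
  rcases hc with ⟨rfl, hd3⟩ | rfl
  · refine (Loc.of_mul_four (l := [a]) (l' := [3, 3, 3 * d]) hN' fun M _ => ?_).append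
      (t.map (3 * ·))
    obtain h | rfl : d % 2 = 1 ∨ d = 2 := by omega
    · exact qLoc_odd4 ha rfl rfl (by omega) M
    · exact qLoc_odd3_two ha rfl rfl rfl M
  · refine (Loc.of_mul_four (l := [a]) (l' := [3, 6, 3 * d]) hN' fun M _ => ?_).append
      (t.map (3 * ·))
    obtain h | h | rfl | rfl : d % 2 = 1 ∨ d % 4 = 2 ∨ d = 4 ∨ d = 8 := by omega
    · exact (qLoc_odd3_two (a := a) (b := 3) (c := 3 * d) (d := 6) ha rfl (by omega) rfl M).perm
        (by simp only [List.cons_append, List.nil_append]; grind)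
    · exact qLoc_odd2_two2 ha rfl rfl (by omega) M
    · exact qLoc_odd2_two_four ha rfl rfl rfl M
    · exact qLoc_odd2_two_eight ha rfl rfl rfl M

/-- The multiples of 8 that represent 8, 16, 24 and 32. -/
theorem Multiples.exists_eight {m : ℕ} (hm : 12 ≤ m) {t : List ℕ} (ht : Multiples 8 t)
    (h8 : Rep m t 8) (h16 : Rep m t 16) (h24 : Rep m t 24) (h32 : Rep m t 32) :
    ∃ c d s, t.Perm (8 :: (8 * c) :: (8 * d) :: s) ∧ (c = 1 ∧ d ≤ 3 ∨ c = 2) ∧ 0 < d ∧ d ≤ 4 := by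
  have hm4 : 4 ≤ m := by omega
  obtain ⟨c, t1, h1, hc0, hc1, hc2, ht1⟩ := ht.pull hm4 h8 (by simp)
  obtain rfl : c = 8 := by omega
  have hc : ∃ c s, t1.Perm ((8 * c) :: s) ∧ (c = 1 ∨ c = 2) ∧ Multiples 8 s := by
    rcases (h16.perm h1).cons_cases hm4 (by omega) with h | h <;>
      obtain ⟨c, s, hs, hc0, hc1, ⟨d, rfl⟩, hs4⟩ := ht1.pull hm4 h (by simp) <;>
      exact ⟨d, s, hs, by push_cast at hc1; omega, hs4⟩
  obtain ⟨c, s, hs, hc, hs8⟩ := hc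
  have hp := h1.trans (hs.cons 8)
  have aux : ∀ N : ℤ, N < 8 * m → Rep m t N →
      Rep m s N ∨ Rep m s (N - 8 * c) ∨ Rep m s (N - 8) ∨ Rep m s (N - 8 - 8 * c) := by
    intro N hN h
    have hcm : (8 * m : ℤ) ≤ ((8 * c : ℕ) : ℤ) * m := by
      rcases hc with rfl | rfl <;> push_cast <;> omega
    rcases (h.perm hp).cons_cases hm4 (by omega) with h | h <;>
      rcases h.cons_cases hm4 (by push_cast at hcm ⊢; omega) with h | h <;> push_cast at h
    · exact Or.inl h
    · exact Or.inr (Or.inl h)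
    · exact Or.inr (Or.inr (Or.inl h))
    · exact Or.inr (Or.inr (Or.inr h))
  have fin : ∀ w : ℤ, Rep m s w → w ≠ 0 → w ≤ 32 → (c = 1 → w ≤ 24) →
      ∃ c d s, t.Perm (8 :: (8 * c) :: (8 * d) :: s) ∧ (c = 1 ∧ d ≤ 3 ∨ c = 2) ∧ 0 < d ∧ d ≤ 4 := by
    intro w hw hw0 hw32 hw24
    obtain ⟨e, u, hu, he0, he1, ⟨d, rfl⟩, hu4⟩ := hs8.pull hm4 hw hw0
    exact ⟨c, d, u, hp.trans ((hu.cons _).cons 8), by omega, by omega, by omega⟩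
  rcases hc with rfl | rfl
  · rcases aux 24 (by omega) h24 with h | h | h | h <;> exact fin _ h (by simp) (by simp)
      (by simp)
  · rcases aux 32 (by omega) h32 with h | h | h | h <;> exact fin _ h (by simp) (by simp)
      (by simp)

namespace ThreeSingle

variable {v a ε : ℕ} {G : List ℕ}

theorem odd_single_odd (h : ThreeSingle v a ε G) (ha : a % 2 = 1) (hG : Multiples 2 G) {N : ℕ}
    (hN : N % 2 = 1) (hN' : N < a * (12 * v + 9))
    (h2 : Loc (4 * v + 4) 2 (a :: G.map (3 * ·)) N)
    (h3 : Loc (4 * v + 4) 3 (a :: G.map (3 * ·)) N) :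
    N % 3 = a % 3 ∧ Rep (4 * v + 4) (G.map (3 * ·)) ((N : ℤ) - a) := by
  have h6 : Multiples 6 (G.map (3 * ·)) := Multiples.map (d := 2) (e := 3) (by simp) hG
  have h1 := Rep.single_odd_of_lt (by omega) (by omega) (h6.mono (by simp))
    (h.regular N h2 h3) (by omega) (by
      have : (N : ℤ) < a * (12 * v + 9) := by exact_mod_cast hN'
      push_cast
      linarith)
  have := (h6.rep (by omega) h1).1
  exact ⟨by omega, h1⟩

theorem odd_single_even (h : ThreeSingle v a ε G) (ha : a % 2 = 1) (hG : Multiples 2 G) {N : ℕ}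
    (hN : N % 2 = 0) (hN3 : N % 3 ≠ 0) (hN' : N < 33 * a) (hNa : N < a * (4 * v + 4))
    (h2 : Loc (4 * v + 4) 2 (a :: G.map (3 * ·)) N)
    (h3 : Loc (4 * v + 4) 3 (a :: G.map (3 * ·)) N) : False := by
  have hv := h.two_le
  have h6 : Multiples 6 (G.map (3 * ·)) := Multiples.map (d := 2) (e := 3) (by simp) hG
  rcases Rep.single_even (by omega) (by omega) (h6.mono (by simp)) ha
    (h.regular N h2 h3) (by omega) (by omega) with h1 | h1
  · have := (h6.rep (by omega) h1).1
    omega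
  · have h0 := h1.nonneg (by omega)
    have : (N : ℤ) < a * ((4 * v + 4 : ℕ) : ℤ) := by exact_mod_cast hNa
    omega

/-- The only odd coefficient is also the only one prime to 3. -/
theorem odd_single_eq (h : ThreeSingle v a ε G) (ha : a % 2 = 1) (hG : Multiples 2 G) :
    v % 2 = 0 ∧ ε = 1 ∧ a = 1 ∧ 6 ≤ v ∧ (4 * v + 4) % 12 = 4 := by
  have hv := h.two_le
  have ha0 := h.pos
  have ha3 := h.not_dvd
  have hG' := h.regular
  have z := val_polygonal_zero (4 * v + 4) (G.map (3 * ·))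
  rcases (by omega : v % 2 = 0 ∨ v % 2 = 1) with hv2 | hv2 <;>
    rcases h.nondeg with ⟨h3, rfl⟩ | ⟨h3, rfl⟩
  · refine ⟨hv2, rfl, ?_, by omega, by omega⟩
    by_contra ha1
    obtain ⟨N, hN96, hN3, hN⟩ := exists_congr_thirty_two v ((4 - v ^ 2) * a) a
    have hNe : N % 2 = 0 := by
      obtain ⟨j, rfl⟩ : ∃ j, v = 2 * j := ⟨v / 2, by omega⟩
      have : (2 * ((2 * j : ℕ) : ℤ) + 1) * (N : ℤ) - (4 - ((2 * j : ℕ) : ℤ) ^ 2) * a =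
        2 * (2 * j * N - (2 - 2 * j ^ 2) * a) + N := by push_cast; ring
      omega
    have ha28 : 5 * 28 ≤ a * (4 * v + 4) := Nat.mul_le_mul (by omega) (by omega)
    exact h.odd_single_even ha hG hNe (by omega) (by omega) (by omega)
      (loc_one_of_thirty_two ha hN _) (Loc.three_one h3 ha3 z (by omega))
  · exfalso
    have hN' : 1 * 33 ≤ a * (12 * v + 9) := Nat.mul_le_mul (by omega) (by omega)
    have := (h.odd_single_odd ha hG (N := 9 * a % 24) (by omega) (by omega)
      (Loc.of_two_unit_even hv2 ha z (by omega)) (Loc.three_zero h3 ha3 z (by omega))).1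
    omega
  · exfalso
    have L : ∀ N : ℕ, ∀ w, Val (polygonal (4 * v + 4)) (G.map (3 * ·)) w →
        ((N : ℤ) - w) % 8 = 0 → Loc (4 * v + 4) 2 (a :: G.map (3 * ·)) N :=
      fun N w hw hN => Loc.of_two_unit_odd hv2 ha hw hN
    have L3 : ∀ N : ℕ, N % 3 = a % 3 → Loc (4 * v + 4) 3 (a :: G.map (3 * ·)) N :=
      fun N hN => Loc.three_one h3 ha3 z (by omega)
    by_cases h16 : a = 1 ∧ v = 3
    · obtain ⟨rfl, rfl⟩ := h16
      -- here 13 is the value at -1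
      have h13 := (h.odd_single_odd ha hG (N := 13) (by simp) (by simp)
        (Loc.of_val ⟨-1, 0, z, by norm_num [polygonal]⟩) (L3 _ rfl)).2
      exact h.odd_single_even ha hG (N := 4) rfl (by simp) (by simp) (by simp)
        (L 4 12 (Rep.val (by simpa using h13)) (by simp)) (L3 _ rfl)
    · have hb : 16 * a % 24 < a * (4 * v + 4) := by
        by_cases ha1 : a = 1
        · subst ha1; omega
        · have : 2 * 16 ≤ a * (4 * v + 4) := Nat.mul_le_mul (by omega) (by omega)
          omega
      exact h.odd_single_even ha hG (N := 16 * a % 24) (by omega) (by omega) (by omega) hb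
        (L _ 0 z (by omega)) (L3 _ (by omega))
  · exfalso
    have key : ∀ N : ℕ, N < 96 → N < a * (12 * v + 9) → (N : ℤ) % 3 = 0 →
        ((2 * v + 1) * (N : ℤ) - (4 - v ^ 2) * a) % 32 = 0 → False := by
      intro N hN96 hNb hN3 hN
      have hNo : N % 2 = 1 := by
        obtain ⟨j, rfl⟩ : ∃ j, v = 2 * j + 1 := ⟨v / 2, by omega⟩
        have : (2 * ((2 * j + 1 : ℕ) : ℤ) + 1) * (N : ℤ) - (4 - ((2 * j + 1 : ℕ) : ℤ) ^ 2) * a =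
          2 * ((2 * j + 1) * N - (1 - 2 * j - 2 * j ^ 2) * a) + N - a := by push_cast; ring
        omega
      have := (h.odd_single_odd ha hG hNo hNb (loc_one_of_thirty_two ha hN _)
        (Loc.three_zero h3 ha3 z (by omega))).1
      omega
    obtain ⟨N, hN96, hN3, hN⟩ := exists_congr_thirty_two v ((4 - v ^ 2) * a) 0
    by_cases ha1 : a = 1
    · subst ha1
      by_cases hv5 : v = 5
      · subst hv5
        exact key 33 (by simp) (by simp) (by simp) (by simp)
      · exact key N hN96 (by omega) hN3 hN
    · have : 5 * 33 ≤ a * (12 * v + 9) := Nat.mul_le_mul (by omega) (by omega)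
      exact key N hN96 (by omega) hN3 hN

theorem odd_single_false (h : ThreeSingle v a ε G) (ha : a % 2 = 1) (hG : Multiples 4 G ∨
    ∃ f s, G.Perm (f :: s) ∧ f % 4 = 2 ∧ (Multiples 8 s ∨
      ∃ g u, s.Perm (g :: u) ∧ (g % 4 = 2 ∨ g % 8 = 4) ∧ Multiples 8 u)) : False := by
  have hG2 : Multiples 2 G := by
    rcases hG with hG | ⟨f, s, hs, hf, hs8 | ⟨g, u, hu, hg, hu8⟩⟩
    · exact hG.mono (by simp)
    · exact Multiples.perm (.cons (by omega) (hs8.mono (by simp))) hs.symm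
    · exact Multiples.perm (.cons (by omega) (.cons (by omega)
        (hu8.mono (by simp)))) (hs.trans (hu.cons f)).symm
  obtain ⟨hv2, rfl, rfl, hv6, hm12⟩ := h.odd_single_eq ha hG2
  have hm4 : 4 ≤ 4 * v + 4 := by omega
  have z := val_polygonal_zero (4 * v + 4) (G.map (3 * ·))
  rcases h.nondeg with ⟨hm3, -⟩ | ⟨-, h0⟩
  swap
  · omega
  have L3 : ∀ N : ℕ, N % 3 = 1 → Loc (4 * v + 4) 3 (1 :: G.map (3 * ·)) N := fun N hN =>
    Loc.three_one hm3 (by simp) z (by omega)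
  have R : ∀ N : ℕ, N % 2 = 0 → N < 88 →
      Loc (4 * v + 4) 2 (1 :: G.map (3 * ·)) ((3 * N + 1 : ℕ) : ℤ) → Rep (4 * v + 4) G N :=
    fun N hN hN' hL => (h.regular _ hL (L3 _ (by omega))).single_one hm12 (by omega) hG2 hN hN'
  have R8 : ∀ i : ℕ, i ≤ 4 → Rep (4 * v + 4) G ((8 * i : ℕ) : ℤ) := fun i hi =>
    R _ (by omega) (by omega) (Loc.of_two_unit_even hv2 rfl z (by omega))
  have no : ∀ N : ℕ, N = 4 ∨ N = 10 → ¬ Loc (4 * v + 4) 2 (1 :: G.map (3 * ·)) N :=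
    fun N hN hL => h.odd_single_even ha hG2 (N := N) (by omega) (by omega) (by omega) (by omega) hL
      (L3 _ (by omega))
  rcases hG with hG | ⟨f, s, hs, hf, hs8 | ⟨g, u, hu, hg | hg, hu8⟩⟩
  · by_cases h4 : ∃ c ∈ G, c % 8 = 4
    · obtain ⟨c, hc, hc8⟩ := h4
      have hp := List.perm_cons_erase hc
      have L : ∀ N : ℕ, N % 4 = 1 → Loc (4 * v + 4) 2 (1 :: G.map (3 * ·)) N := fun N hN =>
        (Loc.even_four hv2 (a := 1) (d := 3 * c) rfl (by omega)
          (val_polygonal_zero (4 * v + 4) ((G.erase c).map (3 * ·))) (by omega)).perm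
          ((hp.symm.map _).cons 1)
      obtain ⟨c, d, s, hs, hc, hd0, hd, -⟩ := hG.exists_four_eight (m := 4 * v + 4) (by omega)
        (by simpa using R 4 rfl (by simp) (L _ rfl)) (by simpa using R 8 rfl (by simp) (L _ rfl))
        (by simpa using R 12 rfl (by simp) (L _ rfl))
        (Or.inl (by simpa using R 16 rfl (by simp) (L _ rfl)))
      exact no 4 (Or.inl rfl) ((loc_one_degenerate_three rfl hd0 hd hc s (by omega)).perm
        ((hs.symm.map _).cons 1))
    · push Not at h4
      have hG8 : Multiples 8 G := fun c hc => by
        have h1 := hG c hc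
        have h2 := h4 c hc
        exact ⟨h1.1, by omega⟩
      obtain ⟨c, d, s, hs, hc, hd0, hd⟩ := hG8.exists_eight (m := 4 * v + 4) (by omega)
        (by simpa using R8 1 (by simp)) (by simpa using R8 2 (by simp))
        (by simpa using R8 3 (by simp)) (by simpa using R8 4 (by simp))
      refine no 4 (Or.inl rfl) (Loc.perm ((hs.symm.map _).cons 1) ?_)
      have h1 := (Loc.of_mul_four (v := v) (N := (4 : ℕ)) (l := [1]) (l' := [6, 6 * c, 6 * d])
        (by omega) (fun M _ => by
          rcases hc with ⟨rfl, hd3⟩ | rfl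
          · obtain hd | rfl : d % 2 = 1 ∨ d = 2 := by omega
            · exact qLoc_odd_two3 rfl rfl rfl (by omega) M
            · exact qLoc_odd_two2_four rfl rfl rfl rfl M
          · obtain hd | rfl | rfl : d % 2 = 1 ∨ d = 2 ∨ d = 4 := by omega
            · exact (qLoc_odd_two2_four (a := 1) (b := 6) (c := 6 * d) (d := 12) rfl rfl (by omega)
                rfl M).perm (((List.Perm.swap 12 _ []).cons 6).cons 1)
            · exact qLoc_odd_two_four2 rfl rfl rfl rfl M
            · exact qLoc_odd_two_four_eight rfl rfl rfl rfl M)).append (s.map (3 * ·))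
      have e1 : ∀ c, 4 * (6 * c) = 3 * (8 * c) := fun c => by ring
      simpa [e1] using h1
  · have h8 : Rep (4 * v + 4) (f :: s) ((8 : ℕ) : ℤ) := (R8 1 (by simp)).perm hs
    obtain ⟨w, hw, hw0, hd, e⟩ := h8.small hm4 hs8 (by omega)
    obtain rfl : w = 8 := by omega
    obtain ⟨x, t, ht, hx0, hx1, hx2, -⟩ := hs8.pull hm4 hw (by simp)
    obtain rfl : x = 8 := by omega
    refine no 10 (Or.inr rfl) (Loc.perm (((hs.trans (ht.cons f)).symm.map _).cons 1) ?_)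
    refine (Loc.of_qLoc_two (l := [1, 3 * f, 24])
      (QLoc.odd_two_eight_of_two rfl (by omega) rfl ?_)).append (t.map (3 * ·))
    have h1 := completed_emod_four v ((10 : ℕ) : ℤ) ([1, 3 * f, 24] : List ℕ).sum
    have h2 : (([1, 3 * f, 24] : List ℕ).sum : ℤ) = 1 + 3 * f + 24 := by simp [add_assoc]
    omega
  · refine no 10 (Or.inr rfl) (Loc.perm (((hs.trans (hu.cons f)).symm.map _).cons 1) ?_)
    exact loc_one_two_two (a := 1) (b := 3 * f) (c := 3 * g) rfl (by omega) (by omega) _ (by omega)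
  · have hp := hs.trans (hu.cons f)
    have S : ∀ N : ℕ, N % 2 = 0 → N < 28 → ∃ w, Rep (4 * v + 4) u w ∧ 0 ≤ w ∧ ((8 : ℕ) : ℤ) ∣ w ∧
        ((N : ℤ) = w ∨ (N : ℤ) = w + f ∨ (N : ℤ) = w + g ∨ (N : ℤ) = w + f + g) := fun N hN hN' =>
      ((R N hN (by omega) ((loc_one_two_four (a := 1) (b := 3 * f) (c := 3 * g) rfl (by omega)
        (by omega) _ (by omega)).perm ((hp.symm.map _).cons 1))).perm hp).small₂ hm4 hu8
          (by omega)
    obtain ⟨w, -, h1, h2, h3⟩ := S 2 rfl (by simp)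
    obtain rfl : f = 2 := by push_cast at h2 h3; omega
    obtain ⟨w, -, h1, h2, h3⟩ := S 4 rfl (by simp)
    obtain rfl : g = 4 := by push_cast at h2 h3; omega
    obtain ⟨w, hw, h1, h2, h3⟩ := S 8 rfl (by simp)
    obtain rfl : w = 8 := by push_cast at h2 h3; omega
    obtain ⟨x, t, ht, hx0, hx1, hx2, -⟩ := hu8.pull hm4 hw (by simp)
    obtain rfl : x = 8 := by omega
    exact h.bad fun N => (loc_all_of_qLoc_two (l := [1, 6, 12, 24])
      (qLoc_odd_two_four_eight rfl rfl rfl rfl) (t.map (3 * ·)) (.refl _) N).perm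
      (((hp.trans ((ht.cons 4).cons 2)).symm.map _).cons 1)

end ThreeSingle

namespace ThreeSingle

variable {v a ε : ℕ} {G : List ℕ}

theorem odd_two_two_false {e f : ℕ} (h : ThreeSingle v a ε (e :: f :: G)) (ha : a % 2 = 1)
    (he : e % 2 = 1) (hf : f % 4 = 2) (hG : Multiples 8 G) : False := by
  have hv := h.two_le
  have ha0 := h.pos
  have ha3 := h.not_dvd
  have L : ∀ N : ℕ, N % 2 = 1 →
      Loc (4 * v + 4) 2 (a :: (e :: f :: G).map (3 * ·)) N := fun N hN =>
    loc_two_two (a := a) (b := 3 * e) (c := 3 * f) (by omega) (by omega) (by omega) _ (by omega)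
  rcases h.nondeg with ⟨h3, rfl⟩ | ⟨h3, rfl⟩
  · have : a * 16 ≤ a * (4 * v + 4) := Nat.mul_le_mul le_rfl (by omega)
    obtain ⟨w, -, h1, h2, h3⟩ := (h.descends 4 (by omega) (L _ (by omega))).small₂ (by omega) hG
      (by omega)
    omega
  · obtain ⟨w, -, h1, h2, h3⟩ := (h.rep (N := 1) (by omega) (L _ (by omega))).small₂ (by omega) hG
      (by omega)
    obtain ⟨w, -, h1', h2', h3'⟩ := (h.rep (N := 3) (by omega) (L _ (by omega))).small₂ (by omega) hG
      (by omega)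
    obtain ⟨rfl, rfl⟩ : e = 1 ∧ f = 2 := by push_cast at h2 h3 h2' h3'; omega
    by_cases hv2 : a = 1 ∧ v = 2
    · obtain ⟨rfl, rfl⟩ := hv2
      -- 27 requires a coefficient 24
      have h27 : Rep 12 (1 :: (1 :: 2 :: G).map (3 * ·)) ((27 : ℕ) : ℤ) :=
        h.regular 27 (L _ rfl) (Loc.three_zero rfl ha3 (val_polygonal_zero _ _) (by simp))
      have h24 : Multiples 24 (G.map (3 * ·)) :=
        Multiples.map (d := 8) (e := 3) (by simp) hG
      have key : ∀ w : ℤ, Rep 12 (G.map (3 * ·)) w → w < 28 →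
          (24 : ℤ) ∣ w ∧ w ≠ 24 ∧ 0 ≤ w := by
        intro w hw hw28
        refine ⟨(h24.rep (by simp) hw).1, ?_, hw.nonneg (by simp)⟩
        rintro rfl
        obtain ⟨x, t, ht, hx0, hx1, hx2, -⟩ := h24.pull (by simp) hw (by simp)
        obtain rfl : x = 24 := by omega
        exact h.bad fun N => (loc_all_of_qLoc_two (l := [1, 3, 6, 24])
          (qLoc_odd2_two_eight rfl rfl rfl rfl) t (.refl _) N).perm
          (((ht.symm.cons 6).cons 3).cons 1)
      obtain ⟨x, w, hw, e⟩ := h27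
      have hw' : 0 ≤ w := Rep.nonneg (m := 12) (by simp) hw
      rcases polygonal_cases (by norm_num : 4 ≤ 12) x with ⟨-, h⟩ | ⟨-, h⟩ | ⟨-, h⟩ | ⟨-, h⟩ <;>
        simp only [h] at e
      rotate_left 3
      · omega
      all_goals
        rcases Rep.cons_cases (m := 12) (c := 3) (by simp) hw (by omega) with h | h <;>
        rcases Rep.cons_cases (m := 12) (c := 6) (by simp) h (by omega) with h | h <;>
        have := key _ h (by omega) <;> omega
    · have hb : 3 * 5 < a * (4 * v + 4) := by
        by_cases ha1 : a = 1
        · subst ha1; omega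
        · have : 2 * 12 ≤ a * (4 * v + 4) := Nat.mul_le_mul (by omega) (by omega)
          omega
      obtain ⟨w, -, h1, h2, h3⟩ := (h.descends 5 (by omega) (L _ (by omega))).small₂ (by omega) hG
        (by omega)
      omega

theorem odd_two_ne_false {e : ℕ} (h : ThreeSingle v a ε (e :: G)) (ha : a % 2 = 1)
    (he : e % 2 = 1) (hae : a % 4 ≠ 3 * e % 4) (hG : Multiples 4 G) : False := by
  have hv := h.two_le
  have ha0 := h.pos
  have z := val_polygonal_zero (4 * v + 4) (G.map (3 * ·))
  have L : ∀ N : ℕ, N % 2 = 1 → Loc (4 * v + 4) 2 (a :: (e :: G).map (3 * ·)) N := by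
    intro N hN
    by_cases h : ((N : ℤ) - a) % 4 = 0
    · exact Loc.two_odd (b := 3 * e) ha (by omega) z (by omega)
    · exact (Loc.two_odd (a := 3 * e) (b := a) (by omega) ha z (by omega)).perm (.swap _ _ _)
  have S : ∀ N : ℕ, N < 4 → (N + ε) % 2 = 1 → ∃ w, Rep (4 * v + 4) G w ∧ 0 ≤ w ∧ ((4 : ℕ) : ℤ) ∣ w ∧
      ((N : ℤ) = w ∨ (N : ℤ) = w + e) := fun N hN hN' =>
    (h.rep (by omega) (L _ (by rcases h.nondeg with ⟨-, rfl⟩ | ⟨-, rfl⟩ <;> omega))).small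
      (by omega) hG (by omega)
  rcases h.nondeg with ⟨-, rfl⟩ | ⟨-, rfl⟩
  · obtain ⟨w, -, h1, h2, h3⟩ := S 2 (by simp) rfl
    omega
  · obtain ⟨w, -, h1, h2, h3⟩ := S 1 (by simp) rfl
    obtain ⟨w, -, h1', h2', h3'⟩ := S 3 (by simp) rfl
    omega

theorem odd_two_eq_one_false {e : ℕ} (h : ThreeSingle v a 1 (e :: G)) (ha : a % 2 = 1)
    (he : e % 2 = 1) (hae : a % 4 = 3 * e % 4) (hG : Multiples 4 G) : False := by
  have hv := h.two_le
  have ha0 := h.pos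
  have ha3 := h.not_dvd
  rcases h.nondeg with ⟨hm3, -⟩ | ⟨-, h0⟩
  swap
  · omega
  have z := val_polygonal_zero (4 * v + 4) (G.map (3 * ·))
  have L : ∀ N : ℕ, N % 4 = a % 4 → Loc (4 * v + 4) 2 (a :: (e :: G).map (3 * ·)) N :=
    fun N hN => Loc.two_odd (b := 3 * e) ha (by omega) z (by omega)
  have hb : a * 16 ≤ a * (4 * v + 4) := Nat.mul_le_mul le_rfl (by omega)
  have h4 : Rep (4 * v + 4) G 4 := by
    obtain ⟨w, hw, h1, h2, h3⟩ := (h.descends 4 (by omega) (L _ (by omega))).small (by omega) hG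
      (by omega)
    obtain rfl : w = 4 := by omega
    exact hw
  obtain ⟨x, t, ht, hx0, hx1, hx2, ht4⟩ := hG.pull (by omega) h4 (by simp)
  obtain rfl : x = 4 := by omega
  have hp : (e :: G).Perm (e :: 4 :: t) := ht.cons e
  have h' := h.perm hp
  have h12 : Multiples 12 ((4 :: t).map (3 * ·)) := Multiples.map_three fun x hx => by
    rcases List.mem_cons.1 hx with rfl | hx
    · norm_num
    · exact ht4 x hx
  set N : ℕ := if a % 3 = 1 then 4 else 8 with hN
  suffices hL : Loc (4 * v + 4) 2 (a :: (e :: 4 :: t).map (3 * ·)) N by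
    obtain ⟨w, -, h1, h2, h3⟩ := (h'.regular N hL (Loc.three_one hm3 ha3 (val_polygonal_zero _ _)
      (by split_ifs at hN <;> omega))).small₂ (by omega) h12 (by split_ifs at hN <;> omega)
    push_cast at h2 h3
    split_ifs at hN <;> omega
  rcases (by omega : v % 2 = 0 ∨ v % 2 = 1) with hv2 | hv2
  · have hb : a * 28 ≤ a * (4 * v + 4) := Nat.mul_le_mul le_rfl (by omega)
    have h8 : ∃ w, Rep (4 * v + 4) t w ∧ (w = 4 ∨ w = 8) := by
      obtain ⟨w, hw, h1, h2, h3⟩ := ((h.descends 8 (by omega) (L _ (by omega))).perm hp).small₂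
        (by omega) ht4 (by omega)
      exact ⟨w, hw, by omega⟩
    obtain ⟨w, hw, hw48⟩ := h8
    obtain ⟨c, s, hs, hc0, hc1, hc2, -⟩ := ht4.pull (by omega) hw (by omega)
    refine (loc_two_degenerate (a := a) (b := 3 * e) (d := 12) (c := 3 * c) ha (by omega) rfl
      (by omega) (s.map (3 * ·)) (by split_ifs at hN <;> omega)).perm ?_
    exact (((hs.symm.map (3 * ·)).cons 12).cons (3 * e)).cons a
  · exact (Loc.odd_four hv2 (a := a) (d := 12) ha rfl
      ((val_polygonal_zero (4 * v + 4) (t.map (3 * ·))).skip (3 * e))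
      (by split_ifs at hN <;> omega)).perm ((List.Perm.swap _ _ _).cons a)

theorem odd_two_eq_zero_false {e : ℕ} (h : ThreeSingle v a 0 (e :: G)) (ha : a % 2 = 1)
    (he : e % 2 = 1) (hae : a % 4 = 3 * e % 4) (hG : Multiples 4 G) : False := by
  have hv := h.two_le
  have ha0 := h.pos
  have ha3 := h.not_dvd
  rcases h.nondeg with ⟨-, h0⟩ | ⟨hm3, -⟩
  · omega
  have z := val_polygonal_zero (4 * v + 4) (G.map (3 * ·))
  -- the argument of `a` has to be 0 or 2 here
  have no : ∀ N : ℕ, N % 4 = 2 → N < 16 → N < 4 * v + 4 →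
      ¬ Loc (4 * v + 4) 2 (a :: (e :: G).map (3 * ·)) ((3 * N : ℕ) : ℤ) := by
    intro N hN hN16 hNm hL
    have hR := h.regular _ hL (Loc.three_zero hm3 ha3 (val_polygonal_zero _ _) (by omega))
    have key : ∀ M : ℤ, M % 4 = 2 → M < 4 * v + 4 →
        ¬ Rep (4 * v + 4) ((e :: G).map (3 * ·)) (3 * M) := by
      intro M hM hMm hR
      obtain ⟨w, -, h1, h2, h3⟩ := (Rep.small (m := 4 * v + 4) (by omega) hG
        (Val.unscale (d := 3) (by simp) hR) (by omega))
      omega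
    have hd : ∀ w : ℤ, Rep (4 * v + 4) ((e :: G).map (3 * ·)) w → (3 : ℤ) ∣ w :=
      fun w hw => Val.dvd (d := 3)
        (fun c hc => by obtain ⟨b, -, rfl⟩ := List.mem_map.1 hc; exact ⟨b, rfl⟩) hw
    obtain ⟨x, w, hw, e⟩ := hR
    have hd' := hd w hw
    have hw0 := Rep.nonneg (by omega : 4 ≤ 4 * v + 4) hw
    obtain ⟨j, hj⟩ : ∃ j, 4 * v + 4 = 12 * j := ⟨(v + 1) / 3, by omega⟩
    rcases polygonal_cases (by omega : 4 ≤ 4 * v + 4) x with ⟨-, h⟩ | ⟨-, h⟩ | ⟨-, h⟩ | ⟨-, h⟩ <;>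
      simp only [h] at e
    · refine key N (by omega) (by omega) ?_
      have : w = 3 * N := by push_cast at e; omega
      rwa [this] at hw
    · push_cast at e
      omega
    · refine key (N - 4 * (a * j)) (by omega) (by
        have : (0 : ℤ) ≤ a * j := by positivity
        omega) ?_
      have : w = 3 * (N - 4 * (a * j)) := by
        rw [hj] at e
        push_cast at e
        linarith
      rwa [this] at hw
    · have h5 : (a : ℤ) * (3 * ((4 * v + 4 : ℕ) : ℤ) - 3) ≤ a * polygonal (4 * v + 4) x :=
        mul_le_mul_of_nonneg_left h (Int.natCast_nonneg a)
      have h6 : (1 : ℤ) * (3 * ((4 * v + 4 : ℕ) : ℤ) - 3) ≤ a * (3 * ((4 * v + 4 : ℕ) : ℤ) - 3) :=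
        mul_le_mul_of_nonneg_right (by omega) (by omega)
      by_cases hv2 : v = 2
      · subst hv2
        omega
      · push_cast at e h5 h6
        omega
  rcases (by omega : v % 2 = 0 ∨ v % 2 = 1) with hv2 | hv2
  · refine no (if (a + 3 * e) % 8 = 6 then 2 else 6) (by split_ifs <;> rfl) (by split_ifs <;> omega)
      (by split_ifs <;> omega) ?_
    exact Loc.of_two_unit_even hv2 ha (z.take (3 * e)) (by split_ifs <;> push_cast <;> omega)
  · obtain ⟨N, hN96, hN3, hN⟩ := exists_congr_thirty_two v (4 * a - v ^ 2 * (a + 3 * e)) 0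
    obtain ⟨i, rfl⟩ : ∃ i, v = 2 * i + 1 := ⟨v / 2, by omega⟩
    have h0 : (2 * ((2 * i + 1 : ℕ) : ℤ) + 1) * (N : ℤ) -
        (4 * a - ((2 * i + 1 : ℕ) : ℤ) ^ 2 * (a + 3 * e)) =
        4 * (i * N - a + (i ^ 2 + i) * (a + 3 * e)) + (3 * N + (a + 3 * e)) := by push_cast; ring
    have hN2 : N % 4 = 2 := by omega
    refine no (N % 48 / 3) (by omega) (by omega) (by omega) ?_
    obtain ⟨q, hq⟩ := Int.dvd_of_emod_eq_zero hN
    obtain ⟨r, hr⟩ : ∃ r : ℤ, ((3 * (N % 48 / 3) : ℕ) : ℤ) = N - 48 * r := ⟨(N / 48 : ℕ), by omega⟩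
    refine (Loc.of_mul_four (v := 2 * i + 1) (l := [a, 3 * e]) (l' := []) (by
      simp only [List.sum_cons, List.sum_nil]
      omega) fun M hM => ?_).append (G.map (3 * ·))
    refine QLoc.of_two_odd ha (by omega) (w := 0) rfl ?_
    have : 4 * (M - 0 - a) = 4 * (4 * (2 * q - 3 * r * (4 * i + 3))) := by
      rw [mul_sub, mul_sub, hM, hr]
      simp only [List.map_nil, List.append_nil, List.sum_cons, List.sum_nil]
      push_cast at hq ⊢
      linear_combination hq
    omega

theorem odd_three_false {e f : ℕ} (h : ThreeSingle v a ε (e :: f :: G)) (ha : a % 2 = 1)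
    (he : 3 * e % 4 = a % 4) (hf : 3 * f % 4 = a % 4) (hG : Multiples 8 G) : False := by
  have hv := h.two_le
  have ha0 := h.pos
  have ha3 := h.not_dvd
  have z := val_polygonal_zero (4 * v + 4) (G.map (3 * ·))
  have L : ∀ N : ℕ, N % 4 = a % 4 ∨ N % 4 = 2 →
      Loc (4 * v + 4) 2 (a :: (e :: f :: G).map (3 * ·)) N := by
    rintro N (hN | hN)
    · exact Loc.two_odd (b := 3 * e) ha (by omega) (z.skip (3 * f)) (by omega)
    · exact Loc.two_odd (b := 3 * e) ha (by omega) (z.take (3 * f)) (by omega)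
  rcases h.nondeg with ⟨h3, rfl⟩ | ⟨h3, rfl⟩
  · have : a * 16 ≤ a * (4 * v + 4) := Nat.mul_le_mul le_rfl (by omega)
    obtain ⟨w, -, h1, h2, h3⟩ := (h.descends 4 (by omega) (L _ (by omega))).small₂ (by omega) hG
      (by omega)
    omega
  · obtain ⟨w, -, h1, h2, h3⟩ := (h.rep (N := 2) (by omega) (L _ (by omega))).small₂ (by omega) hG
      (by omega)
    obtain ⟨rfl, rfl⟩ : e = 1 ∧ f = 1 := by push_cast at h2 h3; omega
    obtain ⟨w, -, h1', h2', h3'⟩ := (h.rep (N := 5) (by omega) (L _ (by omega))).small₂ (by omega)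
      hG (by omega)
    omega

end ThreeSingle

theorem map_perm_cons_cons {d o p : ℕ} {G u : List ℕ}
    (h : (G.map (fun c => d * c)).Perm (o :: p :: u)) :
    ∃ e f G', G.Perm (e :: f :: G') ∧ o = d * e ∧ p = d * f ∧ u.Perm (G'.map (fun c => d * c)) := by
  obtain ⟨e, G', hp, he, hu⟩ := map_perm_cons h
  obtain ⟨f, G'', hp', hf, hu'⟩ := map_perm_cons hu.symm
  exact ⟨e, f, G'', hp.trans (hp'.cons e), he, hf, hu'⟩

theorem Multiples.of_perm_map {d : ℕ} {G t : List ℕ} (ht : Multiples d t) (hd : d.Coprime 3)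
    (hp : t.Perm (G.map (3 * ·))) : Multiples d G := Multiples.of_map hd (ht.perm hp)

namespace ThreeSingle

variable {v a ε : ℕ} {G : List ℕ}

theorem odd_false (h : ThreeSingle v a ε G) (ha : a % 2 = 1)
    (hs : TwoShape (a :: G.map (3 * ·))) : False := by
  have two : ∀ {b : ℕ} {t : List ℕ}, b % 2 = 1 → Multiples 4 t →
      (G.map (3 * ·)).Perm (b :: t) → False := by
    intro b t hb ht hG
    obtain ⟨e, G', hp, rfl, hG'⟩ := map_perm_cons hG
    have h4 := ht.of_perm_map (by decide) hG'
    by_cases hae : a % 4 = 3 * e % 4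
    · rcases h.nondeg with ⟨-, rfl⟩ | ⟨-, rfl⟩
      · exact (h.perm hp).odd_two_eq_one_false ha (by omega) hae h4
      · exact (h.perm hp).odd_two_eq_zero_false ha (by omega) hae h4
    · exact (h.perm hp).odd_two_ne_false ha (by omega) hae h4
  have two_two : ∀ {b c : ℕ} {t : List ℕ}, b % 2 = 1 → c % 4 = 2 → Multiples 8 t →
      (G.map (3 * ·)).Perm (b :: c :: t) → False := by
    intro b c t hb hc ht hG
    obtain ⟨e, f, G', hp, rfl, rfl, hG'⟩ := map_perm_cons_cons hG
    exact (h.perm hp).odd_two_two_false ha (by omega) (by omega) (ht.of_perm_map (by decide) hG')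
  have three : ∀ {b c : ℕ} {t : List ℕ}, b % 4 = a % 4 → c % 4 = a % 4 → Multiples 8 t →
      (G.map (3 * ·)).Perm (b :: c :: t) → False := by
    intro b c t hb hc ht hG
    obtain ⟨e, f, G', hp, rfl, rfl, hG'⟩ := map_perm_cons_cons hG
    exact (h.perm hp).odd_three_false ha (by omega) (by omega) (ht.of_perm_map (by decide) hG')
  rcases hs with ⟨o, t, hl, ho, ht⟩ | ⟨o, b, t, hl, ho, hb, ht⟩ | ⟨o, b, c, t, hl, ho, hb, hc, ht⟩ |
    ⟨o, b, c, t, hl, ho, hb, hc, ht⟩ | ⟨o, b, t, hl, ho, hb, ht⟩ |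
    ⟨o, b, c, t, hl, ho, hb, hc, ht⟩ | ⟨o, b, c, t, hl, ho, hb, hc, ht⟩ <;>
    have ha' := hl.mem_iff.1 List.mem_cons_self <;> simp only [List.mem_cons] at ha' <;>
    by_cases hat : a ∈ t
  all_goals
    try simp only [hat, or_false] at ha'
    try first | omega | (have := (ht a hat).2; omega)
  · subst ha'
    exact h.odd_single_false ha (Or.inl (ht.of_perm_map (by decide) hl.cons_inv.symm))
  · obtain rfl : a = o := by omega
    obtain ⟨e, G', hp, rfl, hG'⟩ := map_perm_cons hl.cons_inv
    exact h.odd_single_false ha (Or.inr ⟨e, G', hp, by omega, Or.inl (ht.of_perm_map (by decide) hG')⟩)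
  · obtain rfl : a = o := by omega
    obtain ⟨e, f, G', hp, rfl, rfl, hG'⟩ := map_perm_cons_cons hl.cons_inv
    exact h.odd_single_false ha (Or.inr ⟨e, _, hp, by omega, Or.inr ⟨f, G', .refl _,
      Or.inr (by omega), ht.of_perm_map (by decide) hG'⟩⟩)
  · obtain rfl : a = o := by omega
    obtain ⟨e, f, G', hp, rfl, rfl, hG'⟩ := map_perm_cons_cons hl.cons_inv
    exact h.odd_single_false ha (Or.inr ⟨e, _, hp, by omega, Or.inr ⟨f, G', .refl _,
      Or.inl (by omega), ht.of_perm_map (by decide) hG'⟩⟩)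
  · rcases ha' with rfl | rfl
    · exact two hb ht hl.cons_inv
    · exact two ho ht (hl.trans (.swap _ _ _)).cons_inv
  · obtain rfl | rfl : a = o ∨ a = b := by omega
    · exact two_two hb hc ht hl.cons_inv
    · exact two_two ho hc ht (hl.trans (.swap _ _ _)).cons_inv
  · rcases ha' with rfl | rfl | rfl
    · exact three hb hc ht hl.cons_inv
    · exact three (by omega) (by omega) ht (hl.trans (.swap _ _ _)).cons_inv
    · exact three (by omega) (by omega) ht (hl.trans perm_rotate).cons_inv

theorem four_of_shape (h : ThreeSingle v a ε G) (ha : a % 8 = 4)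
    (hs : TwoShape (a :: G.map (3 * ·))) :
    TwoThreeExceptional (4 * v + 4) (a :: G.map (3 * ·)) := by
  have fin : ∀ {H : List ℕ}, G.Perm H → TwoThreeExceptional (4 * v + 4) (a :: H.map (3 * ·)) →
      TwoThreeExceptional (4 * v + 4) (a :: G.map (3 * ·)) := fun hp =>
    TwoThreeExceptional.perm ((hp.map _).cons a)
  rcases hs with ⟨o, t, hl, ho, ht⟩ | ⟨o, b, t, hl, ho, hb, ht⟩ | ⟨o, b, c, t, hl, ho, hb, hc, ht⟩ |
    ⟨o, b, c, t, hl, ho, hb, hc, ht⟩ | ⟨o, b, t, hl, ho, hb, ht⟩ |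
    ⟨o, b, c, t, hl, ho, hb, hc, ht⟩ | ⟨o, b, c, t, hl, ho, hb, hc, ht⟩ <;>
    have ha' := hl.mem_iff.1 List.mem_cons_self <;> simp only [List.mem_cons] at ha' <;>
    by_cases hat : a ∈ t
  all_goals
    try simp only [hat, or_false] at ha'
    try first | omega | (have := (ht a hat).2; omega)
  · have hu := List.perm_cons_erase hat
    obtain ⟨e, G', hp, rfl, hG'⟩ := map_perm_cons ((hl.trans ((hu.cons o).trans
      (.swap _ _ _))).cons_inv)
    exact fin hp ((h.perm hp).of_four_one ha (by omega) ((ht.perm hu).of_cons.2.of_perm_map (by decide)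
      hG'))
  · obtain rfl : a = c := by omega
    obtain ⟨e, f, G', hp, rfl, rfl, hG'⟩ := map_perm_cons_cons (hl.trans perm_rotate).cons_inv
    exact ((h.perm hp).four_one_two_false ha (by omega) (by omega) (ht.of_perm_map (by decide) hG')).elim
  · have hu := List.perm_cons_erase hat
    obtain ⟨e, f, G', hp, rfl, rfl, hG'⟩ := map_perm_cons_cons (hl.trans
      (((hu.cons b).cons o).trans perm_rotate)).cons_inv
    have hG4 := (ht.perm hu).of_cons.2.of_perm_map (by decide) hG'
    rcases (by omega : f % 4 = e % 4 ∨ (e % 4 = 1 ∧ f % 4 = 3) ∨ (f % 4 = 1 ∧ e % 4 = 3)) with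
      hef | ⟨he, hf⟩ | ⟨hf, he⟩
    · exact fin hp ((h.perm hp).of_four_two_eq ha (by omega) hef hG4)
    · exact ((h.perm hp).four_two_ne_false ha he hf hG4).elim
    · exact ((h.perm (hp.trans (.swap _ _ _))).four_two_ne_false ha hf he hG4).elim

theorem two_false (h : ThreeSingle v a ε G) (ha : a % 4 = 2)
    (hs : TwoShape (a :: G.map (3 * ·))) : False := by
  rcases hs with ⟨o, t, hl, ho, ht⟩ | ⟨o, b, t, hl, ho, hb, ht⟩ | ⟨o, b, c, t, hl, ho, hb, hc, ht⟩ |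
    ⟨o, b, c, t, hl, ho, hb, hc, ht⟩ | ⟨o, b, t, hl, ho, hb, ht⟩ |
    ⟨o, b, c, t, hl, ho, hb, hc, ht⟩ | ⟨o, b, c, t, hl, ho, hb, hc, ht⟩ <;>
    have ha' := hl.mem_iff.1 List.mem_cons_self <;> simp only [List.mem_cons] at ha' <;>
    by_cases hat : a ∈ t
  all_goals
    try simp only [hat, or_false] at ha'
    try first | omega | (have := (ht a hat).2; omega)
  · obtain rfl : a = b := by omega
    obtain ⟨e, G', hp, rfl, hG'⟩ := map_perm_cons (hl.trans (.swap _ _ _)).cons_inv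
    exact (h.perm hp).two_one_false ha (by omega) (ht.of_perm_map (by decide) hG')
  · obtain rfl : a = b := by omega
    obtain ⟨e, f, G', hp, rfl, rfl, hG'⟩ := map_perm_cons_cons (hl.trans (.swap _ _ _)).cons_inv
    exact (h.perm hp).two_one_four_false ha (by omega) (by omega) (ht.of_perm_map (by decide) hG')
  · obtain rfl | rfl : a = b ∨ a = c := by omega
    · obtain ⟨e, f, G', hp, rfl, rfl, hG'⟩ := map_perm_cons_cons (hl.trans (.swap _ _ _)).cons_inv
      exact (h.perm hp).two_one_two_false ha (by omega) (by omega) (ht.of_perm_map (by decide) hG')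
    · obtain ⟨e, f, G', hp, rfl, rfl, hG'⟩ := map_perm_cons_cons (hl.trans perm_rotate).cons_inv
      exact (h.perm hp).two_one_two_false ha (by omega) (by omega) (ht.of_perm_map (by decide) hG')
  · obtain rfl : a = c := by omega
    obtain ⟨e, f, G', hp, rfl, rfl, hG'⟩ := map_perm_cons_cons (hl.trans perm_rotate).cons_inv
    exact (h.perm hp).two_two_false ha (by omega) (by omega) (ht.of_perm_map (by decide) hG')

theorem exceptional (h : ThreeSingle v a ε G)
    (hodd : ∃ c ∈ a :: G.map (3 * ·), ¬ 2 ∣ c) :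
    TwoThreeExceptional (4 * v + 4) (a :: G.map (3 * ·)) := by
  have hF : ∀ c ∈ a :: G.map (3 * ·), 0 < c := by
    intro c hc
    rcases List.mem_cons.1 hc with rfl | hc
    · exact h.pos
    · obtain ⟨b, hb, rfl⟩ := List.mem_map.1 hc
      have := h.forall_pos b hb
      omega
  have hs := twoShape hF hodd h.bad
  rcases (by omega : a % 2 = 1 ∨ a % 4 = 2 ∨ a % 8 = 4 ∨ a % 8 = 0) with ha | ha | ha | ha
  · exact (h.odd_false ha hs).elim
  · exact (h.two_false ha hs).elim
  · exact h.four_of_shape ha hs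
  · refine h.of_eight_dvd ha ?_
    obtain ⟨c, hc, hc2⟩ := hodd
    rcases List.mem_cons.1 hc with rfl | hc
    · omega
    · obtain ⟨b, hb, rfl⟩ := List.mem_map.1 hc
      exact ⟨b, hb, by omega⟩

end ThreeSingle

/-! ### Escalation -/

/-- The set of the sums `∑ c * p`, with `p` in `vals` for each `c`, as a bit mask. -/
def sumMask (vals : List ℕ) : List ℕ → ℕ
  | [] => 1
  | c :: cs => vals.foldr (fun p acc => acc ||| sumMask vals cs <<< (c * p)) 0

/-- A bit mask whose lowest eight bits are the residues modulo 8 of the sums `∑ c * p`. -/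
def resMask (vals : List ℕ) : List ℕ → ℕ
  | [] => 1
  | c :: cs => vals.foldr (fun p acc => acc ||| (resMask vals cs <<< (c * p % 8) |||
      resMask vals cs <<< (c * p % 8) >>> 8)) 0

theorem testBit_foldr_or {f : ℕ → ℕ} {vals : List ℕ} {i : ℕ} :
    (vals.foldr (fun p acc => acc ||| f p) 0).testBit i = true ↔
      ∃ p ∈ vals, (f p).testBit i = true := by
  induction vals with
  | nil => simp
  | cons p vals ih => simp [Nat.testBit_or, ih, or_comm]

/-- The values up to `T` of `polygonal m` at natural numbers are among `vals`. -/
def Covers (m T : ℕ) (vals : List ℕ) : Prop :=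
  ∀ x : ℕ, polygonal m x ≤ T → ∃ p ∈ vals, polygonal m x = (p : ℕ)

theorem testBit_sumMask {m T : ℕ} (hm : 4 ≤ m) {vals : List ℕ}
    (hvals : Covers m T vals) {cs : List ℕ}
    (hpos : ∀ c ∈ cs, 0 < c) {N : ℕ} (hN : N ≤ T) (h : Rep m cs N) :
    (sumMask vals cs).testBit N = true := by
  induction cs generalizing N with
  | nil =>
    have : (N : ℤ) = 0 := h
    obtain rfl : N = 0 := by omega
    simp [sumMask]
  | cons c cs ih =>
    obtain ⟨x, w, hw, e⟩ := h
    have hw0 := Rep.nonneg hm hw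
    have hx := polygonal_nonneg hm x
    have hc : (1 : ℤ) ≤ c := by exact_mod_cast hpos c (by simp)
    have hcx : polygonal m x ≤ c * polygonal m x := le_mul_of_one_le_left hx hc
    simp only at e
    obtain ⟨p, hp, hpx⟩ := hvals x (by omega)
    rw [hpx] at e
    have hcp : (c : ℤ) * p = (c * p : ℕ) := by push_cast; ring
    have hle : c * p ≤ N := by omega
    have hw' : w = (N - c * p : ℕ) := by push_cast [hle]; omega
    refine testBit_foldr_or.2 ⟨p, hp, ?_⟩
    rw [Nat.testBit_shiftLeft, ih (fun c hc => hpos c (by simp [hc])) (by omega) (hw' ▸ hw)]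
    simpa using hle

theorem exists_val_of_resMask {m : ℕ} {vals : List ℕ}
    (hvals : ∀ p ∈ vals, ∃ x : ℤ, (polygonal m x - p) % 8 = 0) {cs : List ℕ} {i : ℕ}
    (h : (resMask vals cs).testBit i = true) : ∃ w, Val (polygonal m) cs w ∧ (w - i) % 8 = 0 := by
  induction cs generalizing i with
  | nil =>
    have : i = 0 := by simpa [resMask, Nat.testBit_one_eq_true_iff_self_eq_zero] using h
    exact ⟨0, rfl, by simp [this]⟩
  | cons c cs ih =>
    obtain ⟨p, hp, hpi⟩ := testBit_foldr_or.1 h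
    obtain ⟨x, hx⟩ := hvals p hp
    obtain ⟨q, hq⟩ : ∃ q, polygonal m x = p + 8 * q := ⟨(polygonal m x - p) / 8, by omega⟩
    have key : ∀ j w, Val (polygonal m) cs w → (w - j) % 8 = 0 →
        (j + c * p % 8 - i) % 8 = 0 → ∃ w, Val (polygonal m) (c :: cs) w ∧ (w - i) % 8 = 0 := by
      intro j w hw hj h
      refine ⟨_, hw.cons c x, ?_⟩
      rw [hq]
      have : (c : ℤ) * (p + 8 * q) = c * p + 8 * (c * q) := by ring
      omega
    rw [Nat.testBit_or, Bool.or_eq_true, Nat.testBit_shiftRight, Nat.testBit_shiftLeft,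
      Nat.testBit_shiftLeft, Bool.and_eq_true, Bool.and_eq_true, decide_eq_true_iff,
      decide_eq_true_iff] at hpi
    have hc : ((c * p % 8 : ℕ) : ℤ) = (c : ℤ) * p % 8 := by push_cast; rfl
    rcases hpi with ⟨h1, h2⟩ | ⟨h1, h2⟩ <;> obtain ⟨w, hw, hwi⟩ := ih h2 <;>
      refine key _ w hw hwi ?_ <;> rw [← hc] <;> omega

/-- An exhaustive search for the smallest coefficients: a needed number that is not represented by
the coefficients `cs` found so far has to be at least one of the remaining coefficients. -/
def escalates (vals : List ℕ) (T : ℕ) (need : List ℕ → ℕ → Bool) (ok : List ℕ → Bool) :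
    ℕ → List ℕ → Bool
  | 0, _ => false
  | k + 1, cs =>
    match (List.range (T + 1)).find? (fun N => need cs N && !(sumMask vals cs).testBit N) with
    | none => false
    | some N => (List.range N).all
        (fun c => !ok ((c + 1) :: cs) || escalates vals T need ok k ((c + 1) :: cs))

theorem not_escalates {m T : ℕ} (hm : 4 ≤ m) {vals : List ℕ}
    (hvals : Covers m T vals)
    {need : List ℕ → ℕ → Bool} {ok : List ℕ → Bool} {l : List ℕ} (hpos : ∀ c ∈ l, 0 < c)
    (hneed : ∀ cs t N, l.Perm (cs ++ t) → need cs N = true → Rep m l N)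
    (hok : ∀ cs t, l.Perm (cs ++ t) → ok cs = true) (k : ℕ) (cs t : List ℕ)
    (hl : l.Perm (cs ++ t)) : escalates vals T need ok k cs ≠ true := by
  induction k generalizing cs t with
  | zero => simp [escalates]
  | succ k ih =>
    intro h
    rw [escalates] at h
    split at h
    · simp at h
    next N hN =>
      have h1 := List.find?_some hN
      have h2 := List.mem_of_find?_eq_some hN
      rw [List.mem_range] at h2
      simp only [Bool.and_eq_true, Bool.not_eq_true'] at h1
      obtain ⟨u, w, hu, hw, e⟩ := val_append.1 ((hneed cs t N hl h1.1).perm hl)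
      have ht : Multiples 1 t := fun c hc => ⟨hpos c (hl.mem_iff.2 (by simp [hc])), one_dvd c⟩
      have hu0 := Rep.nonneg hm hu
      have hw0 := Rep.nonneg hm hw
      by_cases hw1 : w = 0
      · have hu' : u = (N : ℕ) := by omega
        rw [testBit_sumMask hm hvals (fun c hc => hpos c (hl.mem_iff.2 (by simp [hc])))
          (by omega) (hu' ▸ hu)] at h1
        simp at h1
      · obtain ⟨c, s, hs, hc0, hc, -, -⟩ := ht.pull hm hw hw1
        have hl' : l.Perm ((c :: cs) ++ s) :=
          (hl.trans (hs.append_left cs)).trans List.perm_middle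
        rw [List.all_eq_true] at h
        have h3 := h (c - 1) (List.mem_range.2 (by omega))
        rw [show c - 1 + 1 = c by omega, hok _ _ hl'] at h3
        exact ih _ _ hl' (by simpa using h3)

/-- Two coefficients, of class `r`, are prime to 3, and at most one is exactly divisible by 3. -/
def pairOk (r : ℕ) (cs : List ℕ) : Bool :=
  cs.all (fun c => c % 3 == 0 || c % 3 == r) && Nat.ble (cs.countP (fun c => c % 3 != 0)) 2 &&
    Nat.ble (cs.countP (fun c => c % 3 == 0 && c % 9 != 0)) 1

/-- The numbers that are represented 2-adically with a non-degenerate argument of `o` and with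
`vals` as values modulo 8 at the coefficients `ds`. -/
def unitNeed (vals : List ℕ) (e o : ℕ) (ds : List ℕ) (N : ℕ) : Bool :=
  (resMask vals ds).testBit ((N + 7 * (e * o)) % 8)

/-- The numbers that have to be represented. Here `o` is an odd coefficient modulo 8. -/
def pairNeed (vals : List ℕ) (e o s : ℕ) (extra : List ℕ → ℕ → Bool) (cs : List ℕ) (N : ℕ) : Bool :=
  N % 3 != s && (unitNeed vals e o (cs.filter (fun c => c % 2 == 0)) N ||
    cs.any (fun c => c % 2 == 1 && unitNeed vals e c (cs.erase c) N) || extra cs N)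

/-- Two odd coefficients and two coefficients that are 4 modulo 8. -/
def degenerateExtra (cs : List ℕ) (N : ℕ) : Bool :=
  match cs.filter (fun c => c % 2 != 0), (cs.filter (fun c => c % 2 == 0)).filter (fun c => c % 8 == 4)
  with
  | a :: b :: _, _ :: _ :: _ => (N + 3 * (a + b)) % 4 == 0
  | _, _ => false

/-- An odd coefficient whose argument is chosen such that the derivative is 2 modulo 4. -/
def squareExtra (v : ℕ) (cs : List ℕ) (N : ℕ) : Bool :=
  cs.any (fun o => o % 2 == 1 && ((2 * v + 1) * N + (v ^ 2 - 4) * o) % 32 == 0)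

theorem pairOk_of_perm {r : ℕ} {l cs t : List ℕ} (h : pairOk r l = true) (hl : l.Perm (cs ++ t)) :
    pairOk r cs = true := by
  simp only [pairOk, Bool.and_eq_true, List.all_eq_true, Nat.ble_eq] at h ⊢
  rw [hl.countP_eq, hl.countP_eq, List.countP_append, List.countP_append] at h
  exact ⟨⟨fun c hc => h.1.1 c (hl.mem_iff.2 (by simp [hc])), by omega⟩, by omega⟩

theorem loc_of_unitNeed {v e o a : ℕ} {vals : List ℕ}
    (hvals : ∀ p ∈ vals, ∃ x : ℤ, (polygonal (4 * v + 4) x - p) % 8 = 0)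
    (he : (v % 2 = 0 ∧ e = 1) ∨ (v % 2 = 1 ∧ e = 0)) (ha : a % 2 = 1) (hao : o % 8 = a % 8)
    {l ds t : List ℕ} (hl : l.Perm (a :: (ds ++ t))) {N : ℕ} (h : unitNeed vals e o ds N = true) :
    Loc (4 * v + 4) 2 l N := by
  obtain ⟨w, hw, hwi⟩ := exists_val_of_resMask hvals h
  have hw' := Val.append_zero (0 : ℤ) (polygonal_zero (4 * v + 4)) hw t
  rcases he with ⟨hv, rfl⟩ | ⟨hv, rfl⟩
  · exact (Loc.of_two_unit_even hv ha hw' (by omega)).perm hl.symm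
  · exact (Loc.of_two_unit_odd hv ha hw' (by omega)).perm hl.symm

theorem perm_filter_append (q : ℕ → Bool) (l : List ℕ) :
    l.Perm (l.filter q ++ l.filter (fun c => !q c)) := (List.filter_append_perm q l).symm

theorem loc_of_degenerateExtra {v : ℕ} (hv : v % 2 = 1) {l cs t : List ℕ} (hl : l.Perm (cs ++ t))
    {N : ℕ} (h : degenerateExtra cs N = true) : Loc (4 * v + 4) 2 l N := by
  unfold degenerateExtra at h
  split at h
  next a b s d c u h1 h2 =>
    have ha : a ∈ cs.filter (fun c => c % 2 != 0) := by rw [h1]; simp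
    have hb : b ∈ cs.filter (fun c => c % 2 != 0) := by rw [h1]; simp
    have hd : d ∈ (cs.filter (fun c => c % 2 == 0)).filter (fun c => c % 8 == 4) := by simp [h2]
    have hc : c ∈ (cs.filter (fun c => c % 2 == 0)).filter (fun c => c % 8 == 4) := by simp [h2]
    simp only [List.mem_filter, bne_iff_ne, beq_iff_eq] at ha hb hd hc h
    have p1 := perm_filter_append (fun c => c % 2 == 0) cs
    have p2 := perm_filter_append (fun c => c % 8 == 4) (cs.filter (fun c => c % 2 == 0))
    have h1' : cs.filter (fun c => !(c % 2 == 0)) = a :: b :: s := h1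
    rw [h1'] at p1
    rw [h2] at p2
    have hp : l.Perm (a :: b :: d :: c :: (u ++ ((cs.filter (fun c => c % 2 == 0)).filter
        (fun c => !(c % 8 == 4)) ++ (s ++ t)))) := by
      refine (hl.trans ((p1.trans ((p2.append_right _).trans List.perm_append_comm)).append_right
        t)).trans ?_
      generalize (cs.filter (fun c => c % 2 == 0)).filter (fun c => !(c % 8 == 4)) = z
      simp only [List.cons_append, List.append_assoc]
      have := List.perm_append_comm_assoc s (d :: c :: u ++ z) t
      simpa using (this.cons b).cons a
    exact (loc_two_degenerate (v := v) (by omega) (by omega) hd.2 (Or.inl hc.2) _ (by omega)).perm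
      hp.symm
  · simp at h

theorem loc_of_squareExtra {v : ℕ} (hv : 2 ≤ v) {l cs t : List ℕ} (hl : l.Perm (cs ++ t))
    {N : ℕ} (h : squareExtra v cs N = true) : Loc (4 * v + 4) 2 l N := by
  obtain ⟨o, ho, h⟩ := List.any_eq_true.1 h
  simp only [Bool.and_eq_true, beq_iff_eq] at h
  have hp : l.Perm (o :: (cs.erase o ++ t)) := hl.trans ((List.perm_cons_erase ho).append_right t)
  refine (loc_one_of_thirty_two (v := v) h.1 ?_ _).perm hp.symm
  obtain ⟨q, hq⟩ : ∃ q, v ^ 2 = 4 + q := ⟨v ^ 2 - 4, by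
    have : 2 ^ 2 ≤ v ^ 2 := Nat.pow_le_pow_left hv 2
    omega⟩
  have hq' : (v : ℤ) ^ 2 = 4 + q := by exact_mod_cast hq
  rw [hq, Nat.add_sub_cancel_left] at h
  rw [hq']
  have h2 : (2 * (v : ℤ) + 1) * N - (4 - (4 + (q : ℤ))) * o = ((2 * v + 1) * N + q * o : ℕ) := by
    push_cast
    ring
  rw [h2]
  omega

/-- A form with exactly two coefficients prime to 3 (in the class `r`), with an odd coefficient,
that represents the numbers outside the class `s` modulo 3 that are locally represented at 2. -/
structure ThreePair (v r s : ℕ) (l : List ℕ) : Prop where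
  forall_pos : ∀ c ∈ l, 0 < c
  odd : ∃ c ∈ l, c % 2 = 1
  ok : pairOk r l = true
  rep : ∀ N : ℕ, N % 3 ≠ s → Loc (4 * v + 4) 2 l N → Rep (4 * v + 4) l N

theorem ThreePair.not_escalates {v r s e : ℕ} {l : List ℕ} (h : ThreePair v r s l)
    (he : (v % 2 = 0 ∧ e = 1) ∨ (v % 2 = 1 ∧ e = 0)) {resVals : List ℕ}
    (hres : ∀ p ∈ resVals, ∃ x : ℤ, (polygonal (4 * v + 4) x - p) % 8 = 0) {T : ℕ} {vals : List ℕ}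
    (hvals : Covers (4 * v + 4) T vals)
    {extra : List ℕ → ℕ → Bool}
    (hextra : ∀ cs t N, l.Perm (cs ++ t) → extra cs N = true → Loc (4 * v + 4) 2 l N) (k : ℕ) :
    ∃ o ∈ [1, 3, 5, 7],
      escalates vals T (pairNeed resVals e o s extra) (pairOk r) k [] ≠ true := by
  obtain ⟨a, ha, ha2⟩ := h.odd
  refine ⟨a % 8, by simp only [List.mem_cons, List.not_mem_nil, or_false]; omega,
    PolygonalForm.not_escalates (by omega) hvals h.forall_pos (fun cs t N hl hN => ?_)
      (fun cs t hl => pairOk_of_perm h.ok hl) k [] l (.refl _)⟩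
  simp only [pairNeed, Bool.and_eq_true, Bool.or_eq_true, bne_iff_ne, ne_eq] at hN
  refine h.rep N hN.1 ?_
  rcases hN.2 with (hN | hN) | hN
  · have p1 := perm_filter_append (fun c => c % 2 == 0) cs
    have hl' := hl.trans (p1.append_right t)
    rw [List.append_assoc] at hl'
    have ha' : a ∈ cs.filter (fun c => !(c % 2 == 0)) ++ t := by
      have := hl'.mem_iff.1 ha
      rw [List.mem_append] at this
      rcases this with h | h
      · simp only [List.mem_filter, beq_iff_eq] at h
        omega
      · exact h
    refine loc_of_unitNeed hres he ha2 (by omega)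
      (t := (cs.filter (fun c => !(c % 2 == 0)) ++ t).erase a)
      ?_ hN
    exact (hl'.trans ((List.perm_cons_erase ha').append_left _)).trans List.perm_middle
  · obtain ⟨o, ho, hN⟩ := List.any_eq_true.1 hN
    simp only [Bool.and_eq_true, beq_iff_eq] at hN
    exact loc_of_unitNeed hres he hN.1 rfl (t := t)
      (hl.trans ((List.perm_cons_erase ho).append_right t)) hN.2
  · exact hextra cs t N hl hN

theorem exists_polygonal_even {v : ℕ} (hv : v % 2 = 0) :
    ∀ p ∈ [0, 1, 4], ∃ x : ℤ, (polygonal (4 * v + 4) x - (p : ℕ)) % 8 = 0 := by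
  have h0 := two_mul_polygonal (4 * v + 4) 0
  have h1 := two_mul_polygonal (4 * v + 4) 1
  have h2 := two_mul_polygonal (4 * v + 4) 2
  push_cast at h0 h1 h2
  intro p hp
  simp only [List.mem_cons, List.not_mem_nil, or_false] at hp
  rcases hp with rfl | rfl | rfl
  · exact ⟨0, by omega⟩
  · exact ⟨1, by omega⟩
  · exact ⟨2, by omega⟩

theorem exists_polygonal_odd {v : ℕ} (hv : v % 2 = 1) :
    ∀ p ∈ [0, 1, 5], ∃ x : ℤ, (polygonal (4 * v + 4) x - (p : ℕ)) % 8 = 0 := by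
  have h0 := two_mul_polygonal (4 * v + 4) 0
  have h1 := two_mul_polygonal (4 * v + 4) 1
  have h2 := two_mul_polygonal (4 * v + 4) 3
  push_cast at h0 h1 h2
  intro p hp
  simp only [List.mem_cons, List.not_mem_nil, or_false] at hp
  rcases hp with rfl | rfl | rfl
  · exact ⟨0, by omega⟩
  · exact ⟨1, by omega⟩
  · exact ⟨3, by omega⟩

theorem covers_small {m n : ℕ} (hm : 12 ≤ n) (hn : n = m) : Covers n 59 [0, 1, m, 3 * m - 3] := by
  subst hn
  intro x hx
  rcases polygonal_cases (by omega : 4 ≤ n) x with ⟨-, h⟩ | ⟨-, h⟩ | ⟨-, h⟩ | ⟨h3, -⟩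
  · exact ⟨0, by simp, h⟩
  · exact ⟨1, by simp, h⟩
  · exact ⟨n, by simp, h⟩
  · have h4 := polygonal_four n
    have h3' := polygonal_three n
    by_cases hx4 : 4 ≤ x
    · have := polygonal_mono (by omega : 4 ≤ n) hx4
      push_cast at this hx
      omega
    · obtain rfl : x = 3 := by omega
      exact ⟨3 * n - 3, by simp, by push_cast [show 3 ≤ 3 * n by omega]; omega⟩

theorem covers_large {m : ℕ} (hm : 60 ≤ m) : Covers m 59 [0, 1] := by
  intro x hx
  rcases polygonal_cases (by omega : 4 ≤ m) x with ⟨-, h⟩ | ⟨-, h⟩ | ⟨-, h⟩ | ⟨-, h⟩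
  · exact ⟨0, by simp, h⟩
  · exact ⟨1, by simp, h⟩
  · push_cast at hx; omega
  · push_cast at hx; omega

/-- The searches below are over the coefficients that can occur in a `ThreePair`. The values of
`polygonal m` up to 59 are 0 and 1 when `m ≥ 60`; otherwise `m` and `3 * m - 3` are added. -/
theorem escalates_even_one : ∀ r ∈ [1, 2], ∀ o ∈ [1, 3, 5, 7],
    ∀ vals ∈ [[0, 1], [0, 1, 28, 3 * 28 - 3], [0, 1, 52, 3 * 52 - 3]],
    escalates vals 59 (pairNeed [0, 1, 4] 1 o 0 fun _ _ => false) (pairOk r) 7 [] = true := by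
  decide +kernel

theorem escalates_even_zero : ∀ r ∈ [1, 2], ∀ o ∈ [1, 3, 5, 7],
    ∀ vals ∈ [[0, 1], [0, 1, 12, 3 * 12 - 3], [0, 1, 36, 3 * 36 - 3]],
    escalates vals 59 (pairNeed [0, 1, 4] 1 o (3 - r) fun _ _ => false) (pairOk r) 7 [] = true := by
  decide +kernel

theorem escalates_odd_one : ∀ r ∈ [1, 2],
    ∀ vals ∈ [[0, 1], [0, 1, 16, 3 * 16 - 3], [0, 1, 40, 3 * 40 - 3]],
    escalates vals 59 (pairNeed [0, 1, 5] 0 1 0 fun _ _ => false) (pairOk r) 7 [] = true := by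
  decide +kernel

theorem escalates_odd_zero : ∀ r ∈ [1, 2],
    escalates [0, 1] 59 (pairNeed [0, 1, 5] 0 1 (3 - r) fun _ _ => false) (pairOk r) 7 [] = true := by
  decide +kernel

theorem escalates_forty_eight : ∀ r ∈ [1, 2],
    escalates [0, 1, 48, 3 * 48 - 3] 59 (pairNeed [0, 1, 5] 0 1 (3 - r) (squareExtra 11)) (pairOk r)
      7 [] = true := by
  decide +kernel

theorem escalates_twenty_four : ∀ r ∈ [1, 2],
    escalates [0, 1, 24, 3 * 24 - 3] 59 (pairNeed [0, 1, 5] 0 1 (3 - r)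
      fun cs N => degenerateExtra cs N || squareExtra 5 cs N) (pairOk r) 7 [] = true := by
  decide +kernel

theorem pairNeed_zero {vals : List ℕ} {o s : ℕ} {extra : List ℕ → ℕ → Bool} :
    pairNeed vals 0 o s extra = pairNeed vals 0 1 s extra := by
  funext cs N
  simp [pairNeed, unitNeed]

/-- With exactly two coefficients prime to 3 that are congruent modulo 3, some number is
locally represented but not represented. -/
theorem ThreePair.contradiction {v r s : ℕ} {l : List ℕ} (h : ThreePair v r s l) (hv : 2 ≤ v)
    (hr : r = 1 ∨ r = 2)
    (hs : ((4 * v + 4) % 3 = 1 ∧ s = 0) ∨ ((4 * v + 4) % 3 = 0 ∧ s = 3 - r)) : False := by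
  have hr' : r ∈ [1, 2] := by simpa using hr
  have no : ∀ cs t N, l.Perm (cs ++ t) → (fun (_ : List ℕ) (_ : ℕ) => false) cs N = true →
      Loc (4 * v + 4) 2 l N := fun _ _ _ _ h => by simp at h
  rcases (by omega : v % 2 = 0 ∨ v % 2 = 1) with hv2 | hv2 <;>
    rcases hs with ⟨hm, rfl⟩ | ⟨hm, rfl⟩
  · have key : ∀ vals, vals ∈ [[0, 1], [0, 1, 28, 3 * 28 - 3], [0, 1, 52, 3 * 52 - 3]] →
        Covers (4 * v + 4) 59 vals → False := fun vals hmem hvals => by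
      obtain ⟨o, ho, h⟩ := h.not_escalates (Or.inl ⟨hv2, rfl⟩) (exists_polygonal_even hv2) hvals no 7
      exact h (escalates_even_one r hr' o ho vals hmem)
    obtain h | h | h : 4 * v + 4 = 28 ∨ 4 * v + 4 = 52 ∨ 60 ≤ 4 * v + 4 := by omega
    · exact key _ (by simp) (covers_small (by omega) h)
    · exact key _ (by simp) (covers_small (by omega) h)
    · exact key _ (by simp) (covers_large h)
  · have key : ∀ vals, vals ∈ [[0, 1], [0, 1, 12, 3 * 12 - 3], [0, 1, 36, 3 * 36 - 3]] →
        Covers (4 * v + 4) 59 vals → False := fun vals hmem hvals => by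
      obtain ⟨o, ho, h⟩ := h.not_escalates (Or.inl ⟨hv2, rfl⟩) (exists_polygonal_even hv2) hvals no 7
      exact h (escalates_even_zero r hr' o ho vals hmem)
    obtain h | h | h : 4 * v + 4 = 12 ∨ 4 * v + 4 = 36 ∨ 60 ≤ 4 * v + 4 := by omega
    · exact key _ (by simp) (covers_small (by omega) h)
    · exact key _ (by simp) (covers_small (by omega) h)
    · exact key _ (by simp) (covers_large h)
  · have key : ∀ vals, vals ∈ [[0, 1], [0, 1, 16, 3 * 16 - 3], [0, 1, 40, 3 * 40 - 3]] →
        Covers (4 * v + 4) 59 vals → False := fun vals hmem hvals => by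
      obtain ⟨o, -, h⟩ := h.not_escalates (Or.inr ⟨hv2, rfl⟩) (exists_polygonal_odd hv2) hvals no 7
      rw [pairNeed_zero] at h
      exact h (escalates_odd_one r hr' vals hmem)
    obtain h | h | h : 4 * v + 4 = 16 ∨ 4 * v + 4 = 40 ∨ 60 ≤ 4 * v + 4 := by omega
    · exact key _ (by simp) (covers_small (by omega) h)
    · exact key _ (by simp) (covers_small (by omega) h)
    · exact key _ (by simp) (covers_large h)
  · obtain hv | hv | hv : v = 5 ∨ v = 11 ∨ 60 ≤ 4 * v + 4 := by omega
    · subst hv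
      obtain ⟨o, -, h⟩ := h.not_escalates (Or.inr ⟨hv2, rfl⟩) (exists_polygonal_odd hv2)
        (covers_small (by simp) rfl) (extra := fun cs N => degenerateExtra cs N || squareExtra 5 cs N)
        (fun cs t N hl hN => by
          rcases Bool.or_eq_true _ _ ▸ hN with hN | hN
          · exact loc_of_degenerateExtra hv2 hl hN
          · exact loc_of_squareExtra (by simp) hl hN) 7
      rw [pairNeed_zero] at h
      exact h (escalates_twenty_four r hr')
    · subst hv
      obtain ⟨o, -, h⟩ := h.not_escalates (Or.inr ⟨hv2, rfl⟩) (exists_polygonal_odd hv2)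
        (covers_small (by simp) rfl) (extra := squareExtra 11)
        (fun cs t N hl hN => loc_of_squareExtra (by simp) hl hN) 7
      rw [pairNeed_zero] at h
      exact h (escalates_forty_eight r hr')
    · obtain ⟨o, -, h⟩ := h.not_escalates (Or.inr ⟨hv2, rfl⟩) (exists_polygonal_odd hv2)
        (covers_large hv) no 7
      rw [pairNeed_zero] at h
      exact h (escalates_odd_zero r hr')

/-- The regular forms for which both 2 and 3, and no other prime, exclude numbers. -/
theorem two_three_exceptional {v : ℕ} (hv : 2 ≤ v) (hm3 : (4 * v + 4) % 3 ≠ 2) {l : List ℕ}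
    (hpos : ∀ c ∈ l, 0 < c) (hu2 : ∃ c ∈ l, ¬ 2 ∣ c) (hu3 : ∃ c ∈ l, ¬ 3 ∣ c)
    (hbad2 : ¬ ∀ N : ℕ, Loc (4 * v + 4) 2 l N) (hbad3 : ¬ ∀ N : ℕ, Loc (4 * v + 4) 3 l N)
    (H : ∀ N : ℕ, Loc (4 * v + 4) 2 l N → Loc (4 * v + 4) 3 l N → Rep (4 * v + 4) l N) :
    TwoThreeExceptional (4 * v + 4) l := by
  rcases three_structure (by omega) hm3 hpos hu3 hbad3 with ⟨a, t, hl, ha, ht⟩ |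
    ⟨a, b, t, hl, ha, hab, ht, h9⟩
  · obtain ⟨G, rfl, hG⟩ := ht.exists_map
    refine TwoThreeExceptional.perm hl ?_
    have key : ∀ ε, IsNondegThree (4 * v + 4) ε →
        TwoThreeExceptional (4 * v + 4) (a :: G.map (3 * ·)) := fun ε hε =>
      ThreeSingle.exceptional ⟨hv, hε, hpos a (hl.mem_iff.2 (by simp)), ha, hG,
        fun h => hbad2 fun N => (h N).perm hl.symm,
        fun N h2 h3 => (H N (h2.perm hl.symm) (h3.perm hl.symm)).perm hl⟩
        (by
          obtain ⟨c, hc, hc2⟩ := hu2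
          exact ⟨c, hl.mem_iff.1 hc, hc2⟩)
    rcases (by omega : (4 * v + 4) % 3 = 1 ∨ (4 * v + 4) % 3 = 0) with h | h
    · exact key 1 (Or.inl ⟨h, rfl⟩)
    · exact key 0 (Or.inr ⟨h, rfl⟩)
  · exfalso
    have ht0 : t.countP (fun c => c % 3 != 0) = 0 := List.countP_eq_zero.2 fun c hc => by
      have := (ht c hc).2
      simp
      omega
    have ht9 : ∀ {s : List ℕ}, Multiples 9 s → s.countP (fun c => c % 3 == 0 && c % 9 != 0) = 0 :=
      fun hs => List.countP_eq_zero.2 fun c hc => by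
        have := (hs c hc).2
        simp
        omega
    have ht1 : t.countP (fun c => c % 3 == 0 && c % 9 != 0) ≤ 1 := by
      rcases h9 with h9 | ⟨c, s, hs, -, -, h9⟩
      · rw [ht9 h9]
        norm_num
      · rw [hs.countP_eq, List.countP_cons, ht9 h9]
        split_ifs <;> norm_num
    have hok : pairOk (a % 3) l = true := by
      simp only [pairOk, Bool.and_eq_true, List.all_eq_true, Nat.ble_eq]
      refine ⟨⟨fun c hc => ?_, ?_⟩, ?_⟩
      · have := hl.mem_iff.1 hc
        simp only [List.mem_cons] at this
        rcases this with rfl | rfl | h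
        · simp
        · simp [hab]
        · have := (ht c h).2
          simp
          omega
      · rw [hl.countP_eq, List.countP_cons, List.countP_cons, ht0]
        split_ifs <;> norm_num
      · have ha' : a % 3 ≠ 0 := by omega
        have hb' : b % 3 ≠ 0 := by omega
        rw [hl.countP_eq, List.countP_cons, List.countP_cons]
        simpa [ha', hb'] using ht1
    have hodd : ∃ c ∈ l, c % 2 = 1 := by
      obtain ⟨c, hc, hc2⟩ := hu2
      exact ⟨c, hc, by omega⟩
    have z := val_polygonal_zero (4 * v + 4) t
    rcases (by omega : (4 * v + 4) % 3 = 1 ∨ (4 * v + 4) % 3 = 0) with h | h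
    · refine ThreePair.contradiction (r := a % 3) (s := 0) ⟨hpos, hodd, hok, fun N hN h2 => H N h2 ?_⟩
        hv (by omega) (Or.inl ⟨h, rfl⟩)
      refine Loc.perm hl.symm ?_
      by_cases hNa : ((N : ℤ) - a) % 3 = 0
      · exact Loc.three_one h ha (z.skip b) (by omega)
      · refine Loc.three_one h ha (z.take b) ?_
        rcases (by omega : a % 3 = 1 ∨ a % 3 = 2) with h1 | h1 <;> omega
    · refine ThreePair.contradiction (r := a % 3) (s := 3 - a % 3)
        ⟨hpos, hodd, hok, fun N hN h2 => H N h2 ?_⟩ hv (by omega) (Or.inr ⟨h, rfl⟩)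
      refine Loc.perm hl.symm ?_
      by_cases hNa : N % 3 = 0
      · exact Loc.three_zero h ha (z.skip b) (by omega)
      · exact Loc.three_zero h ha (z.take b) (by omega)

/-! ### Representations as lists of coefficients and arguments -/

/-- The value `∑ c * P_m(x)` of a list of pairs `(c, x)` of a coefficient and its argument. -/
def argVal (m : ℕ) (zs : List (ℕ × ℕ)) : ℤ :=
  (zs.map fun z => (z.1 : ℤ) * polygonal m z.2).sum

@[simp] theorem argVal_cons (m : ℕ) (z : ℕ × ℕ) (zs : List (ℕ × ℕ)) :
    argVal m (z :: zs) = z.1 * polygonal m z.2 + argVal m zs := by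
  simp [argVal]

theorem argVal_perm {m : ℕ} {zs zs' : List (ℕ × ℕ)} (h : zs.Perm zs') :
    argVal m zs = argVal m zs' :=
  (h.map _).sum_eq

theorem Rep.exists_args {m : ℕ} {l : List ℕ} {N : ℤ} (h : Rep m l N) :
    ∃ zs : List (ℕ × ℕ), zs.map Prod.fst = l ∧ argVal m zs = N := by
  induction l generalizing N with
  | nil => exact ⟨[], rfl, Eq.symm h⟩
  | cons c l ih =>
    obtain ⟨x, w, hw, rfl⟩ := h
    obtain ⟨zs, rfl, rfl⟩ := ih hw
    exact ⟨(c, x) :: zs, rfl, by simp⟩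

theorem exists_cons_of_map_perm {zs : List (ℕ × ℕ)} {a : ℕ} {t : List ℕ}
    (h : (zs.map Prod.fst).Perm (a :: t)) :
    ∃ x zs', zs.Perm ((a, x) :: zs') ∧ (zs'.map Prod.fst).Perm t := by
  obtain ⟨⟨c, x⟩, hz, rfl⟩ := List.mem_map.1 (h.mem_iff.2 (List.mem_cons_self (a := a)))
  have hp := List.perm_cons_erase hz
  exact ⟨x, _, hp, ((hp.map _).symm.trans h).cons_inv⟩

theorem dvd_argVal {m d : ℕ} {zs : List (ℕ × ℕ)} (h : ∀ z ∈ zs, d ∣ z.1) :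
    (d : ℤ) ∣ argVal m zs := by
  refine List.dvd_sum fun w hw => ?_
  obtain ⟨z, hz, rfl⟩ := List.mem_map.1 hw
  exact Dvd.dvd.mul_right (by exact_mod_cast h z hz) _

theorem dvd_argVal_of_map_perm {m d : ℕ} {zs : List (ℕ × ℕ)} {t : List ℕ}
    (h : (zs.map Prod.fst).Perm t) (ht : ∀ c ∈ t, d ∣ c) : (d : ℤ) ∣ argVal m zs :=
  dvd_argVal fun z hz => ht z.1 (h.mem_iff.1 (List.mem_map_of_mem hz))

theorem argVal_nonneg {m : ℕ} (hm : 4 ≤ m) (zs : List (ℕ × ℕ)) : 0 ≤ argVal m zs := by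
  refine List.sum_nonneg fun w hw => ?_
  obtain ⟨z, -, rfl⟩ := List.mem_map.1 hw
  exact mul_nonneg (Int.natCast_nonneg _) (polygonal_nonneg hm _)

theorem mul_polygonal_le_argVal {m : ℕ} (hm : 4 ≤ m) {zs : List (ℕ × ℕ)} {z : ℕ × ℕ}
    (hz : z ∈ zs) : z.1 * polygonal m z.2 ≤ argVal m zs := by
  rw [argVal_perm (List.perm_cons_erase hz), argVal_cons]
  have := argVal_nonneg hm (zs.erase z)
  omega

/-! ### Residue classes that force the arguments modulo 2 and 3 -/

/-- Every number congruent to `N₀` modulo `D` satisfies the 2-adic condition; if `D ≠ 2`, then a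
representation of such a number has arguments of prescribed parity `π c` at all coefficients `c`
that are not divisible by `D`. -/
structure TwoClass (m : ℕ) (l : List ℕ) (D N₀ : ℕ) (π : ℕ → ℕ) : Prop where
  loc : ∀ N : ℕ, ((N : ℤ) - N₀) % D = 0 → Loc m 2 l N
  forced : D ≠ 2 → ∀ zs : List (ℕ × ℕ), (zs.map Prod.fst).Perm l →
    (argVal m zs - N₀) % D = 0 → ∀ z ∈ zs, ¬ D ∣ z.1 → z.2 % 2 = π z.1

theorem mul_polygonal_even {v : ℕ} (hv : v % 2 = 0) (a x : ℕ) :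
    (x % 2 = 1 ∧ (a * polygonal (4 * v + 4) x - a) % 8 = 0) ∨
      (x % 2 = 0 ∧ (a * polygonal (4 * v + 4) x % 8 = 0 ∨
        (a * polygonal (4 * v + 4) x - 4 * a) % 8 = 0)) := by
  obtain ⟨j, rfl⟩ : ∃ j, v = 2 * j := ⟨v / 2, by omega⟩
  have h := two_mul_polygonal (4 * (2 * j) + 4) x
  push_cast at h
  rcases Nat.even_or_odd' x with ⟨y, rfl | rfl⟩
  · refine Or.inr ⟨by omega, ?_⟩
    have h1 : polygonal (4 * (2 * j) + 4) (2 * y : ℕ) = 8 * (2 * j * y ^ 2 - j * y) + 4 * y ^ 2 := by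
      push_cast at h ⊢; linarith
    rw [h1]
    rcases Nat.even_or_odd' y with ⟨z, rfl | rfl⟩
    · left
      have : (a : ℤ) * (8 * (2 * j * (2 * z : ℕ) ^ 2 - j * (2 * z : ℕ)) + 4 * (2 * z : ℕ) ^ 2) =
        8 * (a * (2 * j * (2 * z) ^ 2 - j * (2 * z) + 2 * z ^ 2)) := by push_cast; ring
      omega
    · right
      have : (a : ℤ) * (8 * (2 * j * (2 * z + 1 : ℕ) ^ 2 - j * (2 * z + 1 : ℕ)) +
          4 * (2 * z + 1 : ℕ) ^ 2) =
        8 * (a * (2 * j * (2 * z + 1) ^ 2 - j * (2 * z + 1) + 2 * z ^ 2 + 2 * z)) + 4 * a := by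
        push_cast; ring
      omega
  · refine Or.inl ⟨by omega, ?_⟩
    obtain ⟨e, he⟩ := (Int.even_mul_succ_self (y : ℤ)).two_dvd
    have h1 : polygonal (4 * (2 * j) + 4) (2 * y + 1 : ℕ) =
        8 * (j * (y * (y + 1)) + j * y ^ 2) + 8 * e + 1 := by
      push_cast at h ⊢; linarith
    have : (a : ℤ) * (8 * (j * (y * (y + 1)) + j * y ^ 2) + 8 * e + 1) =
      8 * (a * (j * (y * (y + 1)) + j * y ^ 2 + e)) + a := by ring
    rw [h1]
    omega

theorem mul_polygonal_odd {v : ℕ} (hv : v % 2 = 1) (a x : ℕ) :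
    (x % 2 = 0 ∧ a * polygonal (4 * v + 4) x % 8 = 0) ∨
      (x % 2 = 1 ∧ ((a * polygonal (4 * v + 4) x - a) % 8 = 0 ∨
        (a * polygonal (4 * v + 4) x - 5 * a) % 8 = 0)) := by
  obtain ⟨j, rfl⟩ : ∃ j, v = 2 * j + 1 := ⟨v / 2, by omega⟩
  have h := two_mul_polygonal (4 * (2 * j + 1) + 4) x
  push_cast at h
  rcases Nat.even_or_odd' x with ⟨y, rfl | rfl⟩
  · refine Or.inl ⟨by omega, ?_⟩
    obtain ⟨e, he⟩ := (Int.even_mul_succ_self (y : ℤ)).two_dvd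
    have h1 : polygonal (4 * (2 * j + 1) + 4) (2 * y : ℕ) =
        8 * (2 * j * y ^ 2 - j * y + 3 * e - 2 * y) := by
      push_cast at h ⊢; linarith
    have : (a : ℤ) * (8 * (2 * j * y ^ 2 - j * y + 3 * e - 2 * y)) =
      8 * (a * (2 * j * y ^ 2 - j * y + 3 * e - 2 * y)) := by ring
    rw [h1]
    omega
  · refine Or.inr ⟨by omega, ?_⟩
    obtain ⟨e, he⟩ := (Int.even_mul_succ_self (y : ℤ)).two_dvd
    have h1 : polygonal (4 * (2 * j + 1) + 4) (2 * y + 1 : ℕ) =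
        8 * (2 * j * y ^ 2 + j * y + 3 * e) - 4 * y + 1 := by
      push_cast at h ⊢; linarith
    rw [h1]
    rcases Nat.even_or_odd' y with ⟨z, rfl | rfl⟩
    · left
      have : (a : ℤ) * (8 * (2 * j * (2 * z : ℕ) ^ 2 + j * (2 * z : ℕ) + 3 * e) -
          4 * (2 * z : ℕ) + 1) =
        8 * (a * (2 * j * (2 * z) ^ 2 + j * (2 * z) + 3 * e - z)) + a := by push_cast; ring
      omega
    · right
      have : (a : ℤ) * (8 * (2 * j * (2 * z + 1 : ℕ) ^ 2 + j * (2 * z + 1 : ℕ) + 3 * e) -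
          4 * (2 * z + 1 : ℕ) + 1) =
        8 * (a * (2 * j * (2 * z + 1) ^ 2 + j * (2 * z + 1) + 3 * e - z - 1)) + 5 * a := by
        push_cast; ring
      omega

section TwoClass
variable {m D N₀ a b c : ℕ} {π : ℕ → ℕ} {l t : List ℕ}

theorem TwoClass.of_one (hl : l.Perm (a :: t)) (ht : Multiples D t)
    (hloc : ∀ N : ℕ, ((N : ℤ) - N₀) % D = 0 → Loc m 2 (a :: t) N)
    (h : ∀ (x : ℕ) (p : ℤ), p = a * polygonal m x → (p - N₀) % D = 0 → x % 2 = π a) :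
    TwoClass m l D N₀ π := by
  refine ⟨fun N hN => (hloc N hN).perm hl.symm, fun _ zs hzs hN z hz hd => ?_⟩
  obtain ⟨x, zs₁, hx, h1⟩ := exists_cons_of_map_perm (hzs.trans hl)
  have hw := dvd_argVal_of_map_perm (m := m) h1 fun c hc => (ht c hc).2
  rw [argVal_perm hx, argVal_cons, ← Int.dvd_iff_emod_eq_zero] at hN
  have := h x _ rfl (Int.emod_eq_zero_of_dvd ((dvd_add_left hw).1 (by
    rwa [sub_add_eq_add_sub])))
  rcases List.mem_cons.1 (hx.mem_iff.1 hz) with rfl | hz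
  · exact this
  · exact absurd (ht _ (h1.mem_iff.1 (List.mem_map_of_mem hz))).2 hd

theorem TwoClass.of_two (hl : l.Perm (a :: b :: t)) (ht : Multiples D t)
    (hloc : ∀ N : ℕ, ((N : ℤ) - N₀) % D = 0 → Loc m 2 (a :: b :: t) N)
    (h : ∀ (x y : ℕ) (p q : ℤ), p = a * polygonal m x → q = b * polygonal m y →
      (p + q - N₀) % D = 0 → x % 2 = π a ∧ y % 2 = π b) :
    TwoClass m l D N₀ π := by
  refine ⟨fun N hN => (hloc N hN).perm hl.symm, fun _ zs hzs hN z hz hd => ?_⟩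
  obtain ⟨x, zs₁, hx, h1⟩ := exists_cons_of_map_perm (hzs.trans hl)
  obtain ⟨y, zs₂, hy, h2⟩ := exists_cons_of_map_perm h1
  have hw := dvd_argVal_of_map_perm (m := m) h2 fun c hc => (ht c hc).2
  rw [argVal_perm hx, argVal_cons, argVal_perm hy, argVal_cons, ← Int.dvd_iff_emod_eq_zero,
    ← add_assoc] at hN
  have := h x y _ _ rfl rfl (Int.emod_eq_zero_of_dvd ((dvd_add_left hw).1 (by
    rwa [sub_add_eq_add_sub])))
  rcases List.mem_cons.1 (hx.mem_iff.1 hz) with rfl | hz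
  · exact this.1
  rcases List.mem_cons.1 (hy.mem_iff.1 hz) with rfl | hz
  · exact this.2
  · exact absurd (ht _ (h2.mem_iff.1 (List.mem_map_of_mem hz))).2 hd

theorem TwoClass.of_three (hl : l.Perm (a :: b :: c :: t)) (ht : Multiples D t)
    (hloc : ∀ N : ℕ, ((N : ℤ) - N₀) % D = 0 → Loc m 2 (a :: b :: c :: t) N)
    (h : ∀ (x y z : ℕ) (p q r : ℤ), p = a * polygonal m x → q = b * polygonal m y →
      r = c * polygonal m z → (p + q + r - N₀) % D = 0 →
        x % 2 = π a ∧ y % 2 = π b ∧ z % 2 = π c) :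
    TwoClass m l D N₀ π := by
  refine ⟨fun N hN => (hloc N hN).perm hl.symm, fun _ zs hzs hN z hz hd => ?_⟩
  obtain ⟨x, zs₁, hx, h1⟩ := exists_cons_of_map_perm (hzs.trans hl)
  obtain ⟨y, zs₂, hy, h2⟩ := exists_cons_of_map_perm h1
  obtain ⟨u, zs₃, hu, h3⟩ := exists_cons_of_map_perm h2
  have hw := dvd_argVal_of_map_perm (m := m) h3 fun c hc => (ht c hc).2
  rw [argVal_perm hx, argVal_cons, argVal_perm hy, argVal_cons, argVal_perm hu, argVal_cons,
    ← Int.dvd_iff_emod_eq_zero, ← add_assoc, ← add_assoc] at hN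
  have := h x y u _ _ _ rfl rfl rfl (Int.emod_eq_zero_of_dvd ((dvd_add_left hw).1 (by
    rwa [sub_add_eq_add_sub])))
  rcases List.mem_cons.1 (hx.mem_iff.1 hz) with rfl | hz
  · exact this.1
  rcases List.mem_cons.1 (hy.mem_iff.1 hz) with rfl | hz
  · exact this.2.1
  rcases List.mem_cons.1 (hu.mem_iff.1 hz) with rfl | hz
  · exact this.2.2
  · exact absurd (ht _ (h3.mem_iff.1 (List.mem_map_of_mem hz))).2 hd

end TwoClass

theorem Multiples.eight_or_four {t : List ℕ} (ht : Multiples 4 t) :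
    Multiples 8 t ∨ ∃ d s, t.Perm (d :: s) ∧ d % 8 = 4 ∧ Multiples 4 s := by
  by_cases h : ∀ c ∈ t, 8 ∣ c
  · exact Or.inl fun c hc => ⟨(ht c hc).1, h c hc⟩
  · push Not at h
    obtain ⟨d, hd, hd8⟩ := h
    have := (ht d hd).2
    exact Or.inr ⟨d, _, List.perm_cons_erase hd, by omega,
      fun c hc => ht c (List.mem_of_mem_erase hc)⟩

/-- A 2-adic class forcing the parities. If `m ≡ 4 (mod 8)`, the odd coefficients are given odd
arguments and the even ones even arguments; if `m ≡ 0 (mod 8)`, all arguments are even. The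
exceptions are two odd coefficients incongruent modulo 4, and two coefficients `≡ 2 (mod 4)`
incongruent modulo 8, exactly one of which receives an odd argument. -/
theorem TwoShape.exists_twoClass {v : ℕ} {l : List ℕ} (hs : TwoShape l) :
    ∃ D N₀ π, (D = 2 ∨ D = 4 ∨ D = 8) ∧ TwoClass (4 * v + 4) l D N₀ π := by
  have z := val_polygonal_zero (4 * v + 4)
  have e := fun hv : v % 2 = 0 => mul_polygonal_even hv
  have o := fun hv : v % 2 = 1 => mul_polygonal_odd hv
  have hv := Nat.mod_two_eq_zero_or_one v
  cases hs with
  | one a t hl ha ht =>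
    rcases ht.eight_or_four with h8 | ⟨d, s, hp, hd, -⟩
    · rcases hv with hv | hv
      · refine ⟨8, a, fun c => c % 2, by simp, .of_one hl h8 (fun N hN =>
          .of_two_unit_even hv ha (z t) (by push_cast at hN; omega)) fun x p hp h => ?_⟩
        have := e hv a x
        omega
      · refine ⟨8, 0, fun c => 0, by simp, .of_one hl h8 (fun N hN =>
          .of_two_unit_odd hv ha (z t) (by push_cast at hN; omega)) fun x p hp h => ?_⟩
        have := o hv a x
        omega
    · rcases hv with hv | hv
      · refine ⟨4, a, fun c => c % 2, by simp, .of_one hl ht (fun N hN =>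
          (Loc.even_four hv ha hd (z s) (by push_cast at hN; omega)).perm (hp.symm.cons a))
            fun x p hp h => ?_⟩
        have := e hv a x
        omega
      · refine ⟨4, 0, fun c => 0, by simp, .of_one hl ht (fun N hN =>
          (Loc.odd_four hv ha hd (z s) (by push_cast at hN; omega)).perm (hp.symm.cons a))
            fun x p hp h => ?_⟩
        have := o hv a x
        omega
  | one_two a b t hl ha hb ht =>
    rcases hv with hv | hv
    · refine ⟨8, a, fun c => c % 2, by simp, .of_two hl ht (fun N hN =>
        .of_two_unit_even hv ha (z _) (by push_cast at hN; omega)) fun x y p q hp hq h => ?_⟩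
      have := e hv a x
      have := e hv b y
      omega
    · refine ⟨8, 0, fun c => 0, by simp, .of_two hl ht (fun N hN =>
        .of_two_unit_odd hv ha (z _) (by push_cast at hN; omega)) fun x y p q hp hq h => ?_⟩
      have := o hv a x
      have := o hv b y
      omega
  | one_two_four a b c t hl ha hb hc ht =>
    have ht' : Multiples 4 (c :: t) := .cons (by omega) (ht.mono (by simp))
    rcases hv with hv | hv
    · refine ⟨4, a, fun c => c % 2, by simp, .of_two hl ht' (fun N hN =>
        (Loc.even_four hv ha hc (z (b :: t)) (by push_cast at hN; omega)).perm
          (.cons a (.swap _ _ _))) fun x y p q hp hq h => ?_⟩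
      have := e hv a x
      have := e hv b y
      omega
    · refine ⟨4, 0, fun c => 0, by simp, .of_two hl ht' (fun N hN =>
        (Loc.odd_four hv ha hc (z (b :: t)) (by push_cast at hN; omega)).perm
          (.cons a (.swap _ _ _))) fun x y p q hp hq h => ?_⟩
      have := o hv a x
      have := o hv b y
      omega
  | one_two_two a b c t hl ha hb hc ht =>
    by_cases hbc : b % 8 = c % 8
    · rcases hv with hv | hv
      · refine ⟨8, a, fun c => c % 2, by simp, .of_three hl ht (fun N hN =>
          .of_two_unit_even hv ha (z _) (by push_cast at hN; omega))
            fun x y u p q r hp hq hr h => ?_⟩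
        have := e hv a x
        have := e hv b y
        have := e hv c u
        omega
      · refine ⟨8, 0, fun c => 0, by simp, .of_three hl ht (fun N hN =>
          .of_two_unit_odd hv ha (z _) (by push_cast at hN; omega))
            fun x y u p q r hp hq hr h => ?_⟩
        have := o hv a x
        have := o hv b y
        have := o hv c u
        omega
    · rcases hv with hv | hv
      · refine ⟨8, a + b, fun d => if d % 2 = 1 ∨ d % 8 = b % 8 then 1 else 0, by simp,
          .of_three hl ht (fun N hN =>
          .of_two_unit_even hv ha ((z (c :: t)).take b) (by push_cast at hN; omega))
            fun x y u p q r hp hq hr h => ?_⟩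
        have := e hv a x
        have := e hv b y
        have := e hv c u
        push_cast at h
        rw [if_pos (Or.inl ha), if_pos (Or.inr rfl), if_neg (by omega)]
        omega
      · refine ⟨8, b, fun d => if d % 8 = b % 8 then 1 else 0, by simp,
          .of_three hl ht (fun N hN =>
          .of_two_unit_odd hv ha ((z (c :: t)).take b) (by push_cast at hN; omega))
            fun x y u p q r hp hq hr h => ?_⟩
        have := o hv a x
        have := o hv b y
        have := o hv c u
        push_cast at h
        rw [if_neg (by omega), if_pos rfl, if_neg (by omega)]
        omega
  | two a b t hl ha hb ht =>
    by_cases hab : a % 4 = b % 4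
    · rcases ht.eight_or_four with h8 | ⟨d, s, hp, hd, -⟩
      · rcases hv with hv | hv
        · refine ⟨8, a + b, fun c => c % 2, by simp, .of_two hl h8 (fun N hN =>
            .of_two_unit_even hv ha ((z t).take b) (by push_cast at hN; omega))
              fun x y p q hp hq h => ?_⟩
          have := e hv a x
          have := e hv b y
          omega
        · refine ⟨8, 0, fun c => 0, by simp, .of_two hl h8 (fun N hN =>
            .of_two_unit_odd hv ha (z _) (by push_cast at hN; omega)) fun x y p q hp hq h => ?_⟩
          have := o hv a x
          have := o hv b y
          omega
      · have hp' : (a :: d :: b :: s).Perm (a :: b :: t) :=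
          .cons a ((List.Perm.swap _ _ _).trans (.cons b hp.symm))
        rcases hv with hv | hv
        · refine ⟨4, a + b, fun c => c % 2, by simp, .of_two hl ht (fun N hN =>
            (Loc.even_four hv ha hd ((z s).take b) (by push_cast at hN; omega)).perm hp')
              fun x y p q hp hq h => ?_⟩
          have := e hv a x
          have := e hv b y
          omega
        · refine ⟨4, 0, fun c => 0, by simp, .of_two hl ht (fun N hN =>
            (Loc.odd_four hv ha hd (z (b :: s)) (by push_cast at hN; omega)).perm hp')
              fun x y p q hp hq h => ?_⟩
          have := o hv a x
          have := o hv b y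
          omega
    · refine ⟨4, a, fun d => if d % 4 = a % 4 then 1 else 0, by simp,
        .of_two hl ht (fun N hN => .two_odd ha hb (z _) (by push_cast at hN; omega))
          fun x y p q hp hq h => ?_⟩
      push_cast at h
      rw [if_pos rfl, if_neg (by omega)]
      rcases hv with hv | hv
      · have := e hv a x
        have := e hv b y
        omega
      · have := o hv a x
        have := o hv b y
        omega
  | two_two a b c t hl ha hb hc ht =>
    refine ⟨2, 1, fun _ => 0, by simp, fun N hN => Loc.perm hl.symm ?_, by simp⟩
    by_cases h : ((N : ℤ) - a) % 4 = 0
    · exact .two_odd ha hb (z _) (by omega)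
    · exact .two_odd ha hb ((z t).take c) (by push_cast at hN; omega)
  | three a b c t hl ha hb hc ht =>
    rcases hv with hv | hv
    · refine ⟨8, a + b + c, fun c => c % 2, by simp, .of_three hl ht (fun N hN =>
        .of_two_unit_even hv ha (((z t).take c).take b) (by push_cast at hN; omega))
          fun x y u p q r hp hq hr h => ?_⟩
      have := e hv a x
      have := e hv b y
      have := e hv c u
      omega
    · refine ⟨8, 0, fun c => 0, by simp, .of_three hl ht (fun N hN =>
        .of_two_unit_odd hv ha (z _) (by push_cast at hN; omega))
          fun x y u p q r hp hq hr h => ?_⟩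
      have := o hv a x
      have := o hv b y
      have := o hv c u
      omega

/-- The analogue of `TwoClass` at the prime 3: at coefficients that are not divisible by `D` the
argument avoids the residue class of `τ` modulo 3. -/
structure ThreeClass (m : ℕ) (l : List ℕ) (D N₀ τ : ℕ) : Prop where
  loc : ∀ N : ℕ, ((N : ℤ) - N₀) % D = 0 → Loc m 3 l N
  forced : ∀ zs : List (ℕ × ℕ), (zs.map Prod.fst).Perm l →
    (argVal m zs - N₀) % D = 0 → ∀ z ∈ zs, ¬ D ∣ z.1 → z.2 % 3 ≠ τ

theorem mul_polygonal_three_one {m : ℕ} (hm : m % 3 = 1) (a x : ℕ) :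
    (x % 3 = 0 ∧ a * polygonal m x % 3 = 0) ∨ (x % 3 ≠ 0 ∧ (a * polygonal m x - a) % 3 = 0) := by
  obtain ⟨j, rfl⟩ : ∃ j, m = 3 * j + 1 := ⟨m / 3, by omega⟩
  have h := two_mul_polygonal (3 * j + 1) x
  generalize polygonal (3 * j + 1) x = p at h ⊢
  obtain ⟨y, hy⟩ : ∃ y, x = 3 * y + x % 3 := ⟨x / 3, by omega⟩
  have h3 := Nat.mod_lt x (by norm_num : 0 < 3)
  generalize x % 3 = r at hy h3
  subst hy
  push_cast at h
  rw [← Int.dvd_iff_emod_eq_zero, ← Int.dvd_iff_emod_eq_zero]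
  interval_cases r
  · refine Or.inl ⟨by omega, Dvd.dvd.mul_left ⟨p - 3 * y * ((3 * j - 1) * y - (j - 1)), ?_⟩ _⟩
    push_cast at h; linear_combination (-1 : ℤ) * h
  · refine Or.inr ⟨by omega, ⟨a * (p - 1 - ((3 * j - 1) * (3 * y ^ 2 + 2 * y) -
      (j - 1) * (3 * y))), ?_⟩⟩
    push_cast at h; linear_combination (-a : ℤ) * h
  · refine Or.inr ⟨by omega, ⟨a * (p - 1 - 2 * j - ((3 * j - 1) * (3 * y ^ 2 + 4 * y) -
      (j - 1) * (3 * y))), ?_⟩⟩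
    push_cast at h; linear_combination (-a : ℤ) * h

theorem mul_polygonal_three_zero {m : ℕ} (hm : m % 3 = 0) (a x : ℕ) :
    (x % 3 = 1 ∧ (a * polygonal m x - a) % 3 = 0) ∨ (x % 3 ≠ 1 ∧ a * polygonal m x % 3 = 0) := by
  obtain ⟨j, rfl⟩ : ∃ j, m = 3 * j := ⟨m / 3, by omega⟩
  have h := two_mul_polygonal (3 * j) x
  generalize polygonal (3 * j) x = p at h ⊢
  obtain ⟨y, hy⟩ : ∃ y, x = 3 * y + x % 3 := ⟨x / 3, by omega⟩
  have h3 := Nat.mod_lt x (by norm_num : 0 < 3)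
  generalize x % 3 = r at hy h3
  subst hy
  push_cast at h
  rw [← Int.dvd_iff_emod_eq_zero, ← Int.dvd_iff_emod_eq_zero]
  interval_cases r
  · refine Or.inr ⟨by omega, Dvd.dvd.mul_left ⟨p - ((3 * j - 2) * (3 * y ^ 2) -
      (3 * j - 4) * y), ?_⟩ _⟩
    push_cast at h; linear_combination (-1 : ℤ) * h
  · refine Or.inl ⟨by omega, ⟨a * (p - 1 - ((3 * j - 2) * (3 * y ^ 2 + 2 * y) -
      (3 * j - 4) * y)), ?_⟩⟩
    push_cast at h; linear_combination (-a : ℤ) * h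
  · refine Or.inr ⟨by omega, Dvd.dvd.mul_left ⟨p - 2 * j - ((3 * j - 2) * (3 * y ^ 2 + 4 * y) -
      (3 * j - 4) * y), ?_⟩ _⟩
    push_cast at h; linear_combination (-1 : ℤ) * h

theorem exists_threeClass {m : ℕ} (hm : 5 ≤ m) (hm3 : m % 3 ≠ 2) {l : List ℕ}
    (hpos : ∀ c ∈ l, 0 < c) (hu : ∃ c ∈ l, ¬ 3 ∣ c) (hbad : ¬ ∀ N : ℕ, Loc m 3 l N) :
    ∃ N₀ τ, ((m % 3 = 1 ∧ τ = 0) ∨ (m % 3 = 0 ∧ τ = 1)) ∧ ThreeClass m l 3 N₀ τ := by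
  have z := val_polygonal_zero m
  rcases three_structure hm hm3 hpos hu hbad with ⟨a, t, hl, ha, ht⟩ |
    ⟨a, b, t, hl, ha, hab, ht, -⟩
  · have key : ∀ {N₀ τ : ℕ}, (∀ (x : ℕ) (p : ℤ), p = a * polygonal m x → (p - N₀) % 3 = 0 →
        x % 3 ≠ τ) → ∀ zs : List (ℕ × ℕ), (zs.map Prod.fst).Perm l →
        (argVal m zs - N₀) % ((3 : ℕ) : ℤ) = 0 → ∀ z ∈ zs, ¬ 3 ∣ z.1 → z.2 % 3 ≠ τ := by
      intro N₀ τ h zs hzs hN z hz hd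
      obtain ⟨x, zs₁, hx, h1⟩ := exists_cons_of_map_perm (hzs.trans hl)
      have hw := dvd_argVal_of_map_perm (m := m) h1 fun c hc => (ht c hc).2
      rw [argVal_perm hx, argVal_cons] at hN
      have := h x _ rfl (by push_cast at hN hw; omega)
      rcases List.mem_cons.1 (hx.mem_iff.1 hz) with rfl | hz
      · exact this
      · exact absurd (ht _ (h1.mem_iff.1 (List.mem_map_of_mem hz))).2 hd
    rcases (by omega : m % 3 = 1 ∨ m % 3 = 0) with h | h
    · refine ⟨a, 0, Or.inl ⟨h, rfl⟩, fun N hN => (Loc.three_one h ha (z t)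
        (by push_cast at hN; omega)).perm hl.symm, key fun x p hp hN => ?_⟩
      have := mul_polygonal_three_one h a x
      omega
    · refine ⟨0, 1, Or.inr ⟨h, rfl⟩, fun N hN => (Loc.three_zero h ha (z t)
        (by push_cast at hN; omega)).perm hl.symm, key fun x p hp hN => ?_⟩
      have := mul_polygonal_three_zero h a x
      omega
  · have key : ∀ {N₀ τ : ℕ}, (∀ (x y : ℕ) (p q : ℤ), p = a * polygonal m x →
        q = b * polygonal m y → (p + q - N₀) % 3 = 0 → x % 3 ≠ τ ∧ y % 3 ≠ τ) →
        ∀ zs : List (ℕ × ℕ), (zs.map Prod.fst).Perm l →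
        (argVal m zs - N₀) % ((3 : ℕ) : ℤ) = 0 → ∀ z ∈ zs, ¬ 3 ∣ z.1 → z.2 % 3 ≠ τ := by
      intro N₀ τ h zs hzs hN z hz hd
      obtain ⟨x, zs₁, hx, h1⟩ := exists_cons_of_map_perm (hzs.trans hl)
      obtain ⟨y, zs₂, hy, h2⟩ := exists_cons_of_map_perm h1
      have hw := dvd_argVal_of_map_perm (m := m) h2 fun c hc => (ht c hc).2
      rw [argVal_perm hx, argVal_cons, argVal_perm hy, argVal_cons] at hN
      have := h x y _ _ rfl rfl (by push_cast at hN hw; omega)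
      rcases List.mem_cons.1 (hx.mem_iff.1 hz) with rfl | hz
      · exact this.1
      rcases List.mem_cons.1 (hy.mem_iff.1 hz) with rfl | hz
      · exact this.2
      · exact absurd (ht _ (h2.mem_iff.1 (List.mem_map_of_mem hz))).2 hd
    rcases (by omega : m % 3 = 1 ∨ m % 3 = 0) with h | h
    · refine ⟨a + b, 0, Or.inl ⟨h, rfl⟩, fun N hN => (Loc.three_one h ha ((z t).take b)
        (by push_cast at hN; omega)).perm hl.symm, key fun x y p q hp hq hN => ?_⟩
      have := mul_polygonal_three_one h a x
      have := mul_polygonal_three_one h b y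
      omega
    · refine ⟨0, 1, Or.inr ⟨h, rfl⟩, fun N hN => (Loc.three_zero h ha (z (b :: t))
        (by push_cast at hN; omega)).perm hl.symm, key fun x y p q hp hq hN => ?_⟩
      have := mul_polygonal_three_zero h a x
      have := mul_polygonal_three_zero h b y
      omega

/-! ### The primes greater than 3 with an obstruction divide `(m - 3) (m - 4)` -/

/-- The coefficients of a form that is not universal at the prime `p ≥ 5`: all but one or two are
divisible by `p`, and in the second case the two exceptions form an anisotropic pair. -/
inductive PrimeShape (p : ℕ) (l : List ℕ) : Prop
  | one (a : ℕ) (t : List ℕ) (hl : l.Perm (a :: t)) (ha : ¬ p ∣ a) (ht : ∀ c ∈ t, p ∣ c)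
  | two (a b : ℕ) (t : List ℕ) (hl : l.Perm (a :: b :: t)) (hle : a ≤ b) (ha : ¬ p ∣ a)
      (hb : ¬ p ∣ b) (han : ∀ y : ℤ, ¬ (p : ℤ) ∣ a * y ^ 2 + b) (ht : ∀ c ∈ t, p ∣ c)

theorem primeShape {m p : ℕ} (hp : p.Prime) (hp2 : p ≠ 2) {l : List ℕ}
    (hu : ∃ c ∈ l, ¬ p ∣ c) (hbad : ¬ ∀ N : ℕ, Loc m p l N) :
    ¬ (p : ℤ) ∣ (m : ℤ) - 2 ∧ PrimeShape p l := by
  have hm : ¬ (p : ℤ) ∣ (m : ℤ) - 2 := fun h => by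
    obtain ⟨c, hc, hcp⟩ := hu
    exact hbad fun N => (Loc.of_dvd_sub_two hp hp2 h hcp _ N).perm (List.perm_cons_erase hc).symm
  refine ⟨hm, ?_⟩
  obtain ⟨s, t, hl, hs, ht⟩ := exists_perm_append (fun c => ¬ p ∣ c) l
  simp only [not_not] at ht
  rcases s with _ | ⟨a, _ | ⟨b, _ | ⟨c, s⟩⟩⟩
  · obtain ⟨c, hc, hcp⟩ := hu
    exact absurd (ht c (by simpa using hl.mem_iff.1 hc)) hcp
  · exact .one a t hl (hs a (by simp)) ht
  · have ha := hs a (by simp)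
    have hb := hs b (by simp)
    have iso : ∀ {a b : ℕ}, l.Perm (a :: b :: t) → ¬ p ∣ a → ¬ p ∣ b →
        ∀ y : ℤ, ¬ (p : ℤ) ∣ a * y ^ 2 + b := fun hl ha hb y h =>
      hbad fun N => (Loc.of_qLoc_odd hp hp2 hm (QLoc.isotropic hp hp2 ha hb h t)).perm hl.symm
    rcases le_total a b with h | h
    · exact .two a b t hl h ha hb (iso hl ha hb) ht
    · have hl' := hl.trans (.swap b a t)
      exact .two b a t hl' h hb ha (iso hl' hb ha) ht
  · exact absurd (fun N => (Loc.of_qLoc_odd hp hp2 hm (QLoc.three_units hp hp2 (hs a (by simp))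
      (hs b (by simp)) (hs c (by simp)) _ (s ++ t))).perm hl.symm) hbad

/-- Every number that satisfies all local conditions is represented. -/
def ListRegular (m : ℕ) (l : List ℕ) : Prop :=
  ∀ N : ℕ, (∀ p : ℕ, p.Prime → Loc m p l N) → Rep m l N

theorem ListRegular.perm {m : ℕ} {l l' : List ℕ} (h : ListRegular m l) (hp : l.Perm l') :
    ListRegular m l' := fun N hN => (h N fun p hpp => (hN p hpp).perm hp.symm).perm hp

/-- A non-negative value at integral arguments is a value at non-negative arguments. -/
theorem ListRegular.rep_of_val {m : ℕ} {l : List ℕ} (h : ListRegular m l) {w : ℤ}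
    (hw : Val (polygonal m) l w) (h0 : 0 ≤ w) : Rep m l w := by
  obtain ⟨N, rfl⟩ := Int.eq_ofNat_of_zero_le h0
  exact h N fun p _ => Loc.of_val hw

theorem polygonal_le_two {m : ℕ} (hm : 4 ≤ m) {x : ℕ} (h : polygonal m x < 3 * m - 3) :
    polygonal m x = 0 ∨ polygonal m x = 1 ∨ polygonal m x = m := by
  have := polygonal_cases hm x
  omega

theorem polygonal_le_one {m : ℕ} (hm : 4 ≤ m) {x : ℕ} (h : polygonal m x < m) :
    polygonal m x = 0 ∨ polygonal m x = 1 := by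
  have := polygonal_cases hm x
  omega

theorem dvd_of_two {p u v c : ℤ} (hu : p ∣ u) (hv : p ∣ v) (k j : ℤ) (h : k * u + j * v = c) :
    p ∣ c := h ▸ dvd_add (hu.mul_left k) (hv.mul_left j)

theorem prime_cases {p : ℕ} (hp : p.Prime) (h5 : 5 ≤ p) {c : ℤ} (h : (p : ℤ) ∣ c) (h0 : c ≠ 0)
    (hc : c.natAbs ≤ 18) : p = 5 ∨ p = 7 ∨ p = 11 ∨ p = 13 ∨ p = 17 := by
  have h1 : p ≤ 18 := (Nat.le_of_dvd (by omega) (Int.natCast_dvd.1 h)).trans hc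
  interval_cases p <;> first | omega | (exfalso; revert hp; norm_num)

theorem anisotropic_dvd {p a b : ℕ} (hp : p.Prime) (ha : ¬ p ∣ a)
    (han : ∀ y : ℤ, ¬ (p : ℤ) ∣ a * y ^ 2 + b) {x y : ℤ} (h : (p : ℤ) ∣ a * x ^ 2 + b * y ^ 2) :
    (p : ℤ) ∣ x ∧ (p : ℤ) ∣ y := by
  have hpi : Prime (p : ℤ) := Nat.prime_iff_prime_int.1 hp
  have hy : (p : ℤ) ∣ y := by
    by_contra hy
    obtain ⟨u, z, huz⟩ := (hpi.coprime_iff_not_dvd.2 hy)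
    refine han (x * z) (dvd_of_two h (dvd_refl (p : ℤ)) (z ^ 2) (b * u * (1 + z * y)) ?_)
    linear_combination (b * (1 + z * y) : ℤ) * huz
  have h2 : (p : ℤ) ∣ a * x ^ 2 :=
    (dvd_add_left (Dvd.dvd.mul_left (hy.trans (dvd_pow_self y two_ne_zero)) (b : ℤ))).1 h
  exact ⟨hpi.dvd_of_dvd_pow ((hpi.dvd_or_dvd h2).resolve_left (by exact_mod_cast ha)), hy⟩

/-- The setting of an anisotropic pair of units at a prime `p ≥ 5`. -/
structure PrimePair (m p a b : ℕ) (t : List ℕ) : Prop where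
  hm : 9 ≤ m
  prime : p.Prime
  five_le : 5 ≤ p
  hm2 : ¬ (p : ℤ) ∣ (m : ℤ) - 2
  ha0 : 0 < a
  hle : a ≤ b
  ha : ¬ (p : ℤ) ∣ a
  han : ∀ y : ℤ, ¬ (p : ℤ) ∣ a * y ^ 2 + b
  ht : ∀ c ∈ t, p ∣ c
  regular : ListRegular m (a :: b :: t)

section PrimePair
variable {m p a b : ℕ} {t : List ℕ}

theorem PrimePair.rep (h : PrimePair m p a b t) (s u : ℤ)
    (h0 : 0 ≤ a * polygonal m s + b * polygonal m u) : ∃ x y : ℕ,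
      a * polygonal m x + b * polygonal m y ≤ a * polygonal m s + b * polygonal m u ∧
      (p : ℤ) ∣ a * polygonal m s + b * polygonal m u -
        (a * polygonal m x + b * polygonal m y) := by
  have hm := h.hm
  obtain ⟨x, _, ⟨y, w, hw, rfl⟩, e⟩ := h.regular.rep_of_val
    (((val_polygonal_zero m t).cons b u).cons a s) (by simpa using h0)
  have hw0 := Rep.nonneg (by omega : 4 ≤ m) hw
  simp only [add_zero] at e
  exact ⟨x, y, by omega, by rw [e]; convert Val.dvd h.ht hw using 1; ring⟩

/-- If the argument `-s` is degenerate modulo `p` and `s < p / 2`, then representing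
`(a + b) P(-s)` forces arguments congruent to `-s`, and non-negative ones are too large. -/
theorem PrimePair.degenerate (h : PrimePair m p a b t) (s : ℕ) (hs0 : 1 ≤ s) (hs : 2 * s < p)
    (hd : (p : ℤ) ∣ 2 * ((m : ℤ) - 2) * s + ((m : ℤ) - 4)) : False := by
  have hpi : Prime (p : ℤ) := Nat.prime_iff_prime_int.1 h.prime
  have hm : (9 : ℤ) ≤ m := by exact_mod_cast h.hm
  have q := two_mul_polygonal m
  have hneg : 0 ≤ polygonal m (-s) := by
    have := q (-s)
    nlinarith
  have hb0 : (0 : ℤ) < b := by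
    have := h.ha0
    have := h.hle
    omega
  have ha0 : (0 : ℤ) < a := by exact_mod_cast h.ha0
  obtain ⟨x, y, hle, hdvd⟩ := h.rep (-s) (-s) (by positivity)
  have hxy := anisotropic_dvd h.prime (by exact_mod_cast h.ha) h.han
    (x := 2 * ((m : ℤ) - 2) * x - ((m : ℤ) - 4)) (y := 2 * ((m : ℤ) - 2) * y - ((m : ℤ) - 4))
    (dvd_of_two hdvd hd (-(8 * ((m : ℤ) - 2)))
      ((a + b) * (2 * ((m : ℤ) - 2) * s + ((m : ℤ) - 4))) (by
      linear_combination (-4 * ((m : ℤ) - 2) * (a + b)) * q (-s) +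
        4 * ((m : ℤ) - 2) * a * q x + 4 * ((m : ℤ) - 2) * b * q y))
  have large : ∀ x : ℕ, (p : ℤ) ∣ 2 * ((m : ℤ) - 2) * x - ((m : ℤ) - 4) →
      polygonal m (-s) < polygonal m x := by
    intro x hx
    have h1 : (p : ℤ) ∣ (2 * ((m : ℤ) - 2)) * ((x + s : ℕ) : ℤ) :=
      dvd_of_two hx hd 1 1 (by push_cast; ring)
    have h2 : ¬ (p : ℤ) ∣ 2 := fun hd => by
      have := Int.le_of_dvd (by simp) hd
      have := h.five_le
      omega
    have h3 : p ∣ x + s := by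
      rcases hpi.dvd_or_dvd h1 with h1 | h1
      · rcases hpi.dvd_or_dvd h1 with h1 | h1
        · exact absurd h1 h2
        · exact absurd h1 h.hm2
      · exact_mod_cast h1
    have h4 := Nat.le_of_dvd (by omega) h3
    refine lt_of_lt_of_le ?_ (polygonal_mono (by omega : 4 ≤ m) (x := s + 1) (by omega))
    have e1 := q (-s)
    have e2 := q ((s : ℤ) + 1)
    rw [show ((s + 1 : ℕ) : ℤ) = (s : ℤ) + 1 by push_cast; rfl]
    nlinarith
  have h1 := mul_lt_mul_of_pos_left (large x hxy.1) ha0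
  have h2 := mul_lt_mul_of_pos_left (large y hxy.2) hb0
  omega

/-- A divisibility between the values 0, 1 and `m` of `polygonal m` at small arguments leaves few
primes when `m` is known modulo `p`. -/
theorem PrimePair.prime_cases (h : PrimePair m p a b t) {C α β g k P Q : ℤ}
    (F : (p : ℤ) ∣ C - g * (α * P + β * Q)) (hk : (p : ℤ) ∣ g * m - k)
    (hP : P = 0 ∨ P = 1 ∨ P = m) (hQ : Q = 0 ∨ Q = 1 ∨ Q = m)
    (hc : ∀ r ∈ [0, g, k], ∀ s ∈ [0, g, k], C - (α * r + β * s) ≠ 0 ∧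
      (C - (α * r + β * s)).natAbs ≤ 18) : p = 5 ∨ p = 7 ∨ p = 11 ∨ p = 13 ∨ p = 17 := by
  have key : ∀ P : ℤ, P = 0 ∨ P = 1 ∨ P = m → ∃ r ∈ [0, g, k], (p : ℤ) ∣ g * P - r := by
    rintro P (rfl | rfl | rfl)
    exacts [⟨0, by simp⟩, ⟨g, by simp⟩, ⟨k, by simp [hk]⟩]
  obtain ⟨r, hr, hr'⟩ := key P hP
  obtain ⟨s, hs, hs'⟩ := key Q hQ
  obtain ⟨h0, h1⟩ := hc r hr s hs
  refine PolygonalForm.prime_cases h.prime h.five_le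
    (dvd_of_two F (dvd_of_two hr' hs' α β rfl) 1 1 ?_) h0 h1
  ring

theorem PrimePair.dvd (h : PrimePair m p a b t) :
    (p : ℤ) ∣ (m : ℤ) - 3 ∨ (p : ℤ) ∣ (m : ℤ) - 4 := by
  have hpi : Prime (p : ℤ) := Nat.prime_iff_prime_int.1 h.prime
  have hm : (9 : ℤ) ≤ m := by exact_mod_cast h.hm
  have hm4 : 4 ≤ m := by omega
  have ha0 : (0 : ℤ) < a := by exact_mod_cast h.ha0
  have hab : (a : ℤ) ≤ b := by exact_mod_cast h.hle
  have cancel : ∀ k : ℤ, (p : ℤ) ∣ a * k → (p : ℤ) ∣ k := fun k hk =>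
    (hpi.dvd_or_dvd hk).resolve_left h.ha
  have h5 := h.five_le
  -- bounds for the arguments
  have bound : ∀ {c K N : ℤ} {x y : ℕ} {d : ℤ}, 0 < c → 0 ≤ d → c * polygonal m x +
      d * polygonal m y ≤ N → N < c * K → polygonal m x < K := fun hc hd h1 h2 => by
    have := fun y => mul_nonneg hd (polygonal_nonneg hm4 y)
    exact lt_of_mul_lt_mul_left (lt_of_le_of_lt ((le_add_of_nonneg_right (this _)).trans h1) h2) hc.le
  have p1 := polygonal_neg_one m
  have p2 := polygonal_neg_two m
  have p0 := polygonal_zero m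
  have p1' := polygonal_one m
  -- the value `a P(-1)`
  obtain ⟨x, y, hle, hd⟩ := h.rep (-1) 0 (by rw [p1, p0]; nlinarith)
  rw [p1, p0] at hle hd
  have hx := polygonal_le_one hm4 (bound (K := m) ha0 (by omega) hle (by nlinarith))
  rw [add_comm] at hle
  have hy := polygonal_le_one hm4 (bound (K := m) (by omega) ha0.le hle (by nlinarith))
  obtain ⟨ε, hε, hxε⟩ : ∃ ε : ℤ, (ε = 0 ∨ ε = 1) ∧ polygonal m x = ε := by
    rcases hx with h | h <;> exact ⟨_, by simp, h⟩
  rw [hxε] at hle hd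
  rcases hy with hy | hy
  · rw [hy] at hd
    have := cancel ((m : ℤ) - 3 - ε) (by convert hd using 1; ring)
    rcases hε with rfl | rfl
    · left; simpa using this
    · right; convert this using 1; ring
  rw [hy] at hle hd
  by_contra hno
  push Not at hno
  have hb : (p : ℤ) ∣ a * ((m : ℤ) - 3 - ε) - b := by convert hd using 1; ring
  have hbm : (b : ℤ) ≤ a * ((m : ℤ) - 3) := by
    have := mul_nonneg ha0.le (by omega : 0 ≤ ε)
    linarith
  clear hle hd hy hx hxε
  -- the value `a P(-1) + b P(1)`
  obtain ⟨x, y, hle, hd⟩ := h.rep (-1) 1 (by rw [p1, p1']; nlinarith)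
  rw [p1, p1'] at hle hd
  have hx := polygonal_le_two hm4 (bound (K := 3 * m - 3) ha0 (by omega) hle (by nlinarith))
  rw [add_comm] at hle
  have hy := polygonal_le_one hm4 (bound (K := m) (by omega) ha0.le hle (by nlinarith))
  have hkey : (p : ℤ) ∣ 2 * m - 7 ∨ ((p : ℤ) ∣ (m : ℤ) - 6 ∧ ε = 0) ∨
      ((p : ℤ) ∣ (m : ℤ) - 7 ∧ ε = 1) := by
    rcases hy with hy | hy
    · rw [hy] at hd
      have h1 := cancel (2 * m - 6 - ε - polygonal m x) (dvd_of_two hd hb 1 1 (by ring))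
      have h2 : ∀ k : ℤ, (p : ℤ) ∣ 2 * k → (p : ℤ) ∣ k := fun k hk =>
        (hpi.dvd_or_dvd hk).resolve_left fun h2 => by
          have := Int.le_of_dvd (by simp) h2
          omega
      rcases hx with hx | hx | hx <;> rcases hε with rfl | rfl <;> rw [hx] at h1
      · exact absurd (h2 _ (by convert h1 using 1; ring)) hno.1
      · left; convert h1 using 1; ring
      · left; convert h1 using 1; ring
      · exact absurd (h2 _ (by convert h1 using 1; ring)) hno.2
      · exact Or.inr (Or.inl ⟨by convert h1 using 1; ring, rfl⟩)
      · exact Or.inr (Or.inr ⟨by convert h1 using 1; ring, rfl⟩)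
    · rw [hy] at hd
      have h1 := cancel (m - 3 - polygonal m x) (by convert hd using 1; ring)
      rcases hx with hx | hx | hx <;> rw [hx] at h1
      · exact absurd (by simpa using h1) hno.1
      · exact absurd (by convert h1 using 1; ring) hno.2
      · have := Int.le_of_dvd (by norm_num : (0 : ℤ) < 3)
          (dvd_of_two h1 h1 (-1) 0 (by ring))
        omega
  clear hle hd hy hx
  -- the value `a P(-2)`
  obtain ⟨x, y, hle, hd⟩ := h.rep (-2) 0 (by rw [p2, p0]; nlinarith)
  rw [p2, p0] at hle hd
  have hx := polygonal_le_two hm4 (bound (K := 3 * m - 3) ha0 (by omega) hle (by nlinarith))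
  rw [add_comm] at hle
  have hy := polygonal_le_two hm4 (bound (K := 3 * m - 3) (by omega) ha0.le hle (by nlinarith))
  have hE := cancel (3 * m - 8 - polygonal m x - (m - 3 - ε) * polygonal m y)
    (dvd_of_two hd hb 1 (-polygonal m y) (by ring))
  have hm2 := h.hm2
  rcases hkey with h7 | ⟨h6, rfl⟩ | ⟨h7, rfl⟩
  · rcases hε with rfl | rfl
    · have F : (p : ℤ) ∣ 10 - 4 * polygonal m x - 2 * polygonal m y :=
        dvd_of_two hE h7 4 (2 * polygonal m y - 6) (by ring)
      clear hE
      have key := h.prime_cases (C := 10) (α := 2) (β := 1) (g := 2) (k := 7)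
        (F.trans (dvd_of_eq (by ring))) (by simpa using h7) hx hy (by decide)
      rcases key with rfl | rfl | rfl | rfl | rfl <;>
        rcases hx with hx | hx | hx <;> rcases hy with hy | hy | hy <;>
        rw [hx, hy] at F <;>
        first
          | (clear hb hle hd hbm; omega)
          | exact h.degenerate 1 (by simp) (by simp) (by omega)
          | exact h.degenerate 2 (by simp) (by simp) (by omega)
    · have F : (p : ℤ) ∣ 10 - 4 * polygonal m x + 2 * polygonal m y :=
        dvd_of_two hE h7 4 (2 * polygonal m y - 6) (by ring)
      clear hE
      have key := h.prime_cases (C := 10) (α := 2) (β := -1) (g := 2) (k := 7)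
        (F.trans (dvd_of_eq (by ring))) (by simpa using h7) hx hy (by decide)
      rcases key with rfl | rfl | rfl | rfl | rfl <;>
        rcases hx with hx | hx | hx <;> rcases hy with hy | hy | hy <;>
        rw [hx, hy] at F <;>
        first
          | (clear hb hle hd hbm; omega)
          | exact h.degenerate 1 (by simp) (by simp) (by omega)
          | exact h.degenerate 3 (by simp) (by simp) (by omega)
          | skip
      -- here `p = 13`, the arguments of `a` and `b` are 1 and 2, and so `b < 3 a`
      rw [hx, hy] at hle
      have hb3 : (b : ℤ) < 3 * a := by nlinarith
      clear hle hd hx hy F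
      obtain ⟨x, y, hle, hd⟩ := h.rep 1 (-1) (by rw [p1, p1']; nlinarith)
      rw [p1, p1'] at hle hd
      have hx := polygonal_le_two hm4 (bound (K := 3 * m - 3) ha0 (by omega) hle (by nlinarith))
      rw [add_comm] at hle
      have hy := polygonal_le_one hm4 (bound (K := m) (by omega) ha0.le hle (by nlinarith))
      have h10 : ((13 : ℕ) : ℤ) ∣ (m : ℤ) - 10 := by clear hb hle hd hbm; omega
      have hb6 : ((13 : ℕ) : ℤ) ∣ 6 * a - b := dvd_of_two hb h10 1 (-a) (by ring)
      have F := cancel (1 + 6 * (m - 3) - polygonal m x - 6 * polygonal m y)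
        (dvd_of_two hd hb6 1 (m - 3 - polygonal m y) (by ring))
      clear hb hb6 hd hle hbm
      omega
  · have F : (p : ℤ) ∣ 10 - polygonal m x - 3 * polygonal m y :=
      dvd_of_two hE h6 1 (polygonal m y - 3) (by ring)
    clear hE
    have key := h.prime_cases (C := 10) (α := 1) (β := 3) (g := 1) (k := 6)
      (F.trans (dvd_of_eq (by ring))) (by simpa using h6) hx hy (by decide)
    rcases key with rfl | rfl | rfl | rfl | rfl <;>
      rcases hx with hx | hx | hx <;> rcases hy with hy | hy | hy <;>
      rw [hx, hy] at F <;>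
      first
        | (clear hb hle hd hbm; omega)
        | exact h.degenerate 1 (by simp) (by simp) (by omega)
        | exact h.han 2 (dvd_of_two hb (dvd_add (dvd_refl _) h6) (-1) a (by push_cast; ring))
  · have F : (p : ℤ) ∣ 13 - polygonal m x - 3 * polygonal m y :=
      dvd_of_two hE h7 1 (polygonal m y - 3) (by ring)
    clear hE
    have key := h.prime_cases (C := 13) (α := 1) (β := 3) (g := 1) (k := 7)
      (F.trans (dvd_of_eq (by ring))) (by simpa using h7) hx hy (by decide)
    rcases key with rfl | rfl | rfl | rfl | rfl <;>
      rcases hx with hx | hx | hx <;> rcases hy with hy | hy | hy <;>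
      rw [hx, hy] at F <;>
      first
        | (clear hb hle hd hbm; omega)
        | exact h.degenerate 1 (by simp) (by simp) (by omega)

end PrimePair

theorem ListRegular.prime_dvd {m p : ℕ} {l : List ℕ} (hm : 9 ≤ m) (hpos : ∀ c ∈ l, 0 < c)
    (H : ListRegular m l) (hp : p.Prime) (h5 : 5 ≤ p) (hm2 : ¬ (p : ℤ) ∣ (m : ℤ) - 2)
    (hs : PrimeShape p l) : p ∣ m - 4 ∨ p ∣ m - 3 := by
  suffices h : (p : ℤ) ∣ (m : ℤ) - 3 ∨ (p : ℤ) ∣ (m : ℤ) - 4 by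
    rcases h with h | h
    · right
      exact Int.natCast_dvd_natCast.1 (by rw [Nat.cast_sub (by omega)]; exact_mod_cast h)
    · left
      exact Int.natCast_dvd_natCast.1 (by rw [Nat.cast_sub (by omega)]; exact_mod_cast h)
  cases hs with
  | one a t hl ha ht =>
    have hpi : Prime (p : ℤ) := Nat.prime_iff_prime_int.1 hp
    have ha0 : (0 : ℤ) < a := by exact_mod_cast hpos a (hl.mem_iff.2 (by simp))
    have p1 := polygonal_neg_one m
    obtain ⟨x, w, hw, e⟩ := (H.perm hl).rep_of_val ((val_polygonal_zero m t).cons a (-1))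
      (by rw [p1]; nlinarith)
    have hw0 := Rep.nonneg (by omega : 4 ≤ m) hw
    have hwd := Val.dvd ht hw
    have cancel : ∀ k : ℤ, (p : ℤ) ∣ a * k → (p : ℤ) ∣ k := fun k hk =>
      (hpi.dvd_or_dvd hk).resolve_left (by exact_mod_cast ha)
    rw [p1] at e
    simp only at e
    have hx := polygonal_le_one (m := m) (x := x) (by omega)
      (lt_of_mul_lt_mul_left (a := (a : ℤ)) (by nlinarith) ha0.le)
    rcases hx with hx | hx <;> rw [hx] at e
    · exact Or.inl (cancel _ (by convert hwd using 1; linarith))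
    · exact Or.inr (cancel _ (by convert hwd using 1; linarith))
  | two a b t hl hle ha hb han ht =>
    exact PrimePair.dvd ⟨hm, hp, h5, hm2, hpos a (hl.mem_iff.2 (by simp)), hle,
      by exact_mod_cast ha, han, ht, H.perm hl⟩

/-! ### The number of admissible arguments of a coefficient -/

theorem le_prod_sub_one {S : Finset ℕ} (h5 : ∀ p ∈ S, 5 ≤ p) {p : ℕ} (hp : p ∈ S) :
    p - 1 ≤ ∏ q ∈ S, (q - 1) := by
  rw [← Finset.mul_prod_erase S _ hp]
  refine Nat.le_mul_of_pos_right _ (Finset.prod_pos fun q hq => ?_)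
  have := h5 q (Finset.mem_of_mem_erase hq)
  omega

theorem prod_sub_one_of_two {S : Finset ℕ} (h5 : ∀ p ∈ S, p.Prime ∧ 5 ≤ p) {p q : ℕ} (hp : p ∈ S)
    (hq : q ∈ S) (hpq : p < q) :
    24 ≤ ∏ r ∈ S, (r - 1) ∧ 16 * ∏ r ∈ S, r ≤ (∏ r ∈ S, (r - 1)) ^ 2 := by
  have hq' : q ∈ S.erase p := Finset.mem_erase.2 ⟨by omega, hq⟩
  rw [← Finset.mul_prod_erase S _ hp, ← Finset.mul_prod_erase S _ hp,
    ← Finset.mul_prod_erase _ _ hq', ← Finset.mul_prod_erase _ _ hq']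
  have hR : ∀ r ∈ (S.erase p).erase q, 5 ≤ r := fun r hr =>
    (h5 r (Finset.mem_of_mem_erase (Finset.mem_of_mem_erase hr))).2
  generalize (S.erase p).erase q = R at hR
  have h1 : 1 ≤ ∏ r ∈ R, (r - 1) := Finset.prod_pos fun r hr =>
    Nat.sub_pos_of_lt (by have := hR r hr; omega)
  have h2 : ∏ r ∈ R, r ≤ (∏ r ∈ R, (r - 1)) ^ 2 := by
    rw [← Finset.prod_pow]
    refine Finset.prod_le_prod' fun r hr => ?_
    obtain ⟨k, rfl⟩ := Nat.exists_eq_add_of_le (hR r hr)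
    rw [show 5 + k - 1 = 4 + k by omega]
    nlinarith
  have hp5 := (h5 p hp).2
  have hq7 : 7 ≤ q := by
    have h := (h5 q hq).1
    by_contra hlt
    have : q = 6 := by omega
    subst this
    revert h
    norm_num
  obtain ⟨i, rfl⟩ := Nat.exists_eq_add_of_le hp5
  obtain ⟨j, rfl⟩ := Nat.exists_eq_add_of_le hq7
  rw [show 5 + i - 1 = 4 + i by omega, show 7 + j - 1 = 6 + j by omega]
  generalize ∏ r ∈ R, (r - 1) = A at h1 h2 ⊢
  generalize ∏ r ∈ R, r = B at h2 ⊢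
  constructor
  · have : 24 ≤ (4 + i) * (6 + j) := by nlinarith
    calc 24 ≤ ((4 + i) * (6 + j)) * 1 := by omega
      _ ≤ ((4 + i) * (6 + j)) * A := Nat.mul_le_mul le_rfl h1
      _ = _ := by ring
  · have : 16 * ((5 + i) * (7 + j)) ≤ ((4 + i) * (6 + j)) ^ 2 := by
      have h3 : 16 * (5 + i) ≤ 5 * (4 + i) ^ 2 := by nlinarith
      have h4 : 5 * (7 + j) ≤ (6 + j) ^ 2 := by nlinarith
      have := Nat.mul_le_mul h3 h4
      nlinarith
    calc 16 * ((5 + i) * ((7 + j) * B)) = 16 * ((5 + i) * (7 + j)) * B := by ring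
      _ ≤ ((4 + i) * (6 + j)) ^ 2 * A ^ 2 := Nat.mul_le_mul this h2
      _ = _ := by ring

theorem five_le_prod_sub_one {S : Finset ℕ} (h5 : ∀ p ∈ S, p.Prime ∧ 5 ≤ p) (hS : S.Nonempty)
    (hne : S ≠ {5}) : 5 ≤ ∏ q ∈ S, (q - 1) := by
  obtain ⟨p, hp, hp5⟩ : ∃ p ∈ S, p ≠ 5 := by
    by_contra h
    push Not at h
    exact hne (Finset.eq_singleton_iff_nonempty_unique_mem.2 ⟨hS, h⟩)
  have := le_prod_sub_one (fun p hp => (h5 p hp).2) hp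
  have := (h5 p hp).2
  omega

/-- A bound for the arguments of a coefficient when the primes dividing `m - 4` and those dividing
`m - 3` both occur among the primes `p` that do not divide it. -/
theorem two_sided_bound {M X d c V s : ℤ} (hM : 0 < M) (hd : 0 < d) (hV : 0 < V)
    (hX : M * (X * (X - 1)) < 2 * d * V) (hX0 : 0 ≤ X * (X - 1)) (hcV : c * V < M ^ 2)
    (hs : 16 * V ≤ ((s + 1) ^ 2) ^ 2) :
    4 * c * (X * (X - 1)) ^ 2 < (d * (s + 1) ^ 2) ^ 2 := by
  generalize X * (X - 1) = Y at *
  have h1 : (M * Y) ^ 2 < (2 * d * V) ^ 2 := by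
    have := mul_nonneg hM.le hX0
    nlinarith
  have h2 : (c * Y ^ 2) * V < (4 * d ^ 2 * V) * V := by
    have : (c * V) * Y ^ 2 ≤ M ^ 2 * Y ^ 2 := by gcongr
    nlinarith
  have h3 := lt_of_mul_lt_mul_right h2 hV.le
  have h4 : d ^ 2 * (16 * V) ≤ d ^ 2 * ((s + 1) ^ 2) ^ 2 := by gcongr
  nlinarith

theorem not_sq_lt_of_le {C d Y σ k j : ℤ} (h : C * Y ^ 2 < (d * σ) ^ 2) (hσ : 0 ≤ σ) (hk : 0 ≤ k)
    (hC : 0 ≤ C) (hj0 : 0 < j) (hkj : k * σ ≤ j * Y) (hj : d ^ 2 * j ^ 2 ≤ C * k ^ 2) : False := by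
  have h1 : (k * σ) ^ 2 ≤ (j * Y) ^ 2 := pow_le_pow_left₀ (mul_nonneg hk hσ) hkj 2
  have h2 := mul_le_mul_of_nonneg_left h1 hC
  have h3 := mul_le_mul_of_nonneg_right hj (sq_nonneg σ)
  have h5 := mul_lt_mul_of_pos_left h (pow_pos hj0 2)
  nlinarith

/-- The combinations of a window `P_m(x) < d * V` and congruence conditions on `x` that occur for
the arguments of a coefficient. The largest argument is `X`, and at most `s + 1` arguments
satisfy the conditions. -/
inductive WindowType (m d s X : ℕ) : Prop
  | one (hd : d = 1) (hs : s ≤ X)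
  | two (hm : m % 4 = 0) (hd : d = 2) (hs : s ≤ X)
  | three (hm : m % 3 = 1 ∨ m % 3 = 0) (hd : d = 3) (hs : 3 * s ≤ 2 * X)
  | six_one (hm : m % 4 = 0) (hm3 : m % 3 = 1) (hd : d = 6) (hs : 3 * s ≤ 2 * X) (hX : X % 3 ≠ 0)
  | six_zero (hm : m % 4 = 0) (hm3 : m % 3 = 0) (hd : d = 6) (hs : 3 * s ≤ 2 * X)
  | eight (hm : m % 4 = 0) (hd : d = 8) (hs : 2 * s ≤ X)
  | eight_three_one (hm : m % 4 = 0) (hm3 : m % 3 = 1) (hd : d = 24) (hs : 3 * s + 1 ≤ X)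
  | eight_three_zero (hm : m % 4 = 0) (hm3 : m % 3 = 0) (hd : d = 24) (hs : 3 * s ≤ X + 1)

/-- Here `VE` and `VH` are the parts of the modulus that divide `m - 4` and `m - 3`. Their product
is less than `m ^ 2`, so that the window `hX` keeps `X ^ 4` below a multiple of it, in contradiction
to `hV`. -/
theorem two_sided_false {m d s X VE VH : ℕ} (hm : 9 ≤ m) (hT : WindowType m d s X) (hs : 4 ≤ s)
    (hE : VE ∣ m - 4) (hH : VH ∣ m - 3) (hcE : Nat.Coprime 12 VE) (hcH : Nat.Coprime 12 VH)
    (hE5 : 5 ≤ VE) (hH5 : 5 ≤ VH)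
    (hX : ((m : ℤ) - 2) * (X * (X - 1)) + 2 * X < 2 * d * (VE * VH))
    (hV : 16 * (VE * VH) ≤ ((s + 1) ^ 2) ^ 2) : False := by
  have key : ∀ e h : ℕ, 0 < e → 0 < h → e ∣ 12 → h ∣ 12 → e ∣ m - 4 → h ∣ m - 3 → 0 < d →
      e * VE ≤ m - 4 ∧ (4 * (e * h) * ((X : ℤ) * (X - 1)) ^ 2 < (d * ((s : ℤ) + 1) ^ 2) ^ 2) := by
    intro e h he hh he12 hh12 hem hhm hd
    have h1 : e * VE ≤ m - 4 := Nat.le_of_dvd (by omega)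
      (Nat.Coprime.mul_dvd_of_dvd_of_dvd (hcE.coprime_dvd_left he12) hem hE)
    have h2 : h * VH ≤ m - 3 := Nat.le_of_dvd (by omega)
      (Nat.Coprime.mul_dvd_of_dvd_of_dvd (hcH.coprime_dvd_left hh12) hhm hH)
    refine ⟨h1, ?_⟩
    have h3 : (e * VE) * (h * VH) ≤ (m - 4) * (m - 3) := Nat.mul_le_mul h1 h2
    obtain ⟨k, rfl⟩ := Nat.exists_eq_add_of_le hm
    rw [show 9 + k - 4 = 5 + k by omega, show 9 + k - 3 = 6 + k by omega] at h3
    have hX0 : (0 : ℤ) ≤ X * (X - 1) := by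
      rcases Nat.eq_zero_or_pos X with rfl | h
      · simp
      · exact mul_nonneg (by omega) (by omega)
    refine two_sided_bound (M := ((9 + k : ℕ) : ℤ) - 2) (V := VE * VH) (by omega)
      (by positivity) (by positivity) (by linarith) hX0 ?_ (by exact_mod_cast hV)
    zify at h3
    push_cast
    nlinarith
  have hY : ∀ k : ℕ, 1 ≤ k → k ≤ X → (k : ℤ) * (k - 1) ≤ X * (X - 1) := fun k hk h => by
    have : (k : ℤ) ≤ X := by exact_mod_cast h
    have : (1 : ℤ) ≤ k := by exact_mod_cast hk
    nlinarith
  obtain ⟨i, rfl⟩ := Nat.exists_eq_add_of_le hs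
  have four : ∀ {κ : ℕ}, (κ = 1 ∨ κ = 2) → d = κ → 4 + i ≤ X → (∀ e : ℕ, e = κ ^ 2 →
      4 * e * ((X : ℤ) * (X - 1)) ^ 2 < (d * (((4 + i : ℕ) : ℤ) + 1) ^ 2) ^ 2) →
      (κ = 2 → 24 ≤ m) → False := by
    intro κ hκ hd hs h hm'
    have h := h _ rfl
    have h1 := hY (4 + i) (by omega) hs
    push_cast at h h1
    have h2 : 2 * ((X : ℤ) * (X - 1)) < (4 + i + 1) ^ 2 := by
      rcases hκ with rfl | rfl <;> subst hd <;> push_cast at h <;>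
        exact lt_of_pow_lt_pow_left₀ 2 (by positivity) (by linarith)
    have hi : i = 0 := by
      by_contra hi
      have : (1 : ℤ) ≤ i := by omega
      nlinarith
    subst hi
    have h3 : VE * VH ≤ 39 := by omega
    have h4 : ((m : ℤ) - 2) * 12 ≤ (m - 2) * (X * (X - 1)) := by
      apply mul_le_mul_of_nonneg_left _ (by omega)
      simpa using h1
    have h5 : ((VE : ℤ) * VH) ≤ 39 := by exact_mod_cast h3
    rcases hκ with rfl | rfl <;> subst hd <;> push_cast at hX
    · omega
    · have := hm' rfl
      omega
  cases hT with
  | one hd hs =>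
    refine four (Or.inl rfl) hd hs (fun e he => ?_) (by simp)
    have := (key 1 1 (by simp) (by simp) (by simp) (by simp) (by simp) (by simp)
      (by omega)).2
    rw [he]
    simpa using this
  | two hm hd hs =>
    have h := key 4 1 (by simp) (by simp) (by simp) (by simp) (by omega) (by simp)
      (by omega)
    refine four (Or.inr rfl) hd hs (fun e he => ?_) (fun _ => by omega)
    rw [he]
    simpa using h.2
  | three hm hd hs =>
    subst hd
    have h : 12 * ((X : ℤ) * (X - 1)) ^ 2 < (3 * (((4 + i : ℕ) : ℤ) + 1) ^ 2) ^ 2 := by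
      rcases hm with hm | hm
      · simpa using (key 3 1 (by simp) (by simp) (by simp) (by simp) (by omega)
          (by simp) (by omega)).2
      · simpa using (key 1 3 (by simp) (by simp) (by simp) (by simp) (by simp)
          (by omega) (by omega)).2
    push_cast at h
    have h1 : (0 : ℤ) ≤ 2 * X - 3 * (4 + i) := by omega
    exact not_sq_lt_of_le (k := 7) (j := 8) h (by positivity) (by simp) (by simp)
      (by simp) (by nlinarith) (by simp)
  | six_one hm hm3 hd hs _ =>
    subst hd
    have h := (key 12 1 (by simp) (by simp) (by simp) (by simp) (by omega)
          (by simp) (by omega)).2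
    push_cast at h
    have h1 : (0 : ℤ) ≤ 2 * X - 3 * (4 + i) := by omega
    exact not_sq_lt_of_le (k := 7) (j := 8) h (by positivity) (by simp) (by simp)
      (by simp) (by nlinarith) (by simp)
  | six_zero hm hm3 hd hs =>
    subst hd
    have h := (key 4 3 (by simp) (by simp) (by simp) (by simp) (by omega)
          (by omega) (by omega)).2
    push_cast at h
    have h1 : (0 : ℤ) ≤ 2 * X - 3 * (4 + i) := by omega
    exact not_sq_lt_of_le (k := 7) (j := 8) h (by positivity) (by simp) (by simp)
      (by simp) (by nlinarith) (by simp)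
  | eight hm hd hs =>
    subst hd
    have h := (key 4 1 (by simp) (by simp) (by simp) (by simp) (by omega)
          (by simp) (by omega)).2
    push_cast at h
    have h1 : (0 : ℤ) ≤ X - 2 * (4 + i) := by omega
    exact not_sq_lt_of_le (k := 2) (j := 1) h (by positivity) (by simp) (by simp)
      (by simp) (by nlinarith) (by simp)
  | eight_three_one hm hm3 hd hs =>
    subst hd
    have h := (key 12 1 (by simp) (by simp) (by simp) (by simp) (by omega)
          (by simp) (by omega)).2
    push_cast at h
    have h1 : (0 : ℤ) ≤ X + 1 - 3 * (4 + i) := by omega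
    exact not_sq_lt_of_le (k := 7) (j := 2) h (by positivity) (by simp) (by simp)
      (by simp) (by nlinarith) (by simp)
  | eight_three_zero hm hm3 hd hs =>
    subst hd
    have h := (key 4 3 (by simp) (by simp) (by simp) (by simp) (by omega)
          (by omega) (by omega)).2
    push_cast at h
    have h1 : (0 : ℤ) ≤ X + 1 - 3 * (4 + i) := by omega
    exact not_sq_lt_of_le (k := 7) (j := 2) h (by positivity) (by simp) (by simp)
      (by simp) (by nlinarith) (by simp)

theorem coprime_twelve_prod {S : Finset ℕ} (h5 : ∀ p ∈ S, p.Prime ∧ 5 ≤ p) :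
    Nat.Coprime 12 (∏ p ∈ S, p) := by
  refine Nat.Coprime.prod_right fun p hp => ?_
  obtain ⟨h1, h2⟩ := h5 p hp
  have h2' := (Nat.coprime_primes Nat.prime_two h1).2 (by omega)
  have h3' := (Nat.coprime_primes Nat.prime_three h1).2 (by omega)
  exact Nat.Coprime.mul_left (h2'.mul_left h2') h3'

/-- The number `s + 1` of admissible arguments satisfies `(s + 1) ^ 2 ≤ φ(V)`, where `V` is the
product of the primes in `S`, with equality only for `V = 5`. -/
theorem WindowType.bound {m d s X : ℕ} {S : Finset ℕ} (hm : 9 ≤ m) (hT : WindowType m d s X)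
    (h5 : ∀ p ∈ S, p.Prime ∧ 5 ≤ p) (hS : S.Nonempty) (hdvd : ∀ p ∈ S, p ∣ m - 4 ∨ p ∣ m - 3)
    (hX : polygonal m X < d * ((∏ p ∈ S, p : ℕ) : ℤ)) :
    (s + 1) ^ 2 ≤ ∏ p ∈ S, (p - 1) ∧ (S ≠ {5} → (s + 1) ^ 2 < ∏ p ∈ S, (p - 1)) := by
  have hS5 : ∀ p ∈ S, 5 ≤ p := fun p hp => (h5 p hp).2
  suffices h : s ≤ 1 ∨ (s = 2 ∧ 10 ≤ ∏ p ∈ S, (p - 1)) ∨ (s + 1) ^ 2 < ∏ p ∈ S, (p - 1) by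
    rcases h with h | ⟨rfl, h⟩ | h
    · have h1 : (s + 1) ^ 2 ≤ 4 := by
        interval_cases s <;> norm_num
      obtain ⟨p, hp⟩ := hS
      have := le_prod_sub_one hS5 hp
      have := hS5 p hp
      exact ⟨by omega, fun hne => by have := five_le_prod_sub_one h5 ⟨p, hp⟩ hne; omega⟩
    · exact ⟨by omega, fun _ => by omega⟩
    · exact ⟨h.le, fun _ => h⟩
  have hdE : ∏ p ∈ S with p ∣ m - 4, p ∣ m - 4 :=
    Finset.prod_primes_dvd _ (fun p hp => (h5 p (Finset.mem_of_mem_filter p hp)).1.prime)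
      fun p hp => (Finset.mem_filter.1 hp).2
  have hdH : ∏ p ∈ S with ¬ p ∣ m - 4, p ∣ m - 3 :=
    Finset.prod_primes_dvd _ (fun p hp => (h5 p (Finset.mem_of_mem_filter p hp)).1.prime)
      fun p hp => by
        obtain ⟨h1, h2⟩ := Finset.mem_filter.1 hp
        exact (hdvd p h1).resolve_left h2
  have hcE := coprime_twelve_prod (S := S.filter fun p => p ∣ m - 4) fun p hp =>
    h5 p (Finset.mem_of_mem_filter p hp)
  have hcH := coprime_twelve_prod (S := S.filter fun p => ¬ p ∣ m - 4) fun p hp =>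
    h5 p (Finset.mem_of_mem_filter p hp)
  have hprod := Finset.prod_filter_mul_prod_filter_not S (fun p => p ∣ m - 4) (fun p => p)
  have hle : ∀ {T : Finset ℕ}, T ⊆ S → T.Nonempty → 5 ≤ ∏ p ∈ T, p := by
    rintro T hT ⟨p, hp⟩
    exact (hS5 p (hT hp)).trans (Nat.le_of_dvd (Finset.prod_pos fun q hq => by
      have := hS5 q (hT hq); omega) (Finset.dvd_prod_of_mem _ hp))
  by_cases hE : ∃ p ∈ S, p ∣ m - 4
  · by_cases hH : ∃ q ∈ S, ¬ q ∣ m - 4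
    · -- both kinds of primes occur
      right; right
      by_contra hlt
      obtain ⟨p, hp, hp4⟩ := hE
      obtain ⟨q, hq, hq4⟩ := hH
      have h2 : 24 ≤ ∏ r ∈ S, (r - 1) ∧ 16 * ∏ r ∈ S, r ≤ (∏ r ∈ S, (r - 1)) ^ 2 := by
        rcases lt_trichotomy p q with h | rfl | h
        · exact prod_sub_one_of_two h5 hp hq h
        · exact absurd hp4 hq4
        · exact prod_sub_one_of_two h5 hq hp h
      have hs : 4 ≤ s := by
        by_contra hs
        have : (s + 1) ^ 2 ≤ 4 ^ 2 := Nat.pow_le_pow_left (by omega) 2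
        omega
      refine two_sided_false hm hT hs hdE hdH hcE hcH
        (hle (Finset.filter_subset _ _) ⟨p, Finset.mem_filter.2 ⟨hp, hp4⟩⟩)
        (hle (Finset.filter_subset _ _) ⟨q, Finset.mem_filter.2 ⟨hq, hq4⟩⟩) ?_ ?_
      · have h3 := two_mul_polygonal m X
        have h4 : ((∏ p ∈ S with p ∣ m - 4, p : ℕ) : ℤ) * (∏ p ∈ S with ¬ p ∣ m - 4, p : ℕ) =
          (∏ p ∈ S, p : ℕ) := by exact_mod_cast hprod
        rw [h4]
        linarith
      · rw [hprod]
        exact h2.2.trans (Nat.pow_le_pow_left (by omega) 2)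
    · -- all the primes divide `m - 4`
      left
      push Not at hH
      rw [Finset.filter_true_of_mem hH] at hdE hcE
      have key : ∀ e : ℕ, e ∣ 12 → e ∣ m - 4 → e * ∏ p ∈ S, p ≤ m - 4 := fun e he hem =>
        Nat.le_of_dvd (by omega) (Nat.Coprime.mul_dvd_of_dvd_of_dvd (hcE.coprime_dvd_left he)
          hem hdE)
      have mono : ∀ k : ℕ, k ≤ X → polygonal m k ≤ polygonal m X := fun k hk =>
        polygonal_mono (by omega) hk
      have m2 := mono 2
      have m3 := mono 3
      have m4 := mono 4
      push_cast at m2 m3 m4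
      rw [polygonal_two] at m2
      rw [polygonal_three] at m3
      rw [polygonal_four] at m4
      generalize ∏ p ∈ S, p = V at *
      have k1 := key 1 (by simp) (by simp)
      cases hT with
      | one hd hs => subst hd; omega
      | two hm hd hs => subst hd; have := key 4 (by simp) (by omega); omega
      | three hm hd hs => subst hd; omega
      | six_one hm hm3 hd hs _ => subst hd; have := key 4 (by simp) (by omega); omega
      | six_zero hm hm3 hd hs => subst hd; have := key 4 (by simp) (by omega); omega
      | eight hm hd hs => subst hd; have := key 4 (by simp) (by omega); omega
      | eight_three_one hm hm3 hd hs =>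
        subst hd; have := key 12 (by simp) (by omega); omega
      | eight_three_zero hm hm3 hd hs =>
        subst hd; have := key 4 (by simp) (by omega); omega
  · -- all the primes divide `m - 3`
    push Not at hE
    rw [Finset.filter_true_of_mem hE] at hdH hcH
    suffices h : s ≤ 1 ∨ (s = 2 ∧ m % 4 = 0 ∧ m - 3 < 2 * ∏ p ∈ S, p) by
      refine h.imp_right fun ⟨h1, h2, h3⟩ => Or.inl ⟨h1, ?_⟩
      obtain ⟨p, hp⟩ := hS
      by_cases hq : ∃ q ∈ S, q ≠ p
      · obtain ⟨q, hq, hqp⟩ := hq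
        rcases lt_or_gt_of_ne hqp with h | h
        · have := (prod_sub_one_of_two h5 hq hp h).1
          omega
        · have := (prod_sub_one_of_two h5 hp hq h).1
          omega
      · push Not at hq
        obtain rfl := Finset.eq_singleton_iff_unique_mem.2 ⟨hp, hq⟩
        rw [Finset.prod_singleton] at hdH h3 ⊢
        obtain ⟨k, hk⟩ := hdH
        obtain ⟨hpp, hp5⟩ := h5 p hp
        have hk1 : k = 1 := by
          have h4 : p * k < p * 2 := by omega
          have := Nat.lt_of_mul_lt_mul_left h4
          have : k ≠ 0 := by rintro rfl; omega
          omega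
        subst hk1
        have : p ≠ 9 := by rintro rfl; revert hpp; norm_num
        omega
    have key : ∀ e : ℕ, e ∣ 12 → e ∣ m - 3 → e * ∏ p ∈ S, p ≤ m - 3 := fun e he hem =>
      Nat.le_of_dvd (by omega) (Nat.Coprime.mul_dvd_of_dvd_of_dvd (hcH.coprime_dvd_left he)
        hem hdH)
    have mono : ∀ k : ℕ, k ≤ X → polygonal m k ≤ polygonal m X := fun k hk =>
      polygonal_mono (by omega) hk
    have m2 := mono 2
    have m3 := mono 3
    have m4 := mono 4
    have m5 := mono 5
    have m7 := mono 7
    have m8 := mono 8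
    have e7 := two_mul_polygonal m 7
    have e8 := two_mul_polygonal m 8
    push_cast at m2 m3 m4 m5 m7 m8
    rw [polygonal_two] at m2
    rw [polygonal_three] at m3
    rw [polygonal_four] at m4
    rw [polygonal_five] at m5
    generalize ∏ p ∈ S, p = V at *
    have k1 := key 1 (by simp) (by simp)
    cases hT with
    | one hd hs => subst hd; omega
    | two hm hd hs => subst hd; omega
    | three hm hd hs => subst hd; omega
    | six_one hm hm3 hd hs _ => subst hd; omega
    | six_zero hm hm3 hd hs => subst hd; have := key 3 (by simp) (by omega); omega
    | eight hm hd hs => subst hd; omega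
    | eight_three_one hm hm3 hd hs => subst hd; omega
    | eight_three_zero hm hm3 hd hs =>
      subst hd; have := key 3 (by simp) (by omega); omega

/-! ### Counting residues: no prime greater than 5 has an obstruction -/

/-- A regular form together with residue classes `N₂` modulo `D₂` and `N₃` modulo `D₃` on which the
conditions at 2 and at 3 hold and force congruences on the arguments. -/
structure ClassData (m : ℕ) (l : List ℕ) (D₂ N₂ : ℕ) (π : ℕ → ℕ) (D₃ N₃ τ : ℕ) : Prop where
  hm : 9 ≤ m
  hpos : ∀ c ∈ l, 0 < c
  unit : ∀ p : ℕ, p.Prime → ∃ c ∈ l, ¬ p ∣ c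
  regular : ListRegular m l
  hD₂ : D₂ = 1 ∨ (m % 4 = 0 ∧ (D₂ = 2 ∨ D₂ = 4 ∨ D₂ = 8))
  two : TwoClass m l D₂ N₂ π
  hD₃ : D₃ = 1 ∨ (D₃ = 3 ∧ ((m % 3 = 1 ∧ τ = 0) ∨ (m % 3 = 0 ∧ τ = 1)))
  three : ThreeClass m l D₃ N₃ τ

/-- The congruence conditions on the argument `x` of the coefficient `c`. -/
def Admissible (D₂ : ℕ) (π : ℕ → ℕ) (D₃ τ c x : ℕ) : Prop :=
  (D₂ ≠ 2 → ¬ D₂ ∣ c → x % 2 = π c) ∧ (¬ D₃ ∣ c → x % 3 ≠ τ)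

/-- The factor of the window for the arguments of `c` that is due to the moduli `D₂` and `D₃`. -/
def windowFactor (D₂ D₃ c : ℕ) : ℕ :=
  (if D₂ ∣ c then 1 else if D₂ = 2 then 2 else 8) * if D₃ ∣ c then 1 else 3

theorem card_le_of_injOn {A : Finset ℕ} {s : ℕ} (g : ℕ → ℕ) (h : ∀ x ∈ A, g x ≤ s)
    (hg : ∀ x ∈ A, ∀ y ∈ A, g x = g y → x = y) : A.card ≤ s + 1 := by
  have := Finset.card_le_card_of_injOn (s := A) (t := Finset.range (s + 1)) g
    (fun x hx => by simpa using Nat.lt_succ_of_le (h x hx)) (fun x hx y hy => hg x hx y hy)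
  simpa using this

/-- The size of the set of admissible arguments in the window, compared with the number of residues
that satisfy the conditions at the primes in `S`. -/
theorem card_sq_le {m c D₂ D₃ τ : ℕ} {π : ℕ → ℕ} (hm : 9 ≤ m)
    (hD₂ : D₂ = 1 ∨ (m % 4 = 0 ∧ (D₂ = 2 ∨ D₂ = 4 ∨ D₂ = 8)))
    (hD₃ : D₃ = 1 ∨ (D₃ = 3 ∧ ((m % 3 = 1 ∧ τ = 0) ∨ (m % 3 = 0 ∧ τ = 1)))) {S : Finset ℕ}
    (h5 : ∀ p ∈ S, p.Prime ∧ 5 ≤ p) (hS : S.Nonempty) (hdvd : ∀ p ∈ S, p ∣ m - 4 ∨ p ∣ m - 3)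
    {A : Finset ℕ} (hA : ∀ x ∈ A, Admissible D₂ π D₃ τ c x ∧
      polygonal m x < windowFactor D₂ D₃ c * ((∏ p ∈ S, p : ℕ) : ℤ)) :
    A.card ^ 2 ≤ ∏ p ∈ S, (p - 1) ∧ (S ≠ {5} → A.card ^ 2 < ∏ p ∈ S, (p - 1)) := by
  rcases A.eq_empty_or_nonempty with rfl | hne
  · obtain ⟨p, hp⟩ := hS
    have := le_prod_sub_one (fun p hp => (h5 p hp).2) hp
    have := (h5 p hp).2
    simp only [Finset.card_empty]
    omega
  set X := A.max' hne with hX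
  have hXA : X ∈ A := A.max'_mem hne
  have hle : ∀ x ∈ A, x ≤ X := fun x hx => A.le_max' x hx
  suffices h : ∃ s, A.card ≤ s + 1 ∧ WindowType m (windowFactor D₂ D₃ c) s X by
    obtain ⟨s, h1, h2⟩ := h
    have h3 := h2.bound hm h5 hS hdvd (hA X hXA).2
    have h4 := Nat.pow_le_pow_left h1 2
    exact ⟨h4.trans h3.1, fun hne => lt_of_le_of_lt h4 (h3.2 hne)⟩
  have ad := fun x hx => (hA x hx).1
  clear hA hX
  clear_value X
  unfold Admissible at ad
  unfold windowFactor
  by_cases h3 : D₃ ∣ c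
  · rw [if_pos h3]
    by_cases h2 : D₂ ∣ c
    · rw [if_pos h2]
      exact ⟨X, card_le_of_injOn id hle (by simp), .one rfl le_rfl⟩
    · rw [if_neg h2]
      have hm4 : m % 4 = 0 := by
        rcases hD₂ with rfl | h
        · simp at h2
        · exact h.1
      by_cases hD : D₂ = 2
      · rw [if_pos hD]
        exact ⟨X, card_le_of_injOn id hle (by simp), .two hm4 rfl le_rfl⟩
      · rw [if_neg hD]
        have ad := fun x hx => (ad x hx).1 hD h2
        exact ⟨X / 2, card_le_of_injOn (fun x => x / 2) (fun x hx => Nat.div_le_div_right (hle x hx))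
          (fun x hx y hy h => by
            have := ad x hx
            have := ad y hy
            omega), .eight hm4 rfl (by omega)⟩
  · rw [if_neg h3]
    replace hD₃ := hD₃.resolve_left (by rintro rfl; simp at h3)
    have ad3 := fun x hx => (ad x hx).2 h3
    have g0 : τ = 0 → A.card ≤ (X - X / 3 - 1) + 1 := fun h0 =>
      card_le_of_injOn (fun x => x - x / 3 - 1)
        (fun x hx => by
          have := hle x hx
          omega) (fun x hx y hy h => by
          have := ad3 x hx
          have := ad3 y hy
          omega)
    have g1 : τ = 1 → A.card ≤ (X - (X + 2) / 3) + 1 := fun h0 =>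
      card_le_of_injOn (fun x => x - (x + 2) / 3)
        (fun x hx => by
          have := hle x hx
          omega) (fun x hx y hy h => by
          have := ad3 x hx
          have := ad3 y hy
          omega)
    by_cases h2 : D₂ ∣ c
    · rw [if_pos h2]
      rcases hD₃.2 with ⟨h, h0⟩ | ⟨h, h0⟩
      · exact ⟨_, g0 h0, .three (Or.inl h) rfl (by omega)⟩
      · exact ⟨_, g1 h0, .three (Or.inr h) rfl (by omega)⟩
    · rw [if_neg h2]
      have hm4 : m % 4 = 0 := by
        rcases hD₂ with rfl | h
        · simp at h2
        · exact h.1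
      by_cases hD : D₂ = 2
      · rw [if_pos hD]
        rcases hD₃.2 with ⟨h, h0⟩ | ⟨h, h0⟩
        · exact ⟨_, g0 h0, .six_one hm4 h rfl (by omega) (by have := ad3 X hXA; omega)⟩
        · exact ⟨_, g1 h0, .six_zero hm4 h rfl (by omega)⟩
      · rw [if_neg hD]
        have ad := fun x hx => (ad x hx).1 hD h2
        rcases hD₃.2 with ⟨h, h0⟩ | ⟨h, h0⟩
        · exact ⟨X / 3, card_le_of_injOn (fun x => x / 3)
            (fun x hx => Nat.div_le_div_right (hle x hx)) (fun x hx y hy h => by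
              have := ad x hx
              have := ad y hy
              have := ad3 x hx
              have := ad3 y hy
              omega), .eight_three_one hm4 h rfl (by
                have := ad3 X hXA
                omega)⟩
        · exact ⟨(X + 1) / 3, card_le_of_injOn (fun x => (x + 1) / 3)
            (fun x hx => Nat.div_le_div_right (Nat.add_le_add_right (hle x hx) 1))
            (fun x hx y hy h => by
              have := ad x hx
              have := ad y hy
              have := ad3 x hx
              have := ad3 y hy
              omega), .eight_three_zero hm4 h rfl (by omega)⟩

/-- The residues modulo `p` all of whose members satisfy the condition at `p`. -/
noncomputable def goodResidues (m p : ℕ) (l : List ℕ) : Finset ℕ :=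
  open Classical in (Finset.range p).filter fun r => ∀ N : ℕ, N % p = r → Loc m p l N

theorem mem_goodResidues {m p : ℕ} {l : List ℕ} {r : ℕ} :
    r ∈ goodResidues m p l ↔ r < p ∧ ∀ N : ℕ, N % p = r → Loc m p l N := by
  simp [goodResidues]

theorem PrimeShape.goodResidues {m p : ℕ} (hp : p.Prime) (h5 : 5 ≤ p)
    (hm2 : ¬ (p : ℤ) ∣ (m : ℤ) - 2) {l : List ℕ} (hs : PrimeShape p l) :
    (p - 1) ^ l.countP (fun c => decide (¬ p ∣ c)) ≤ (goodResidues m p l).card ^ 2 := by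
  have hpi : Prime (p : ℤ) := Nat.prime_iff_prime_int.1 hp
  have h2 : ¬ (p : ℤ) ∣ 2 := fun h => by
    have := Int.le_of_dvd (by simp) h
    omega
  have hcount : ∀ {t : List ℕ}, (∀ c ∈ t, p ∣ c) → t.countP (fun c => decide (¬ p ∣ c)) = 0 :=
    fun ht => List.countP_eq_zero.2 fun c hc => by simpa using ht c hc
  cases hs with
  | one a t hl ha ht =>
    rw [hl.countP_eq, List.countP_cons, hcount ht, if_pos (by simpa using ha), zero_add, pow_one]
    -- the arguments `x` with `2 (m - 2) x - (m - 4) ≡ y`, for `1 ≤ y ≤ (p - 1) / 2`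
    have hinv : ∀ y : ℕ, ∃ x : ℤ, (p : ℤ) ∣ 2 * ((m : ℤ) - 2) * x - ((m : ℤ) - 4) - y := fun y => by
      have h3 : ¬ (p : ℤ) ∣ 2 * ((m : ℤ) - 2) := fun h =>
        (hpi.dvd_or_dvd h).elim h2 hm2
      obtain ⟨u, v, huv⟩ := hpi.coprime_iff_not_dvd.2 h3
      exact ⟨v * (m - 4 + y), ⟨-u * (m - 4 + y), by linear_combination ((m : ℤ) - 4 + y) * huv⟩⟩
    choose x hx using hinv
    have hy : ∀ y ∈ Finset.Icc 1 ((p - 1) / 2), ¬ (p : ℤ) ∣ y := fun y hy hd => by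
      obtain ⟨h3, h4⟩ := Finset.mem_Icc.1 hy
      have := Int.le_of_dvd (by omega) hd
      omega
    have hcard : (p - 1) / 2 ≤ (PolygonalForm.goodResidues m p l).card := by
      have hp0 : (0 : ℤ) < p := by omega
      have := Finset.card_le_card_of_injOn (s := Finset.Icc 1 ((p - 1) / 2))
        (t := PolygonalForm.goodResidues m p l) (fun y => (a * polygonal m (x y) % p).toNat) ?_ ?_
      · simpa using this
      · intro y hyI
        have h3 := Int.emod_nonneg (a * polygonal m (x y)) hp0.ne'
        have h4 := Int.emod_lt_of_pos (a * polygonal m (x y)) hp0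
        beta_reduce
        refine mem_goodResidues.2 ⟨by omega, fun N hN => Loc.perm hl.symm ?_⟩
        refine Loc.of_prime_unit hp (by omega) hm2 ha (x := x y) (fun hd => hy y hyI ?_)
          (val_polygonal_zero m t) ?_
        · exact (dvd_sub_right hd).1 (hx y)
        · have h6 : (N : ℤ) % p = a * polygonal m (x y) % p := by
            rw [← Int.toNat_of_nonneg h3, ← hN]
            exact Int.natCast_mod N p
          rw [add_zero]
          exact h6.symm
      · intro y hyI z hzI h
        have h3 : a * polygonal m (x y) % p = a * polygonal m (x z) % p := by
          have h3 := Int.emod_nonneg (a * polygonal m (x y)) hp0.ne'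
          have h4 := Int.emod_nonneg (a * polygonal m (x z)) hp0.ne'
          simp only at h
          omega
        have h4 : (p : ℤ) ∣ a * (polygonal m (x z) - polygonal m (x y)) := by
          rw [mul_sub]
          exact Int.ModEq.dvd h3
        have h5 := (hpi.dvd_or_dvd h4).resolve_left (by exact_mod_cast ha)
        have h6 : (p : ℤ) ∣ ((z : ℤ) - y) * (z + y) := by
          have q1 := two_mul_polygonal m (x y)
          have q2 := two_mul_polygonal m (x z)
          have := dvd_add (h5.mul_left (8 * ((m : ℤ) - 2)))
            (dvd_sub ((hx y).mul_right (2 * ((m : ℤ) - 2) * x y - ((m : ℤ) - 4) + y))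
              ((hx z).mul_right (2 * ((m : ℤ) - 2) * x z - ((m : ℤ) - 4) + z)))
          refine this.trans (dvd_of_eq ?_)
          linear_combination 4 * ((m : ℤ) - 2) * q2 - 4 * ((m : ℤ) - 2) * q1
        obtain ⟨hy1, hy2⟩ := Finset.mem_Icc.1 hyI
        obtain ⟨hz1, hz2⟩ := Finset.mem_Icc.1 hzI
        rcases hpi.dvd_or_dvd h6 with h7 | h7
        · have := Int.eq_zero_of_abs_lt_dvd h7 (by rw [abs_lt]; omega)
          omega
        · have := Int.le_of_dvd (by omega) h7
          omega
    have hodd : 2 * ((p - 1) / 2) = p - 1 := by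
      have := hp.eq_two_or_odd
      omega
    have h3 := Nat.pow_le_pow_left hcard 2
    have h4 : 2 ≤ (p - 1) / 2 := by omega
    nlinarith
  | two a b t hl hle ha hb han ht =>
    rw [hl.countP_eq, List.countP_cons, List.countP_cons, hcount ht, if_pos (by simpa using hb),
      if_pos (by simpa using ha)]
    refine Nat.pow_le_pow_left ?_ 2
    set f : ℕ → ℤ := fun r => 8 * ((m : ℤ) - 2) * r + ((m : ℤ) - 4) ^ 2 * l.sum with hf
    have h8 : ¬ (p : ℤ) ∣ 8 * ((m : ℤ) - 2) := fun h => by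
      rcases hpi.dvd_or_dvd h with h | h
      · exact h2 (hpi.dvd_of_dvd_pow (n := 3) (by norm_num; exact h))
      · exact hm2 h
    have hsub : ((Finset.range p).filter fun r => ¬ (p : ℤ) ∣ f r) ⊆
        PolygonalForm.goodResidues m p l := by
      intro r hr
      obtain ⟨hr1, hr2⟩ := Finset.mem_filter.1 hr
      refine mem_goodResidues.2 ⟨by simpa using hr1, fun N hN => ?_⟩
      refine Loc.of_qLoc_odd hp (by omega) hm2 (QLoc.perm hl.symm
        (QLoc.two_units hp (by omega) ha hb (fun hd => hr2 ?_) t))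
      obtain ⟨k, hk⟩ : ∃ k, N = r + p * k := ⟨N / p, by rw [← hN]; exact (Nat.mod_add_div N p).symm⟩
      rw [hf]
      refine (dvd_add_left (Dvd.intro (8 * ((m : ℤ) - 2) * k) rfl)).1 ?_
      refine hd.trans (dvd_of_eq ?_)
      rw [hk]
      push_cast
      ring
    have hcompl : ((Finset.range p).filter fun r => (p : ℤ) ∣ f r).card ≤ 1 := by
      refine Finset.card_le_one.2 fun r hr s hs => ?_
      simp only [Finset.mem_filter, Finset.mem_range] at hr hs
      have h3 : (p : ℤ) ∣ (8 * ((m : ℤ) - 2)) * ((r : ℤ) - s) := by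
        refine (dvd_sub hr.2 hs.2).trans (dvd_of_eq ?_)
        rw [hf]
        ring
      have h4 := (hpi.dvd_or_dvd h3).resolve_left h8
      have := Int.eq_zero_of_abs_lt_dvd h4 (by rw [abs_lt]; omega)
      omega
    have h3 := Finset.card_filter_add_card_filter_not (s := Finset.range p)
      (fun r => (p : ℤ) ∣ f r)
    rw [Finset.card_range] at h3
    have h4 := Finset.card_le_card hsub
    omega

/-- The values `∑ c * P_m(x)` with `x ∈ A c` for all coefficients `c`. -/
def argVals (m : ℕ) (A : ℕ → Finset ℕ) : List ℕ → Finset ℤ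
  | [] => {0}
  | c :: l => Finset.image₂ (fun (x : ℕ) w => c * polygonal m x + w) (A c) (argVals m A l)

theorem card_argVals_le (m : ℕ) (A : ℕ → Finset ℕ) (l : List ℕ) :
    (argVals m A l).card ≤ (l.map fun c => (A c).card).prod := by
  induction l with
  | nil => simp [argVals]
  | cons c l ih =>
    rw [List.map_cons, List.prod_cons]
    exact (Finset.card_image₂_le _ _ _).trans (Nat.mul_le_mul le_rfl ih)

theorem exists_mem_argVals {m Q : ℕ} {A : ℕ → Finset ℕ} {zs : List (ℕ × ℕ)}
    (h : ∀ z ∈ zs, z.2 ∈ A z.1 ∨ (Q ∣ z.1 ∧ (A z.1).Nonempty)) :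
    ∃ w ∈ argVals m A (zs.map Prod.fst), (Q : ℤ) ∣ argVal m zs - w := by
  induction zs with
  | nil => exact ⟨0, by simp [argVals], by simp [argVal]⟩
  | cons z zs ih =>
    obtain ⟨w, hw, hd⟩ := ih fun z hz => h z (List.mem_cons_of_mem _ hz)
    rcases h z List.mem_cons_self with hz | ⟨hz, y, hy⟩
    · exact ⟨_, Finset.mem_image₂_of_mem hz hw, by
        rw [argVal_cons, add_sub_add_left_eq_sub]; exact hd⟩
    · refine ⟨_, Finset.mem_image₂_of_mem hy hw, ?_⟩
      have h1 : (Q : ℤ) ∣ z.1 := by exact_mod_cast hz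
      rw [argVal_cons, add_sub_add_comm]
      exact dvd_add (dvd_sub (h1.mul_right _) (h1.mul_right _)) hd

theorem prod_map_le {f g : ℕ → ℕ} {l : List ℕ} (h : ∀ c ∈ l, f c ≤ g c) :
    (l.map f).prod ≤ (l.map g).prod := by
  induction l with
  | nil => simp
  | cons c l ih =>
    rw [List.map_cons, List.map_cons, List.prod_cons, List.prod_cons]
    exact Nat.mul_le_mul (h c List.mem_cons_self) (ih fun d hd => h d (List.mem_cons_of_mem _ hd))

theorem prod_map_lt {f g : ℕ → ℕ} {l : List ℕ} (h : ∀ c ∈ l, f c ≤ g c) (h0 : ∀ c ∈ l, 0 < g c)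
    {c : ℕ} (hc : c ∈ l) (hlt : f c < g c) : (l.map f).prod < (l.map g).prod := by
  have hp := List.perm_cons_erase hc
  rw [(hp.map f).prod_eq, (hp.map g).prod_eq, List.map_cons, List.map_cons, List.prod_cons,
    List.prod_cons]
  have h1 := prod_map_le (f := f) (g := g) (l := l.erase c) fun d hd =>
    h d (List.mem_of_mem_erase hd)
  have h2 : 0 < ((l.erase c).map g).prod := List.prod_pos fun y hy => by
    obtain ⟨d, hd, rfl⟩ := List.mem_map.1 hy
    exact h0 d (List.mem_of_mem_erase hd)
  exact lt_of_le_of_lt (Nat.mul_le_mul le_rfl h1) (Nat.mul_lt_mul_of_pos_right hlt h2)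

theorem prod_map_prod_filter (B : Finset ℕ) (l : List ℕ) :
    (l.map fun c => ∏ p ∈ B with ¬ p ∣ c, (p - 1)).prod =
      ∏ p ∈ B, (p - 1) ^ l.countP (fun c => decide (¬ p ∣ c)) := by
  induction l with
  | nil => simp
  | cons c l ih =>
    rw [List.map_cons, List.prod_cons, ih, Finset.prod_filter, ← Finset.prod_mul_distrib]
    refine Finset.prod_congr rfl fun p _ => ?_
    rw [List.countP_cons]
    by_cases h : p ∣ c
    · rw [if_neg (not_not_intro h), if_neg (by simpa using h), one_mul, add_zero]
    · rw [if_pos h, if_pos (by simpa using h), pow_succ, mul_comm]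

theorem prod_map_sq (f : ℕ → ℕ) (l : List ℕ) :
    (l.map fun c => f c ^ 2).prod = (l.map f).prod ^ 2 := by
  induction l with
  | nil => rfl
  | cons c l ih =>
    rw [List.map_cons, List.map_cons, List.prod_cons, List.prod_cons, ih, mul_pow]

/-- If `T` has fewer elements than there are systems of residues `g p ∈ G p`, some system is
not attained by an element of `T`. -/
theorem exists_residues {B : Finset ℕ} {G : ℕ → Finset ℕ} {T : Finset ℤ}
    (h : T.card < ∏ p ∈ B, (G p).card) :
    ∃ g : ℕ → ℕ, (∀ p ∈ B, g p ∈ G p) ∧ ∀ w ∈ T, ∃ p ∈ B, w % p ≠ g p := by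
  classical
  rw [← Finset.card_pi] at h
  obtain ⟨g, hg, hgT⟩ := Finset.exists_mem_notMem_of_card_lt_card
    (s := T.image fun (w : ℤ) (p : ℕ) (_ : p ∈ B) => (w % (p : ℤ)).toNat)
    (lt_of_le_of_lt Finset.card_image_le h)
  refine ⟨fun p => if hp : p ∈ B then g p hp else 0, fun p hp => ?_, fun w hw => ?_⟩
  · simpa only [dif_pos hp] using Finset.mem_pi.1 hg p hp
  · by_contra hno
    push Not at hno
    refine hgT (Finset.mem_image.2 ⟨w, hw, ?_⟩)
    funext p hp
    have := hno p hp
    rw [dif_pos hp] at this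
    rw [this]
    simp

theorem exists_modEq_of_residues (B : Finset ℕ) (hB : ∀ p ∈ B, p.Prime) (g : ℕ → ℕ) :
    ∃ N : ℕ, ∀ p ∈ B, N ≡ g p [MOD p] := by
  induction B using Finset.induction_on with
  | empty => exact ⟨0, by simp⟩
  | insert q B hq ih =>
    obtain ⟨N, hN⟩ := ih fun p hp => hB p (Finset.mem_insert_of_mem hp)
    have hc : Nat.Coprime q (∏ p ∈ B, p) := Nat.Coprime.prod_right fun p hp =>
      (Nat.coprime_primes (hB q (Finset.mem_insert_self _ _))
        (hB p (Finset.mem_insert_of_mem hp))).2 (by rintro rfl; exact hq hp)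
    obtain ⟨k, hk1, hk2⟩ := Nat.chineseRemainder hc (g q) N
    refine ⟨k, fun p hp => ?_⟩
    rcases Finset.mem_insert.1 hp with rfl | hp
    · exact hk1
    · exact (hk2.of_dvd (Finset.dvd_prod_of_mem _ hp)).trans (hN p hp)

section ClassData
variable {m D₂ N₂ D₃ N₃ τ : ℕ} {π : ℕ → ℕ} {l : List ℕ}

theorem ClassData.dvd_eight (h : ClassData m l D₂ N₂ π D₃ N₃ τ) : D₂ ∣ 8 := by
  rcases h.hD₂ with h | ⟨-, h | h | h⟩ <;> rw [h] <;> norm_num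

theorem ClassData.dvd_three (h : ClassData m l D₂ N₂ π D₃ N₃ τ) : D₃ ∣ 3 := by
  rcases h.hD₃ with h | ⟨h, -⟩ <;> rw [h]
  norm_num

theorem ClassData.coprime (h : ClassData m l D₂ N₂ π D₃ N₃ τ) : Nat.Coprime D₂ D₃ :=
  Nat.Coprime.coprime_dvd_left h.dvd_eight (Nat.Coprime.coprime_dvd_right h.dvd_three (by norm_num))

theorem ClassData.coprime_prod (h : ClassData m l D₂ N₂ π D₃ N₃ τ) {B : Finset ℕ}
    (hB : ∀ p ∈ B, p.Prime ∧ 5 ≤ p) : Nat.Coprime (D₂ * D₃) (∏ p ∈ B, p) := by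
  have h1 := coprime_twelve_prod hB
  have h2 : Nat.Coprime 2 (∏ p ∈ B, p) := h1.coprime_dvd_left (by simp)
  exact Nat.Coprime.mul_left ((h2.pow_left 3).coprime_dvd_left h.dvd_eight)
    (h1.coprime_dvd_left (h.dvd_three.trans (by simp)))

theorem ClassData.pos (h : ClassData m l D₂ N₂ π D₃ N₃ τ) : 0 < D₂ * D₃ :=
  Nat.mul_pos (Nat.pos_of_dvd_of_pos h.dvd_eight (by simp))
    (Nat.pos_of_dvd_of_pos h.dvd_three (by simp))

theorem ClassData.exists_nat (h : ClassData m l D₂ N₂ π D₃ N₃ τ) {Q : ℕ}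
    (hQ : Nat.Coprime (D₂ * D₃) Q) (hQ0 : 0 < Q) (r : ℕ) :
    ∃ N < D₂ * D₃ * Q, N ≡ N₂ [MOD D₂] ∧ N ≡ N₃ [MOD D₃] ∧ N ≡ r [MOD Q] := by
  obtain ⟨n₁, hn₁, hn₁'⟩ := Nat.chineseRemainder h.coprime N₂ N₃
  obtain ⟨n₂, hn₂, hn₂'⟩ := Nat.chineseRemainder hQ n₁ r
  have hN : n₂ % (D₂ * D₃ * Q) ≡ n₂ [MOD D₂ * D₃ * Q] := Nat.mod_modEq _ _
  have hD := (hN.of_dvd (Dvd.intro _ rfl)).trans hn₂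
  exact ⟨_, Nat.mod_lt _ (Nat.mul_pos h.pos hQ0), (hD.of_dvd (Dvd.intro _ rfl)).trans hn₁,
    (hD.of_dvd (Dvd.intro_left _ rfl)).trans hn₁', (hN.of_dvd (Dvd.intro_left _ rfl)).trans hn₂'⟩

/-- A representation of a number in the given classes has admissible arguments. -/
theorem ClassData.exists_args (h : ClassData m l D₂ N₂ π D₃ N₃ τ) {N : ℕ} (h2 : N ≡ N₂ [MOD D₂])
    (h3 : N ≡ N₃ [MOD D₃]) (hN : ∀ p : ℕ, p.Prime → 5 ≤ p → Loc m p l N) :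
    ∃ zs : List (ℕ × ℕ), zs.map Prod.fst = l ∧ argVal m zs = N ∧
      ∀ z ∈ zs, Admissible D₂ π D₃ τ z.1 z.2 ∧ z.1 * polygonal m z.2 ≤ N := by
  have h2' : ((N : ℤ) - N₂) % D₂ = 0 := Int.emod_eq_zero_of_dvd (Nat.modEq_iff_dvd.1 h2.symm)
  have h3' : ((N : ℤ) - N₃) % D₃ = 0 := Int.emod_eq_zero_of_dvd (Nat.modEq_iff_dvd.1 h3.symm)
  obtain ⟨zs, hzs, hv⟩ := Rep.exists_args (h.regular N fun p hp => by
    rcases (by have := hp.two_le; omega : p = 2 ∨ p = 3 ∨ p = 4 ∨ 5 ≤ p) with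
      rfl | rfl | rfl | hp5
    · exact h.two.loc N h2'
    · exact h.three.loc N h3'
    · revert hp; norm_num
    · exact hN p hp hp5)
  refine ⟨zs, hzs, hv, fun z hz => ⟨⟨fun hD hd => ?_, fun hd => ?_⟩, ?_⟩⟩
  · exact h.two.forced hD zs (by rw [hzs]) (by rw [hv]; exact h2') z hz hd
  · exact h.three.forced zs (by rw [hzs]) (by rw [hv]; exact h3') z hz hd
  · rw [← hv]
    exact mul_polygonal_le_argVal (by have := h.hm; omega) hz

/-- The size of a coefficient gives the window for its arguments. -/
theorem ClassData.window (h : ClassData m l D₂ N₂ π D₃ N₃ τ) {B : Finset ℕ}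
    (hB : ∀ p ∈ B, p.Prime ∧ 5 ≤ p) {c : ℕ} (hc : c ∈ l) {x K : ℕ}
    (hx : c * polygonal m x < D₂ * D₃ * K * ∏ p ∈ B, p) :
    polygonal m x < windowFactor D₂ D₃ c * K * ((∏ p ∈ B with ¬ p ∣ c, p : ℕ) : ℤ) := by
  have h0 := h.hpos c hc
  set e₂ := if D₂ ∣ c then D₂ else 1 with he₂
  set e₃ := if D₃ ∣ c then D₃ else 1 with he₃
  have hd2 : e₂ ∣ c ∧ e₂ ∣ D₂ ∧ D₂ ≤ e₂ * (if D₂ ∣ c then 1 else if D₂ = 2 then 2 else 8) := by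
    rw [he₂]
    have h8 := Nat.le_of_dvd (by simp) h.dvd_eight
    split_ifs with h1 h2 <;> simp [h1]
    · omega
    · omega
  have hd3 : e₃ ∣ c ∧ e₃ ∣ D₃ ∧ D₃ ≤ e₃ * (if D₃ ∣ c then 1 else 3) := by
    rw [he₃]
    have h8 := Nat.le_of_dvd (by simp) h.dvd_three
    split_ifs with h1 <;> simp [h1]
    omega
  have hR : ∏ p ∈ B with p ∣ c, p ∣ c :=
    Finset.prod_primes_dvd _ (fun p hp => (hB p (Finset.mem_of_mem_filter p hp)).1.prime)
      fun p hp => (Finset.mem_filter.1 hp).2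
  have hprod := Finset.prod_filter_mul_prod_filter_not B (fun p => p ∣ c) (fun p => p)
  have hcop : Nat.Coprime (D₂ * D₃) (∏ p ∈ B with p ∣ c, p) :=
    h.coprime_prod fun p hp => hB p (Finset.mem_of_mem_filter p hp)
  have hdvd : e₂ * e₃ * ∏ p ∈ B with p ∣ c, p ∣ c := by
    refine Nat.Coprime.mul_dvd_of_dvd_of_dvd
      (hcop.coprime_dvd_left (Nat.mul_dvd_mul hd2.2.1 hd3.2.1)) ?_ hR
    exact Nat.Coprime.mul_dvd_of_dvd_of_dvd
      ((h.coprime.coprime_dvd_left hd2.2.1).coprime_dvd_right hd3.2.1) hd2.1 hd3.1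
  have hRpos : 0 < ∏ p ∈ B with p ∣ c, p := Nat.pos_of_dvd_of_pos hR h0
  obtain ⟨P, hP⟩ := Int.eq_ofNat_of_zero_le (polygonal_nonneg (by have := h.hm; omega : 4 ≤ m) x)
  rw [hP] at hx ⊢
  unfold windowFactor
  generalize (if D₂ ∣ c then 1 else if D₂ = 2 then 2 else 8) = w₂ at *
  generalize (if D₃ ∣ c then 1 else 3) = w₃ at *
  clear_value e₂ e₃
  rw [← hprod] at hx
  generalize ∏ p ∈ B with p ∣ c, p = R at *
  generalize ∏ p ∈ B with ¬ p ∣ c, p = V at *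
  have hle := Nat.le_of_dvd h0 hdvd
  have e₂0 : 0 < e₂ := Nat.pos_of_dvd_of_pos hd2.1 h0
  have e₃0 : 0 < e₃ := Nat.pos_of_dvd_of_pos hd3.1 h0
  have hx' : c * P < D₂ * D₃ * K * (R * V) := by exact_mod_cast hx
  have h1 : (e₂ * e₃ * R) * P < (e₂ * e₃ * R) * (w₂ * w₃ * K * V) := by
    calc (e₂ * e₃ * R) * P ≤ c * P := Nat.mul_le_mul hle le_rfl
      _ < D₂ * D₃ * K * (R * V) := hx'
      _ ≤ (e₂ * w₂) * (e₃ * w₃) * K * (R * V) :=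
        Nat.mul_le_mul (Nat.mul_le_mul (Nat.mul_le_mul hd2.2.2 hd3.2.2) le_rfl) le_rfl
      _ = _ := by ring
  exact_mod_cast Nat.lt_of_mul_lt_mul_left h1

/-- The residues of the represented numbers below `D₂ D₃ Q`, where `Q` is the product of the primes
with an obstruction, are too few unless 5 is the only such prime. -/
theorem ClassData.eq_singleton_five (h : ClassData m l D₂ N₂ π D₃ N₃ τ) {B : Finset ℕ}
    (hB : ∀ p ∈ B, p.Prime ∧ 5 ≤ p ∧ ¬ (p : ℤ) ∣ (m : ℤ) - 2 ∧ PrimeShape p l)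
    (hgood : ∀ p : ℕ, p.Prime → 5 ≤ p → p ∉ B → ∀ N : ℕ, Loc m p l N) {q : ℕ} (hq : q ∈ B) :
    q = 5 := by
  by_contra hq5
  have hm := h.hm
  have hB5 : ∀ p ∈ B, p.Prime ∧ 5 ≤ p := fun p hp => ⟨(hB p hp).1, (hB p hp).2.1⟩
  have hdvd : ∀ p ∈ B, p ∣ m - 4 ∨ p ∣ m - 3 := fun p hp =>
    h.regular.prime_dvd hm h.hpos (hB p hp).1 (hB p hp).2.1 (hB p hp).2.2.1 (hB p hp).2.2.2
  set Q := ∏ p ∈ B, p with hQ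
  have hQ0 : 0 < Q := Finset.prod_pos fun p hp => (hB p hp).1.pos
  set K := D₂ * D₃ * Q with hK
  classical
  set A : ℕ → Finset ℕ := fun c => if Q ∣ c then {0} else (Finset.range K).filter fun x =>
    Admissible D₂ π D₃ τ c x ∧ c * polygonal m x < K with hA
  have hA1 : ∀ c ∈ l, (A c).card ^ 2 ≤ ∏ p ∈ B with ¬ p ∣ c, (p - 1) ∧
      ((B.filter fun p => ¬ p ∣ c).Nonempty → (B.filter fun p => ¬ p ∣ c) ≠ {5} →
        (A c).card ^ 2 < ∏ p ∈ B with ¬ p ∣ c, (p - 1)) := by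
    intro c hc
    rcases (B.filter fun p => ¬ p ∣ c).eq_empty_or_nonempty with he | hne
    · have hQc : Q ∣ c := Finset.prod_primes_dvd _ (fun p hp => (hB p hp).1.prime) fun p hp => by
        by_contra hpc
        have : p ∈ B.filter fun p => ¬ p ∣ c := Finset.mem_filter.2 ⟨hp, hpc⟩
        rw [he] at this
        simp at this
      rw [he]
      simp only [hA, if_pos hQc]
      simp
    · have hQc : ¬ Q ∣ c := fun hd => by
        obtain ⟨p, hp⟩ := hne
        obtain ⟨hp1, hp2⟩ := Finset.mem_filter.1 hp
        exact hp2 ((Finset.dvd_prod_of_mem _ hp1).trans hd)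
      have := card_sq_le (c := c) (π := π) hm h.hD₂ h.hD₃ (S := B.filter fun p => ¬ p ∣ c)
        (fun p hp => hB5 p (Finset.mem_of_mem_filter p hp)) hne
        (fun p hp => hdvd p (Finset.mem_of_mem_filter p hp)) (A := A c) (fun x hx => by
          simp only [hA, if_neg hQc, Finset.mem_filter] at hx
          refine ⟨hx.2.1, ?_⟩
          have := h.window hB5 hc (x := x) (K := 1) (by
            have h2 := hx.2.2
            refine lt_of_lt_of_eq h2 ?_
            rw [hK, hQ]
            push_cast
            ring)
          simpa using this)
      exact ⟨this.1, fun _ => this.2⟩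
  have hT : (argVals m A l).card < ∏ p ∈ B, (goodResidues m p l).card := by
    obtain ⟨c, hc, hqc⟩ := h.unit q (hB q hq).1
    have hlt : (l.map fun c => (A c).card ^ 2).prod <
        (l.map fun c => ∏ p ∈ B with ¬ p ∣ c, (p - 1)).prod := by
      have hmem : q ∈ B.filter fun p => ¬ p ∣ c := Finset.mem_filter.2 ⟨hq, hqc⟩
      refine prod_map_lt (fun c hc => (hA1 c hc).1) (fun c hc => Finset.prod_pos fun p hp => ?_) hc
        ((hA1 c hc).2 ⟨q, hmem⟩ fun he => hq5 (by rw [he] at hmem; simpa using hmem))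
      have := (hB5 p (Finset.mem_of_mem_filter p hp)).2
      omega
    rw [prod_map_prod_filter] at hlt
    have h2 : ∏ p ∈ B, (p - 1) ^ l.countP (fun c => decide (¬ p ∣ c)) ≤
        (∏ p ∈ B, (goodResidues m p l).card) ^ 2 := by
      rw [← Finset.prod_pow]
      exact Finset.prod_le_prod' fun p hp =>
        (hB p hp).2.2.2.goodResidues (hB p hp).1 (hB p hp).2.1 (hB p hp).2.2.1
    rw [prod_map_sq fun c => (A c).card] at hlt
    exact lt_of_le_of_lt (card_argVals_le m A l)
      (lt_of_pow_lt_pow_left₀ 2 (Nat.zero_le _) (lt_of_lt_of_le hlt h2))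
  obtain ⟨g, hg, hgT⟩ := exists_residues hT
  obtain ⟨n, hn⟩ := exists_modEq_of_residues B (fun p hp => (hB p hp).1) g
  obtain ⟨N, hNK, hN2, hN3, hNn⟩ := h.exists_nat (h.coprime_prod hB5) hQ0 n
  have hNp : ∀ p ∈ B, N ≡ g p [MOD p] := fun p hp =>
    (hNn.of_dvd (Finset.dvd_prod_of_mem _ hp)).trans (hn p hp)
  obtain ⟨zs, rfl, hv, hz⟩ := h.exists_args hN2 hN3 (fun p hp hp5 => by
      by_cases hpB : p ∈ B
      · obtain ⟨h1, h2⟩ := mem_goodResidues.1 (hg p hpB)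
        exact h2 N (Eq.trans (hNp p hpB) (Nat.mod_eq_of_lt h1))
      · exact hgood p hp hp5 hpB N)
  obtain ⟨w, hw, hd⟩ := exists_mem_argVals (m := m) (Q := Q) (A := A) (zs := zs) fun z hzm => by
    by_cases hQz : Q ∣ z.1
    · exact Or.inr ⟨hQz, by simp [hA, hQz]⟩
    · left
      have hlt : z.1 * polygonal m z.2 < K :=
        lt_of_le_of_lt (hz z hzm).2 (by exact_mod_cast hNK)
      simp only [hA, if_neg hQz, Finset.mem_filter, Finset.mem_range]
      refine ⟨?_, (hz z hzm).1, hlt⟩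
      have h1 : (1 : ℤ) ≤ z.1 := by
        exact_mod_cast h.hpos z.1 (List.mem_map_of_mem hzm)
      have h2 : (z.2 : ℤ) ≤ polygonal m z.2 := by
        have := two_mul_polygonal m z.2
        have hm' : (9 : ℤ) ≤ m := by exact_mod_cast hm
        have h3 : (0 : ℤ) ≤ z.2 * (z.2 - 1) := by
          rcases Nat.eq_zero_or_pos z.2 with h | h
          · simp [h]
          · exact mul_nonneg (by omega) (by omega)
        nlinarith
      have h3 : polygonal m z.2 ≤ z.1 * polygonal m z.2 :=
        le_mul_of_one_le_left ((Int.natCast_nonneg _).trans h2) h1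
      exact_mod_cast lt_of_le_of_lt (h2.trans h3) hlt
  obtain ⟨p, hp, hne⟩ := hgT w hw
  refine hne ?_
  have h1 : (p : ℤ) ∣ N - w := by
    rw [← hv]
    exact (Int.natCast_dvd_natCast.2 (Finset.dvd_prod_of_mem _ hp)).trans hd
  have h2 : w % p = N % p := Int.modEq_iff_dvd.2 h1
  rw [h2, ← Int.natCast_mod, hNp p hp, Nat.mod_eq_of_lt (mem_goodResidues.1 (hg p hp)).1]

end ClassData

/-! ### The prime 5 has no obstruction -/

/-- The arguments of `c` in the window of length `5` times the window factor take at most one value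
modulo 5 apart from `δ`, the value at which `polygonal m` is degenerate modulo 5. -/
def Narrow (m D₂ : ℕ) (π : ℕ → ℕ) (D₃ τ : ℕ) (δ : ℤ) (c : ℕ) : Prop :=
  ∃ p : ℤ, ∀ x : ℕ, Admissible D₂ π D₃ τ c x → polygonal m x < windowFactor D₂ D₃ c * 5 →
    (polygonal m x - p) % 5 = 0 ∨ (polygonal m x - δ) % 5 = 0

theorem polygonal_cases_four {m : ℕ} (hm : 4 ≤ m) (x : ℕ) :
    (x = 0 ∧ polygonal m x = 0) ∨ (x = 1 ∧ polygonal m x = 1) ∨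
      (x = 2 ∧ polygonal m x = m) ∨ (x = 3 ∧ polygonal m x = 3 * m - 3) ∨
      6 * (m : ℤ) - 8 ≤ polygonal m x := by
  rcases (by omega : x = 0 ∨ x = 1 ∨ x = 2 ∨ x = 3 ∨ 4 ≤ x) with rfl | rfl | rfl | rfl | h
  · exact Or.inl ⟨rfl, polygonal_zero m⟩
  · exact Or.inr (Or.inl ⟨rfl, polygonal_one m⟩)
  · exact Or.inr (Or.inr (Or.inl ⟨rfl, polygonal_two m⟩))
  · exact Or.inr (Or.inr (Or.inr (Or.inl ⟨rfl, polygonal_three m⟩)))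
  · exact Or.inr (Or.inr (Or.inr (Or.inr (polygonal_four m ▸ polygonal_mono hm h))))

theorem narrow_or {m c D₂ D₃ τ : ℕ} {π : ℕ → ℕ} {δ : ℤ} (hm : 9 ≤ m)
    (hD₂ : D₂ = 1 ∨ (m % 4 = 0 ∧ (D₂ = 2 ∨ D₂ = 4 ∨ D₂ = 8)))
    (hD₃ : D₃ = 1 ∨ (D₃ = 3 ∧ ((m % 3 = 1 ∧ τ = 0) ∨ (m % 3 = 0 ∧ τ = 1))))
    (hδ : (m % 5 = 4 ∧ δ = 0) ∨ (m % 5 = 3 ∧ δ = 3)) :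
    Narrow m D₂ π D₃ τ δ c ∨ (m % 5 = 3 ∧ δ = 3 ∧ D₃ ∣ c ∧ (D₂ ∣ c ∨ D₂ = 2 ∧ m % 4 = 0) ∧
      ∀ x : ℕ, polygonal m x < windowFactor D₂ D₃ c * 5 → polygonal m x = 0 ∨ polygonal m x = 1) := by
  by_cases hw : m % 5 = 3 ∧ D₃ ∣ c ∧ (D₂ ∣ c ∨ D₂ = 2)
  · obtain ⟨h5, h3, h2⟩ := hw
    refine Or.inr ⟨h5, by omega, h3, by grind, fun x hx => ?_⟩
    have := polygonal_cases (by omega : 4 ≤ m) x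
    unfold windowFactor at hx
    rw [if_pos h3] at hx
    split_ifs at hx <;> grind
  · left
    by_cases hex : ∃ x : ℕ, Admissible D₂ π D₃ τ c x ∧ polygonal m x < windowFactor D₂ D₃ c * 5 ∧
      (polygonal m x - δ) % 5 ≠ 0
    · obtain ⟨x, hx1, hx2, hx3⟩ := hex
      refine ⟨polygonal m x, fun y hy1 hy2 => ?_⟩
      have kx := polygonal_cases_four (by omega : 4 ≤ m) x
      have ky := polygonal_cases_four (by omega : 4 ≤ m) y
      generalize polygonal m x = P at *
      generalize polygonal m y = R at *
      unfold Admissible at hx1 hy1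
      unfold windowFactor at hx2 hy2
      by_cases h3 : D₃ ∣ c
      · have g : D₂ ∣ c ∨ D₂ = 2 → m % 5 = 4 ∧ δ = 0 := fun h =>
          hδ.resolve_right fun h5 => hw ⟨h5.1, h3, h⟩
        clear hw
        by_cases h2 : D₂ ∣ c
        · obtain ⟨g1, g2⟩ := g (Or.inl h2)
          simp only [if_pos h2, if_pos h3] at hx2 hy2
          clear g hδ hD₂ hD₃ hx1 hy1 h2 h3
          omega
        · obtain ⟨hm4, -⟩ := hD₂.resolve_left fun h => h2 (h ▸ one_dvd c)
          by_cases hD : D₂ = 2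
          · obtain ⟨g1, g2⟩ := g (Or.inr hD)
            simp only [if_neg h2, if_pos hD, if_pos h3] at hx2 hy2
            clear g hδ hD₂ hD₃ hx1 hy1 h2 h3
            omega
          · have a1 := (hx1.1 hD h2).trans (hy1.1 hD h2).symm
            simp only [if_neg h2, if_neg hD, if_pos h3] at hx2 hy2
            clear g hD₂ hD₃ hx1 hy1 h2 h3
            rcases hδ with ⟨g1, g2⟩ | ⟨g1, g2⟩ <;> rcases kx with kx | kx | kx | kx | kx <;> omega
      · obtain ⟨-, h⟩ := hD₃.resolve_left fun h => h3 (h ▸ one_dvd c)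
        have b1 := hx1.2 h3
        have b2 := hy1.2 h3
        clear hw
        by_cases h2 : D₂ ∣ c
        · simp only [if_pos h2, if_neg h3] at hx2 hy2
          clear hD₂ hD₃ hx1 hy1 h2 h3
          rcases hδ with ⟨g1, g2⟩ | ⟨g1, g2⟩ <;> rcases kx with kx | kx | kx | kx | kx <;> omega
        · obtain ⟨hm4, -⟩ := hD₂.resolve_left fun h => h2 (h ▸ one_dvd c)
          by_cases hD : D₂ = 2
          · simp only [if_neg h2, if_pos hD, if_neg h3] at hx2 hy2
            clear hD₂ hD₃ hx1 hy1 h2 h3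
            rcases hδ with ⟨g1, g2⟩ | ⟨g1, g2⟩ <;> rcases kx with kx | kx | kx | kx | kx <;> omega
          · have a1 := (hx1.1 hD h2).trans (hy1.1 hD h2).symm
            simp only [if_neg h2, if_neg hD, if_neg h3] at hx2 hy2
            clear hD₂ hD₃ hx1 hy1 h2 h3
            rcases hδ with ⟨g1, g2⟩ | ⟨g1, g2⟩ <;> rcases kx with kx | kx | kx | kx | kx <;> omega
    · exact ⟨0, fun x h1 h2 => Or.inr (by by_contra h3; exact hex ⟨x, h1, h2, h3⟩)⟩

section Five
variable {m D₂ N₂ D₃ N₃ τ : ℕ} {π : ℕ → ℕ} {l t : List ℕ}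

/-- A form in which the condition at 5 is the only one at the primes `p ≥ 5`, and the value `δ` at
which `polygonal m` is degenerate modulo 5. -/
structure FiveData (m : ℕ) (l : List ℕ) (D₂ N₂ : ℕ) (π : ℕ → ℕ) (D₃ N₃ τ : ℕ) (δ : ℤ) : Prop
    extends ClassData m l D₂ N₂ π D₃ N₃ τ where
  good : ∀ p : ℕ, p.Prime → 5 ≤ p → p ≠ 5 → ∀ N : ℕ, Loc m p l N
  hδ : (m % 5 = 4 ∧ δ = 0) ∨ (m % 5 = 3 ∧ δ = 3)

variable {δ : ℤ}

theorem FiveData.not_dvd (h : FiveData m l D₂ N₂ π D₃ N₃ τ δ) : ¬ ((5 : ℕ) : ℤ) ∣ (m : ℤ) - 2 := by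
  have := h.hδ
  omega

/-- A number in the given classes modulo `D₂`, `D₃` and 5 that satisfies the condition at 5 is
represented with admissible arguments. -/
theorem FiveData.exists_args (h : FiveData m l D₂ N₂ π D₃ N₃ τ δ) (r K : ℕ) :
    ∃ n < D₂ * D₃ * 5, n % 5 = r % 5 ∧ ∀ k < K,
      (∀ N : ℕ, N = n + D₂ * D₃ * (5 * k) → N % 5 = r % 5 → Loc m 5 l N) →
      ∃ zs : List (ℕ × ℕ), zs.map Prod.fst = l ∧
        argVal m zs = n + 5 * ((D₂ * D₃ : ℕ) * k) ∧ argVal m zs < 5 * ((D₂ * D₃ : ℕ) * K) ∧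
        ∀ z ∈ zs, Admissible D₂ π D₃ τ z.1 z.2 := by
  have hc : Nat.Coprime (D₂ * D₃) 5 := by
    simpa using h.coprime_prod (B := {5}) (by simp [Nat.prime_five])
  obtain ⟨n, hn, h2, h3, hr⟩ := h.exists_nat hc (by simp) r
  refine ⟨n, hn, hr, fun k hk h5 => ?_⟩
  have hd : n ≡ n + D₂ * D₃ * (5 * k) [MOD D₂ * D₃] := by simp [Nat.ModEq]
  obtain ⟨zs, hzs, hv, hz⟩ := h.toClassData.exists_args ((hd.symm.of_dvd (Dvd.intro _ rfl)).trans h2)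
    ((hd.symm.of_dvd (Dvd.intro_left _ rfl)).trans h3) fun p hp hp5 => by
      by_cases hp' : p = 5
      · subst hp'
        refine h5 _ rfl ?_
        rw [← hr, mul_left_comm]
        simp
      · exact h.good p hp hp5 hp' _
  have h1 : argVal m zs = n + 5 * ((D₂ * D₃ : ℕ) * k) := by
    rw [hv]
    push_cast
    ring
  refine ⟨zs, hzs, h1, ?_, fun z hzm => (hz z hzm).1⟩
  have : D₂ * D₃ * (k + 1) ≤ D₂ * D₃ * K := Nat.mul_le_mul le_rfl hk
  rw [h1]
  zify at this hn
  push_cast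
  linarith

theorem FiveData.window (h : FiveData m l D₂ N₂ π D₃ N₃ τ δ) {c : ℕ} (hc : c ∈ l) (hc5 : ¬ 5 ∣ c)
    {x K : ℕ} (hx : c * polygonal m x < 5 * ((D₂ * D₃ : ℕ) * K)) :
    polygonal m x < windowFactor D₂ D₃ c * K * 5 := by
  have := h.toClassData.window (B := {5}) (by simp [Nat.prime_five]) hc (x := x) (K := K) (by
    refine lt_of_lt_of_eq hx ?_
    push_cast
    simp
    ring)
  rwa [Finset.filter_true_of_mem (by simpa using hc5), Finset.prod_singleton] at this

theorem Narrow.of_window (h : FiveData m l D₂ N₂ π D₃ N₃ τ δ) {c : ℕ} (hc : c ∈ l) (hc5 : ¬ 5 ∣ c)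
    (hn : Narrow m D₂ π D₃ τ δ c) : ∃ p : ℤ, ∀ zs : List (ℕ × ℕ), ∀ x : ℕ, (c, x) ∈ zs →
      argVal m zs < 5 * ((D₂ * D₃ : ℕ) * (1 : ℕ)) → (∀ z ∈ zs, Admissible D₂ π D₃ τ z.1 z.2) →
      (c * polygonal m x - p) % 5 = 0 ∨ (c * polygonal m x - c * δ) % 5 = 0 := by
  obtain ⟨p, hp⟩ := hn
  have key : ∀ u v : ℤ, (u - v) % 5 = 0 → (c * u - c * v) % 5 = 0 := fun u v h => by
    rw [← mul_sub]
    exact Int.emod_eq_zero_of_dvd ((Int.dvd_of_emod_eq_zero h).mul_left _)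
  refine ⟨c * p, fun zs x hx hlt had => (hp x (had _ hx) ?_).imp (key _ _) (key _ _)⟩
  have := h.window hc hc5 (lt_of_le_of_lt
    (mul_polygonal_le_argVal (by have := h.hm; omega : 4 ≤ m) hx) hlt)
  simpa using this

theorem FiveData.not_narrow_one (h : FiveData m l D₂ N₂ π D₃ N₃ τ δ) {a : ℕ}
    (hl : l.Perm (a :: t)) (ha : ¬ 5 ∣ a) (ht : ∀ c ∈ t, 5 ∣ c) : ¬ Narrow m D₂ π D₃ τ δ a := by
  intro hn
  obtain ⟨p, hp⟩ := hn.of_window h (hl.mem_iff.2 List.mem_cons_self) ha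
  have key : ∀ (y r : ℕ), ((m % 5 = 4 ∧ (y = 1 ∧ r = a ∨ y = 2 ∧ r = 4 * a)) ∨
      (m % 5 = 3 ∧ (y = 0 ∧ r = 0 ∨ y = 1 ∧ r = a))) →
        (r - p) % 5 = 0 ∨ (r - a * δ) % 5 = 0 := by
    intro y r hy
    obtain ⟨n, -, hn, H⟩ := h.exists_args r 1
    obtain ⟨zs, hzs, hv, hlt, had⟩ := H 0 one_pos (fun N _ hN => Loc.perm hl.symm
      (Loc.of_prime_unit Nat.prime_five (by simp) h.not_dvd ha (x := y)
        (by rcases hy with ⟨hm, ⟨rfl, -⟩ | ⟨rfl, -⟩⟩ | ⟨hm, ⟨rfl, -⟩ | ⟨rfl, -⟩⟩ <;> push_cast <;>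
          omega)
        (val_polygonal_zero m t) (by
          rw [Int.modEq_iff_dvd]
          rcases hy with ⟨hm, ⟨rfl, rfl⟩ | ⟨rfl, rfl⟩⟩ | ⟨hm, ⟨rfl, rfl⟩ | ⟨rfl, rfl⟩⟩
          · rw [Nat.cast_one, polygonal_one]
            omega
          · obtain ⟨j, rfl⟩ : ∃ j, m = 5 * j + 4 := ⟨m / 5, by omega⟩
            rw [Nat.cast_two, polygonal_two]
            push_cast
            ring_nf
            omega
          · rw [Nat.cast_zero, polygonal_zero]
            omega
          · rw [Nat.cast_one, polygonal_one]
            omega)))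
    obtain ⟨x, zs₁, hx, h1⟩ := exists_cons_of_map_perm (hzs ▸ hl)
    have hw := dvd_argVal_of_map_perm (m := m) h1 ht
    have := hp zs x (hx.mem_iff.2 List.mem_cons_self) hlt had
    rw [argVal_perm hx, argVal_cons] at hv
    push_cast at hv hw
    omega
  rcases h.hδ with ⟨hm, rfl⟩ | ⟨hm, rfl⟩
  · have h1 := key 1 a (by omega)
    have h2 := key 2 (4 * a) (by omega)
    omega
  · have h1 := key 0 0 (by omega)
    have h2 := key 1 a (by omega)
    omega

theorem FiveData.loc_two (h : FiveData m l D₂ N₂ π D₃ N₃ τ δ) {a b : ℕ}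
    (hl : l.Perm (a :: b :: t)) (ha : ¬ 5 ∣ a) (hb : ¬ 5 ∣ b) (ht : ∀ c ∈ t, 5 ∣ c) {N : ℕ}
    (hN : (N - δ * (a + b)) % 5 ≠ 0) : Loc m 5 l N := by
  refine Loc.perm hl.symm (Loc.of_qLoc_odd Nat.prime_five (by simp) h.not_dvd
    (QLoc.two_units Nat.prime_five (by simp) ha hb (fun hd => hN ?_) t))
  have hs : 5 ∣ t.sum := List.dvd_sum ht
  obtain ⟨s, hs⟩ := hs
  rw [List.sum_cons, List.sum_cons, hs] at hd
  rcases h.hδ with ⟨hm, rfl⟩ | ⟨hm, rfl⟩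
  · obtain ⟨j, rfl⟩ : ∃ j, m = 5 * j + 4 := ⟨m / 5, by omega⟩
    push_cast at hd
    ring_nf at hd
    omega
  · obtain ⟨j, rfl⟩ : ∃ j, m = 5 * j + 3 := ⟨m / 5, by omega⟩
    push_cast at hd
    ring_nf at hd
    omega

/-- Two unit coefficients take at most four values modulo 5 in the window, and one of them is
degenerate or they are not all four of the others. -/
theorem FiveData.not_narrow_two (h : FiveData m l D₂ N₂ π D₃ N₃ τ δ) {a b : ℕ}
    (hl : l.Perm (a :: b :: t)) (ha : ¬ 5 ∣ a) (hb : ¬ 5 ∣ b) (ht : ∀ c ∈ t, 5 ∣ c) :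
    ¬ Narrow m D₂ π D₃ τ δ a := by
  intro hn
  obtain ⟨p, hp⟩ := hn.of_window h (hl.mem_iff.2 List.mem_cons_self) ha
  have hbl := hl.mem_iff.2 (List.mem_cons_of_mem a List.mem_cons_self)
  have key : ∀ k : ℕ, k % 5 ≠ 0 → ∃ (zs : List (ℕ × ℕ)) (u : ℤ) (y : ℕ), (b, y) ∈ zs ∧
      argVal m zs < 5 * ((D₂ * D₃ : ℕ) * (1 : ℕ)) ∧
      (∀ z ∈ zs, Admissible D₂ π D₃ τ z.1 z.2) ∧
      ((u - p) % 5 = 0 ∨ (u - a * δ) % 5 = 0) ∧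
      (u + b * polygonal m y - δ * (a + b) - k) % 5 = 0 := by
    intro k hk
    have hδ0 : 0 ≤ δ := by have := h.hδ; omega
    obtain ⟨d, rfl⟩ := Int.eq_ofNat_of_zero_le hδ0
    obtain ⟨n, -, hn, H⟩ := h.exists_args (d * (a + b) + k) 1
    obtain ⟨zs, hzs, hv, hlt, had⟩ := H 0 one_pos fun N _ hN =>
      h.loc_two hl ha hb ht (by zify at hN; omega)
    obtain ⟨x, zs₁, hx, h1⟩ := exists_cons_of_map_perm (hzs ▸ hl)
    obtain ⟨y, zs₂, hy, h2⟩ := exists_cons_of_map_perm h1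
    have hw := dvd_argVal_of_map_perm (m := m) h2 ht
    refine ⟨zs, a * polygonal m x, y, hx.mem_iff.2 (List.mem_cons_of_mem _
      (hy.mem_iff.2 List.mem_cons_self)), hlt, had,
      hp zs x (hx.mem_iff.2 List.mem_cons_self) hlt had, ?_⟩
    rw [argVal_perm hx, argVal_cons, argVal_perm hy, argVal_cons] at hv
    zify at hn
    push_cast at hv hw
    omega
  obtain ⟨z₁, u₁, y₁, m₁, l₁, d₁, e₁, f₁⟩ := key 1 (by simp)
  obtain ⟨z₂, u₂, y₂, m₂, l₂, d₂, e₂, f₂⟩ := key 2 (by simp)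
  obtain ⟨z₃, u₃, y₃, m₃, l₃, d₃, e₃, f₃⟩ := key 3 (by simp)
  obtain ⟨z₄, u₄, y₄, m₄, l₄, d₄, e₄, f₄⟩ := key 4 (by simp)
  rcases narrow_or (c := b) (π := π) h.hm h.hD₂ h.hD₃ h.hδ with hn | ⟨hm, rfl, -, -, H⟩
  · obtain ⟨q, hq⟩ := hn.of_window h hbl hb
    have g₁ := hq _ _ m₁ l₁ d₁
    have g₂ := hq _ _ m₂ l₂ d₂
    have g₃ := hq _ _ m₃ l₃ d₃
    have g₄ := hq _ _ m₄ l₄ d₄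
    rw [mul_add, mul_comm δ, mul_comm δ] at f₁ f₂ f₃ f₄
    have k : ∀ {u v i p q s t : ℤ}, ((u - p) % 5 = 0 ∨ (u - s) % 5 = 0) →
        ((v - q) % 5 = 0 ∨ (v - t) % 5 = 0) → (u + v - (s + t) - i) % 5 = 0 → i % 5 ≠ 0 →
        (p + q - s - t - i) % 5 = 0 ∨ (p - s - i) % 5 = 0 ∨ (q - t - i) % 5 = 0 := by
      intros
      omega
    have k₁ := k e₁ g₁ f₁ (by simp)
    have k₂ := k e₂ g₂ f₂ (by simp)
    have k₃ := k e₃ g₃ f₃ (by simp)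
    have k₄ := k e₄ g₄ f₄ (by simp)
    push_cast at k₁ k₂ k₃ k₄
    clear * - k₁ k₂ k₃ k₄
    omega
  · have H' : ∀ zs : List (ℕ × ℕ), ∀ y : ℕ, (b, y) ∈ zs → argVal m zs < 5 * ((D₂ * D₃ : ℕ) * (1 : ℕ)) →
        b * polygonal m y = 0 ∨ b * polygonal m y = b := fun zs y hy hlt => by
      have := h.window hbl hb (lt_of_le_of_lt
        (mul_polygonal_le_argVal (by have := h.hm; omega : 4 ≤ m) hy) hlt)
      rcases H y (by simpa using this) with h | h <;> simp [h]
    have g₁ := H' _ _ m₁ l₁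
    have g₂ := H' _ _ m₂ l₂
    have g₃ := H' _ _ m₃ l₃
    have g₄ := H' _ _ m₄ l₄
    have k : ∀ {u v i : ℤ}, ((u - p) % 5 = 0 ∨ (u - a * 3) % 5 = 0) → (v = 0 ∨ v = b) →
        (u + v - 3 * (a + b) - i) % 5 = 0 → (p - a * 3 - 3 * b - i) % 5 = 0 ∨
          (p - a * 3 - 2 * b - i) % 5 = 0 ∨ (2 * b - i) % 5 = 0 ∨ (3 * b - i) % 5 = 0 := by
      intros
      omega
    have k₁ := k e₁ g₁ f₁
    have k₂ := k e₂ g₂ f₂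
    have k₃ := k e₃ g₃ f₃
    have k₄ := k e₄ g₄ f₄
    push_cast at k₁ k₂ k₃ k₄
    clear * - k₁ k₂ k₃ k₄ hb
    generalize p - a * 3 = r at *
    rcases (by omega : b % 5 = 1 ∨ b % 5 = 2 ∨ b % 5 = 3 ∨ b % 5 = 4) with h | h | h | h <;> omega

end Five

theorem exists_perm_of_not_dvd (d : ℕ) (t : List ℕ) : (∀ c ∈ t, d ∣ c) ∨
    (∃ e s, t.Perm (e :: s) ∧ ∀ c ∈ s, d ∣ c) ∨
    ∃ e f s, t.Perm (e :: f :: s) ∧ ¬ d ∣ e ∧ ¬ d ∣ f := by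
  by_cases h1 : ∀ c ∈ t, d ∣ c
  · exact Or.inl h1
  push Not at h1
  obtain ⟨e, he, hde⟩ := h1
  have hp := List.perm_cons_erase he
  by_cases h2 : ∀ c ∈ t.erase e, d ∣ c
  · exact Or.inr (Or.inl ⟨e, _, hp, h2⟩)
  push Not at h2
  obtain ⟨f, hf, hdf⟩ := h2
  exact Or.inr (Or.inr ⟨e, f, _, hp.trans ((List.perm_cons_erase hf).cons e), hde, hdf⟩)

theorem polygonal_mod_five {m : ℕ} (hm : m % 5 = 3) (x : ℤ) :
    polygonal m x % 5 = 0 ∨ polygonal m x % 5 = 1 ∨ polygonal m x % 5 = 3 := by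
  obtain ⟨j, rfl⟩ : ∃ j, m = 5 * j + 3 := ⟨m / 5, by omega⟩
  obtain ⟨q, r, hx, hr⟩ : ∃ q r : ℤ, x = 5 * q + r ∧ (r = 0 ∨ r = 1 ∨ r = 2 ∨ r = 3 ∨ r = 4) :=
    ⟨x / 5, x % 5, by omega, by omega⟩
  have h := two_mul_polygonal (5 * j + 3) x
  push_cast at h
  have h2 : 2 * polygonal (5 * j + 3) x = r ^ 2 + r +
      5 * (j * (x ^ 2 - x) + 5 * q ^ 2 + 2 * q * r + q) := by
    rw [h, hx]
    ring
  rcases hr with rfl | rfl | rfl | rfl | rfl <;> omega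

section Five
variable {m D₂ N₂ D₃ N₃ τ : ℕ} {π : ℕ → ℕ} {l t : List ℕ}

/-- If small numbers divisible by 5 are represented by the coefficients divisible by 5 alone, then
two of these are not divisible by 25, so that the degenerate class modulo 5 contains a small number
that is represented locally. -/
theorem FiveData.false_of_tail (h : FiveData m l D₂ N₂ π D₃ N₃ τ 3) {U : List ℕ}
    (hl : l.Perm (U ++ t)) (ht : ∀ c ∈ t, 5 ∣ c) (loc0 : ∀ N : ℕ, N % 5 = 0 → Loc m 5 l N)
    (H0 : ∀ zs : List (ℕ × ℕ), zs.map Prod.fst = l → argVal m zs % 5 = 0 →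
      argVal m zs < 15 * (D₂ * D₃ : ℕ) ∨
        (argVal m zs < 20 * (D₂ * D₃ : ℕ) ∧ m < 3 * (D₂ * D₃)) →
      ∃ zs' : List (ℕ × ℕ), (zs'.map Prod.fst).Perm t ∧ argVal m zs' = argVal m zs)
    (H1 : ∀ zs : List (ℕ × ℕ), zs.map Prod.fst = l → (argVal m zs - 3 * (U.sum : ℕ)) % 5 = 0 →
      10 * ((D₂ * D₃ : ℕ) : ℤ) ≤ argVal m zs) : False := by
  have hm := h.hm
  have hm5 : m % 5 = 3 := by have := h.hδ; omega
  have hD5 : (D₂ * D₃) % 5 ≠ 0 := fun h5 => by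
    have hc : Nat.Coprime (D₂ * D₃) 5 := by
      simpa using h.coprime_prod (B := {5}) (by simp [Nat.prime_five])
    have := Nat.dvd_gcd (Nat.dvd_of_mod_eq_zero h5) (dvd_refl 5)
    rw [hc] at this
    omega
  have hpos : ∀ c ∈ t, 0 < c := fun c hc =>
    h.hpos c (hl.mem_iff.2 (List.mem_append_right _ hc))
  have ex := h.exists_args
  generalize D₂ * D₃ = D at *
  obtain ⟨K, hK3, hK⟩ : ∃ K, 3 ≤ K ∧ ((K = 3 ∧ 3 * D ≤ m) ∨ (K = 4 ∧ m < 3 * D)) := by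
    by_cases h3 : 3 * D ≤ m
    · exact ⟨3, le_rfl, Or.inl ⟨rfl, h3⟩⟩
    · exact ⟨4, by simp, Or.inr ⟨rfl, by omega⟩⟩
  obtain ⟨n, hn, hn5, H⟩ := ex 0 K
  have H' : ∀ k < K, ∃ zs : List (ℕ × ℕ), (zs.map Prod.fst).Perm t ∧
      argVal m zs = n + 5 * (D * k) ∧ argVal m zs < 5 * (D * K) := fun k hk => by
    obtain ⟨zs, hzs, hv, hlt, -⟩ := H k hk fun N _ => loc0 N
    obtain ⟨zs', h1, h2⟩ := H0 zs hzs (by rw [hv]; omega) (by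
      rcases hK with ⟨rfl, hK⟩ | ⟨rfl, hK⟩ <;> push_cast at hlt <;> omega)
    exact ⟨zs', h1, h2.trans hv, h2 ▸ hlt⟩
  rcases exists_perm_of_not_dvd 25 t with h25 | ⟨e, s, he, h25⟩ | ⟨e, f, s, he, he1, hf1⟩
  · obtain ⟨zs, h1, h2, -⟩ := H' 0 (by omega)
    obtain ⟨zs', h3, h4, -⟩ := H' 1 (by omega)
    have h5 := dvd_argVal_of_map_perm (m := m) h1 h25
    have h6 := dvd_argVal_of_map_perm (m := m) h3 h25
    omega
  · have he5 := ht e (he.mem_iff.2 List.mem_cons_self)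
    have he0 := hpos e (he.mem_iff.2 List.mem_cons_self)
    have key : ∀ k < K, ((n : ℤ) + 5 * (D * k)) % 25 = 0 ∨ ((n : ℤ) + 5 * (D * k) - e) % 25 = 0 ∨
        (m < 3 * D ∧ ((n : ℤ) + 5 * (D * k) - 3 * e) % 25 = 0) := fun k hk => by
      obtain ⟨zs, h1, h2, hlt⟩ := H' k hk
      obtain ⟨x, zs₁, hx, h3⟩ := exists_cons_of_map_perm (h1.trans he)
      have h4 := dvd_argVal_of_map_perm (m := m) h3 h25
      have h5 := argVal_nonneg (by omega : 4 ≤ m) zs₁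
      have h6 := polygonal_nonneg (by omega : 4 ≤ m) x
      rw [argVal_perm hx, argVal_cons] at h2 hlt
      obtain ⟨e', rfl⟩ := he5
      have h7 := polygonal_mod_five hm5 x
      have h8 : m < 3 * D ∨ polygonal m x < m := by
        rcases hK with ⟨rfl, hK⟩ | ⟨-, hK⟩
        · right
          have : 5 * polygonal m x ≤ (5 * e' : ℕ) * polygonal m x :=
            mul_le_mul_of_nonneg_right (by omega) h6
          push_cast at hlt this
          omega
        · exact Or.inl hK
      have h9 := polygonal_le_one (by omega : 4 ≤ m) (x := x)
      generalize polygonal m x = P at *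
      obtain ⟨q, r, hP, hr⟩ : ∃ q r, P = 5 * q + r ∧ r = P % 5 := ⟨P / 5, P % 5, by omega, rfl⟩
      have h10 : ((5 * e' : ℕ) : ℤ) * P = 25 * (e' * q) + 5 * (e' * r) := by
        rw [hP]
        push_cast
        ring
      rw [h10] at h2
      push_cast at h2 h4
      clear ex H H' H0 H1 hlt h10
      rcases h7 with h7 | h7 | h7
      · rw [hr, h7] at h2
        omega
      · rw [hr, h7] at h2
        omega
      · rw [hr, h7] at h2
        omega
    obtain ⟨e', rfl⟩ := he5
    obtain ⟨n', rfl⟩ := Nat.dvd_of_mod_eq_zero (Eq.trans hn5 (by simp) : n % 5 = 0)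
    have red : ∀ k < K, (n' + D * k) % 5 = 0 ∨ (n' + D * k) % 5 = e' % 5 ∨
        (m < 3 * D ∧ (n' + D * k) % 5 = 3 * e' % 5) := fun k hk => by
      have := key k hk
      rw [← Nat.cast_mul D] at this
      generalize D * k = w at *
      omega
    have k0 := red 0 (by omega)
    have k1 := red 1 (by omega)
    have k2 := red 2 (by omega)
    have k3 := red 3
    clear * - k0 k1 k2 k3 hD5 hK
    rcases hK with ⟨rfl, hK⟩ | ⟨rfl, hK⟩
    · omega
    · replace k3 := k3 (by simp)
      rcases (by omega : D % 5 = 1 ∨ D % 5 = 2 ∨ D % 5 = 3 ∨ D % 5 = 4) with h | h | h | h <;>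
      rcases k0 with k0 | k0 | ⟨-, k0⟩ <;> rcases k1 with k1 | k1 | ⟨-, k1⟩ <;> omega
  · obtain ⟨s5, hs5⟩ := List.dvd_sum ht
    have hM : ∀ N : ℕ, N % 5 = 3 * U.sum % 5 →
        (8 * ((m : ℤ) - 2) * N + ((m : ℤ) - 4) ^ 2 * l.sum) % 25 ≠ 0 → Loc m 5 l N := by
      intro N hN hM
      obtain ⟨M, hM5⟩ : (5 : ℤ) ∣ 8 * ((m : ℤ) - 2) * N + ((m : ℤ) - 4) ^ 2 * l.sum := by
        rw [hl.sum_eq, List.sum_append, hs5]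
        clear H0 H1
        generalize U.sum = u at *
        obtain ⟨j, rfl⟩ : ∃ j, m = 5 * j + 3 := ⟨m / 5, by omega⟩
        push_cast
        ring_nf
        omega
      refine Loc.of_qLoc_odd Nat.prime_five (by simp) h.not_dvd ?_
      rw [hM5] at hM ⊢
      have ht' : t = (t.map (· / 5)).map (5 * ·) := by
        rw [List.map_map]
        exact (List.map_id t).symm.trans
          (List.map_congr_left fun c hc => (Nat.mul_div_cancel' (ht c hc)).symm)
      have hp : (t.map (· / 5)).Perm (e / 5 :: f / 5 :: s.map (· / 5)) := he.map _
      have hunit : ∀ c ∈ t, ¬ 25 ∣ c → ¬ 5 ∣ c / 5 := fun c hc hc25 => by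
        have := ht c hc
        omega
      refine QLoc.perm ((List.Perm.of_eq (by rw [← ht'])).trans hl.symm)
        (QLoc.mul_prime (p := 5) (l := U) (l' := t.map (· / 5)) (M := M) ?_)
      have h2 : QLoc 5 ((e / 5 :: f / 5 :: s.map (· / 5)) ++ U.map fun c => 5 * c) M :=
        QLoc.two_units Nat.prime_five (by simp) (hunit e (he.mem_iff.2 List.mem_cons_self) he1)
          (hunit f (he.mem_iff.2 (List.mem_cons_of_mem _ List.mem_cons_self)) hf1)
          (fun hd => by push_cast at hd; omega) _
      exact QLoc.perm ((hp.symm.append_right _).trans List.perm_append_comm) h2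
    obtain ⟨n, hn, hn5, H⟩ := ex (3 * U.sum) 2
    have fin : ∀ k < 2, (8 * ((m : ℤ) - 2) * (n + D * (5 * k) : ℕ) + ((m : ℤ) - 4) ^ 2 * l.sum) % 25
        = 0 := fun k hk => by
      by_contra hne
      obtain ⟨zs, hzs, hv, hlt, -⟩ := H k hk fun N hN hN5 => hM N hN5 (by rw [hN]; exact hne)
      have := H1 zs hzs (by rw [hv]; omega)
      omega
    have f0 := fin 0 (by simp)
    have f1 := fin 1 (by simp)
    have : (8 * ((m : ℤ) - 2) * (5 * D)) % 25 = 0 := by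
      have := dvd_sub (Int.dvd_of_emod_eq_zero f1) (Int.dvd_of_emod_eq_zero f0)
      refine Int.emod_eq_zero_of_dvd (this.trans (dvd_of_eq ?_))
      push_cast
      ring
    clear * - this hm5 hD5
    obtain ⟨j, rfl⟩ : ∃ j, m = 5 * j + 3 := ⟨m / 5, by omega⟩
    push_cast at this
    ring_nf at this
    omega

end Five

section Five
variable {m D₂ N₂ D₃ N₃ τ : ℕ} {π : ℕ → ℕ} {l : List ℕ} {δ : ℤ}

/-- The sizes of the coefficients that are not narrow. -/
theorem FiveData.size (h : FiveData m l D₂ N₂ π D₃ N₃ τ δ) (hm5 : m % 5 = 3) :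
    13 ≤ m ∧ ((28 ≤ m ∧ 3 * (D₂ * D₃) ≤ m ∧ ∀ c : ℕ, D₃ ∣ c → (D₂ ∣ c ∨ D₂ = 2 ∧ m % 4 = 0) →
        D₂ * D₃ ∣ 2 * c) ∨
      ((3 * (D₂ * D₃) ≤ m ∨ 28 ≤ m) ∧ ∀ c : ℕ, D₃ ∣ c → (D₂ ∣ c ∨ D₂ = 2 ∧ m % 4 = 0) →
        D₂ * D₃ ∣ c)) := by
  have hm := h.hm
  refine ⟨by omega, ?_⟩
  by_cases h2 : D₂ = 2
  · left
    have h4 := h.hD₂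
    refine ⟨by omega, ?_, fun c hc _ => h2 ▸ mul_dvd_mul_left 2 hc⟩
    rcases h.hD₃ with f | ⟨f, -⟩ <;> rw [h2, f] <;> omega
  · right
    refine ⟨?_, fun c hc hc2 => h.coprime.mul_dvd_of_dvd_of_dvd
      (hc2.resolve_right fun h => h2 h.1) hc⟩
    rcases h.hD₂ with e | ⟨h4, -⟩
    · left
      rcases h.hD₃ with f | ⟨f, -⟩ <;> rw [e, f] <;> omega
    · omega

/-- The terms of a coefficient, up to multiples of 5, with a bound for the large ones. -/
theorem term_cases (hm5 : m % 5 = 3) (h13 : 13 ≤ m) (c x : ℕ) {w : ℤ} (hw : c * polygonal m x = w) :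
    w = 0 ∨ w = c ∨ ((w - 3 * c) % 5 = 0 ∧ 13 * (c : ℤ) ≤ w ∧ (28 ≤ m → 28 * (c : ℤ) ≤ w)) ∨
      (36 * (c : ℤ) ≤ w ∧ (28 ≤ m → 81 * (c : ℤ) ≤ w) ∧ (w % 5 = 0 ∨ (w - c) % 5 = 0)) := by
  have hle : ∀ k : ℤ, k ≤ polygonal m x → k * c ≤ w := fun k hk => by
    rw [← hw, mul_comm]
    exact mul_le_mul_of_nonneg_left hk (Int.natCast_nonneg c)
  have hmod : ∀ k : ℤ, polygonal m x % 5 = k % 5 → (w - k * c) % 5 = 0 := fun k hk => by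
    rw [← hw, mul_comm k, ← mul_sub]
    exact Int.emod_eq_zero_of_dvd ((Int.dvd_of_emod_eq_zero (by omega)).mul_left _)
  have h5 := polygonal_mod_five hm5 x
  have m0 := hmod 0
  have m1 := hmod 1
  have m3 := hmod 3
  have l1 := hle 13
  have l2 := hle 28
  have l3 := hle 36
  have l4 := hle 81
  rcases polygonal_cases (by omega : 4 ≤ m) x with ⟨-, e⟩ | ⟨-, e⟩ | ⟨-, e⟩ | ⟨-, e⟩
  · exact Or.inl (by rw [← hw, e, mul_zero])
  · exact Or.inr (Or.inl (by rw [← hw, e, mul_one]))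
  · rw [e] at m3 l1 l2
    omega
  · clear hle hmod hw
    omega

/-- The coefficients prime to 5 are not narrow, which bounds them from below. Hence small multiples
of 5 in the given classes are represented by the other coefficients alone. -/
theorem FiveData.false (h : FiveData m l D₂ N₂ π D₃ N₃ τ δ) (hs : PrimeShape 5 l) : False := by
  have hm4 : 4 ≤ m := by have := h.hm; omega
  cases hs with
  | one a t hl ha ht =>
    obtain ⟨hm5, rfl, h3, h2, -⟩ := (narrow_or (c := a) (π := π) h.hm h.hD₂ h.hD₃ h.hδ).resolve_left
      (h.not_narrow_one hl ha ht)
    obtain ⟨h13, hsize⟩ := h.size hm5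
    have ha0 := h.hpos a (hl.mem_iff.2 List.mem_cons_self)
    have hsz : D₂ * D₃ ≤ a ∨ (28 ≤ m ∧ D₂ * D₃ ≤ 2 * a) := by
      rcases hsize with ⟨h1, -, H⟩ | ⟨-, H⟩
      · exact Or.inr ⟨h1, Nat.le_of_dvd (by omega) (H a h3 h2)⟩
      · exact Or.inl (Nat.le_of_dvd ha0 (H a h3 h2))
    refine h.false_of_tail (U := [a]) hl ht (fun N hN => Loc.perm hl.symm
      (Loc.of_prime_unit Nat.prime_five (by simp) h.not_dvd ha (x := 0) (by omega)
        (val_polygonal_zero m t) (by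
          rw [polygonal_zero, Int.modEq_iff_dvd]
          omega))) ?_ ?_
    · rintro zs rfl h5 hlt
      obtain ⟨x, zs₁, hx, h1⟩ := exists_cons_of_map_perm hl
      have hw := dvd_argVal_of_map_perm (m := m) h1 ht
      have hw0 := argVal_nonneg hm4 zs₁
      rw [argVal_perm hx, argVal_cons] at h5 hlt ⊢
      refine ⟨zs₁, h1, ?_⟩
      obtain ⟨w, hxw⟩ : ∃ w, a * polygonal m x = w := ⟨_, rfl⟩
      have := term_cases hm5 h13 a x hxw
      push_cast at hw
      simp only [hxw] at h5 hlt ⊢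
      omega
    · rintro zs rfl h5
      obtain ⟨x, zs₁, hx, h1⟩ := exists_cons_of_map_perm hl
      have hw := dvd_argVal_of_map_perm (m := m) h1 ht
      have hw0 := argVal_nonneg hm4 zs₁
      rw [argVal_perm hx, argVal_cons] at h5 ⊢
      obtain ⟨w, hxw⟩ : ∃ w, a * polygonal m x = w := ⟨_, rfl⟩
      have := term_cases hm5 h13 a x hxw
      rw [List.sum_singleton] at h5
      push_cast at hw
      simp only [hxw] at h5 ⊢
      omega
  | two a b t hl hle ha hb han ht =>
    obtain ⟨hm5, rfl, h3, h2, -⟩ := (narrow_or (c := a) (π := π) h.hm h.hD₂ h.hD₃ h.hδ).resolve_left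
      (h.not_narrow_two hl ha hb ht)
    obtain ⟨-, -, h3', h2', -⟩ := (narrow_or (c := b) (π := π) h.hm h.hD₂ h.hD₃ h.hδ).resolve_left
      (h.not_narrow_two (hl.trans (.swap _ _ _)) hb ha ht)
    obtain ⟨h13, hsize⟩ := h.size hm5
    have ha0 := h.hpos a (hl.mem_iff.2 List.mem_cons_self)
    have hb0 := h.hpos b (hl.mem_iff.2 (List.mem_cons_of_mem _ List.mem_cons_self))
    have hab : b % 5 = 2 * a % 5 ∨ b % 5 = 3 * a % 5 := by
      have h1 := han 1
      have h2 := han 2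
      push_cast at h1 h2
      rcases (by omega : a % 5 = 1 ∨ a % 5 = 2 ∨ a % 5 = 3 ∨ a % 5 = 4) with e | e | e | e <;> omega
    have gap : ∀ {D u v : ℕ}, D ∣ u → D ∣ v → u ≠ v → u + D ≤ v ∨ v + D ≤ u :=
      fun {D u v} hu hv hne => by
        rcases Nat.lt_or_gt_of_ne hne with hlt | hlt
        · have := Nat.le_of_dvd (by omega) (Nat.dvd_sub hv hu)
          omega
        · have := Nat.le_of_dvd (by omega) (Nat.dvd_sub hu hv)
          omega
    have hsz : (28 ≤ m ∧ 3 * (D₂ * D₃) ≤ m ∧ D₂ * D₃ ≤ 2 * a ∧ D₂ * D₃ ≤ 2 * b ∧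
          (2 * a + D₂ * D₃ ≤ 2 * b ∨ 2 * b + D₂ * D₃ ≤ 2 * a)) ∨
        ((3 * (D₂ * D₃) ≤ m ∨ 28 ≤ m) ∧ D₂ * D₃ ≤ a ∧ D₂ * D₃ ≤ b ∧
          (a + D₂ * D₃ ≤ b ∨ b + D₂ * D₃ ≤ a)) := by
      rcases hsize with ⟨h28, h3D, H⟩ | ⟨h3D, H⟩
      · have d1 := H a h3 h2
        have d2 := H b h3' h2'
        exact Or.inl ⟨h28, h3D, Nat.le_of_dvd (by omega) d1, Nat.le_of_dvd (by omega) d2,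
          gap d1 d2 (by omega)⟩
      · have d1 := H a h3 h2
        have d2 := H b h3' h2'
        exact Or.inr ⟨h3D, Nat.le_of_dvd ha0 d1, Nat.le_of_dvd hb0 d2, gap d1 d2 (by omega)⟩
    clear hsize gap h2 h3 h2' h3' han
    have args : ∀ zs : List (ℕ × ℕ), (zs.map Prod.fst).Perm (a :: b :: t) →
        ∃ (x y : ℕ) (zs' : List (ℕ × ℕ)), (zs'.map Prod.fst).Perm t ∧ 0 ≤ argVal m zs' ∧
          argVal m zs' % 5 = 0 ∧
          argVal m zs = a * polygonal m x + (b * polygonal m y + argVal m zs') := fun zs hzs => by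
      obtain ⟨x, zs₁, hx, h1⟩ := exists_cons_of_map_perm hzs
      obtain ⟨y, zs₂, hy, h2⟩ := exists_cons_of_map_perm h1
      exact ⟨x, y, zs₂, h2, argVal_nonneg hm4 _,
        Int.emod_eq_zero_of_dvd (dvd_argVal_of_map_perm (m := m) h2 ht),
        by rw [argVal_perm hx, argVal_cons, argVal_perm hy, argVal_cons]⟩
    refine h.false_of_tail (U := [a, b]) hl ht (fun N hN => h.loc_two hl ha hb ht (by omega)) ?_ ?_
    · rintro zs rfl h5 hlt
      obtain ⟨x, y, zs', h1, hw0, hw, e⟩ := args zs hl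
      refine ⟨zs', h1, ?_⟩
      obtain ⟨u, hu⟩ : ∃ w, a * polygonal m x = w := ⟨_, rfl⟩
      obtain ⟨v, hv⟩ : ∃ w, b * polygonal m y = w := ⟨_, rfl⟩
      have tu := term_cases hm5 h13 a x hu
      have tv := term_cases hm5 h13 b y hv
      rw [hu, hv] at e
      generalize D₂ * D₃ = D at *
      generalize argVal m zs' = W at *
      generalize argVal m zs = V at *
      clear * - tu tv e h5 hlt hw0 hw hsz hab ha hb h13
      rcases tu with tu | tu | tu | tu <;> rcases tv with tv | tv | tv | tv <;> omega
    · rintro zs rfl h5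
      obtain ⟨x, y, zs', h1, hw0, hw, e⟩ := args zs hl
      obtain ⟨u, hu⟩ : ∃ w, a * polygonal m x = w := ⟨_, rfl⟩
      obtain ⟨v, hv⟩ : ∃ w, b * polygonal m y = w := ⟨_, rfl⟩
      have tu := term_cases hm5 h13 a x hu
      have tv := term_cases hm5 h13 b y hv
      rw [hu, hv] at e
      rw [List.sum_cons, List.sum_singleton] at h5
      generalize D₂ * D₃ = D at *
      generalize argVal m zs' = W at *
      generalize argVal m zs = V at *
      clear * - tu tv e h5 hw0 hw hsz hab ha hb h13
      rcases tu with tu | tu | tu | tu <;> rcases tv with tv | tv | tv | tv <;> omega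

end Five

/-! ### The classification -/

theorem exists_classData {m : ℕ} {l : List ℕ} (hm : 9 ≤ m) (hpos : ∀ c ∈ l, 0 < c)
    (hu : ∀ p : ℕ, p.Prime → ∃ c ∈ l, ¬ p ∣ c) (H : ListRegular m l) :
    ∃ D₂ N₂ π D₃ N₃ τ, ClassData m l D₂ N₂ π D₃ N₃ τ := by
  obtain ⟨D₂, N₂, π, hD₂, h2⟩ : ∃ D₂ N₂ π, (D₂ = 1 ∨ (m % 4 = 0 ∧ (D₂ = 2 ∨ D₂ = 4 ∨ D₂ = 8))) ∧
      TwoClass m l D₂ N₂ π := by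
    by_cases hg : ∀ N : ℕ, Loc m 2 l N
    · exact ⟨1, 0, fun _ => 0, Or.inl rfl, fun N _ => hg N,
        fun _ _ _ _ z _ hd => absurd (one_dvd z.1) hd⟩
    · have hu2 := hu 2 Nat.prime_two
      have hm4 : m % 4 = 0 := by
        by_contra hm4
        obtain ⟨c, hc, hc2⟩ := hu2
        exact hg fun N =>
          (Loc.of_not_four_dvd hm4 (by omega) _ N).perm (List.perm_cons_erase hc).symm
      obtain ⟨v, rfl⟩ : ∃ v, m = 4 * v + 4 := ⟨m / 4 - 1, by omega⟩
      obtain ⟨D, N₀, π, hD, h⟩ := (twoShape hpos hu2 hg).exists_twoClass (v := v)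
      exact ⟨D, N₀, π, Or.inr ⟨hm4, hD⟩, h⟩
  obtain ⟨D₃, N₃, τ, hD₃, h3⟩ : ∃ D₃ N₃ τ, (D₃ = 1 ∨ (D₃ = 3 ∧ ((m % 3 = 1 ∧ τ = 0) ∨
      (m % 3 = 0 ∧ τ = 1)))) ∧ ThreeClass m l D₃ N₃ τ := by
    by_cases hg : ∀ N : ℕ, Loc m 3 l N
    · exact ⟨1, 0, 0, Or.inl rfl, fun N _ => hg N, fun _ _ _ z _ hd => absurd (one_dvd z.1) hd⟩
    · have hu3 := hu 3 Nat.prime_three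
      have hm3 := (primeShape Nat.prime_three (by simp) hu3 hg).1
      obtain ⟨N₀, τ, h1, h2⟩ := exists_threeClass (m := m) (by omega) (by omega) hpos hu3 hg
      exact ⟨3, N₀, τ, Or.inr ⟨rfl, h1⟩, h2⟩
  exact ⟨D₂, N₂, π, D₃, N₃, τ, hm, hpos, hu, H, hD₂, h2, hD₃, h3⟩

/-- The primes `p ≥ 5` put no condition on the numbers represented by a regular form. -/
theorem ListRegular.loc_of_five_le {m : ℕ} {l : List ℕ} (H : ListRegular m l) (hm : 9 ≤ m)
    (hpos : ∀ c ∈ l, 0 < c) (hu : ∀ p : ℕ, p.Prime → ∃ c ∈ l, ¬ p ∣ c) {p : ℕ} (hp : p.Prime)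
    (h5 : 5 ≤ p) (N : ℕ) : Loc m p l N := by
  classical
  obtain ⟨D₂, N₂, π, D₃, N₃, τ, h⟩ := exists_classData hm hpos hu H
  have hdvd : ∀ p : ℕ, p.Prime → 5 ≤ p → (¬ ∀ N : ℕ, Loc m p l N) → p ∣ m - 4 ∨ p ∣ m - 3 :=
    fun p hp h5 hbad =>
      have hs := primeShape hp (by omega) (hu p hp) hbad
      H.prime_dvd hm hpos hp h5 hs.1 hs.2
  set B := ((m - 4) * (m - 3)).primeFactors.filter fun p => 5 ≤ p ∧ ¬ ∀ N : ℕ, Loc m p l N with hB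
  have hmem : ∀ p : ℕ, p.Prime → 5 ≤ p → (¬ ∀ N : ℕ, Loc m p l N) → p ∈ B := fun p hp h5 hbad =>
    Finset.mem_filter.2 ⟨Nat.mem_primeFactors.2 ⟨hp, hp.dvd_mul.2 (hdvd p hp h5 hbad),
      (Nat.mul_pos (by omega) (by omega)).ne'⟩, h5, hbad⟩
  have heq : ∀ q ∈ B, q = 5 := fun q hq => h.eq_singleton_five (fun p hp => by
      obtain ⟨h1, h2, h3⟩ := Finset.mem_filter.1 hp
      have hp' := Nat.prime_of_mem_primeFactors h1
      exact ⟨hp', h2, primeShape hp' (by omega) (hu p hp') h3⟩)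
    (fun p hp h5 hpB => by
      by_contra hbad
      exact hpB (hmem p hp h5 hbad)) hq
  by_contra hN
  have hbad : ¬ ∀ N : ℕ, Loc m p l N := fun h => hN (h N)
  obtain rfl := heq p (hmem p hp h5 hbad)
  have good : ∀ p : ℕ, p.Prime → 5 ≤ p → p ≠ 5 → ∀ N : ℕ, Loc m p l N := fun p hp h5 hne => by
    by_contra hbad
    exact hne (heq p (hmem p hp h5 hbad))
  have hs := (primeShape hp (by simp) (hu 5 hp) hbad).2
  rcases hdvd 5 hp h5 hbad with h4 | h3
  · exact FiveData.false (δ := 0) ⟨h, good, by omega⟩ hs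
  · exact FiveData.false (δ := 3) ⟨h, good, by omega⟩ hs

theorem hasShape_of_perm {n d : ℕ} {a : Fin n → ℕ} {h t : List ℕ} (hd : 0 < d)
    (hl : (List.ofFn a).Perm (h ++ t)) (ht : Multiples d t) : HasShape (h : Multiset ℕ) d a := by
  refine ⟨(t.map (· / d) : List ℕ), fun b hb => ?_, ?_⟩
  · obtain ⟨c, hc, rfl⟩ := List.mem_map.1 (Multiset.mem_coe.1 hb)
    exact Nat.div_pos (Nat.le_of_dvd (ht c hc).1 (ht c hc).2) hd
  · have ht' : (t.map (· / d)).map (fun b => d * b) = t := by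
      rw [List.map_map]
      exact (List.map_congr_left fun c hc => Nat.mul_div_cancel' (ht c hc).2).trans (List.map_id t)
    rw [Multiset.map_coe, ht', Multiset.coe_add, Fin.univ_val_map]
    exact Multiset.coe_eq_coe.2 hl

theorem classification {m n : ℕ} (hm : 9 ≤ m) {a : Fin n → ℕ} (ha : ∀ i, 0 < a i)
    (hprim : IsPrimitive a) (hreg : IsRegular m a) :
    IsUniversal m a ∨ (m % 3 ≠ 2 ∧ Type3 m a) ∨
      (m % 4 = 0 ∧ (Type4 m a ∨ Type13 m a ∨ Type11 m a)) ∨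
      (m % 4 = 0 ∧ m % 3 ≠ 2 ∧ (Type34 m a ∨ Type38 m a ∨ Type334 m a)) := by
  obtain ⟨l, hl⟩ : ∃ l, l = List.ofFn a := ⟨_, rfl⟩
  have hpos : ∀ c ∈ l, 0 < c := fun c hc => by
    rw [hl] at hc
    obtain ⟨i, rfl⟩ := List.mem_ofFn.1 hc
    exact ha i
  have hu : ∀ p : ℕ, p.Prime → ∃ c ∈ l, ¬ p ∣ c := fun p hp => by
    by_contra! hall
    have : p ∣ Finset.univ.gcd a := Finset.dvd_gcd fun i _ =>
      hall (a i) (by rw [hl]; exact List.mem_ofFn.2 ⟨i, rfl⟩)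
    rw [hprim] at this
    exact hp.one_lt.ne' (Nat.dvd_one.1 this)
  have rep : ∀ {N : ℕ}, Rep m l N → Represents m a N := fun h => represents_iff.2 (hl ▸ h)
  have H : ListRegular m l := fun N hN => by
    rw [hl]
    exact represents_iff.1 (hreg N (locallyRepresents_of_loc fun p hp => hl ▸ hN p hp))
  have H23 : ∀ N : ℕ, Loc m 2 l N → Loc m 3 l N → Rep m l N := fun N h2 h3 => H N fun p hp => by
    rcases (by have := hp.two_le; omega : p = 2 ∨ p = 3 ∨ p = 4 ∨ 5 ≤ p) with
      rfl | rfl | rfl | hp5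
    · exact h2
    · exact h3
    · revert hp; norm_num
    · exact H.loc_of_five_le hm hpos hu hp hp5 N
  have hu2 := hu 2 Nat.prime_two
  have hu3 := hu 3 Nat.prime_three
  have shape : ∀ {d : ℕ} {h t : List ℕ}, 0 < d → l.Perm (h ++ t) → Multiples d t →
      HasShape (h : Multiset ℕ) d a := fun hd hp ht => hasShape_of_perm hd (hl ▸ hp) ht
  have m3 : (¬ ∀ N : ℕ, Loc m 3 l N) → m % 3 ≠ 2 := fun hbad => by
    have := (primeShape Nat.prime_three (by simp) hu3 hbad).1
    omega
  have m4 : (¬ ∀ N : ℕ, Loc m 2 l N) → ∃ v, 2 ≤ v ∧ m = 4 * v + 4 := fun hbad => by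
    have hm4 : m % 4 = 0 := by
      by_contra hm4
      obtain ⟨c, hc, hc2⟩ := hu2
      exact hbad fun N =>
        (Loc.of_not_four_dvd hm4 (by omega) _ N).perm (List.perm_cons_erase hc).symm
    exact ⟨m / 4 - 1, by omega, by omega⟩
  clear hl hprim hreg
  by_cases g2 : ∀ N : ℕ, Loc m 2 l N
  · by_cases g3 : ∀ N : ℕ, Loc m 3 l N
    · exact Or.inl fun N => rep (H23 N (g2 N) (g3 N))
    · have hm3 := m3 g3
      refine Or.inr (Or.inl ⟨hm3, ?_⟩)
      rcases three_structure (by omega) hm3 hpos hu3 g3 with ⟨c, t, hp, hc, ht⟩ |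
        ⟨c, b, t, hp, hc, hcb, ht, h9⟩
      · obtain ⟨hc12, hrep⟩ := three_single hm hm3 hc ht fun N hN =>
          (H23 N (g2 N) (hN.perm hp.symm)).perm hp
        refine ⟨c, hc12, shape (h := [c]) (by simp) hp ht, fun N hN =>
          rep ((hrep N ?_).perm hp.symm)⟩
        rcases hN with ⟨k, rfl⟩ | ⟨k, rfl⟩ <;> omega
      · exact (three_pair_false hm hm3 hc hcb ht h9 fun N hN =>
          (H23 N (g2 N) (hN.perm hp.symm)).perm hp).elim
  · obtain ⟨v, hv, rfl⟩ := m4 g2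
    by_cases g3 : ∀ N : ℕ, Loc (4 * v + 4) 3 l N
    · refine Or.inr (Or.inr (Or.inl ⟨by omega, ?_⟩))
      rcases (twoShape hpos hu2 g2).twoExceptional hv g2 fun N _ h => H23 N h (g3 N) with
        ⟨c, d, t, hp, hc, hd, ht, h⟩ | ⟨t, hp, ht, h⟩ | ⟨d, t, hp, hd, ht, h⟩
      · refine Or.inl ⟨c, hc, shape (h := [c]) (by simp) hp
          (.cons (by simp) (.cons (by omega) ht)), fun N hN => rep (H23 N (h N ?_) (g3 N))⟩
        rcases hN with ⟨k, rfl⟩ | ⟨k, rfl⟩ <;> omega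
      · refine Or.inr (Or.inl ⟨shape (h := [1, 3]) (by simp) hp (.cons (by simp) ht),
          fun N hN => rep (H23 N (h N fun h2 => hN ⟨N / 4, by omega⟩) (g3 N))⟩)
      · refine Or.inr (Or.inr ⟨shape (h := [1, 1]) (by simp) hp
          (.cons (by simp) (.cons (by omega) ht)),
          fun N hN => rep (H23 N (h N fun h2 => hN ⟨N / 4, by omega⟩) (g3 N))⟩)
    · refine Or.inr (Or.inr (Or.inr ⟨by omega, m3 g3, ?_⟩))
      rcases two_three_exceptional hv (m3 g3) hpos hu2 hu3 g2 g3 H23 with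
        ⟨t, hp, ht, h⟩ | ⟨t, hp, ht, h⟩ | ⟨t, hp, ht, h⟩
      · refine Or.inl ⟨shape (h := [3, 4]) (by simp) hp ht, fun N hN => rep (h N ?_ ?_)⟩ <;>
        · simp only [Finset.mem_insert, Finset.mem_singleton] at hN
          omega
      · refine Or.inr (Or.inl ⟨shape (h := [3, 8]) (by simp) hp ht, fun N hN =>
          rep (h N ?_ ?_)⟩) <;>
        · simp only [Finset.mem_insert, Finset.mem_singleton] at hN
          omega
      · refine Or.inr (Or.inr ⟨shape (h := [3, 3, 4]) (by simp) hp ht, fun N hN =>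
          rep (h N ?_ ?_)⟩) <;>
        · simp only [Finset.mem_insert, Finset.mem_singleton] at hN
          omega

end PolygonalForm

theorem mainTheorem5 (m n : ℕ) (hn : 4 ≤ n) (a : Fin n → ℕ) (ha : ∀ i, 0 < a i)
    (hprim : PolygonalForm.IsPrimitive a) (hreg : PolygonalForm.IsRegular m a) :
    (9 ≤ m → ¬ m ≡ 0 [MOD 4] → m ≡ 2 [MOD 3] →
      PolygonalForm.IsUniversal m a) ∧
    (9 ≤ m → ¬ m ≡ 0 [MOD 4] → ¬ m ≡ 2 [MOD 3] →
      PolygonalForm.IsUniversal m a ∨ PolygonalForm.Type3 m a) ∧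
    (12 ≤ m → m ≡ 0 [MOD 4] → m ≡ 2 [MOD 3] →
      PolygonalForm.IsUniversal m a ∨ PolygonalForm.Type4 m a ∨
      PolygonalForm.Type13 m a ∨ PolygonalForm.Type11 m a) ∧
    (12 ≤ m → m ≡ 0 [MOD 4] → ¬ m ≡ 2 [MOD 3] →
      PolygonalForm.IsUniversal m a ∨ PolygonalForm.Type3 m a ∨ PolygonalForm.Type4 m a ∨
      PolygonalForm.Type13 m a ∨ PolygonalForm.Type11 m a ∨ PolygonalForm.Type34 m a ∨
      PolygonalForm.Type38 m a ∨ PolygonalForm.Type334 m a) := by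
  simp only [Nat.ModEq]
  refine ⟨fun hm h4 h3 => ?_, fun hm h4 h3 => ?_, fun hm h4 h3 => ?_, fun hm h4 h3 => ?_⟩ <;>
  · have := PolygonalForm.classification (by omega : 9 ≤ m) ha hprim hreg
    have e4 : m % 4 = 0 ↔ m % 4 = 0 % 4 := by norm_num
    have e3 : m % 3 = 2 ↔ m % 3 = 2 % 3 := by norm_num
    tauto
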